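/- **Setting.** Let $\Gamma=\mathbb Z a_1+\mathbb Z a_2\subset\mathbb R^2$ be the hexagonal lattice with $a_1=(\tfrac{\sqrt3}2,\tfrac12)$, $a_2=(\tfrac{\sqrt3}2,-\tfrac12)$, let $\tau=e^{2\pi i/3}$, and let $(R\psi)(x)=\psi(M_Rx)$, where $M_R$ is the clockwise rotation of the plane by $2\pi/3$ about the origin. For $k=(k_1,k_2)\in\mathbb R^2$ the Bloch functions with quasimomentum $k$ are the functions with $\psi(x+n_1a_1+n_2a_2)=e^{i(n_1k_1+n_2k_2)}\psi(x)$ for all $n_1,n_2\in\mathbb Z$. Let $\Omega_H$ be the hexagon of points at least as close to $0$ as to any other point of $\Gamma$ (a fundamental domain of $\Gamma$), and let $\Omega_R\subset\Omega_H$ be the rhombus with vertices $(0,0)$, $(-\tfrac1{\sqrt3},0)$, $(-\tfrac1{2\sqrt3},-\tfrac12)$, $(\tfrac1{2\sqrt3},-\tfrac12)$, whose three rotations by multiples of $2\pi/3$ tile $\Omega_H$. **(A) Differential operators.** Let $H=\sum a_{ij}(x)\partial_i\partial_j+\sum b_i(x)\partial_i+c(x)$ be a second order differential operator on $\mathbb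 R^2$ with real bounded measurable coefficients (for instance $-\Delta+q(x)$) that is self-adjoint in $L^2(\mathbb R^2)$ with domain $H^2(\mathbb R^2)$ and is invariant under the shifts by $\Gamma$ and under the rotation $R$. Let $H(k)$ be the restriction of $H$ to the Bloch functions with quasimomentum $k$ in $H^2_{\rm loc}(\mathbb R^2)$, regarded as an operator in $L^2(\Omega_H)$ by restricting functions to $\Omega_H$. For $j=0,1,2$ let $Q^0_j$ be the operator in $L^2(\Omega_R)$ whose domain consists of the restrictions $\psi|_{\Omega_R}$ of the $\Gamma$-periodic functions $\psi\in H^2_{\rm loc}(\mathbb R^2)$ with $R\psi=\tau^{-j}\psi$ and which maps $\psi|_{\Omega_R}$ to $(H\psi)|_{\Omega_R}$. Then: 1. $H(0)\cong Q^0_0\oplus Q^0_1\oplus Q^0_2$. More precisely, the maps $T_j=\tfrac1{\sqrt3}(I+\tau^jR+\tau^{2j}R^2):L^2(\Omega_R)\to L^2(\Omega_H)$ (functions on $\Omega_R$ being extended by $0$ to $\Omega_H$) are isometries with mutually orthogonal ranges, $L^2(\Omega_H)=\bigoplus_jT_j(L^2(\Omega_R))$, $\operatorname{Dom}H(0)=\bigoplus_jT_j(\operatorname{Dom}Q^0_j)$,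 and $H(0)T_j=T_jQ^0_j$ on $\operatorname{Dom}Q^0_j$. The operators $Q^0_j$ are self-adjoint. 2. $Q^0_1$ and $Q^0_2$ are isospectral: they have the same spectrum, and the same eigenvalues with the same multiplicities. 3. If $\lambda_0$ is a simple eigenvalue of $Q^0_1$ and not an eigenvalue of $Q^0_0$, then the dispersion relation is locally flat at $k=0$: there are $\eta>0$ and two functions $\lambda_1(k),\lambda_2(k)$ such that for all $k$ near $0$ the eigenvalues of $H(k)$ in $(\lambda_0-\eta,\lambda_0+\eta)$, counted with multiplicity, are exactly $\lambda_1(k)$ and $\lambda_2(k)$, and $$(\lambda_i(k)-\lambda_0)^2=o(|k|^2)\quad (k\to0),\qquad i=1,2.$$ **(B) Discrete Schrödinger operators.** Let $G$ be a graph whose vertex set $V\subset\mathbb R^2$ is locally finite, with finite degrees, symmetric edge weights $m_{v,u}>0$ and a potential $q:V\to\mathbb R$, all invariant under the shifts by $\Gamma$ and under the rotation by $2\pi/3$, and let $(Hf)_v=\sum_{u\sim v}m_{v,u}(f_v-f_u)+q_vf_v$. Let $H(k)$ be the restriction of $H$ to the Bloch functions on $V$ with quasimomentum $k$, and let $Q^0_j$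 be the restriction of $H$ to the space $X_j$ of $\Gamma$-periodic functions on $V$ with $Rf=\tau^{-j}f$. Then $H$ maps each $X_j$ to itself, the space of $H(0)$ is the orthogonal sum $X_0\oplus X_1\oplus X_2$ (for the inner product over one period cell), so that $H(0)=Q^0_0\oplus Q^0_1\oplus Q^0_2$; $Q^0_1$ and $Q^0_2$ have the same eigenvalues with the same multiplicities; and 3. holds as in (A). -/

import Mathlib

open MeasureTheory Filter Topology Asymptotics
open scoped ContDiff InnerProductSpace

noncomputable section

namespace HexLattice

/-- The Euclidean plane; also used for the quasimomentum coordinates `k = (k₁, k₂)`. -/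
abbrev Plane : Type := EuclideanSpace ℝ (Fin 2)

/-! ### The lattice, the rotation, the fundamental domains -/

/-- First basis vector of the hexagonal lattice. -/
def a₁ : Plane := !₂[√3 / 2, 1 / 2]

/-- Second basis vector of the hexagonal lattice. -/
def a₂ : Plane := !₂[√3 / 2, -(1 / 2)]

/-- The lattice vector `n₁ a₁ + n₂ a₂`. -/
def latt (n₁ n₂ : ℤ) : Plane := (n₁ : ℝ) • a₁ + (n₂ : ℝ) • a₂

/-- The clockwise rotation of the plane by `2π/3`. The symmetry `R` acts on functions by
`(R ψ)(x) = ψ (rotPt x)`, i.e. it rotates functions counter-clockwise. -/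
def rotPt (x : Plane) : Plane :=
  !₂[-(1 / 2) * x 0 + √3 / 2 * x 1, -(√3 / 2) * x 0 - 1 / 2 * x 1]

/-- The primitive cube root of unity `τ = exp(2πi/3)`. -/
def τ : ℂ := Complex.exp (2 * Real.pi * Complex.I / 3)

/-- The Bloch phase `exp(i (n₁ k₁ + n₂ k₂))`. -/
def phase (k : Plane) (n₁ n₂ : ℤ) : ℂ :=
  Complex.exp (Complex.I * ((n₁ * k 0 + n₂ * k 1 : ℝ) : ℂ))

/-- The hexagonal fundamental domain of the lattice, centered at the origin
(the set of points at least as close to `0` as to any other lattice point). -/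
def ΩH : Set Plane :=
  {x | |√3 / 2 * x 0 + 1 / 2 * x 1| ≤ 1 / 2 ∧ |√3 / 2 * x 0 - 1 / 2 * x 1| ≤ 1 / 2 ∧
    |x 1| ≤ 1 / 2}

/-- The lower left of the three rhombi into which the hexagon is cut by the segments that join
the origin to every second vertex; its vertices are `(0,0)`, `(-1/√3, 0)`, `(-1/(2√3), -1/2)`
and `(1/(2√3), -1/2)`. -/
def ΩR : Set Plane :=
  {x | -(1 / 2) ≤ x 1 ∧ x 1 ≤ 0 ∧ -1 ≤ √3 * x 0 + x 1 ∧ √3 * x 0 + x 1 ≤ 0}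

/-- The Hilbert space `L²(Ω)` of complex functions. -/
abbrev L2 (Ω : Set Plane) : Type := Lp ℂ 2 (volume.restrict Ω : Measure Plane)

/-! ### Weak derivatives -/

/-- `v` is the weak partial derivative `∂ᵢ u` on the plane. -/
def HasWeakPartial (i : Fin 2) (u v : Plane → ℂ) : Prop :=
  LocallyIntegrable u volume ∧ LocallyIntegrable v volume ∧
    ∀ φ : Plane → ℝ, ContDiff ℝ ∞ φ → HasCompactSupport φ →
      ∫ x, (fderiv ℝ φ x (EuclideanSpace.single i 1)) • u x = -∫ x, φ x • v x

/-- Locally square integrable functions on the plane. -/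
def LocL2 (u : Plane → ℂ) : Prop :=
  ∀ K : Set Plane, IsCompact K → MemLp u 2 (volume.restrict K)

/-- Square integrable functions on the plane. -/
def GlobL2 (u : Plane → ℂ) : Prop := MemLp u 2 (volume : Measure Plane)

/-- `d₁ i = ∂ᵢ u` and `d₂ i j = ∂ᵢ ∂ⱼ u` weakly, and `u` and all these derivatives satisfy `P`.
With `P = LocL2` this says that `u ∈ H²_loc(ℝ²)`, with `P = GlobL2` that `u ∈ H²(ℝ²)`. -/
structure IsJet (P : (Plane → ℂ) → Prop) (u : Plane → ℂ) (d₁ : Fin 2 → Plane → ℂ)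
    (d₂ : Fin 2 → Fin 2 → Plane → ℂ) : Prop where
  base : P u
  first : ∀ i, P (d₁ i)
  second : ∀ i j, P (d₂ i j)
  weak_first : ∀ i, HasWeakPartial i u (d₁ i)
  weak_second : ∀ i j, HasWeakPartial i (d₁ j) (d₂ i j)

/-! ### Differential operators with real coefficients -/

/-- A differential expression `∑ aᵢⱼ(x) ∂ᵢ∂ⱼ + ∑ bᵢ(x) ∂ᵢ + c(x)` with real, bounded,
measurable coefficients (for instance `-Δ + q(x)`). -/
structure RealDiffOp where
  a : Fin 2 → Fin 2 → Plane → ℝ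
  b : Fin 2 → Plane → ℝ
  c : Plane → ℝ
  measurable_a : ∀ i j, Measurable (a i j)
  measurable_b : ∀ i, Measurable (b i)
  measurable_c : Measurable c
  bounded_a : ∃ C, ∀ i j x, |a i j x| ≤ C
  bounded_b : ∃ C, ∀ i x, |b i x| ≤ C
  bounded_c : ∃ C, ∀ x, |c x| ≤ C

namespace RealDiffOp

/-- The differential expression evaluated on a function and its derivatives. -/
def onJet (H : RealDiffOp) (u : Plane → ℂ) (d₁ : Fin 2 → Plane → ℂ)
    (d₂ : Fin 2 → Fin 2 → Plane → ℂ) (x : Plane) : ℂ :=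
  ∑ i, ∑ j, (H.a i j x : ℂ) * d₂ i j x + ∑ i, (H.b i x : ℂ) * d₁ i x + (H.c x : ℂ) * u x

/-- `u` has weak derivatives up to second order, all in the class `P`, and `H u = g` almost
everywhere. -/
def Maps (H : RealDiffOp) (P : (Plane → ℂ) → Prop) (u g : Plane → ℂ) : Prop :=
  ∃ d₁ d₂, IsJet P u d₁ d₂ ∧ g =ᵐ[volume] H.onJet u d₁ d₂

/-- Invariance of `H` under the substitution `S`: `H (u ∘ S) = (H u) ∘ S` for all `u` on which
`H` acts. -/
def InvariantUnder (H : RealDiffOp) (S : Plane → Plane) : Prop :=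
  ∀ u g, H.Maps LocL2 u g → H.Maps LocL2 (u ∘ S) (g ∘ S)

/-- Invariance under the shifts by the lattice. -/
def ShiftInvariant (H : RealDiffOp) : Prop :=
  ∀ n₁ n₂ : ℤ, H.InvariantUnder (fun x => x + latt n₁ n₂)

/-- Invariance under the rotation by `2π/3`. -/
def RotInvariant (H : RealDiffOp) : Prop := H.InvariantUnder rotPt

end RealDiffOp

/-- `ψ` is a Bloch function with quasimomentum `k` (in the almost everywhere sense). -/
def IsBloch (k : Plane) (ψ : Plane → ℂ) : Prop :=
  ∀ n₁ n₂ : ℤ, ∀ᵐ x, ψ (x + latt n₁ n₂) = phase k n₁ n₂ * ψ x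

/-- `R ψ = τ⁻ʲ ψ` (almost everywhere). -/
def IsEquivariant (j : Fin 3) (ψ : Plane → ℂ) : Prop :=
  ∀ᵐ x, ψ (rotPt x) = (τ ^ (j : ℕ))⁻¹ * ψ x

/-! #### Closure properties needed to form the operators -/

theorem HasWeakPartial.add {i : Fin 2} {u v u' v' : Plane → ℂ} (h : HasWeakPartial i u v)
    (h' : HasWeakPartial i u' v') : HasWeakPartial i (u + u') (v + v') := by
  refine ⟨h.1.add h'.1, h.2.1.add h'.2.1, fun φ hφ hc => ?_⟩
  have hd : Continuous fun x => fderiv ℝ φ x (EuclideanSpace.single i 1) :=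
    (hφ.continuous_fderiv (by simp)).clm_apply continuous_const
  have hdc : HasCompactSupport fun x => fderiv ℝ φ x (EuclideanSpace.single i 1) :=
    hc.fderiv_apply (𝕜 := ℝ) _
  have e1 := h.1.integrable_smul_left_of_hasCompactSupport hd hdc
  have e2 := h'.1.integrable_smul_left_of_hasCompactSupport hd hdc
  have e3 := h.2.1.integrable_smul_left_of_hasCompactSupport hφ.continuous hc
  have e4 := h'.2.1.integrable_smul_left_of_hasCompactSupport hφ.continuous hc
  simp only [Pi.add_apply, smul_add]
  rw [integral_add e1 e2, integral_add e3 e4, h.2.2 φ hφ hc, h'.2.2 φ hφ hc]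
  ring

theorem HasWeakPartial.smul {i : Fin 2} {u v : Plane → ℂ} (z : ℂ) (h : HasWeakPartial i u v) :
    HasWeakPartial i (z • u) (z • v) := by
  refine ⟨h.1.smul z, h.2.1.smul z, fun φ hφ hc => ?_⟩
  simp only [Pi.smul_apply, smul_comm _ z]
  rw [integral_smul, integral_smul, h.2.2 φ hφ hc, smul_neg]

theorem HasWeakPartial.zero (i : Fin 2) : HasWeakPartial i 0 0 :=
  ⟨locallyIntegrable_zero, locallyIntegrable_zero, fun φ _ _ => by simp⟩

theorem HasWeakPartial.ae_zero {i : Fin 2} {u v : Plane → ℂ} (h : HasWeakPartial i u v)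
    (hu : ∀ᵐ x, u x = 0) : ∀ᵐ x, v x = 0 := by
  refine ae_eq_zero_of_integral_contDiff_smul_eq_zero h.2.1 fun φ hφ hc => ?_
  have h1 := h.2.2 φ hφ hc
  have h2 : ∫ x, (fderiv ℝ φ x (EuclideanSpace.single i 1)) • u x = 0 := by
    refine integral_eq_zero_of_ae ?_
    filter_upwards [hu] with x hx
    simp [hx]
  rw [h2] at h1
  exact neg_eq_zero.mp h1.symm

/-- A class of functions closed under linear combinations. -/
structure IsLinClass (P : (Plane → ℂ) → Prop) : Prop where
  zero : P 0
  add : ∀ {u v}, P u → P v → P (u + v)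
  smul : ∀ (z : ℂ) {u}, P u → P (z • u)

theorem isLinClass_locL2 : IsLinClass LocL2 :=
  ⟨fun _ _ => MemLp.zero, fun hu hv K hK => (hu K hK).add (hv K hK),
    fun z _ hu K hK => (hu K hK).const_smul z⟩

theorem isLinClass_globL2 : IsLinClass GlobL2 :=
  ⟨MemLp.zero, fun hu hv => MemLp.add hu hv, fun z _ hu => MemLp.const_smul hu z⟩

namespace RealDiffOp

variable {H : RealDiffOp} {P : (Plane → ℂ) → Prop}

theorem Maps.add (hP : IsLinClass P) {u g u' g' : Plane → ℂ} (h : H.Maps P u g)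
    (h' : H.Maps P u' g') : H.Maps P (u + u') (g + g') := by
  obtain ⟨d₁, d₂, hj, hg⟩ := h
  obtain ⟨e₁, e₂, hj', hg'⟩ := h'
  refine ⟨fun i => d₁ i + e₁ i, fun i j => d₂ i j + e₂ i j,
    ⟨hP.add hj.base hj'.base, fun i => hP.add (hj.first i) (hj'.first i),
      fun i j => hP.add (hj.second i j) (hj'.second i j),
      fun i => (hj.weak_first i).add (hj'.weak_first i),
      fun i j => (hj.weak_second i j).add (hj'.weak_second i j)⟩, ?_⟩
  filter_upwards [hg, hg'] with x hx hx'
  simp only [Pi.add_apply, hx, hx', onJet, Fin.sum_univ_two]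
  ring

theorem Maps.smul (hP : IsLinClass P) {u g : Plane → ℂ} (z : ℂ) (h : H.Maps P u g) :
    H.Maps P (z • u) (z • g) := by
  obtain ⟨d₁, d₂, hj, hg⟩ := h
  refine ⟨fun i => z • d₁ i, fun i j => z • d₂ i j,
    ⟨hP.smul z hj.base, fun i => hP.smul z (hj.first i), fun i j => hP.smul z (hj.second i j),
      fun i => (hj.weak_first i).smul z, fun i j => (hj.weak_second i j).smul z⟩, ?_⟩
  filter_upwards [hg] with x hx
  simp only [Pi.smul_apply, smul_eq_mul, hx, onJet, Fin.sum_univ_two]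
  ring

theorem Maps.zero (hP : IsLinClass P) : H.Maps P 0 0 :=
  ⟨fun _ => 0, fun _ _ => 0, ⟨hP.zero, fun _ => hP.zero, fun _ _ => hP.zero,
    fun i => HasWeakPartial.zero i, fun i _ => HasWeakPartial.zero i⟩,
    Eventually.of_forall fun x => by simp [onJet]⟩

theorem Maps.ae_zero {u g : Plane → ℂ} (h : H.Maps P u g) (hu : ∀ᵐ x, u x = 0) :
    ∀ᵐ x, g x = 0 := by
  obtain ⟨d₁, d₂, hj, hg⟩ := h
  have h1 : ∀ i, ∀ᵐ x, d₁ i x = 0 := fun i => (hj.weak_first i).ae_zero hu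
  have h2 : ∀ i j, ∀ᵐ x, d₂ i j x = 0 := fun i j => (hj.weak_second i j).ae_zero (h1 j)
  have h1' := ae_all_iff.2 h1
  have h2' := ae_all_iff.2 fun i => ae_all_iff.2 (h2 i)
  filter_upwards [hg, hu, h1', h2'] with x hx hux h1x h2x
  simp [hx, onJet, hux, h1x, h2x]

end RealDiffOp

theorem IsBloch.add {k : Plane} {u v : Plane → ℂ} (hu : IsBloch k u) (hv : IsBloch k v) :
    IsBloch k (u + v) := fun n₁ n₂ => by
  filter_upwards [hu n₁ n₂, hv n₁ n₂] with x h h'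
  simp only [Pi.add_apply, h, h']
  ring

theorem IsBloch.smul {k : Plane} {u : Plane → ℂ} (z : ℂ) (hu : IsBloch k u) :
    IsBloch k (z • u) := fun n₁ n₂ => by
  filter_upwards [hu n₁ n₂] with x h
  simp only [Pi.smul_apply, smul_eq_mul, h]
  ring

theorem IsBloch.zero (k : Plane) : IsBloch k 0 := fun _ _ => by simp

theorem IsEquivariant.add {j : Fin 3} {u v : Plane → ℂ} (hu : IsEquivariant j u)
    (hv : IsEquivariant j v) : IsEquivariant j (u + v) := by
  filter_upwards [hu, hv] with x h h'
  simp only [Pi.add_apply, h, h']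
  ring

theorem IsEquivariant.smul {j : Fin 3} {u : Plane → ℂ} (z : ℂ) (hu : IsEquivariant j u) :
    IsEquivariant j (z • u) := by
  filter_upwards [hu] with x h
  simp only [Pi.smul_apply, smul_eq_mul, h]
  ring

theorem IsEquivariant.zero (j : Fin 3) : IsEquivariant j 0 := by simp [IsEquivariant]

/-! ### The operators `H`, `H(k)` and `Q⁰ⱼ` as unbounded operators on Hilbert spaces -/

theorem isLinClass_true : IsLinClass (fun _ => True) := ⟨trivial, fun _ _ => trivial,
  fun _ _ _ => trivial⟩

theorem isLinClass_bloch (k : Plane) : IsLinClass (IsBloch k) :=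
  ⟨IsBloch.zero k, IsBloch.add, fun z _ hu => hu.smul z⟩

theorem isLinClass_blochEquiv (j : Fin 3) :
    IsLinClass (fun ψ => IsBloch 0 ψ ∧ IsEquivariant j ψ) :=
  ⟨⟨IsBloch.zero 0, IsEquivariant.zero j⟩, fun hu hv => ⟨hu.1.add hv.1, hu.2.add hv.2⟩,
    fun z _ hu => ⟨hu.1.smul z, hu.2.smul z⟩⟩

namespace RealDiffOp

/-- The graph of the operator induced on `L²(Ω)` by `H` acting on the functions `ψ` on the plane
that have the property `C` and weak derivatives up to second order in the class `P`: it consists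
of the pairs `(ψ|_Ω, (H ψ)|_Ω)`. -/
def restrGraph (H : RealDiffOp) (Ω : Set Plane) {P C : (Plane → ℂ) → Prop}
    (hP : IsLinClass P) (hC : IsLinClass C) : Submodule ℂ (L2 Ω × L2 Ω) where
  carrier := {p | ∃ ψ g : Plane → ℂ, C ψ ∧ H.Maps P ψ g ∧
    p.1 =ᵐ[volume.restrict Ω] ψ ∧ p.2 =ᵐ[volume.restrict Ω] g}
  zero_mem' := ⟨0, 0, hC.zero, Maps.zero hP, Lp.coeFn_zero _ _ _, Lp.coeFn_zero _ _ _⟩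
  add_mem' := by
    rintro p p' ⟨ψ, g, hψ, hg, h1, h2⟩ ⟨ψ', g', hψ', hg', h1', h2'⟩
    refine ⟨ψ + ψ', g + g', hC.add hψ hψ', hg.add hP hg', ?_, ?_⟩
    · exact (Lp.coeFn_add _ _).trans (h1.add h1')
    · exact (Lp.coeFn_add _ _).trans (h2.add h2')
  smul_mem' := by
    rintro z p ⟨ψ, g, hψ, hg, h1, h2⟩
    refine ⟨z • ψ, z • g, hC.smul z hψ, hg.smul hP z, ?_, ?_⟩
    · exact (Lp.coeFn_smul _ _).trans (h1.const_smul z)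
    · exact (Lp.coeFn_smul _ _).trans (h2.const_smul z)

/-- The graph of `H` in `L²(ℝ²)` with domain `H²(ℝ²)`. -/
def planeGraph (H : RealDiffOp) : Submodule ℂ (L2 Set.univ × L2 Set.univ) :=
  H.restrGraph Set.univ isLinClass_globL2 isLinClass_true

/-- The graph of `H(k)`: the restriction of `H` to the Bloch functions with quasimomentum `k`
that are in `H²_loc(ℝ²)`. A Bloch function is identified with its restriction to the
fundamental domain, which makes the Bloch functions the Hilbert space `L²(ΩH)`. -/
def blochGraph (H : RealDiffOp) (k : Plane) : Submodule ℂ (L2 ΩH × L2 ΩH) :=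
  H.restrGraph ΩH isLinClass_locL2 (isLinClass_bloch k)

/-- The graph of `Q⁰ⱼ`: the differential expression `H` on the rhombus `ΩR`, with the boundary
conditions which say that a function extends from `ΩR` to a lattice periodic function `ψ` in
`H²_loc(ℝ²)` with `R ψ = τ⁻ʲ ψ`. -/
def quotGraph (H : RealDiffOp) (j : Fin 3) : Submodule ℂ (L2 ΩR × L2 ΩR) :=
  H.restrGraph ΩR isLinClass_locL2 (isLinClass_blochEquiv j)

/-- The operator `H` in `L²(ℝ²)` with domain `H²(ℝ²)`. -/
def planeOp (H : RealDiffOp) : L2 Set.univ →ₗ.[ℂ] L2 Set.univ := H.planeGraph.toLinearPMap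

/-- The operator `H(k)`. -/
def blochOp (H : RealDiffOp) (k : Plane) : L2 ΩH →ₗ.[ℂ] L2 ΩH := (H.blochGraph k).toLinearPMap

/-- The operator `Q⁰ⱼ`. -/
def quotOp (H : RealDiffOp) (j : Fin 3) : L2 ΩR →ₗ.[ℂ] L2 ΩR := (H.quotGraph j).toLinearPMap

end RealDiffOp

/-! #### The three graphs are graphs of (single-valued) operators -/

theorem restrGraph_single_valued (H : RealDiffOp) (Ω : Set Plane) {P C : (Plane → ℂ) → Prop}
    (hP : IsLinClass P) (hC : IsLinClass C)
    (h : ∀ ψ, C ψ → (∀ᵐ x ∂(volume.restrict Ω), ψ x = 0) → ∀ᵐ x, ψ x = 0)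
    (p : L2 Ω × L2 Ω) (hp : p ∈ H.restrGraph Ω hP hC) (h0 : p.1 = 0) : p.2 = 0 := by
  obtain ⟨ψ, g, hψ, hg, h1, h2⟩ := hp
  rw [h0] at h1
  have e1 : ∀ᵐ x ∂(volume.restrict Ω), ψ x = 0 := by
    filter_upwards [h1, Lp.coeFn_zero ℂ 2 (volume.restrict Ω)] with x hx hx'
    rw [← hx, hx', Pi.zero_apply]
  have e2 := hg.ae_zero (h ψ hψ e1)
  rw [Lp.eq_zero_iff_ae_eq_zero]
  filter_upwards [h2, ae_restrict_of_ae e2] with x hx hx'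
  rw [hx, hx', Pi.zero_apply]

/-- The shifts of the hexagon cover the plane. -/
theorem exists_sub_latt_mem (x : Plane) : ∃ n₁ n₂ : ℤ, x - latt n₁ n₂ ∈ ΩH := by
  have h3 : √3 * √3 = 3 := Real.mul_self_sqrt (by norm_num)
  obtain ⟨s, t, hs, ht⟩ : ∃ s t : ℝ, √3 / 2 * (s + t) = x 0 ∧ (s - t) / 2 = x 1 :=
    ⟨x 0 / √3 + x 1, x 0 / √3 - x 1, by field_simp; ring, by ring⟩
  have key : ∀ n₁ n₂ : ℤ, |2 * (s - n₁) + (t - n₂)| ≤ 1 → |(s - n₁) + 2 * (t - n₂)| ≤ 1 →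
      |(s - n₁) - (t - n₂)| ≤ 1 → x - latt n₁ n₂ ∈ ΩH := by
    intro n₁ n₂ p1 p2 p3
    have c0 : (x - latt n₁ n₂) 0 = √3 / 2 * ((s - n₁) + (t - n₂)) := by
      simp [latt, a₁, a₂, ← hs]
      ring
    have c1 : (x - latt n₁ n₂) 1 = ((s - n₁) - (t - n₂)) / 2 := by
      simp [latt, a₁, a₂, ← ht]
      ring
    have m : √3 / 2 * (√3 / 2 * ((s - n₁) + (t - n₂))) = 3 / 4 * ((s - n₁) + (t - n₂)) := by
      linear_combination (1 / 4 * ((s - n₁) + (t - n₂))) * h3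
    rw [abs_le] at p1 p2 p3
    simp only [ΩH, Set.mem_ofPred_eq, c0, c1, m, abs_le]
    refine ⟨⟨?_, ?_⟩, ⟨?_, ?_⟩, ⟨?_, ?_⟩⟩ <;> linarith [p1.1, p1.2, p2.1, p2.2, p3.1, p3.2]
  have hs0 := Int.floor_le s
  have hs1 := Int.lt_floor_add_one s
  have ht0 := Int.floor_le t
  have ht1 := Int.lt_floor_add_one t
  by_cases b1 : 2 * (s - ⌊s⌋) + (t - ⌊t⌋) ≤ 1
  · by_cases b2 : (s - ⌊s⌋) + 2 * (t - ⌊t⌋) ≤ 1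
    · refine ⟨⌊s⌋, ⌊t⌋, key _ _ ?_ ?_ ?_⟩ <;> rw [abs_le] <;> constructor <;> linarith
    · refine ⟨⌊s⌋, ⌊t⌋ + 1, key _ _ ?_ ?_ ?_⟩ <;> push_cast <;> rw [abs_le] <;>
        constructor <;> linarith
  · by_cases b2 : (s - ⌊s⌋) + 2 * (t - ⌊t⌋) ≤ 1
    · refine ⟨⌊s⌋ + 1, ⌊t⌋, key _ _ ?_ ?_ ?_⟩ <;> push_cast <;> rw [abs_le] <;>
        constructor <;> linarith
    · by_cases b3 : (s - ⌊s⌋) + 2 * (t - ⌊t⌋) ≤ 2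
      · by_cases b4 : 2 * (s - ⌊s⌋) + (t - ⌊t⌋) ≤ 2
        · by_cases b5 : t - ⌊t⌋ ≤ s - ⌊s⌋
          · refine ⟨⌊s⌋ + 1, ⌊t⌋, key _ _ ?_ ?_ ?_⟩ <;> push_cast <;> rw [abs_le] <;>
              constructor <;> linarith
          · refine ⟨⌊s⌋, ⌊t⌋ + 1, key _ _ ?_ ?_ ?_⟩ <;> push_cast <;> rw [abs_le] <;>
              constructor <;> linarith
        · refine ⟨⌊s⌋ + 1, ⌊t⌋, key _ _ ?_ ?_ ?_⟩ <;> push_cast <;> rw [abs_le] <;>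
            constructor <;> linarith
      · by_cases b4 : 2 * (s - ⌊s⌋) + (t - ⌊t⌋) ≤ 2
        · refine ⟨⌊s⌋, ⌊t⌋ + 1, key _ _ ?_ ?_ ?_⟩ <;> push_cast <;> rw [abs_le] <;>
            constructor <;> linarith
        · refine ⟨⌊s⌋ + 1, ⌊t⌋ + 1, key _ _ ?_ ?_ ?_⟩ <;> push_cast <;> rw [abs_le] <;>
            constructor <;> linarith

theorem IsBloch.ae_zero {k : Plane} {ψ : Plane → ℂ} (hψ : IsBloch k ψ)
    (h : ∀ᵐ x ∂(volume.restrict ΩH), ψ x = 0) : ∀ᵐ x, ψ x = 0 := by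
  have h' := ae_imp_of_ae_restrict h
  have key : ∀ n₁ n₂ : ℤ, ∀ᵐ y : Plane, y - latt n₁ n₂ ∈ ΩH → ψ y = 0 := by
    intro n₁ n₂
    have mp := (measurePreserving_sub_right (volume : Measure Plane)
      (latt n₁ n₂)).quasiMeasurePreserving
    filter_upwards [mp.ae h', mp.ae (hψ n₁ n₂)] with y h1 h2 hy
    rw [sub_add_cancel] at h2
    rw [h2, h1 hy, mul_zero]
  have key' := ae_all_iff.2 fun n₁ => ae_all_iff.2 (key n₁)
  filter_upwards [key'] with y hy
  obtain ⟨n₁, n₂, hn⟩ := exists_sub_latt_mem y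
  exact hy n₁ n₂ hn

/-- The rotation as a linear isometry. -/
def rotIso : Plane →ₗᵢ[ℝ] Plane where
  toFun := rotPt
  map_add' x y := by
    ext i
    fin_cases i <;> simp [rotPt] <;> ring
  map_smul' z x := by
    ext i
    fin_cases i <;> simp [rotPt] <;> ring
  norm_map' x := by
    have h3 : √3 * √3 = 3 := Real.mul_self_sqrt (by norm_num)
    rw [EuclideanSpace.norm_eq, EuclideanSpace.norm_eq]
    congr 1
    simp [rotPt, Fin.sum_univ_two]
    linear_combination (1 / 4 * (x 0 ^ 2 + x 1 ^ 2)) * h3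

theorem measurePreserving_rotPt : MeasurePreserving rotPt (volume : Measure Plane) volume :=
  (rotIso.toLinearIsometryEquiv rfl).measurePreserving

/-- The rotated copies of the rhombus cover the hexagon. -/
theorem mem_rhombus_or {x : Plane} (hx : x ∈ ΩH) :
    x ∈ ΩR ∨ rotPt x ∈ ΩR ∨ rotPt (rotPt x) ∈ ΩR := by
  have h3 : √3 * √3 = 3 := Real.mul_self_sqrt (by norm_num)
  obtain ⟨⟨p1, p2⟩, ⟨p3, p4⟩, ⟨p5, p6⟩⟩ :
      (-(1 / 2) ≤ √3 / 2 * x 0 + 1 / 2 * x 1 ∧ √3 / 2 * x 0 + 1 / 2 * x 1 ≤ 1 / 2) ∧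
      (-(1 / 2) ≤ √3 / 2 * x 0 - 1 / 2 * x 1 ∧ √3 / 2 * x 0 - 1 / 2 * x 1 ≤ 1 / 2) ∧
      (-(1 / 2) ≤ x 1 ∧ x 1 ≤ 1 / 2) := by
    simpa only [ΩH, Set.mem_ofPred_eq, abs_le] using hx
  have e1 : √3 * (-(1 / 2) * x 0 + √3 / 2 * x 1) = -(√3 / 2) * x 0 + 3 / 2 * x 1 := by
    linear_combination (1 / 2 * x 1) * h3
  have e2 : √3 * (-(√3 / 2) * x 0 - 1 / 2 * x 1) = -(3 / 2) * x 0 - √3 / 2 * x 1 := by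
    linear_combination (-(1 / 2) * x 0) * h3
  have r1 : rotPt x ∈ ΩR ↔ -(1 / 2) ≤ -(√3 / 2) * x 0 - 1 / 2 * x 1 ∧
      -(√3 / 2) * x 0 - 1 / 2 * x 1 ≤ 0 ∧ -1 ≤ -√3 * x 0 + x 1 ∧ -√3 * x 0 + x 1 ≤ 0 := by
    simp only [ΩR, rotPt, Set.mem_ofPred_eq, Matrix.cons_val_zero, Matrix.cons_val_one, e1]
    constructor <;> rintro ⟨q1, q2, q3, q4⟩ <;> refine ⟨?_, ?_, ?_, ?_⟩ <;> linarith
  have r2 : rotPt (rotPt x) ∈ ΩR ↔ -(1 / 2) ≤ √3 / 2 * x 0 - 1 / 2 * x 1 ∧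
      √3 / 2 * x 0 - 1 / 2 * x 1 ≤ 0 ∧ -1 ≤ -2 * x 1 ∧ -2 * x 1 ≤ 0 := by
    have f0 : √3 * (-(1 / 2) * (-(1 / 2) * x 0 + √3 / 2 * x 1) +
        √3 / 2 * (-(√3 / 2) * x 0 - 1 / 2 * x 1)) = -(√3 / 2) * x 0 - 3 / 2 * x 1 := by
      linear_combination (-(1 / 4) * √3 * x 0 - 1 / 2 * x 1) * h3
    have f1 : -(√3 / 2) * (-(1 / 2) * x 0 + √3 / 2 * x 1) -
        1 / 2 * (-(√3 / 2) * x 0 - 1 / 2 * x 1) = √3 / 2 * x 0 - 1 / 2 * x 1 := by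
      linear_combination (-(1 / 4) * x 1) * h3
    simp only [ΩR, rotPt, Set.mem_ofPred_eq, PiLp.toLp_apply, Matrix.cons_val_zero,
      Matrix.cons_val_one, f0, f1]
    constructor <;> rintro ⟨q1, q2, q3, q4⟩ <;> refine ⟨?_, ?_, ?_, ?_⟩ <;> linarith
  rw [r1, r2]
  simp only [ΩR, Set.mem_ofPred_eq]
  by_cases c1 : √3 * x 0 + x 1 ≤ 0
  · by_cases c2 : x 1 ≤ 0
    · left
      refine ⟨?_, ?_, ?_, ?_⟩ <;> linarith
    · right; right
      refine ⟨?_, ?_, ?_, ?_⟩ <;> linarith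
  · by_cases c3 : -√3 * x 0 + x 1 ≤ 0
    · right; left
      refine ⟨?_, ?_, ?_, ?_⟩ <;> linarith
    · right; right
      refine ⟨?_, ?_, ?_, ?_⟩ <;> linarith

theorem IsEquivariant.ae_zero {j : Fin 3} {ψ : Plane → ℂ} (hψ : IsEquivariant j ψ)
    (h : ∀ᵐ x ∂(volume.restrict ΩR), ψ x = 0) : ∀ᵐ x ∂(volume.restrict ΩH), ψ x = 0 := by
  have hτ : (τ ^ (j : ℕ))⁻¹ ≠ 0 := inv_ne_zero (pow_ne_zero _ (Complex.exp_ne_zero _))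
  have mp := measurePreserving_rotPt.quasiMeasurePreserving
  have h0 := ae_imp_of_ae_restrict h
  have h1 := mp.ae h0
  have h2 := mp.ae h1
  have g1 := mp.ae hψ
  have all : ∀ᵐ x : Plane, x ∈ ΩH → ψ x = 0 := by
    filter_upwards [h0, h1, h2, hψ, g1] with x h0 h1 h2 g0 g1 hx
    rcases mem_rhombus_or hx with hr | hr | hr
    · exact h0 hr
    · have := h1 hr
      rw [g0] at this
      exact (mul_eq_zero.1 this).resolve_left hτ
    · have := h2 hr
      rw [g1, g0] at this
      exact (mul_eq_zero.1 ((mul_eq_zero.1 this).resolve_left hτ)).resolve_left hτ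
  have hm : MeasurableSet ΩH := by
    simp only [ΩH]
    apply IsClosed.measurableSet
    simp only [Set.ofPred_and]
    refine IsClosed.inter ?_ (IsClosed.inter ?_ ?_) <;>
      exact isClosed_le (by fun_prop) continuous_const
  exact (ae_restrict_iff' hm).2 all

theorem graph_planeOp (H : RealDiffOp) : H.planeOp.graph = H.planeGraph :=
  Submodule.toLinearPMap_graph_eq _ fun p hp h0 =>
    restrGraph_single_valued H _ _ _ (fun ψ _ h => by rwa [Measure.restrict_univ] at h) p hp h0

theorem graph_blochOp (H : RealDiffOp) (k : Plane) : (H.blochOp k).graph = H.blochGraph k :=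
  Submodule.toLinearPMap_graph_eq _ fun p hp h0 =>
    restrGraph_single_valued H _ _ _ (fun _ hψ h => hψ.ae_zero h) p hp h0

theorem graph_quotOp (H : RealDiffOp) (j : Fin 3) : (H.quotOp j).graph = H.quotGraph j :=
  Submodule.toLinearPMap_graph_eq _ fun p hp h0 =>
    restrGraph_single_valued H _ _ _ (fun _ hψ h => hψ.1.ae_zero (hψ.2.ae_zero h)) p hp h0

/-! ### Spectra, splittings, flatness -/

section Spectral

variable {E F : Type*} [NormedAddCommGroup E] [InnerProductSpace ℂ E]
  [NormedAddCommGroup F] [InnerProductSpace ℂ F]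

/-- The eigenspace `ker (A - z)` of an unbounded operator. -/
def eigenspaceOf (A : E →ₗ.[ℂ] E) (z : ℂ) : Submodule ℂ E where
  carrier := {f | (f, z • f) ∈ A.graph}
  zero_mem' := by
    simp only [Set.mem_ofPred_eq, smul_zero]
    exact A.graph.zero_mem
  add_mem' {f g} hf hg := by
    have := A.graph.add_mem hf hg
    simpa only [Set.mem_ofPred_eq, smul_add, Prod.mk_add_mk] using this
  smul_mem' w f hf := by
    have := A.graph.smul_mem w hf
    simpa only [Set.mem_ofPred_eq, Prod.smul_mk, smul_comm w z f] using this

/-- The multiplicity of `z` as an eigenvalue of `A` (`0` if it is not an eigenvalue). -/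
def multOf (A : E →ₗ.[ℂ] E) (z : ℂ) : Cardinal := Module.rank ℂ (eigenspaceOf A z)

/-- The spectrum of an unbounded operator: the `z` for which `A - z` does not have a bounded
everywhere defined inverse. -/
def spectrumOf (A : E →ₗ.[ℂ] E) : Set ℂ :=
  {z | ¬ ∃ B : E →L[ℂ] E, (∀ f, (B f, f + z • B f) ∈ A.graph) ∧
    ∀ f g, (f, g) ∈ A.graph → B (g - z • f) = f}

/-- Two operators are isospectral: they have the same spectrum and the same eigenvalues,
with the same multiplicities. -/
def Isospectral (A B : E →ₗ.[ℂ] E) : Prop :=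
  spectrumOf A = spectrumOf B ∧ ∀ z, multOf A z = multOf B z

/-- The isometries `T j` identify `A` with the direct sum `Q 0 ⊕ Q 1 ⊕ Q 2`: they identify
`E` with the orthogonal sum of three copies of `F`, the domain of `A` with the sum of the domains
of the `Q j`, and they intertwine the operators. -/
structure SplitsAs (A : E →ₗ.[ℂ] E) (Q : Fin 3 → F →ₗ.[ℂ] F) (T : Fin 3 → F →ₗᵢ[ℂ] E) :
    Prop where
  orthogonal : ∀ i j, i ≠ j → ∀ f g, ⟪T i f, T j g⟫_ℂ = 0
  complete : ∀ h : E, ∃ f : Fin 3 → F, h = ∑ j, T j (f j)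
  domain_iff : ∀ f : Fin 3 → F, ∑ j, T j (f j) ∈ A.domain ↔ ∀ j, f j ∈ (Q j).domain
  intertwines : ∀ j f g, (f, g) ∈ (Q j).graph → (T j f, T j g) ∈ A.graph

end Spectral

open Classical in
/-- Local flatness of a dispersion relation at `(0, l₀)`, where `mult k l` is the multiplicity of
`l` as an eigenvalue of `H(k)`: near `(0, l₀)` the dispersion relation consists of exactly two
sheets `l = s₁(k)` and `l = s₂(k)` (counted with multiplicity), and on both of them
`(l - l₀)² = o(|k|²)`. -/
def LocallyFlat (mult : Plane → ℝ → Cardinal.{0}) (l₀ : ℝ) : Prop :=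
  ∃ η > 0, ∃ s₁ s₂ : Plane → ℝ,
    (∀ᶠ k in 𝓝 (0 : Plane), |s₁ k - l₀| < η ∧ |s₂ k - l₀| < η ∧
      ∀ l, |l - l₀| < η → mult k l = (if l = s₁ k then 1 else 0) + (if l = s₂ k then 1 else 0)) ∧
    (fun k => (s₁ k - l₀) ^ 2) =o[𝓝 0] (fun k : Plane => ‖k‖ ^ 2) ∧
    (fun k => (s₂ k - l₀) ^ 2) =o[𝓝 0] (fun k : Plane => ‖k‖ ^ 2)

/-- The unfolding of functions on the rhombus:
`T j φ = 3^(-1/2) (φ + τʲ R φ + τ²ʲ R² φ)` on the hexagon, where `φ` is extended by `0`. -/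
def IsUnfolding (j : Fin 3) (T : L2 ΩR → L2 ΩH) : Prop :=
  ∀ φ : L2 ΩR, ∀ᵐ x ∂(volume.restrict ΩH), T φ x =
    (1 / √3 : ℝ) * ∑ l : Fin 3, τ ^ ((j : ℕ) * (l : ℕ)) * ΩR.indicator φ (rotPt^[(l : ℕ)] x)

/-! ### Discrete Schrödinger operators on graphs in the plane -/

/-- A discrete Schrödinger operator with real coefficients on a graph embedded in the plane.
Vertices are identified with their locations; `m u v > 0` is the weight of the edge `uv`, and
`m u v = 0` if there is no such edge. -/
structure GraphOp where
  V : Set Plane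
  m : Plane → Plane → ℝ
  q : Plane → ℝ
  locallyFinite : ∀ r : ℝ, (V ∩ Metric.closedBall 0 r).Finite
  m_nonneg : ∀ u v, 0 ≤ m u v
  m_symm : ∀ u v, m u v = m v u
  m_support : ∀ u v, m u v ≠ 0 → u ∈ V ∧ v ∈ V
  finiteDegree : ∀ v, {u | m v u ≠ 0}.Finite

namespace GraphOp

/-- `(H f)_v = ∑_{u ∼ v} m_{v,u} (f_v - f_u) + q_v f_v`. Functions on the vertex set are
functions on the plane that vanish off the vertex set. -/
def apply (G : GraphOp) (f : Plane → ℂ) (v : Plane) : ℂ :=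
  ∑ᶠ u, (G.m v u : ℂ) * (f v - f u) + (G.q v : ℂ) * f v

/-- Invariance under a transformation of the plane. -/
def InvariantUnder (G : GraphOp) (S : Plane → Plane) : Prop :=
  (∀ x, S x ∈ G.V ↔ x ∈ G.V) ∧ (∀ x y, G.m (S x) (S y) = G.m x y) ∧ ∀ x ∈ G.V, G.q (S x) = G.q x

/-- Invariance under the shifts by the lattice. -/
def ShiftInvariant (G : GraphOp) : Prop :=
  ∀ n₁ n₂ : ℤ, G.InvariantUnder (fun x => x + latt n₁ n₂)

/-- Invariance under the rotation by `2π/3`. -/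
def RotInvariant (G : GraphOp) : Prop := G.InvariantUnder rotPt

/-- The space of Bloch functions on the graph with quasimomentum `k`. -/
def bloch (G : GraphOp) (k : Plane) : Submodule ℂ (Plane → ℂ) where
  carrier := {f | (∀ x, x ∉ G.V → f x = 0) ∧
    ∀ (n₁ n₂ : ℤ) x, f (x + latt n₁ n₂) = phase k n₁ n₂ * f x}
  zero_mem' := by simp
  add_mem' {f g} hf hg := by
    refine ⟨fun x hx => ?_, fun n₁ n₂ x => ?_⟩
    · rw [Pi.add_apply, hf.1 x hx, hg.1 x hx, add_zero]
    · rw [Pi.add_apply, Pi.add_apply, hf.2, hg.2, mul_add]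
  smul_mem' z f hf := by
    refine ⟨fun x hx => ?_, fun n₁ n₂ x => ?_⟩
    · rw [Pi.smul_apply, hf.1 x hx, smul_zero]
    · rw [Pi.smul_apply, Pi.smul_apply, hf.2, smul_eq_mul, smul_eq_mul, mul_left_comm]

/-- The functions `f` in the space of `H(0)` with `R f = τ⁻ʲ f`; this is the space of `Q⁰ⱼ`. -/
def isotypic (G : GraphOp) (j : Fin 3) : Submodule ℂ (Plane → ℂ) where
  carrier := {f | f ∈ G.bloch 0 ∧ ∀ x, f (rotPt x) = (τ ^ (j : ℕ))⁻¹ * f x}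
  zero_mem' := ⟨Submodule.zero_mem _, by simp⟩
  add_mem' {f g} hf hg := by
    refine ⟨Submodule.add_mem _ hf.1 hg.1, fun x => ?_⟩
    rw [Pi.add_apply, Pi.add_apply, hf.2, hg.2, mul_add]
  smul_mem' z f hf := by
    refine ⟨Submodule.smul_mem _ z hf.1, fun x => ?_⟩
    rw [Pi.smul_apply, Pi.smul_apply, hf.2, smul_eq_mul, smul_eq_mul, mul_left_comm]

/-- The functions `f` in the space `W` with `H f = z f`. -/
def eigen (G : GraphOp) (W : Submodule ℂ (Plane → ℂ)) (z : ℂ) : Submodule ℂ (Plane → ℂ) where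
  carrier := {f | f ∈ W ∧ G.apply f = z • f}
  zero_mem' := ⟨Submodule.zero_mem _, by ext v; simp [apply]⟩
  add_mem' {f g} hf hg := by
    refine ⟨Submodule.add_mem _ hf.1 hg.1, ?_⟩
    rw [smul_add, ← hf.2, ← hg.2]
    ext v
    have fin : ∀ f : Plane → ℂ,
        (Function.support fun u => (G.m v u : ℂ) * (f v - f u)).Finite := fun f =>
      (G.finiteDegree v).subset fun u hu h0 => hu (by simp [h0])
    simp only [apply, Pi.add_apply]
    rw [show (∑ᶠ u, (G.m v u : ℂ) * (f v + g v - (f u + g u))) =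
      ∑ᶠ u, ((G.m v u : ℂ) * (f v - f u) + (G.m v u : ℂ) * (g v - g u)) from
        finsum_congr fun u => by ring, finsum_add_distrib (fin f) (fin g)]
    ring
  smul_mem' w f hf := by
    refine ⟨Submodule.smul_mem _ w hf.1, ?_⟩
    rw [smul_comm, ← hf.2]
    ext v
    simp only [apply, Pi.smul_apply, smul_eq_mul, mul_add]
    rw [mul_finsum' (fun u => (G.m v u : ℂ) * (f v - f u)) w
      ((G.finiteDegree v).subset fun u hu h0 => hu (by simp [h0]))]
    congr 1
    · exact finsum_congr fun u => by ring
    · ring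

/-- The multiplicity of `z` as an eigenvalue of the restriction of the operator to `W`. -/
def mult (G : GraphOp) (W : Submodule ℂ (Plane → ℂ)) (z : ℂ) : Cardinal :=
  Module.rank ℂ (G.eigen W z)

/-- The inner product of Bloch functions: the sum over the vertices in one period cell. -/
def cellInner (G : GraphOp) (f g : Plane → ℂ) : ℂ :=
  ∑ᶠ x ∈ G.V ∩ {x | ∃ s ∈ Set.Ico (0 : ℝ) 1, ∃ t ∈ Set.Ico (0 : ℝ) 1, x = s • a₁ + t • a₂},
    starRingEnd ℂ (f x) * g x

end GraphOp

end HexLattice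

end

noncomputable section

namespace HexLattice

/-! ### Hermitian matrices of size two -/

/-! Decomposition. The rotation commutes with `H` and has order three, so the lattice periodic
functions split into the components `R u = τ⁻ʲ u` by the projections `rotProj`. Such a component is
determined by its values on one rhombus; extending from the rhombus is, up to normalization, the
isometry `unfoldL2`, and this gives `splitsAs_blochOp`. Distinct components are orthogonal because
the integrand over the hexagon is multiplied by a nontrivial cube root of unity under rotation. The
coefficients are real, so complex conjugation is an antiunitary that exchanges the components `1`
and `2`, which makes them isospectral.

Self-adjointness. Only the operator on the whole plane is assumed self-adjoint, so symmetry and the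
surjectivity of `H(0) - z` must be derived from it. Symmetry on Bloch functions is Green's formula
on a period cell, `integral_symm_bloch`: cut off with smooth functions, use symmetry on the plane,
and resum over the lattice with a partition of unity. For surjectivity, a periodic right side is not
in `L²(ℝ²)`, but it is after division by a slowly growing weight. Conjugating `H` by that weight
changes it by a small bounded operator on `H²`, so the weighted resolvent exists, and its uniqueness
forces the solution to be periodic (`exists_periodic_solution`). Both properties pass to the
summands `Q⁰ⱼ`.

Flatness. Multiplication by a plane wave turns `H(k)` into `H + i L(k) - Q(k)` on the fixed space of
periodic `H²` functions, with `L` linear and `Q` quadratic in `k`. The eigenspace at `l₀` is spanned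
by an eigenfunction `u` of the component `1` and its conjugate. All matrix elements of `L(k)` on it
vanish. The diagonal ones are additive in `k` and invariant under a rotation of `k`, hence zero
(`eq_zero_of_rotMom`). The off-diagonal ones vanish because `L(k)` is real and antisymmetric. So the
eigenvalues move only by `O(‖k‖²)`, which is more than is claimed.

To obtain exactly two sheets, `locallyFlat_of_double_eigenvalue` adds the projection to the
eigenspace, which makes `H(k) - l` invertible near `(0, l₀)`, and reduces the kernel to that of a
Hermitian matrix of size two (`rank_ker_eq_schur`). This matrix is strictly decreasing in `l`, so
each of its two eigenvalues crosses zero once. The Fredholm property needed here comes from the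
compactness of the periodic `H²` in `L²`, proved with Fourier series (`isCompactOperator_jetBase`).

For graphs the same argument runs in finite dimension, with sums over the edges that start in a
period cell in place of integrals; both cases end in `locallyFlat_of_expansion`. -/

/-- The larger eigenvalue of the Hermitian matrix with diagonal `a, d` and upper entry `b`. -/
def topEig (a d : ℝ) (b : ℂ) : ℝ := (a + d) / 2 + √(((a - d) / 2) ^ 2 + ‖b‖ ^ 2)

/-- The smaller eigenvalue of the Hermitian matrix with diagonal `a, d` and upper entry `b`. -/
def botEig (a d : ℝ) (b : ℂ) : ℝ := (a + d) / 2 - √(((a - d) / 2) ^ 2 + ‖b‖ ^ 2)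

/-- Passing to the negative matrix lets every fact about the smaller eigenvalue follow from the
larger one. -/
theorem botEig_eq_neg (a d : ℝ) (b : ℂ) : botEig a d b = -topEig (-a) (-d) (-b) := by
  simp only [botEig, topEig, norm_neg]
  rw [show ((-a - -d) / 2) ^ 2 = ((a - d) / 2) ^ 2 by ring]
  ring

/-- The quadratic form of the Hermitian matrix with diagonal `a, d` and upper entry `b`. -/
def hermForm (a d : ℝ) (b : ℂ) (x y : ℂ) : ℝ :=
  a * ‖x‖ ^ 2 + d * ‖y‖ ^ 2 + 2 * (starRingEnd ℂ x * b * y).re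

theorem hermForm_neg (a d : ℝ) (b x y : ℂ) :
    hermForm (-a) (-d) (-b) x y = -hermForm a d b x y := by
  simp only [hermForm, mul_neg, neg_mul, Complex.neg_re]
  ring

theorem topEig_root (a d : ℝ) (b : ℂ) :
    (topEig a d b - a) * (topEig a d b - d) = ‖b‖ ^ 2 ∧ a ≤ topEig a d b ∧ d ≤ topEig a d b := by
  have h0 : 0 ≤ ((a - d) / 2) ^ 2 + ‖b‖ ^ 2 := by positivity
  have hs := Real.sq_sqrt h0
  have hs' := Real.sqrt_nonneg (((a - d) / 2) ^ 2 + ‖b‖ ^ 2)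
  have habs : |(a - d) / 2| ≤ √(((a - d) / 2) ^ 2 + ‖b‖ ^ 2) :=
    Real.abs_le_sqrt (by nlinarith [sq_nonneg ‖b‖])
  rw [abs_le] at habs
  refine ⟨?_, ?_, ?_⟩
  · simp only [topEig]
    linear_combination hs
  · simp only [topEig]; linarith
  · simp only [topEig]; linarith

/-- With `t` the larger root, `(t - a)(t - d) = ‖b‖²`, so `t` times the norm squared minus the form
is at least the perfect square of `√(t - a) ‖x‖ - √(t - d) ‖y‖`. -/
theorem hermForm_le (a d : ℝ) (b x y : ℂ) :
    hermForm a d b x y ≤ topEig a d b * (‖x‖ ^ 2 + ‖y‖ ^ 2) := by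
  obtain ⟨h1, h2, h3⟩ := topEig_root a d b
  set t := topEig a d b
  have hre : (starRingEnd ℂ x * b * y).re ≤ ‖x‖ * ‖b‖ * ‖y‖ := by
    refine (Complex.re_le_norm _).trans (le_of_eq ?_)
    rw [norm_mul, norm_mul, RCLike.norm_conj]
  have hb : ‖b‖ = √(t - a) * √(t - d) := by
    rw [← Real.sqrt_mul (by linarith), h1, Real.sqrt_sq (norm_nonneg _)]
  have e1 := Real.sq_sqrt (show 0 ≤ t - a by linarith)
  have e2 := Real.sq_sqrt (show 0 ≤ t - d by linarith)
  rw [hb] at hre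
  have := sq_nonneg (√(t - a) * ‖x‖ - √(t - d) * ‖y‖)
  have e3 : (√(t - a) * ‖x‖ - √(t - d) * ‖y‖) ^ 2 = (t - a) * ‖x‖ ^ 2 + (t - d) * ‖y‖ ^ 2
      - 2 * (‖x‖ * (√(t - a) * √(t - d)) * ‖y‖) := by
    linear_combination ‖x‖ ^ 2 * e1 + ‖y‖ ^ 2 * e2
  simp only [hermForm]
  nlinarith

/-- The maximum of the form is attained at the eigenvector `(b, t - a)`; when `t = a` the vector
`(1, 0)` serves instead. -/
theorem exists_hermForm_eq (a d : ℝ) (b : ℂ) : ∃ x y : ℂ, 0 < ‖x‖ ^ 2 + ‖y‖ ^ 2 ∧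
    hermForm a d b x y = topEig a d b * (‖x‖ ^ 2 + ‖y‖ ^ 2) := by
  obtain ⟨h1, h2, h3⟩ := topEig_root a d b
  set t := topEig a d b
  by_cases hta : t = a
  · refine ⟨1, 0, by norm_num, ?_⟩
    simp [hermForm, hta]
  · have hpos : 0 < t - a := lt_of_le_of_ne (by linarith) (fun h => hta (by linarith))
    refine ⟨b, (t - a : ℝ), ?_, ?_⟩
    · rw [Complex.norm_real, Real.norm_of_nonneg hpos.le]
      positivity
    · rw [hermForm, Complex.norm_real, Real.norm_of_nonneg hpos.le, mul_comm (starRingEnd ℂ b) b,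
        Complex.mul_conj, ← Complex.ofReal_mul, Complex.ofReal_re, Complex.normSq_eq_norm_sq]
      linear_combination (a - t) * h1

/-- The larger eigenvalue is the maximum of the form on unit vectors: test the larger form at a
maximiser of the smaller one. -/
theorem topEig_strictMono {a d a' d' : ℝ} {b b' : ℂ}
    (h : ∀ x y : ℂ, 0 < ‖x‖ ^ 2 + ‖y‖ ^ 2 → hermForm a d b x y < hermForm a' d' b' x y) :
    topEig a d b < topEig a' d' b' := by
  obtain ⟨x, y, hxy, he⟩ := exists_hermForm_eq a d b
  have h1 := h x y hxy
  have h2 := hermForm_le a' d' b' x y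
  rw [he] at h1
  exact lt_of_mul_lt_mul_right (h1.trans_le h2) hxy.le

theorem botEig_strictMono {a d a' d' : ℝ} {b b' : ℂ}
    (h : ∀ x y : ℂ, 0 < ‖x‖ ^ 2 + ‖y‖ ^ 2 → hermForm a d b x y < hermForm a' d' b' x y) :
    botEig a d b < botEig a' d' b' := by
  rw [botEig_eq_neg, botEig_eq_neg, neg_lt_neg_iff]
  refine topEig_strictMono fun x y hxy => ?_
  rw [hermForm_neg, hermForm_neg, neg_lt_neg_iff]
  exact h x y hxy

/-- The Hermitian matrix with diagonal `a, d` and upper entry `b`. -/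
def hermMat (a d : ℝ) (b : ℂ) : Matrix (Fin 2) (Fin 2) ℂ := !![(a : ℂ), b; starRingEnd ℂ b, (d : ℂ)]

theorem det_hermMat (a d : ℝ) (b : ℂ) :
    (hermMat a d b).det = ((topEig a d b * botEig a d b : ℝ) : ℂ) := by
  have h0 : 0 ≤ ((a - d) / 2) ^ 2 + ‖b‖ ^ 2 := by positivity
  have hs := Real.sq_sqrt h0
  have h1 : topEig a d b * botEig a d b = a * d - ‖b‖ ^ 2 := by
    simp only [topEig, botEig]
    linear_combination -hs
  rw [h1, hermMat, Matrix.det_fin_two_of, Complex.mul_conj, Complex.normSq_eq_norm_sq]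
  push_cast
  ring

theorem eq_zero_of_topEig_botEig {a d : ℝ} {b : ℂ} (h1 : topEig a d b = 0)
    (h2 : botEig a d b = 0) : a = 0 ∧ d = 0 ∧ b = 0 := by
  have h0 : 0 ≤ ((a - d) / 2) ^ 2 + ‖b‖ ^ 2 := by positivity
  have hs : √(((a - d) / 2) ^ 2 + ‖b‖ ^ 2) = 0 := by
    simp only [topEig, botEig] at h1 h2
    linarith
  have hsum : a + d = 0 := by
    simp only [topEig, botEig] at h1 h2
    linarith
  rw [Real.sqrt_eq_zero h0] at hs
  have hb : ‖b‖ = 0 := by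
    have : ‖b‖ ^ 2 = 0 := by nlinarith [sq_nonneg ((a - d) / 2), sq_nonneg ‖b‖]
    exact pow_eq_zero_iff (two_ne_zero) |>.1 this
  have had : (a - d) / 2 = 0 := by
    have : ((a - d) / 2) ^ 2 = 0 := by nlinarith [sq_nonneg ((a - d) / 2), sq_nonneg ‖b‖]
    exact pow_eq_zero_iff (two_ne_zero) |>.1 this
  exact ⟨by linarith, by linarith, norm_eq_zero.1 hb⟩

-- The kernel is everything only for the zero matrix, when both eigenvalues vanish. If just one
-- vanishes, the determinant is zero and the matrix is not, so the kernel is a line.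
open Classical in
theorem rank_ker_hermMat (a d : ℝ) (b : ℂ) :
    Module.rank ℂ (LinearMap.ker (Matrix.toLin' (hermMat a d b))) =
      (if topEig a d b = 0 then 1 else 0) + (if botEig a d b = 0 then 1 else 0) := by
  rw [← Module.finrank_eq_rank]
  have key : Module.finrank ℂ (LinearMap.ker (Matrix.toLin' (hermMat a d b))) =
      (if topEig a d b = 0 then 1 else 0) + (if botEig a d b = 0 then 1 else 0) := by
    by_cases h1 : topEig a d b = 0 ∧ botEig a d b = 0
    · obtain ⟨rfl, rfl, rfl⟩ := eq_zero_of_topEig_botEig h1.1 h1.2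
      have : hermMat 0 0 0 = 0 := by
        ext i j; fin_cases i <;> fin_cases j <;> simp [hermMat]
      rw [this, map_zero, LinearMap.ker_zero, finrank_top, if_pos h1.1, if_pos h1.2]
      simp
    · by_cases h2 : topEig a d b = 0 ∨ botEig a d b = 0
      · have hdet : (hermMat a d b).det = 0 := by
          rw [det_hermMat]
          rcases h2 with h | h <;> simp [h]
        obtain ⟨v, hv, hv0⟩ := Matrix.exists_mulVec_eq_zero_iff.2 hdet
        have hne : LinearMap.ker (Matrix.toLin' (hermMat a d b)) ≠ ⊥ := by
          rw [Submodule.ne_bot_iff]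
          exact ⟨v, by simpa using hv0, hv⟩
        have hnt : LinearMap.ker (Matrix.toLin' (hermMat a d b)) ≠ ⊤ := by
          intro h
          rw [LinearMap.ker_eq_top, LinearEquiv.map_eq_zero_iff] at h
          have ha : a = 0 := by simpa [hermMat] using congrFun (congrFun h 0) 0
          have hd : d = 0 := by simpa [hermMat] using congrFun (congrFun h 1) 1
          have hb : b = 0 := by simpa [hermMat] using congrFun (congrFun h 0) 1
          exact h1 (by simp [topEig, botEig, ha, hd, hb])
        have hlt := Submodule.finrank_lt hnt
        have hgt := Submodule.one_le_finrank_iff.2 hne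
        simp only [Module.finrank_fin_fun] at hlt
        have h3 : Module.finrank ℂ (LinearMap.ker (Matrix.toLin' (hermMat a d b))) = 1 := by omega
        rw [h3]
        rcases h2 with h | h
        · rw [if_pos h, if_neg fun h' => h1 ⟨h, h'⟩]
        · rw [if_pos h, if_neg fun h' => h1 ⟨h', h⟩]
      · push Not at h2
        have hdet : (hermMat a d b).det ≠ 0 := by
          rw [det_hermMat]
          exact_mod_cast mul_ne_zero h2.1 h2.2
        have hker : LinearMap.ker (Matrix.toLin' (hermMat a d b)) = ⊥ := by
          rw [Submodule.eq_bot_iff]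
          intro v hv
          by_contra hne
          exact hdet (Matrix.exists_mulVec_eq_zero_iff.1 ⟨v, hne, by simpa using hv⟩)
        rw [hker, finrank_bot, if_neg h2.1, if_neg h2.2]
  rw [key]
  push_cast
  split_ifs <;> rfl

/-- A strictly decreasing continuous family of Hermitian matrices of size two that starts positive
and ends negative has a kernel at exactly two parameters, counted with multiplicity. -/
theorem exists_two_crossings {a d : ℝ → ℝ} {b : ℝ → ℂ} {p q : ℝ} (hpq : p < q)
    (ha : ContinuousOn a (Set.Icc p q)) (hd : ContinuousOn d (Set.Icc p q))
    (hb : ContinuousOn b (Set.Icc p q))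
    (hmono : ∀ l ∈ Set.Icc p q, ∀ l' ∈ Set.Icc p q, l < l' → ∀ x y : ℂ, 0 < ‖x‖ ^ 2 + ‖y‖ ^ 2 →
      hermForm (a l') (d l') (b l') x y < hermForm (a l) (d l) (b l) x y)
    (hp : ∀ x y : ℂ, 0 < ‖x‖ ^ 2 + ‖y‖ ^ 2 → 0 < hermForm (a p) (d p) (b p) x y)
    (hq : ∀ x y : ℂ, 0 < ‖x‖ ^ 2 + ‖y‖ ^ 2 → hermForm (a q) (d q) (b q) x y < 0) :
    ∃ s₁ ∈ Set.Ioo p q, ∃ s₂ ∈ Set.Ioo p q, ∀ l ∈ Set.Icc p q,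
      (topEig (a l) (d l) (b l) = 0 ↔ l = s₁) ∧ (botEig (a l) (d l) (b l) = 0 ↔ l = s₂) := by
  have z0 : topEig 0 0 0 = 0 := by simp [topEig]
  have z1 : botEig 0 0 0 = 0 := by simp [botEig]
  have zf : ∀ x y, hermForm 0 0 0 x y = 0 := by simp [hermForm]
  -- Both eigenvalues are continuous, inherit the strict decrease of the form, and have its signs at
  -- the ends. So each has exactly one zero.
  have main : ∀ f : ℝ → ℝ, ContinuousOn f (Set.Icc p q) →
      (∀ l ∈ Set.Icc p q, ∀ l' ∈ Set.Icc p q, l < l' → f l' < f l) → 0 < f p → f q < 0 →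
      ∃ s ∈ Set.Ioo p q, ∀ l ∈ Set.Icc p q, f l = 0 ↔ l = s := by
    intro f hf hm h1 h2
    obtain ⟨s, hs, hs0⟩ := intermediate_value_Ioo' hpq.le hf ⟨h2, h1⟩
    have hs' := Set.Ioo_subset_Icc_self hs
    refine ⟨s, hs, fun l hl => ⟨fun h0 => ?_, fun h => h ▸ hs0⟩⟩
    rcases lt_trichotomy l s with h | h | h
    · have := hm l hl s hs' h
      linarith
    · exact h
    · have := hm s hs' l hl h
      linarith
  obtain ⟨s₁, hs₁, h₁⟩ := main (fun l => topEig (a l) (d l) (b l))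
    (by unfold topEig; fun_prop) (fun l hl l' hl' h => topEig_strictMono (hmono l hl l' hl' h))
    (z0.symm.trans_lt (topEig_strictMono fun x y h => (zf x y).trans_lt (hp x y h)))
    ((topEig_strictMono fun x y h => (hq x y h).trans_eq (zf x y).symm).trans_eq z0)
  obtain ⟨s₂, hs₂, h₂⟩ := main (fun l => botEig (a l) (d l) (b l))
    (by unfold botEig; fun_prop) (fun l hl l' hl' h => botEig_strictMono (hmono l hl l' hl' h))
    (z1.symm.trans_lt (botEig_strictMono fun x y h => (zf x y).trans_lt (hp x y h)))
    ((botEig_strictMono fun x y h => (hq x y h).trans_eq (zf x y).symm).trans_eq z1)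
  exact ⟨s₁, hs₁, s₂, hs₂, fun l hl => ⟨h₁ l hl, h₂ l hl⟩⟩

/-! ### Perturbation of a double eigenvalue -/

section Perturbation

variable {X Y : Type} [NormedAddCommGroup X] [NormedSpace ℂ X]
  [NormedAddCommGroup Y] [InnerProductSpace ℂ Y]

/-- The operator `B - l + P`, where `P` is the orthogonal projection to the span of `n 0, n 1`. -/
def bordered (ι : X →L[ℂ] Y) (n : Fin 2 → X) (B : X →L[ℂ] Y) (l : ℝ) : X →L[ℂ] Y :=
  B - (l : ℂ) • ι + ∑ i, ((innerSL ℂ (ι (n i))).comp ι).smulRight (ι (n i))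

theorem bordered_apply (ι : X →L[ℂ] Y) (n : Fin 2 → X) (B : X →L[ℂ] Y) (l : ℝ) (u : X) :
    bordered ι n B l u = B u - (l : ℂ) • ι u + ∑ i, ⟪ι (n i), ι u⟫_ℂ • ι (n i) := by
  simp [bordered, Fin.sum_univ_two]

theorem bordered_sub (ι : X →L[ℂ] Y) (n : Fin 2 → X) (B : X →L[ℂ] Y) (l l' : ℝ) (u : X) :
    bordered ι n B l u - bordered ι n B l' u = ((l' : ℂ) - l) • ι u := by
  simp only [bordered_apply]
  module

variable {ι : X →L[ℂ] Y} {n : Fin 2 → X} {B : X →L[ℂ] Y} {l : ℝ} {e : X ≃L[ℂ] Y}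

theorem bordered_symmetric (hsym : ∀ u v, ⟪B u, ι v⟫_ℂ = ⟪ι u, B v⟫_ℂ) (u v : X) :
    ⟪bordered ι n B l u, ι v⟫_ℂ = ⟪ι u, bordered ι n B l v⟫_ℂ := by
  simp only [bordered_apply, inner_add_left, inner_add_right, inner_sub_left, inner_sub_right,
    hsym, inner_smul_left, inner_smul_right, Fin.sum_univ_two, Complex.conj_ofReal,
    inner_conj_symm]
  ring

/-- The inverse of a symmetric operator is symmetric, where `ι` identifies `X` with a subspace of
`Y`. -/
theorem inner_symm_symmetric (hsym : ∀ u v, ⟪B u, ι v⟫_ℂ = ⟪ι u, B v⟫_ℂ)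
    (he : (e : X →L[ℂ] Y) = bordered ι n B l) (y z : Y) :
    ⟪y, ι (e.symm z)⟫_ℂ = ⟪ι (e.symm y), z⟫_ℂ := by
  have h := bordered_symmetric (n := n) (l := l) hsym (e.symm y) (e.symm z)
  rw [← he] at h
  simpa using h

/-- The matrix of the reduced problem on the span of `n 0, n 1`. -/
def schurMat (ι : X →L[ℂ] Y) (n : Fin 2 → X) (R : Y → X) : Matrix (Fin 2) (Fin 2) ℂ :=
  Matrix.of fun i j => (if i = j then 1 else 0) - ⟪ι (n i), ι (R (ι (n j)))⟫_ℂ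

/-- If `B u = l ι u`, only the projection survives in `e u`, so `u = e⁻¹ (∑ cⱼ ι nⱼ)` with `cⱼ = ⟪ι
nⱼ, ι u⟫`. That the coefficients reproduce themselves is the equation `S c = 0`. Hence `u ↦ c` and
`c ↦ e⁻¹ (∑ cⱼ ι nⱼ)` are inverse to each other. -/
theorem rank_ker_eq_schur (he : (e : X →L[ℂ] Y) = bordered ι n B l) :
    Module.rank ℂ (LinearMap.ker (B - (l : ℂ) • ι).toLinearMap) =
      Module.rank ℂ (LinearMap.ker (Matrix.toLin' (schurMat ι n e.symm))) := by
  have hmat : ∀ c : Fin 2 → ℂ, ∀ i, Matrix.mulVec (schurMat ι n e.symm) c i =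
      c i - ⟪ι (n i), ι (e.symm (∑ j, c j • ι (n j)))⟫_ℂ := by
    intro c i
    fin_cases i <;>
      simp only [schurMat, Matrix.mulVec, dotProduct, Fin.sum_univ_two, inner_add_right,
        inner_smul_right, Matrix.of_apply, map_add, map_smul] <;> simp <;> ring
  have hB : ∀ u, e u = B u - (l : ℂ) • ι u + ∑ i, ⟪ι (n i), ι u⟫_ℂ • ι (n i) := by
    intro u
    rw [← bordered_apply, ← he]; rfl
  have hker : ∀ u, u ∈ LinearMap.ker (B - (l : ℂ) • ι).toLinearMap ↔
      B u - (l : ℂ) • ι u = 0 := fun u => by simp [LinearMap.mem_ker]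
  have hker' : ∀ c, c ∈ LinearMap.ker (Matrix.toLin' (schurMat ι n e.symm)) ↔
      ∀ i, c i = ⟪ι (n i), ι (e.symm (∑ j, c j • ι (n j)))⟫_ℂ := by
    intro c
    rw [LinearMap.mem_ker, Matrix.toLin'_apply, funext_iff]
    refine forall_congr' fun i => ?_
    rw [hmat, Pi.zero_apply, sub_eq_zero]
  have h1 : ∀ u, B u - (l : ℂ) • ι u = 0 → e.symm (∑ j, ⟪ι (n j), ι u⟫_ℂ • ι (n j)) = u := by
    intro u hu
    have := hB u
    rw [hu, zero_add] at this
    rw [← this, e.symm_apply_apply]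
  refine LinearEquiv.rank_eq (LinearEquiv.ofLinearMap
    (LinearMap.codRestrict _ ((LinearMap.pi fun i =>
      ((innerSL ℂ (ι (n i))).comp ι).toLinearMap).comp (Submodule.subtype _)) ?_)
    (LinearMap.codRestrict _ ((e.symm.toLinearEquiv.toLinearMap.comp
      (∑ j, (LinearMap.proj j).smulRight (ι (n j)))).comp (Submodule.subtype _)) ?_) ?_ ?_)
  · rintro ⟨u, hu⟩
    rw [hker] at hu
    rw [hker']
    intro i
    simp only [LinearMap.comp_apply, LinearMap.pi_apply, Submodule.subtype_apply,
      ContinuousLinearMap.coe_coe, ContinuousLinearMap.comp_apply, innerSL_apply_apply]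
    rw [h1 u hu]
  · rintro ⟨c, hc⟩
    rw [hker'] at hc
    rw [hker]
    have := hB (e.symm (∑ j, c j • ι (n j)))
    rw [e.apply_symm_apply] at this
    simp only [← hc] at this
    have h2 : B (e.symm (∑ j, c j • ι (n j))) - (l : ℂ) • ι (e.symm (∑ j, c j • ι (n j))) = 0 := by
      simpa using this
    simpa [Fin.sum_univ_two] using h2
  · ext ⟨c, hc⟩ i
    rw [hker'] at hc
    have := hc i
    simpa [Fin.sum_univ_two, inner_add_right, inner_smul_right] using this.symm
  · ext ⟨u, hu⟩
    rw [hker] at hu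
    have := h1 u hu
    simpa [Fin.sum_univ_two] using this

theorem schurMat_eq_hermMat (hsym : ∀ u v, ⟪B u, ι v⟫_ℂ = ⟪ι u, B v⟫_ℂ)
    (he : (e : X →L[ℂ] Y) = bordered ι n B l) :
    schurMat ι n e.symm = hermMat (schurMat ι n e.symm 0 0).re (schurMat ι n e.symm 1 1).re
      (schurMat ι n e.symm 0 1) := by
  have hc : ∀ i j, starRingEnd ℂ (schurMat ι n e.symm i j) = schurMat ι n e.symm j i := by
    intro i j
    simp only [schurMat, Matrix.of_apply, map_sub, inner_conj_symm,
      inner_symm_symmetric hsym he, apply_ite (starRingEnd ℂ), map_one, map_zero]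
    simp only [eq_comm]
  ext i j
  fin_cases i <;> fin_cases j
  · simpa [hermMat] using (Complex.conj_eq_iff_re.1 (hc 0 0)).symm
  · simp [hermMat]
  · simpa [hermMat] using (hc 0 1).symm
  · simpa [hermMat] using (Complex.conj_eq_iff_re.1 (hc 1 1)).symm

/-- Expresses the reduced form through the resolvent on a single vector of the eigenspace, so that
it can be estimated without coordinates. -/
theorem hermForm_schurMat (hsym : ∀ u v, ⟪B u, ι v⟫_ℂ = ⟪ι u, B v⟫_ℂ)
    (he : (e : X →L[ℂ] Y) = bordered ι n B l) (x y : ℂ) :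
    hermForm (schurMat ι n e.symm 0 0).re (schurMat ι n e.symm 1 1).re
      (schurMat ι n e.symm 0 1) x y = ‖x‖ ^ 2 + ‖y‖ ^ 2 -
      (⟪x • ι (n 0) + y • ι (n 1), ι (e.symm (x • ι (n 0) + y • ι (n 1)))⟫_ℂ).re := by
  have hs := inner_symm_symmetric hsym he
  have h10 : ⟪ι (n 1), ι (e.symm (ι (n 0)))⟫_ℂ = starRingEnd ℂ ⟪ι (n 0), ι (e.symm (ι (n 1)))⟫_ℂ := by
    rw [inner_conj_symm, hs]
  simp only [hermForm, schurMat, Matrix.of_apply, map_add, map_smul, inner_add_left,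
    inner_add_right, inner_smul_left, inner_smul_right, h10, ← Complex.normSq_eq_norm_sq,
    Complex.normSq_apply, if_true, if_neg (show (0 : Fin 2) ≠ 1 by decide)]
  simp only [Complex.sub_re, Complex.add_re, Complex.mul_re, Complex.mul_im, Complex.conj_re,
    Complex.conj_im, Complex.one_re, Complex.zero_re, Complex.zero_im, Complex.sub_im,
    Complex.add_im]
  have h0 : (⟪ι (n 0), ι (e.symm (ι (n 0)))⟫_ℂ).im = 0 := by
    refine Complex.conj_eq_iff_im.1 ?_
    rw [inner_conj_symm, hs]
  have h1 : (⟪ι (n 1), ι (e.symm (ι (n 1)))⟫_ℂ).im = 0 := by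
    refine Complex.conj_eq_iff_im.1 ?_
    rw [inner_conj_symm, hs]
  rw [h0, h1]
  ring

theorem norm_comb_sq (horth : Orthonormal ℂ fun i => ι (n i)) (x y : ℂ) :
    ‖x • ι (n 0) + y • ι (n 1)‖ ^ 2 = ‖x‖ ^ 2 + ‖y‖ ^ 2 := by
  have h0 : ‖ι (n 0)‖ = 1 := horth.1 0
  have h1 : ‖ι (n 1)‖ = 1 := horth.1 1
  have h2 : ⟪x • ι (n 0), y • ι (n 1)⟫_ℂ = 0 := by
    rw [inner_smul_left, inner_smul_right, horth.2 (show (0 : Fin 2) ≠ 1 by decide)]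
    simp
  rw [sq, norm_add_sq_eq_norm_sq_add_norm_sq_of_inner_eq_zero _ _ h2, norm_smul, norm_smul, h0, h1]
  ring

section Estimates

variable {D : X →L[ℂ] Y} {l₀ K : ℝ} {m : X}

/-- The resolvent on the unperturbed eigenspace. -/
theorem symm_apply_eigen (horth : Orthonormal ℂ fun i => ι (n i))
    (he : (e : X →L[ℂ] Y) = bordered ι n B l)
    (hker : ∀ i, B (n i) - D (n i) = (l₀ : ℂ) • ι (n i)) (x y : ℂ)
    (hm : m = x • n 0 + y • n 1) :
    e.symm (ι m) = ((1 + l₀ - l : ℝ) : ℂ) • e.symm (ι m) - ((l₀ - l : ℝ) : ℂ) • e.symm (ι m) ∧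
    ((1 + l₀ - l : ℝ) : ℂ) • e.symm (ι m) = m - e.symm (D m) := by
  refine ⟨by push_cast; module, ?_⟩
  have h00 : ⟪ι (n 0), ι (n 0)⟫_ℂ = 1 := by
    rw [inner_self_eq_norm_sq_to_K, show ‖ι (n 0)‖ = 1 from horth.1 0]; simp
  have h11 : ⟪ι (n 1), ι (n 1)⟫_ℂ = 1 := by
    rw [inner_self_eq_norm_sq_to_K, show ‖ι (n 1)‖ = 1 from horth.1 1]; simp
  have h01 : ⟪ι (n 0), ι (n 1)⟫_ℂ = 0 := horth.2 (show (0 : Fin 2) ≠ 1 by decide)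
  have h10 : ⟪ι (n 1), ι (n 0)⟫_ℂ = 0 := horth.2 (show (1 : Fin 2) ≠ 0 by decide)
  have hB : ∀ i, B (n i) = (l₀ : ℂ) • ι (n i) + D (n i) := fun i => by rw [← hker i]; abel
  -- On the unperturbed eigenspace the added projection is the identity, which contributes the `1`.
  have h1 : e m = ((1 + l₀ - l : ℝ) : ℂ) • ι m + D m := by
    have : e m = bordered ι n B l m := by rw [← he]; rfl
    rw [this, bordered_apply, hm]
    simp only [map_add, map_smul, hB, Fin.sum_univ_two, inner_add_right, inner_smul_right, h00, h11,
      h01, h10]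
    push_cast
    module
  have h2 : e.symm (e m) = e.symm (((1 + l₀ - l : ℝ) : ℂ) • ι m + D m) := by rw [h1]
  rw [e.symm_apply_apply, map_add, map_smul] at h2
  rw [eq_sub_iff_add_eq, ← h2]

/-- To leading order the bordered resolvent acts on the unperturbed eigenspace as a scalar, with an
error linear in `D`. This crude bound suffices for monotonicity; flatness needs the second order
bound on the form. -/
theorem norm_symm_sub_le (horth : Orthonormal ℂ fun i => ι (n i))
    (he : (e : X →L[ℂ] Y) = bordered ι n B l)
    (hker : ∀ i, B (n i) - D (n i) = (l₀ : ℂ) • ι (n i)) (x y : ℂ)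
    (hm : m = x • n 0 + y • n 1) (hl : |l - l₀| ≤ 1 / 2) {M : ℝ}
    (hM : ‖(e.symm : Y →L[ℂ] X)‖ ≤ M) (hK : ‖m‖ ≤ K) (hM0 : 0 ≤ M) :
    ‖ι (e.symm (ι m)) - (((1 + l₀ - l)⁻¹ : ℝ) : ℂ) • ι m‖ ≤ 2 * (‖ι‖ * M * ‖D‖ * K) := by
  obtain ⟨-, h⟩ := symm_apply_eigen horth he hker x y hm
  rw [abs_le] at hl
  have hpos : (1 / 2 : ℝ) ≤ 1 + l₀ - l := by linarith
  have hne : ((1 + l₀ - l : ℝ) : ℂ) ≠ 0 := by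
    exact_mod_cast (by linarith : (1 + l₀ - l : ℝ) ≠ 0)
  have h2 : e.symm (ι m) = (((1 + l₀ - l)⁻¹ : ℝ) : ℂ) • (m - e.symm (D m)) := by
    rw [← h, Complex.ofReal_inv, inv_smul_smul₀ hne]
  have h3 : ι (e.symm (ι m)) - (((1 + l₀ - l)⁻¹ : ℝ) : ℂ) • ι m =
      -((((1 + l₀ - l)⁻¹ : ℝ) : ℂ) • ι (e.symm (D m))) := by
    rw [h2, map_smul, map_sub, smul_sub]; abel
  have h4 : ‖e.symm (D m)‖ ≤ M * (‖D‖ * ‖m‖) :=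
    ((e.symm : Y →L[ℂ] X).le_of_opNorm_le hM _).trans
      (mul_le_mul_of_nonneg_left (D.le_opNorm _) hM0)
  have h5 : ‖ι (e.symm (D m))‖ ≤ ‖ι‖ * M * ‖D‖ * K := by
    refine (ι.le_opNorm _).trans ((mul_le_mul_of_nonneg_left h4 (norm_nonneg _)).trans ?_)
    calc ‖ι‖ * (M * (‖D‖ * ‖m‖)) = ‖ι‖ * M * ‖D‖ * ‖m‖ := by ring
      _ ≤ _ := mul_le_mul_of_nonneg_left hK (by positivity)
  have h6 : (1 + l₀ - l)⁻¹ ≤ 2 := by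
    rw [inv_le_comm₀ (by linarith) (by norm_num)]; linarith
  rw [h3, norm_neg, norm_smul, Complex.norm_real, Real.norm_of_nonneg (by positivity)]
  exact mul_le_mul h6 h5 (norm_nonneg _) (by norm_num)

/-- The reduced form is `(l₀ - l) / (1 + l₀ - l)` up to second order in the perturbation. -/
theorem abs_form_sub_le (hsym : ∀ u v, ⟪B u, ι v⟫_ℂ = ⟪ι u, B v⟫_ℂ)
    (horth : Orthonormal ℂ fun i => ι (n i))
    (he : (e : X →L[ℂ] Y) = bordered ι n B l)
    (hker : ∀ i, B (n i) - D (n i) = (l₀ : ℂ) • ι (n i)) (x y : ℂ)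
    (hm : m = x • n 0 + y • n 1) (hl : |l - l₀| ≤ 1 / 2) {M c : ℝ}
    (hM : ‖(e.symm : Y →L[ℂ] X)‖ ≤ M) (hK : ‖m‖ ≤ K) (hM0 : 0 ≤ M)
    (hc : ‖⟪ι m, D m⟫_ℂ‖ ≤ c) :
    |(⟪ι m, ι (e.symm (ι m))⟫_ℂ).re - (1 + l₀ - l)⁻¹ * ‖ι m‖ ^ 2| ≤
      4 * (c + ‖ι‖ * M * (‖D‖ * K) ^ 2) := by
  obtain ⟨-, h⟩ := symm_apply_eigen horth he hker x y hm
  rw [abs_le] at hl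
  have hpos : (1 / 2 : ℝ) ≤ 1 + l₀ - l := by linarith
  have hne : ((1 + l₀ - l : ℝ) : ℂ) ≠ 0 := by
    exact_mod_cast (by linarith : (1 + l₀ - l : ℝ) ≠ 0)
  set θ : ℝ := (1 + l₀ - l)⁻¹ with hθ
  have h6 : θ ≤ 2 := by
    rw [hθ, inv_le_comm₀ (by linarith) (by norm_num)]; linarith
  have h60 : 0 ≤ θ := by positivity
  have h2 : e.symm (ι m) = (θ : ℂ) • (m - e.symm (D m)) := by
    rw [← h, hθ, Complex.ofReal_inv, inv_smul_smul₀ hne]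
  -- Expand the resolvent, move the remaining resolvent to the left slot by symmetry, and expand
  -- again. Then `D` enters only through `⟪ι m, D m⟫`, which is small by assumption, and through a
  -- term quadratic in `D`.
  have h3 : ⟪ι m, ι (e.symm (ι m))⟫_ℂ = θ * ⟪ι m, ι m⟫_ℂ -
      θ ^ 2 * (⟪ι m, D m⟫_ℂ - ⟪ι (e.symm (D m)), D m⟫_ℂ) := by
    have e1 : ⟪ι m, ι (e.symm (D m))⟫_ℂ = ⟪ι (e.symm (ι m)), D m⟫_ℂ :=
      inner_symm_symmetric hsym he _ _
    conv_lhs => rw [h2]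
    rw [map_smul, map_sub, inner_smul_right, inner_sub_right, e1, h2, map_smul, map_sub,
      inner_smul_left, inner_sub_left, Complex.conj_ofReal]
    ring
  have h4 : ‖D m‖ ≤ ‖D‖ * K := (D.le_opNorm _).trans (mul_le_mul_of_nonneg_left hK (norm_nonneg _))
  have h5 : ‖⟪ι (e.symm (D m)), D m⟫_ℂ‖ ≤ ‖ι‖ * M * (‖D‖ * K) ^ 2 := by
    refine (norm_inner_le_norm _ _).trans ?_
    have : ‖ι (e.symm (D m))‖ ≤ ‖ι‖ * (M * (‖D‖ * K)) :=
      (ι.le_opNorm _).trans (mul_le_mul_of_nonneg_left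
        (((e.symm : Y →L[ℂ] X).le_of_opNorm_le hM _).trans
          (mul_le_mul_of_nonneg_left h4 hM0)) (norm_nonneg _))
    calc ‖ι (e.symm (D m))‖ * ‖D m‖ ≤ ‖ι‖ * (M * (‖D‖ * K)) * (‖D‖ * K) :=
          mul_le_mul this h4 (norm_nonneg _) ((norm_nonneg _).trans this)
      _ = _ := by ring
  have h7 : (⟪ι m, ι (e.symm (ι m))⟫_ℂ).re - θ * ‖ι m‖ ^ 2 =
      (-(θ ^ 2 * (⟪ι m, D m⟫_ℂ - ⟪ι (e.symm (D m)), D m⟫_ℂ)) : ℂ).re := by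
    have hself : (⟪ι m, ι m⟫_ℂ).re = ‖ι m‖ ^ 2 := inner_self_eq_norm_sq (𝕜 := ℂ) (ι m)
    rw [h3, Complex.sub_re, Complex.neg_re, Complex.re_ofReal_mul, hself]
    ring
  rw [h7]
  refine (Complex.abs_re_le_norm _).trans ?_
  rw [norm_neg, norm_mul, norm_pow, Complex.norm_real, Real.norm_of_nonneg h60]
  have h8 : θ ^ 2 ≤ 4 := by nlinarith
  exact mul_le_mul h8 ((norm_sub_le _ _).trans (add_le_add hc h5)) (norm_nonneg _) (by norm_num)

/-- The reduced form is strictly decreasing in the spectral parameter. -/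
theorem form_strictMono (hsym : ∀ u v, ⟪B u, ι v⟫_ℂ = ⟪ι u, B v⟫_ℂ)
    {l' : ℝ} {e' : X ≃L[ℂ] Y} (he : (e : X →L[ℂ] Y) = bordered ι n B l)
    (he' : (e' : X →L[ℂ] Y) = bordered ι n B l') (hll : l < l') {w : Y} {θ θ' ε : ℝ}
    (h1 : ‖ι (e.symm w) - (θ : ℂ) • w‖ ≤ ε * ‖w‖) (h2 : ‖ι (e'.symm w) - (θ' : ℂ) • w‖ ≤ ε * ‖w‖)
    (hθ : 1 / 2 ≤ θ) (hθ' : 1 / 2 ≤ θ') (hθ2 : θ ≤ 2) (hθ2' : θ' ≤ 2) (hε : ε ≤ 1 / 40)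
    (hw : w ≠ 0) :
    (⟪w, ι (e.symm w)⟫_ℂ).re < (⟪w, ι (e'.symm w)⟫_ℂ).re := by
  have hw' : 0 < ‖w‖ := norm_pos_iff.2 hw
  -- The resolvent identity.
  have h3 : e'.symm w - e.symm w = ((l' : ℂ) - l) • e'.symm (ι (e.symm w)) := by
    have a1 : e (e.symm w) = bordered ι n B l (e.symm w) := by rw [← he]; rfl
    have a2 : e' (e.symm w) = bordered ι n B l' (e.symm w) := by rw [← he']; rfl
    have a3 := bordered_sub ι n B l l' (e.symm w)
    rw [← a1, ← a2, e.apply_symm_apply] at a3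
    apply e'.injective
    rw [map_sub, map_smul, e'.apply_symm_apply, e'.apply_symm_apply, a3]
  have h4 : ⟪w, ι (e'.symm w)⟫_ℂ - ⟪w, ι (e.symm w)⟫_ℂ =
      ((l' - l : ℝ) : ℂ) * ⟪ι (e'.symm w), ι (e.symm w)⟫_ℂ := by
    rw [← inner_sub_right, ← map_sub, h3, map_smul, inner_smul_right,
      inner_symm_symmetric hsym he']
    push_cast; rfl
  -- Both vectors are close to positive multiples of `w`. The main term is at least `‖w‖² / 4`, and
  -- the three errors add up to at most `5 ε ‖w‖² ≤ ‖w‖² / 8`; this is where `1 / 40` comes from.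
  have h5 : 0 < (⟪ι (e'.symm w), ι (e.symm w)⟫_ℂ).re := by
    set p := ι (e.symm w) - (θ : ℂ) • w with hp
    set p' := ι (e'.symm w) - (θ' : ℂ) • w with hp'
    have b1 : ι (e.symm w) = (θ : ℂ) • w + p := by rw [hp]; abel
    have b2 : ι (e'.symm w) = (θ' : ℂ) • w + p' := by rw [hp']; abel
    have b3 : (⟪ι (e'.symm w), ι (e.symm w)⟫_ℂ).re = θ' * θ * ‖w‖ ^ 2 +
        (θ' * (⟪w, p⟫_ℂ).re + θ * (⟪p', w⟫_ℂ).re + (⟪p', p⟫_ℂ).re) := by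
      rw [b1, b2]
      have hself : (⟪w, w⟫_ℂ).re = ‖w‖ ^ 2 := inner_self_eq_norm_sq (𝕜 := ℂ) w
      simp only [inner_add_left, inner_add_right, inner_smul_left, inner_smul_right,
        Complex.conj_ofReal, Complex.add_re, Complex.re_ofReal_mul, hself]
      ring
    have c1 : |(⟪w, p⟫_ℂ).re| ≤ ‖w‖ * (ε * ‖w‖) := (Complex.abs_re_le_norm _).trans
      ((norm_inner_le_norm _ _).trans (mul_le_mul_of_nonneg_left h1 hw'.le))
    have c2 : |(⟪p', w⟫_ℂ).re| ≤ (ε * ‖w‖) * ‖w‖ := (Complex.abs_re_le_norm _).trans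
      ((norm_inner_le_norm _ _).trans (mul_le_mul_of_nonneg_right h2 hw'.le))
    have c3 : |(⟪p', p⟫_ℂ).re| ≤ (ε * ‖w‖) * (ε * ‖w‖) := (Complex.abs_re_le_norm _).trans
      ((norm_inner_le_norm _ _).trans (mul_le_mul h2 h1 (norm_nonneg _)
        ((norm_nonneg _).trans h2)))
    have hε0 : 0 ≤ ε := by
      have := (norm_nonneg _).trans h1
      by_contra hneg
      push Not at hneg
      nlinarith
    rw [abs_le] at c1 c2 c3
    have d1 : -(2 * (ε * ‖w‖ ^ 2)) ≤ θ' * (⟪w, p⟫_ℂ).re := by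
      nlinarith [mul_nonneg hε0 (sq_nonneg ‖w‖), c1.1, c1.2]
    have d2 : -(2 * (ε * ‖w‖ ^ 2)) ≤ θ * (⟪p', w⟫_ℂ).re := by
      nlinarith [mul_nonneg hε0 (sq_nonneg ‖w‖), c2.1, c2.2]
    have d3 : -(ε * ‖w‖ ^ 2) ≤ (⟪p', p⟫_ℂ).re := by
      have : ε * ε ≤ ε := by nlinarith
      nlinarith [mul_le_mul_of_nonneg_right this (sq_nonneg ‖w‖), c3.1]
    have d4 : 1 / 4 ≤ θ' * θ := by nlinarith
    have d5 : 0 < ‖w‖ ^ 2 := by positivity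
    have d6 := mul_le_mul_of_nonneg_right d4 d5.le
    have d7 := mul_le_mul_of_nonneg_right hε d5.le
    rw [b3]
    linarith
  have h6 : (⟪w, ι (e'.symm w)⟫_ℂ).re - (⟪w, ι (e.symm w)⟫_ℂ).re =
      (l' - l) * (⟪ι (e'.symm w), ι (e.symm w)⟫_ℂ).re := by
    rw [← Complex.sub_re, h4, Complex.re_ofReal_mul]
  linarith [mul_pos (sub_pos.2 hll) h5]

end Estimates

end Perturbation

/-! ### Uniform invertibility and the splitting into two flat sheets. -/

section Perturbation

variable {X Y : Type} [NormedAddCommGroup X] [NormedSpace ℂ X] [CompleteSpace X]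
  [NormedAddCommGroup Y] [InnerProductSpace ℂ Y] [CompleteSpace Y]

/-- Near a bijective bordered operator all bordered operators have bounded inverses. -/
theorem exists_uniform_inverse {ι : X →L[ℂ] Y} {n : Fin 2 → X} {A : Plane → X →L[ℂ] Y} {l₀ : ℝ}
    (hbij : Function.Bijective (bordered ι n (A 0) l₀)) (hA : ContinuousAt A 0) :
    ∃ δ > 0, ∃ M > 0, ∀ k : Plane, ‖k‖ < δ → ∀ l : ℝ, |l - l₀| ≤ δ → ∃ e : X ≃L[ℂ] Y,
      (e : X →L[ℂ] Y) = bordered ι n (A k) l ∧ ‖(e.symm : Y →L[ℂ] X)‖ ≤ M := by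
  obtain ⟨e₀, he₀⟩ : ∃ e₀ : X ≃L[ℂ] Y, (e₀ : X →L[ℂ] Y) = bordered ι n (A 0) l₀ :=
    ⟨ContinuousLinearEquiv.ofBijective _ (LinearMap.ker_eq_bot.2 hbij.1)
      (LinearMap.range_eq_top.2 hbij.2), ContinuousLinearEquiv.coe_ofBijective _ _ _⟩
  have hcont : Tendsto (fun p : Plane × ℝ => bordered ι n (A p.1) p.2) (𝓝 (0, l₀))
      (𝓝 (e₀ : X →L[ℂ] Y)) := by
    rw [he₀]
    have h1 : Tendsto (fun p : Plane × ℝ => A p.1) (𝓝 (0, l₀)) (𝓝 (A 0)) :=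
      hA.tendsto.comp (continuous_fst.tendsto _)
    have h2 : Tendsto (fun p : Plane × ℝ => ((p.2 : ℂ)) • ι) (𝓝 (0, l₀)) (𝓝 ((l₀ : ℂ) • ι)) :=
      (by fun_prop : Continuous fun p : Plane × ℝ => ((p.2 : ℂ)) • ι).tendsto' _ _ rfl
    exact (h1.sub h2).add_const _
  have h1 := hcont.eventually (ContinuousLinearEquiv.nhds e₀)
  -- Inversion is continuous at an invertible operator, so the norm of the inverse exceeds its value
  -- at `e₀` by less than `1` nearby.
  have h2 : ∀ᶠ T in 𝓝 (e₀ : X →L[ℂ] Y), ‖ContinuousLinearMap.inverse T‖ <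
      ‖(e₀.symm : Y →L[ℂ] X)‖ + 1 := by
    have hc := (contDiffAt_map_inverse (𝕜 := ℂ) (n := 1) e₀).continuousAt.norm
    refine hc.eventually_lt continuousAt_const ?_
    rw [ContinuousLinearMap.inverse_equiv]
    exact lt_add_one _
  have h3 := hcont.eventually h2
  obtain ⟨δ, hδ, hball⟩ := Metric.eventually_nhds_iff.1 (h1.and h3)
  -- The bound on `l` is not strict, so half the radius of the ball is used.
  refine ⟨δ / 2, by positivity, ‖(e₀.symm : Y →L[ℂ] X)‖ + 1, by positivity, fun k hk l hl => ?_⟩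
  obtain ⟨⟨e, he⟩, hn⟩ := @hball (k, l) (by
    rw [Prod.dist_eq, max_lt_iff, dist_zero_right, Real.dist_eq]
    exact ⟨by linarith, by linarith⟩)
  refine ⟨e, he, ?_⟩
  simp only [← he, ContinuousLinearMap.inverse_equiv] at hn
  exact hn.le

/-- An eigenvector with eigenvalue zero makes the form vanish, so there the scalar part must be
absorbed by the error. This locates the crossings. -/
theorem abs_le_of_hermForm_zero {a d t c : ℝ} {b : ℂ} (hbound : ∀ x y : ℂ,
      |hermForm a d b x y - t * (‖x‖ ^ 2 + ‖y‖ ^ 2)| ≤ c * (‖x‖ ^ 2 + ‖y‖ ^ 2))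
    (h : topEig a d b = 0 ∨ botEig a d b = 0) : |t| ≤ c := by
  have key : ∃ x y : ℂ, 0 < ‖x‖ ^ 2 + ‖y‖ ^ 2 ∧ hermForm a d b x y = 0 := by
    rcases h with h | h
    · obtain ⟨x, y, h1, h2⟩ := exists_hermForm_eq a d b
      exact ⟨x, y, h1, by rw [h2, h, zero_mul]⟩
    · obtain ⟨x, y, h1, h2⟩ := exists_hermForm_eq (-a) (-d) (-b)
      rw [botEig_eq_neg, neg_eq_zero] at h
      rw [h, zero_mul, hermForm_neg, neg_eq_zero] at h2
      exact ⟨x, y, h1, h2⟩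
  obtain ⟨x, y, h1, h2⟩ := key
  have := hbound x y
  rw [h2, zero_sub, abs_neg, abs_mul, abs_of_pos h1] at this
  exact le_of_mul_le_mul_right this h1

set_option maxHeartbeats 1000000 in
/-- A double eigenvalue of a symmetric family splits into two sheets that are flat, if the
perturbation vanishes to first order on the eigenspace. -/
theorem locallyFlat_of_double_eigenvalue {ι : X →L[ℂ] Y} {n : Fin 2 → X} {A : Plane → X →L[ℂ] Y}
    {l₀ : ℝ} (hsym : ∀ k u v, ⟪A k u, ι v⟫_ℂ = ⟪ι u, A k v⟫_ℂ)
    (horth : Orthonormal ℂ fun i => ι (n i))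
    (hker : ∀ i, A 0 (n i) = (l₀ : ℂ) • ι (n i))
    (hbij : Function.Bijective (bordered ι n (A 0) l₀)) {C : ℝ}
    (h1 : ∀ᶠ k in 𝓝 0, ‖A k - A 0‖ ≤ C * ‖k‖)
    (h2 : ∀ᶠ k in 𝓝 0, ∀ i j, ‖⟪ι (n i), (A k - A 0) (n j)⟫_ℂ‖ ≤ C * ‖k‖ ^ 2) :
    LocallyFlat (fun k l => Module.rank ℂ (LinearMap.ker (A k - (l : ℂ) • ι).toLinearMap)) l₀ := by
  have hA : ContinuousAt A 0 := by
    rw [ContinuousAt, tendsto_iff_norm_sub_tendsto_zero]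
    refine squeeze_zero' (Eventually.of_forall fun _ => norm_nonneg _) h1 ?_
    exact (by fun_prop : Continuous fun k : Plane => C * ‖k‖).tendsto' _ _ (by simp)
  obtain ⟨δ, hδ, M, hM, hinv⟩ := exists_uniform_inverse hbij hA
  set κ : ℝ := ‖n 0‖ + ‖n 1‖ with hκ
  have hκ0 : 0 ≤ κ := by positivity
  -- `C₁ ‖k‖²` is the error of the reduced form in `abs_form_sub_le`, `C₂ ‖k‖` that of the resolvent
  -- in `norm_symm_sub_le`; `κ` compares the norm of `X` with that of `Y` on the eigenspace. The
  -- bound `η ≤ 1 / 2` keeps `1 + l₀ - l` away from zero.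
  set C₁ : ℝ := 4 * (2 * C + ‖ι‖ * M * (C * κ) ^ 2) with hC₁
  set C₂ : ℝ := 2 * (‖ι‖ * M * C * κ) with hC₂
  set η : ℝ := min δ (1 / 2) with hη
  have hη0 : 0 < η := by positivity
  have hηδ : η ≤ δ := min_le_left _ _
  have hη2 : η ≤ 1 / 2 := min_le_right _ _
  -- the smallness conditions on the parameter
  have good : ∀ᶠ k in 𝓝 (0 : Plane), ‖k‖ < δ ∧ ‖A k - A 0‖ ≤ C * ‖k‖ ∧
      (∀ i j, ‖⟪ι (n i), (A k - A 0) (n j)⟫_ℂ‖ ≤ C * ‖k‖ ^ 2) ∧ C₁ * ‖k‖ ^ 2 < η / 2 ∧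
      C₂ * ‖k‖ < 1 / 40 := by
    refine Filter.Eventually.and ?_ (h1.and (h2.and (Filter.Eventually.and ?_ ?_)))
    · exact (continuous_norm.tendsto' (0 : Plane) 0 norm_zero).eventually_lt_const hδ
    · exact ((by fun_prop : Continuous fun k : Plane => C₁ * ‖k‖ ^ 2).tendsto' 0 0
        (by simp)).eventually_lt_const (by positivity)
    · exact ((by fun_prop : Continuous fun k : Plane => C₂ * ‖k‖).tendsto' 0 0
        (by simp)).eventually_lt_const (by norm_num)
  -- The total function `inverse` makes `S` a function of all `k` and `l`, so that its continuity in
  -- `l` can be stated; near `(0, l₀)` it is the true reduced matrix.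
  set S : Plane → ℝ → Matrix (Fin 2) (Fin 2) ℂ := fun k l =>
    schurMat ι n (ContinuousLinearMap.inverse (bordered ι n (A k) l)) with hS
  -- the two sheets
  have sheets : ∀ k : Plane, (‖k‖ < δ ∧ ‖A k - A 0‖ ≤ C * ‖k‖ ∧
      (∀ i j, ‖⟪ι (n i), (A k - A 0) (n j)⟫_ℂ‖ ≤ C * ‖k‖ ^ 2) ∧ C₁ * ‖k‖ ^ 2 < η / 2 ∧
      C₂ * ‖k‖ < 1 / 40) → ∃ s₁ ∈ Set.Ioo (l₀ - η) (l₀ + η), ∃ s₂ ∈ Set.Ioo (l₀ - η) (l₀ + η),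
      (∀ l ∈ Set.Icc (l₀ - η) (l₀ + η),
        (topEig (S k l 0 0).re (S k l 1 1).re (S k l 0 1) = 0 ↔ l = s₁) ∧
        (botEig (S k l 0 0).re (S k l 1 1).re (S k l 0 1) = 0 ↔ l = s₂)) ∧
      |s₁ - l₀| ≤ 2 * C₁ * ‖k‖ ^ 2 ∧ |s₂ - l₀| ≤ 2 * C₁ * ‖k‖ ^ 2 := by
    rintro k ⟨hk, hD, hD2, hk1, hk2⟩
    set D := A k - A 0 with hDdef
    have hkerD : ∀ i, A k (n i) - D (n i) = (l₀ : ℂ) • ι (n i) := fun i => by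
      rw [← hker i, hDdef]; simp
    have hmem : ∀ l ∈ Set.Icc (l₀ - η) (l₀ + η), |l - l₀| ≤ η := fun l hl => by
      rw [abs_le]; constructor <;> linarith [hl.1, hl.2]
    have hm : ∀ x y : ℂ, ‖x • n 0 + y • n 1‖ ≤ κ * ‖x • ι (n 0) + y • ι (n 1)‖ := by
      intro x y
      have hsq := norm_comb_sq horth x y
      have hx : ‖x‖ ≤ ‖x • ι (n 0) + y • ι (n 1)‖ :=
        le_of_sq_le_sq (by rw [hsq]; nlinarith [sq_nonneg ‖y‖]) (norm_nonneg _)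
      have hy : ‖y‖ ≤ ‖x • ι (n 0) + y • ι (n 1)‖ :=
        le_of_sq_le_sq (by rw [hsq]; nlinarith [sq_nonneg ‖x‖]) (norm_nonneg _)
      refine (norm_add_le _ _).trans ?_
      rw [norm_smul, norm_smul, hκ]
      nlinarith [mul_le_mul_of_nonneg_right hx (norm_nonneg (n 0)),
        mul_le_mul_of_nonneg_right hy (norm_nonneg (n 1))]
    have hmD : ∀ x y : ℂ, ‖⟪ι (x • n 0 + y • n 1), D (x • n 0 + y • n 1)⟫_ℂ‖ ≤
        2 * C * ‖k‖ ^ 2 * (‖x‖ ^ 2 + ‖y‖ ^ 2) := by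
      intro x y
      have e1 : ⟪ι (x • n 0 + y • n 1), D (x • n 0 + y • n 1)⟫_ℂ =
          (starRingEnd ℂ x * x * ⟪ι (n 0), D (n 0)⟫_ℂ + starRingEnd ℂ x * y * ⟪ι (n 0), D (n 1)⟫_ℂ) +
          (starRingEnd ℂ y * x * ⟪ι (n 1), D (n 0)⟫_ℂ + starRingEnd ℂ y * y * ⟪ι (n 1), D (n 1)⟫_ℂ) := by
        simp only [map_add, map_smul, inner_add_left, inner_add_right, inner_smul_left,
          inner_smul_right]
        ring
      have e2 : ∀ (p q : ℂ) i j, ‖starRingEnd ℂ p * q * ⟪ι (n i), D (n j)⟫_ℂ‖ ≤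
          ‖p‖ * ‖q‖ * (C * ‖k‖ ^ 2) := by
        intro p q i j
        rw [norm_mul, norm_mul, RCLike.norm_conj]
        exact mul_le_mul_of_nonneg_left (hD2 i j) (by positivity)
      have hCk : 0 ≤ C * ‖k‖ ^ 2 := (norm_nonneg _).trans (hD2 0 0)
      rw [e1]
      refine (norm_add_le _ _).trans ((add_le_add (norm_add_le _ _) (norm_add_le _ _)).trans ?_)
      refine (add_le_add (add_le_add (e2 _ _ _ _) (e2 _ _ _ _))
        (add_le_add (e2 _ _ _ _) (e2 _ _ _ _))).trans ?_
      have : (‖x‖ + ‖y‖) ^ 2 ≤ 2 * (‖x‖ ^ 2 + ‖y‖ ^ 2) := by nlinarith [sq_nonneg (‖x‖ - ‖y‖)]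
      nlinarith [mul_le_mul_of_nonneg_right this hCk]
    have hι : ∀ x y : ℂ, ι (x • n 0 + y • n 1) = x • ι (n 0) + y • ι (n 1) := by simp
    have hbound : ∀ l ∈ Set.Icc (l₀ - η) (l₀ + η), ∀ x y : ℂ,
        |hermForm (S k l 0 0).re (S k l 1 1).re (S k l 0 1) x y -
          (1 - (1 + l₀ - l)⁻¹) * (‖x‖ ^ 2 + ‖y‖ ^ 2)| ≤ C₁ * ‖k‖ ^ 2 * (‖x‖ ^ 2 + ‖y‖ ^ 2) := by
      intro l hl x y
      obtain ⟨e, he, heM⟩ := hinv k hk l ((hmem l hl).trans hηδ)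
      have hSe : S k l = schurMat ι n e.symm := by
        simp only [hS, ← he, ContinuousLinearMap.inverse_equiv]; rfl
      rw [hSe, hermForm_schurMat (hsym k) he, ← hι]
      have := abs_form_sub_le (hsym k) horth he hkerD x y rfl ((hmem l hl).trans hη2) heM
        (hm x y) hM.le (hmD x y)
      rw [hι, norm_comb_sq horth, ← hι] at this
      rw [show ‖x‖ ^ 2 + ‖y‖ ^ 2 - (⟪ι (x • n 0 + y • n 1), ι (e.symm (ι (x • n 0 + y • n 1)))⟫_ℂ).re
        - (1 - (1 + l₀ - l)⁻¹) * (‖x‖ ^ 2 + ‖y‖ ^ 2) =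
        -((⟪ι (x • n 0 + y • n 1), ι (e.symm (ι (x • n 0 + y • n 1)))⟫_ℂ).re -
          (1 + l₀ - l)⁻¹ * (‖x‖ ^ 2 + ‖y‖ ^ 2)) by ring, abs_neg]
      refine this.trans ?_
      have e3 : (‖D‖ * (κ * ‖x • ι (n 0) + y • ι (n 1)‖)) ^ 2 ≤
          (C * κ) ^ 2 * ‖k‖ ^ 2 * (‖x‖ ^ 2 + ‖y‖ ^ 2) := by
        rw [mul_pow, mul_pow, norm_comb_sq horth]
        calc ‖D‖ ^ 2 * (κ ^ 2 * (‖x‖ ^ 2 + ‖y‖ ^ 2)) ≤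
            (C * ‖k‖) ^ 2 * (κ ^ 2 * (‖x‖ ^ 2 + ‖y‖ ^ 2)) := by gcongr
          _ = _ := by ring
      have e4 := mul_le_mul_of_nonneg_left e3 (by positivity : 0 ≤ ‖ι‖ * M)
      rw [← hι] at e4
      rw [hC₁]
      linarith
    have hθ : ∀ l ∈ Set.Icc (l₀ - η) (l₀ + η), 1 / 2 ≤ (1 + l₀ - l)⁻¹ ∧ (1 + l₀ - l)⁻¹ ≤ 2 := by
      intro l hl
      have h := abs_le.1 ((hmem l hl).trans hη2)
      constructor
      · rw [le_inv_comm₀ (by norm_num) (by linarith)]; linarith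
      · rw [inv_le_comm₀ (by linarith) (by norm_num)]; linarith
    have hmono : ∀ l ∈ Set.Icc (l₀ - η) (l₀ + η), ∀ l' ∈ Set.Icc (l₀ - η) (l₀ + η), l < l' →
        ∀ x y : ℂ, 0 < ‖x‖ ^ 2 + ‖y‖ ^ 2 →
        hermForm (S k l' 0 0).re (S k l' 1 1).re (S k l' 0 1) x y <
          hermForm (S k l 0 0).re (S k l 1 1).re (S k l 0 1) x y := by
      intro l hl l' hl' hll x y hxy
      obtain ⟨e, he, heM⟩ := hinv k hk l ((hmem l hl).trans hηδ)
      obtain ⟨e', he', heM'⟩ := hinv k hk l' ((hmem l' hl').trans hηδ)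
      have hSe : S k l = schurMat ι n e.symm := by
        simp only [hS, ← he, ContinuousLinearMap.inverse_equiv]; rfl
      have hSe' : S k l' = schurMat ι n e'.symm := by
        simp only [hS, ← he', ContinuousLinearMap.inverse_equiv]; rfl
      rw [hSe, hSe', hermForm_schurMat (hsym k) he, hermForm_schurMat (hsym k) he']
      have b1 := norm_symm_sub_le horth he hkerD x y rfl ((hmem l hl).trans hη2) heM
        (hm x y) hM.le
      have b2 := norm_symm_sub_le horth he' hkerD x y rfl ((hmem l' hl').trans hη2) heM'
        (hm x y) hM.le
      rw [hι] at b1 b2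
      have b3 : 2 * (‖ι‖ * M * ‖D‖ * (κ * ‖x • ι (n 0) + y • ι (n 1)‖)) ≤
          C₂ * ‖k‖ * ‖x • ι (n 0) + y • ι (n 1)‖ := by
        calc _ ≤ 2 * (‖ι‖ * M * (C * ‖k‖) * (κ * ‖x • ι (n 0) + y • ι (n 1)‖)) := by gcongr
          _ = _ := by rw [hC₂]; ring
      have hw : x • ι (n 0) + y • ι (n 1) ≠ 0 := by
        intro h0
        have := norm_comb_sq horth x y
        rw [h0, norm_zero] at this
        linarith
      have := form_strictMono (hsym k) he he' hll (b1.trans b3) (b2.trans b3) (hθ l hl).1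
        (hθ l' hl').1 (hθ l hl).2 (hθ l' hl').2 hk2.le hw
      linarith
    have hcont : ContinuousOn (fun l => ContinuousLinearMap.inverse (bordered ι n (A k) l))
        (Set.Icc (l₀ - η) (l₀ + η)) := by
      intro l hl
      obtain ⟨e, he, -⟩ := hinv k hk l ((hmem l hl).trans hηδ)
      have hb : Continuous fun l : ℝ => bordered ι n (A k) l := by
        unfold bordered; fun_prop
      have hc := (contDiffAt_map_inverse (𝕜 := ℂ) (n := 1) e).continuousAt
      rw [he] at hc
      exact (hc.comp hb.continuousAt).continuousWithinAt
    have hcS : ∀ i j, ContinuousOn (fun l => S k l i j) (Set.Icc (l₀ - η) (l₀ + η)) := by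
      intro i j
      simp only [hS, schurMat, Matrix.of_apply]
      refine continuousOn_const.sub (continuousOn_const.inner (𝕜 := ℂ) ?_)
      exact ι.continuous.comp_continuousOn (hcont.clm_apply continuousOn_const)
    have hleft : l₀ - η ∈ Set.Icc (l₀ - η) (l₀ + η) := ⟨le_rfl, by linarith⟩
    have hright : l₀ + η ∈ Set.Icc (l₀ - η) (l₀ + η) := ⟨by linarith, le_rfl⟩
    obtain ⟨s₁, hs₁, s₂, hs₂, hs⟩ := exists_two_crossings
      (a := fun l => (S k l 0 0).re) (d := fun l => (S k l 1 1).re) (b := fun l => S k l 0 1)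
      (by linarith : l₀ - η < l₀ + η)
      (Complex.continuous_re.comp_continuousOn (hcS 0 0))
      (Complex.continuous_re.comp_continuousOn (hcS 1 1)) (hcS 0 1) hmono
      (by
        intro x y hxy
        have h := (abs_le.1 (hbound _ hleft x y)).1
        -- At the two ends the scalar part is `η / (1 + η)` and `-η / (1 - η)`, of size at least `η
        -- / 2`. This beats the error `C₁ ‖k‖² < η / 2`, so the form is definite there.
        have ht : η / 2 ≤ 1 - (1 + l₀ - (l₀ - η))⁻¹ := by
          have e1 : 1 - (1 + l₀ - (l₀ - η))⁻¹ = η / (1 + η) := by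
            rw [show 1 + l₀ - (l₀ - η) = 1 + η by ring]; field_simp; ring
          rw [e1]
          exact div_le_div_of_nonneg_left hη0.le (by linarith) (by linarith)
        nlinarith [mul_lt_mul_of_pos_right hk1 hxy, mul_le_mul_of_nonneg_right ht hxy.le])
      (by
        intro x y hxy
        have h := (abs_le.1 (hbound _ hright x y)).2
        have ht : 1 - (1 + l₀ - (l₀ + η))⁻¹ ≤ -(η / 2) := by
          have hne : (1 - η) ≠ 0 := by linarith
          have e1 : 1 - (1 + l₀ - (l₀ + η))⁻¹ = -(η / (1 - η)) := by
            rw [show 1 + l₀ - (l₀ + η) = 1 - η by ring]; field_simp; ring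
          rw [e1, neg_le_neg_iff]
          exact div_le_div_of_nonneg_left hη0.le (by linarith) (by linarith)
        nlinarith [mul_lt_mul_of_pos_right hk1 hxy, mul_le_mul_of_nonneg_right ht hxy.le])
    -- The scalar part is `(l₀ - l) / (1 + l₀ - l)` with denominator at most `2`, so a bound on it
    -- is a bound on `l - l₀`.
    have hclose : ∀ l ∈ Set.Icc (l₀ - η) (l₀ + η), |1 - (1 + l₀ - l)⁻¹| ≤ C₁ * ‖k‖ ^ 2 →
        |l - l₀| ≤ 2 * C₁ * ‖k‖ ^ 2 := by
      intro l hl h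
      have hb := abs_le.1 ((hmem l hl).trans hη2)
      have hpos : 0 < 1 + l₀ - l := by linarith
      have e1 : l - l₀ = -((1 - (1 + l₀ - l)⁻¹) * (1 + l₀ - l)) := by
        rw [sub_mul, inv_mul_cancel₀ hpos.ne']; ring
      rw [e1, abs_neg, abs_mul, abs_of_pos hpos]
      refine (mul_le_mul h (by linarith : 1 + l₀ - l ≤ 2) hpos.le
        ((abs_nonneg _).trans h)).trans (le_of_eq (by ring))
    refine ⟨s₁, hs₁, s₂, hs₂, hs, ?_, ?_⟩
    · have hs₁' := Set.Ioo_subset_Icc_self hs₁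
      exact hclose s₁ hs₁' (abs_le_of_hermForm_zero (hbound s₁ hs₁')
        (Or.inl ((hs s₁ hs₁').1.2 rfl)))
    · have hs₂' := Set.Ioo_subset_Icc_self hs₂
      exact hclose s₂ hs₂' (abs_le_of_hermForm_zero (hbound s₂ hs₂')
        (Or.inr ((hs s₂ hs₂').2.2 rfl)))
  choose! s₁ hs₁ s₂ hs₂ hs using sheets
  -- Each sheet is within `O(‖k‖²)` of `l₀`, hence within `o(‖k‖)`, and squaring gives the claim.
  have little : ∀ s : Plane → ℝ, (∀ᶠ k in 𝓝 (0 : Plane), |s k - l₀| ≤ 2 * C₁ * ‖k‖ ^ 2) →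
      (fun k => (s k - l₀) ^ 2) =o[𝓝 0] (fun k : Plane => ‖k‖ ^ 2) := by
    intro s hs
    have hO : (fun k => s k - l₀) =O[𝓝 0] (fun k : Plane => ‖k‖ ^ 2) := by
      refine IsBigO.of_bound (2 * C₁) ?_
      filter_upwards [hs] with k hk
      rwa [Real.norm_eq_abs, Real.norm_of_nonneg (by positivity)]
    have ho : (fun k : Plane => ‖k‖ ^ 2) =o[𝓝 0] (fun k : Plane => ‖k‖) := by
      refine (isLittleO_pow_id one_lt_two).comp_tendsto ?_
      exact continuous_norm.tendsto' _ _ norm_zero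
    exact (hO.trans_isLittleO ho).pow two_pos
  refine ⟨η, hη0, s₁, s₂, ?_, little s₁ ?_, little s₂ ?_⟩
  · filter_upwards [good] with k hk
    have a1 := hs₁ k hk
    have a2 := hs₂ k hk
    refine ⟨abs_lt.2 ⟨by linarith [a1.1], by linarith [a1.2]⟩,
      abs_lt.2 ⟨by linarith [a2.1], by linarith [a2.2]⟩, fun l hl => ?_⟩
    have hl' := abs_lt.1 hl
    obtain ⟨e, he, heM⟩ := hinv k hk.1 l (hl.le.trans hηδ)
    have hSe : S k l = schurMat ι n e.symm := by
      simp only [hS, ← he, ContinuousLinearMap.inverse_equiv]; rfl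
    obtain ⟨c1, c2⟩ := (hs k hk).1 l ⟨by linarith, by linarith⟩
    rw [hSe] at c1 c2
    simp only [rank_ker_eq_schur he]
    rw [schurMat_eq_hermMat (hsym k) he, rank_ker_hermMat]
    simp only [c1, c2]
  · filter_upwards [good] with k hk using (hs k hk).2.1
  · filter_upwards [good] with k hk using (hs k hk).2.2

/-- If `ι` is compact, `B - z ι` is bijective for some `z`, and the kernel of `B - l₀` is spanned by
`n 0, n 1`, then the bordered operator is bijective. -/
theorem bordered_bijective {ι : X →L[ℂ] Y} {n : Fin 2 → X} {B : X →L[ℂ] Y} {l₀ : ℝ} {z : ℂ}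
    (hsym : ∀ u v, ⟪B u, ι v⟫_ℂ = ⟪ι u, B v⟫_ℂ) (hinj : Function.Injective ι)
    (horth : Orthonormal ℂ fun i => ι (n i)) (hker : ∀ i, B (n i) = (l₀ : ℂ) • ι (n i))
    (hspan : ∀ u, B u = (l₀ : ℂ) • ι u → u ∈ Submodule.span ℂ (Set.range n))
    (hι : IsCompactOperator ι) (hz : Function.Bijective (B - z • ι)) :
    Function.Bijective (bordered ι n B l₀) := by
  -- Pair with `n i`: by symmetry `B - l₀` can be moved onto `n i`, which it kills, and only the
  -- projection remains.
  have hPzero : ∀ u, bordered ι n B l₀ u = 0 → ∀ i, ⟪ι (n i), ι u⟫_ℂ = 0 := by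
    intro u hu i
    have h1 := congrArg (fun y => ⟪ι (n i), y⟫_ℂ) hu
    simp only [inner_zero_right] at h1
    rw [← bordered_symmetric hsym, bordered_apply, hker, sub_self, zero_add] at h1
    have h2 : ∑ j, ⟪ι (n j), ι (n i)⟫_ℂ • ι (n j) = ι (n i) := by
      simp [orthonormal_iff_ite.1 horth]
    rwa [h2] at h1
  have hinjS : Function.Injective (bordered ι n B l₀) := by
    rw [injective_iff_map_eq_zero]
    intro u hu
    have h0 := hPzero u hu
    have h1 : B u = (l₀ : ℂ) • ι u := by
      rw [bordered_apply] at hu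
      simpa [h0, sub_eq_zero] using hu
    have h2 : ι u = 0 := by
      have h3 : ∀ v ∈ Submodule.span ℂ (Set.range n), ⟪ι v, ι u⟫_ℂ = 0 := by
        intro v hv
        induction hv using Submodule.span_induction with
        | mem v hv => obtain ⟨i, rfl⟩ := hv; exact h0 i
        | zero => simp
        | add v w _ _ hv hw => rw [map_add, inner_add_left, hv, hw, add_zero]
        | smul c v _ hv => rw [map_smul, inner_smul_left, hv, mul_zero]
      exact inner_self_eq_zero.1 (h3 u (hspan u h1))
    exact hinj (by rw [h2, map_zero])
  obtain ⟨e, he⟩ : ∃ e : X ≃L[ℂ] Y, (e : X →L[ℂ] Y) = B - z • ι :=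
    ⟨ContinuousLinearEquiv.ofBijective _ (LinearMap.ker_eq_bot.2 hz.1)
      (LinearMap.range_eq_top.2 hz.2), ContinuousLinearEquiv.coe_ofBijective _ _ _⟩
  -- Fredholm alternative: `B - l₀ ι` plus the projection is `B - z ι` plus `P ∘ ι`. Composed with
  -- the inverse of `B - z ι` it becomes the identity plus a compact operator, for which injectivity
  -- excludes the eigenvalue `-1` and so yields surjectivity.
  set P : Y →L[ℂ] Y := (z - l₀) • ContinuousLinearMap.id ℂ Y +
    ∑ i, (innerSL ℂ (ι (n i))).smulRight (ι (n i)) with hP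
  set T : Y →L[ℂ] Y := P.comp (ι.comp (e.symm : Y →L[ℂ] X)) with hT
  have hTc : IsCompactOperator T := (hι.comp_clm (e.symm : Y →L[ℂ] X)).clm_comp P
  have hfac : ∀ y, bordered ι n B l₀ (e.symm y) = y + T y := by
    intro y
    have h1 : B (e.symm y) = y + z • ι (e.symm y) := by
      have : e (e.symm y) = B (e.symm y) - z • ι (e.symm y) := by
        rw [← ContinuousLinearEquiv.coe_coe e, he]; simp
      rw [e.apply_symm_apply] at this
      nth_rewrite 2 [this]; abel
    rw [bordered_apply, h1, hT, hP]
    simp only [Fin.sum_univ_two, ContinuousLinearMap.comp_apply, add_apply,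
      smul_apply, ContinuousLinearMap.id_apply,
      ContinuousLinearMap.smulRight_apply, innerSL_apply_apply, ContinuousLinearEquiv.coe_coe]
    module
  have hsurj : Function.Surjective (bordered ι n B l₀) := by
    rcases hTc.hasEigenvalue_or_mem_resolventSet (μ := -1) (by norm_num) with h | h
    · exfalso
      obtain ⟨v, hv⟩ := h.exists_hasEigenvector
      have h1 : T v = (-1 : ℂ) • v := hv.apply_eq_smul
      have h2 : bordered ι n B l₀ (e.symm v) = 0 := by rw [hfac, h1]; simp
      have h3 := hinjS (h2.trans (map_zero _).symm)
      exact hv.2 (by simpa using h3)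
    · intro y
      rw [spectrum.mem_resolventSet_iff, ContinuousLinearMap.isUnit_iff_bijective] at h
      obtain ⟨w, hw⟩ := h.2 y
      refine ⟨e.symm (-w), ?_⟩
      rw [hfac, ← hw]
      simp
      abel
  exact ⟨hinjS, hsurj⟩

end Perturbation

/-! ### Self-adjoint unbounded operators -/

section SelfAdjoint

variable {E : Type*} [NormedAddCommGroup E] [InnerProductSpace ℂ E]

/-- Symmetry of a linear relation. -/
def SymmetricGraph (g : Submodule ℂ (E × E)) : Prop :=
  ∀ p ∈ g, ∀ q ∈ g, ⟪p.2, q.1⟫_ℂ = ⟪p.1, q.2⟫_ℂ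

/-- Since `⟪f, A f⟫` is real, the imaginary part of `⟪f, (A - z) f⟫` is `-Im z ‖f‖²`; then use
Cauchy–Schwarz. -/
theorem SymmetricGraph.norm_le {g : Submodule ℂ (E × E)} (h : SymmetricGraph g) {p : E × E}
    (hp : p ∈ g) (z : ℂ) : |z.im| * ‖p.1‖ ≤ ‖p.2 - z • p.1‖ := by
  have h1 : (⟪p.1, p.2⟫_ℂ).im = 0 := by
    refine Complex.conj_eq_iff_im.1 ?_
    rw [inner_conj_symm]
    exact h p hp p hp
  have h2 : (⟪p.1, p.2 - z • p.1⟫_ℂ).im = -(z.im * ‖p.1‖ ^ 2) := by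
    have hre : (⟪p.1, p.1⟫_ℂ).re = ‖p.1‖ ^ 2 := inner_self_eq_norm_sq (𝕜 := ℂ) p.1
    have him : (⟪p.1, p.1⟫_ℂ).im = 0 := inner_self_im (𝕜 := ℂ) p.1
    rw [inner_sub_right, inner_smul_right, Complex.sub_im, h1, Complex.mul_im, hre, him]
    ring
  have h3 : |z.im| * ‖p.1‖ ^ 2 ≤ ‖p.1‖ * ‖p.2 - z • p.1‖ := by
    have h4 := (Complex.abs_im_le_norm ⟪p.1, p.2 - z • p.1⟫_ℂ).trans (norm_inner_le_norm _ _)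
    rwa [h2, abs_neg, abs_mul, abs_of_nonneg (by positivity : 0 ≤ ‖p.1‖ ^ 2)] at h4
  by_cases h0 : ‖p.1‖ = 0
  · rw [h0, mul_zero]; exact norm_nonneg _
  · have hpos : 0 < ‖p.1‖ := lt_of_le_of_ne (norm_nonneg _) (Ne.symm h0)
    refine le_of_mul_le_mul_left ?_ hpos
    linarith [h3, sq ‖p.1‖]

theorem SymmetricGraph.eq_zero {g : Submodule ℂ (E × E)} (h : SymmetricGraph g) {f : E} {z : ℂ}
    (hz : z.im ≠ 0) (hp : (f, z • f) ∈ g) : f = 0 := by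
  have := h.norm_le hp z
  rw [sub_self, norm_zero] at this
  have hpos : 0 < |z.im| := abs_pos.2 hz
  exact norm_le_zero_iff.1 (nonpos_of_mul_nonpos_right this hpos)

/-- The range of `A - z` is everything. -/
def SurjectiveAt (g : Submodule ℂ (E × E)) (z : ℂ) : Prop := ∀ y, ∃ p ∈ g, p.2 - z • p.1 = y

variable [CompleteSpace E]

theorem graph_eq_adjoint {A : E →ₗ.[ℂ] E} (hA : IsSelfAdjoint A) : A.graph = A.graph.adjoint := by
  rw [← LinearPMap.adjoint_graph_eq_graph_adjoint hA.dense_domain,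
    LinearPMap.isSelfAdjoint_def.1 hA]

theorem symmetricGraph_of_isSelfAdjoint {A : E →ₗ.[ℂ] E} (hA : IsSelfAdjoint A) :
    SymmetricGraph A.graph := by
  intro p hp q hq
  have hq' : q ∈ A.graph.adjoint := by rwa [← graph_eq_adjoint hA]
  have := (Submodule.mem_adjoint_iff _ _).1 hq' p.1 p.2 hp
  exact sub_eq_zero.1 this

/-- On the closed graph `A - z` is bounded below, so its range is closed. A vector orthogonal to the
range lies in the kernel of `A - z̄`, because `A` is its own adjoint, and is therefore zero. -/
theorem surjectiveAt_of_isSelfAdjoint {A : E →ₗ.[ℂ] E} (hA : IsSelfAdjoint A) {z : ℂ}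
    (hz : z.im ≠ 0) : SurjectiveAt A.graph z := by
  have hsym := symmetricGraph_of_isSelfAdjoint hA
  have hclosed : IsClosed (A.graph : Set (E × E)) := hA.isClosed
  have : CompleteSpace A.graph := hclosed.completeSpace_coe
  set Φ : A.graph →L[ℂ] E := (ContinuousLinearMap.snd ℂ E E - z • ContinuousLinearMap.fst ℂ E E).comp
    A.graph.subtypeL with hΦ
  have hΦa : ∀ p : A.graph, Φ p = p.1.2 - z • p.1.1 := fun p => by simp [hΦ]
  have hpos : 0 < |z.im| := abs_pos.2 hz
  have hb1 : ∀ p : A.graph, ‖p.1.1‖ ≤ |z.im|⁻¹ * ‖Φ p‖ := by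
    intro p
    rw [hΦa, inv_mul_eq_div, le_div_iff₀ hpos, mul_comm]
    exact hsym.norm_le p.2 z
  have hanti : AntilipschitzWith ⟨|z.im|⁻¹ + (1 + ‖z‖ * |z.im|⁻¹), by positivity⟩ Φ := by
    refine ContinuousLinearMap.antilipschitz_of_bound Φ fun p => ?_
    have hb2 : ‖p.1.2‖ ≤ (1 + ‖z‖ * |z.im|⁻¹) * ‖Φ p‖ := by
      have e1 : p.1.2 = Φ p + z • p.1.1 := by rw [hΦa]; abel
      rw [e1]
      refine (norm_add_le _ _).trans ?_
      rw [norm_smul]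
      nlinarith [mul_le_mul_of_nonneg_left (hb1 p) (norm_nonneg z)]
    have h0 : 0 ≤ ‖Φ p‖ := norm_nonneg _
    have e0 : ‖p‖ = max ‖p.1.1‖ ‖p.1.2‖ := rfl
    rw [e0]
    refine max_le ((hb1 p).trans ?_) (hb2.trans ?_) <;>
      refine mul_le_mul_of_nonneg_right ?_ h0
    · exact le_add_of_nonneg_right (by positivity)
    · exact le_add_of_nonneg_left (by positivity)
  have hdense : DenseRange Φ := by
    have h1 : (LinearMap.range Φ.toLinearMap)ᗮ = ⊥ := by
      rw [Submodule.eq_bot_iff]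
      intro y hy
      have h2 : ∀ p : A.graph, ⟪Φ p, y⟫_ℂ = 0 := fun p => hy _ ⟨p, rfl⟩
      have h3 : (y, (starRingEnd ℂ z) • y) ∈ A.graph := by
        rw [graph_eq_adjoint hA, Submodule.mem_adjoint_iff]
        intro a b hab
        have := h2 ⟨(a, b), hab⟩
        rw [hΦa, inner_sub_left, inner_smul_left] at this
        rw [inner_smul_right]
        exact this
      exact hsym.eq_zero (by simpa using hz) h3
    have h2 := (Submodule.topologicalClosure_eq_top_iff).2 h1
    exact Submodule.dense_iff_topologicalClosure_eq_top.2 h2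
  have hbij := (ContinuousLinearMap.bijective_iff_dense_range_and_antilipschitz Φ).2
    ⟨by
      rw [← Submodule.dense_iff_topologicalClosure_eq_top]
      exact hdense, _, hanti⟩
  intro y
  obtain ⟨p, hp⟩ := hbij.2 y
  exact ⟨p.1, p.2, by rw [← hΦa, hp]⟩

/-- A vector orthogonal to the domain is `(A - i) f`; pairing with `f` gives `f = 0`, so the domain
is dense. For `x` in the graph of the adjoint, solve `(A - i) p = (A* - i) x`; then `x - p` is
orthogonal to the range of `A + i`, which is everything. -/
theorem isSelfAdjoint_of_surjectiveAt {A : E →ₗ.[ℂ] E} (hsym : SymmetricGraph A.graph)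
    (h1 : SurjectiveAt A.graph Complex.I) (h2 : SurjectiveAt A.graph (-Complex.I)) :
    IsSelfAdjoint A := by
  have hdense : Dense (A.domain : Set E) := by
    rw [Submodule.dense_iff_topologicalClosure_eq_top, Submodule.topologicalClosure_eq_top_iff,
      Submodule.eq_bot_iff]
    intro y hy
    obtain ⟨p, hp, hpy⟩ := h1 y
    have hpd : p.1 ∈ A.domain := LinearPMap.mem_domain_of_mem_graph (y := p.2) hp
    have h3 : ⟪p.1, p.2 - Complex.I • p.1⟫_ℂ = 0 := by rw [hpy]; exact hy _ hpd
    have h4 : (⟪p.1, p.2⟫_ℂ).im = 0 := by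
      refine Complex.conj_eq_iff_im.1 ?_
      rw [inner_conj_symm]
      exact hsym p hp p hp
    have hre : (⟪p.1, p.1⟫_ℂ).re = ‖p.1‖ ^ 2 := inner_self_eq_norm_sq (𝕜 := ℂ) p.1
    have h5 := congrArg Complex.im h3
    rw [inner_sub_right, inner_smul_right, Complex.sub_im, h4, Complex.mul_im, hre] at h5
    have h6 : p.1 = 0 := by
      have : ‖p.1‖ ^ 2 = 0 := by simpa using h5
      exact norm_eq_zero.1 (pow_eq_zero_iff two_ne_zero |>.1 this)
    have h7 : p.2 = 0 := A.graph_fst_eq_zero_snd hp h6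
    rw [← hpy, h6, h7, smul_zero, sub_zero]
  rw [LinearPMap.isSelfAdjoint_def]
  apply LinearPMap.eq_of_eq_graph
  rw [LinearPMap.adjoint_graph_eq_graph_adjoint hdense]
  refine le_antisymm ?_ ?_
  · intro x hx
    rw [Submodule.mem_adjoint_iff] at hx
    obtain ⟨p, hp, hpx⟩ := h1 (x.2 - Complex.I • x.1)
    obtain ⟨r, hr, hrd⟩ := h2 (x.1 - p.1)
    have e1 := hx r.1 r.2 hr
    have e2 := hsym r hr p hp
    have e3 : ⟪r.2 - (-Complex.I) • r.1, x.1 - p.1⟫_ℂ = 0 := by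
      have e4 : x.2 - p.2 = Complex.I • (x.1 - p.1) := by
        rw [smul_sub, sub_eq_sub_iff_sub_eq_sub, hpx]
      have e5 : ⟪r.2, x.1 - p.1⟫_ℂ = ⟪r.1, x.2 - p.2⟫_ℂ := by
        rw [inner_sub_right, inner_sub_right, e2, sub_eq_zero.1 e1]
      rw [inner_sub_left, e5, e4, inner_smul_right, inner_smul_left]
      simp
    rw [hrd, inner_self_eq_zero] at e3
    have e6 : x.2 = p.2 := by
      rw [sub_eq_zero.1 e3] at hpx
      exact (sub_left_inj.1 hpx).symm
    have : x = p := Prod.ext (sub_eq_zero.1 e3) e6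
    rwa [this]
  · intro x hx
    rw [Submodule.mem_adjoint_iff]
    intro a b hab
    exact sub_eq_zero.2 (hsym (a, b) hab x hx)

/-- Preimages under `A - z` exist and are unique, so the chosen ones depend linearly on the datum;
`SymmetricGraph.norm_le` bounds them. -/
theorem notMem_spectrumOf {A : E →ₗ.[ℂ] E} (hA : IsSelfAdjoint A) {z : ℂ} (hz : z.im ≠ 0) :
    z ∉ spectrumOf A := by
  have hsym := symmetricGraph_of_isSelfAdjoint hA
  choose p hp hpy using surjectiveAt_of_isSelfAdjoint hA hz
  have huniq : ∀ q ∈ A.graph, p (q.2 - z • q.1) = q := by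
    intro q hq
    have hd := A.graph.sub_mem (hp (q.2 - z • q.1)) hq
    have h1 : (p (q.2 - z • q.1) - q).1 = 0 := by
      refine hsym.eq_zero (f := (p (q.2 - z • q.1) - q).1) hz ?_
      have : z • (p (q.2 - z • q.1) - q).1 = (p (q.2 - z • q.1) - q).2 := by
        have := hpy (q.2 - z • q.1)
        rw [Prod.fst_sub, Prod.snd_sub, smul_sub]
        rw [sub_eq_sub_iff_sub_eq_sub] at this
        exact this.symm
      rw [this]
      exact hd
    have h2 := A.graph_fst_eq_zero_snd hd h1
    exact sub_eq_zero.1 (Prod.ext h1 h2)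
  have hadd : ∀ y y', p (y + y') = p y + p y' := by
    intro y y'
    have := huniq _ (A.graph.add_mem (hp y) (hp y'))
    rw [← this]
    congr 1
    rw [Prod.fst_add, Prod.snd_add, smul_add]
    nth_rewrite 1 [← hpy y, ← hpy y']
    abel
  have hsmul : ∀ (c : ℂ) y, p (c • y) = c • p y := by
    intro c y
    have := huniq _ (A.graph.smul_mem c (hp y))
    rw [← this]
    congr 1
    rw [Prod.smul_fst, Prod.smul_snd, smul_comm z c, ← smul_sub, hpy]
  have hpos : 0 < |z.im| := abs_pos.2 hz
  intro hspec
  refine hspec ⟨LinearMap.mkContinuous ⟨⟨fun y => (p y).1, fun y y' => by rw [hadd]; rfl⟩,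
    fun c y => congrArg Prod.fst (hsmul c y)⟩ |z.im|⁻¹ fun y => ?_, fun f => ?_, fun f g hfg => ?_⟩
  · have := hsym.norm_le (hp y) z
    rw [hpy] at this
    rwa [inv_mul_eq_div, le_div_iff₀ hpos, mul_comm]
  · have h1 : f + z • (p f).1 = (p f).2 := by rw [← sub_eq_iff_eq_add.1 (hpy f)]
    change ((p f).1, f + z • (p f).1) ∈ A.graph
    rw [h1]
    exact hp f
  · change (p (g - z • f)).1 = f
    rw [huniq (f, g) hfg]

end SelfAdjoint

/-! ### Lattice coordinates -/

theorem sqrt_three_mul_self : √3 * √3 = 3 := Real.mul_self_sqrt (by norm_num)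

/-- The coordinates of a point with respect to the basis `a₁, a₂`. -/
def coord : Fin 2 → Plane →L[ℝ] ℝ :=
  ![(√3)⁻¹ • EuclideanSpace.proj 0 + EuclideanSpace.proj 1,
    (√3)⁻¹ • EuclideanSpace.proj 0 - EuclideanSpace.proj 1]

theorem coord_zero_apply (x : Plane) : coord 0 x = (√3)⁻¹ * x 0 + x 1 := by simp [coord]

theorem coord_one_apply (x : Plane) : coord 1 x = (√3)⁻¹ * x 0 - x 1 := by simp [coord]

theorem apply_zero_eq (x : Plane) : x 0 = √3 / 2 * (coord 0 x + coord 1 x) := by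
  rw [coord_zero_apply, coord_one_apply]
  field_simp
  ring

theorem apply_one_eq (x : Plane) : x 1 = (coord 0 x - coord 1 x) / 2 := by
  rw [coord_zero_apply, coord_one_apply]
  ring

theorem sqrt_three_mul_apply_zero (x : Plane) : √3 * x 0 = 3 / 2 * (coord 0 x + coord 1 x) := by
  rw [apply_zero_eq]
  linear_combination (1 / 2 * (coord 0 x + coord 1 x)) * sqrt_three_mul_self

theorem coord_ext {x y : Plane} (h0 : coord 0 x = coord 0 y) (h1 : coord 1 x = coord 1 y) :
    x = y := by
  ext i
  fin_cases i
  · simp [apply_zero_eq, h0, h1]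
  · simp [apply_one_eq, h0, h1]

theorem coord_a₁ : coord 0 a₁ = 1 ∧ coord 1 a₁ = 0 := by
  constructor
  · rw [coord_zero_apply]; simp [a₁]; field_simp; norm_num
  · rw [coord_one_apply]; simp [a₁]; field_simp; norm_num

theorem coord_a₂ : coord 0 a₂ = 0 ∧ coord 1 a₂ = 1 := by
  constructor
  · rw [coord_zero_apply]; simp [a₂]; field_simp; norm_num
  · rw [coord_one_apply]; simp [a₂]; field_simp; norm_num

theorem coord_zero_comb (s t : ℝ) : coord 0 (s • a₁ + t • a₂) = s := by
  simp [coord_a₁, coord_a₂]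

theorem coord_one_comb (s t : ℝ) : coord 1 (s • a₁ + t • a₂) = t := by
  simp [coord_a₁, coord_a₂]

theorem eq_comb (x : Plane) : x = coord 0 x • a₁ + coord 1 x • a₂ :=
  coord_ext (coord_zero_comb _ _).symm (coord_one_comb _ _).symm

theorem coord_zero_latt (n₁ n₂ : ℤ) : coord 0 (latt n₁ n₂) = n₁ := coord_zero_comb _ _

theorem coord_one_latt (n₁ n₂ : ℤ) : coord 1 (latt n₁ n₂) = n₂ := coord_one_comb _ _

/-- In lattice coordinates the rotation is `(s, t) ↦ (-s - t, s)`, an integer matrix of order three.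
All later geometry is done in these coordinates, where `√3` does not occur. -/
theorem coord_zero_rotPt (x : Plane) : coord 0 (rotPt x) = -coord 0 x - coord 1 x := by
  simp only [coord_zero_apply, coord_one_apply, rotPt]
  simp
  field_simp
  linear_combination (-x 0) * sqrt_three_mul_self

theorem coord_one_rotPt (x : Plane) : coord 1 (rotPt x) = coord 0 x := by
  simp only [coord_zero_apply, coord_one_apply, rotPt]
  simp
  field_simp
  linear_combination x 0 * sqrt_three_mul_self

theorem latt_add (m₁ m₂ n₁ n₂ : ℤ) : latt (m₁ + n₁) (m₂ + n₂) = latt m₁ m₂ + latt n₁ n₂ :=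
  coord_ext (by rw [map_add]; simp only [coord_zero_latt]; push_cast; ring)
    (by rw [map_add]; simp only [coord_one_latt]; push_cast; ring)

theorem latt_neg (n₁ n₂ : ℤ) : latt (-n₁) (-n₂) = -latt n₁ n₂ :=
  coord_ext (by rw [map_neg]; simp only [coord_zero_latt]; push_cast; ring)
    (by rw [map_neg]; simp only [coord_one_latt]; push_cast; ring)

theorem rotPt_add_latt (x : Plane) (n₁ n₂ : ℤ) :
    rotPt (x + latt n₁ n₂) = rotPt x + latt (-n₁ - n₂) n₁ :=
  coord_ext (by simp only [coord_zero_rotPt, map_add, coord_zero_latt, coord_one_latt]; push_cast; ring)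
    (by simp only [coord_one_rotPt, map_add, coord_zero_latt, coord_one_latt])

theorem rotPt_rotPt_rotPt (x : Plane) : rotPt (rotPt (rotPt x)) = x :=
  coord_ext (by simp only [coord_zero_rotPt, coord_one_rotPt]; ring)
    (by simp only [coord_zero_rotPt, coord_one_rotPt]; ring)

/-! ### The fundamental domains in lattice coordinates -/

/-- The three linear forms `2s + t`, `s + 2t` and `s - t` are permuted up to sign by the rotation,
so the invariance of the hexagon becomes visible. -/
theorem mem_ΩH_iff (x : Plane) : x ∈ ΩH ↔ |2 * coord 0 x + coord 1 x| ≤ 1 ∧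
    |coord 0 x + 2 * coord 1 x| ≤ 1 ∧ |coord 0 x - coord 1 x| ≤ 1 := by
  have h := sqrt_three_mul_apply_zero x
  have e1 : √3 / 2 * x 0 + 1 / 2 * x 1 = (2 * coord 0 x + coord 1 x) / 2 := by
    rw [apply_one_eq]; linear_combination (1 / 2) * h
  have e2 : √3 / 2 * x 0 - 1 / 2 * x 1 = (coord 0 x + 2 * coord 1 x) / 2 := by
    rw [apply_one_eq]; linear_combination (1 / 2) * h
  simp only [ΩH, Set.mem_ofPred_eq, e1, e2]
  rw [apply_one_eq]
  simp only [abs_div, abs_two]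
  refine and_congr ?_ (and_congr ?_ ?_) <;> constructor <;> intro h <;> linarith

theorem mem_ΩR_iff (x : Plane) : x ∈ ΩR ↔ (-1 ≤ coord 0 x - coord 1 x ∧ coord 0 x - coord 1 x ≤ 0) ∧
    -1 ≤ 2 * coord 0 x + coord 1 x ∧ 2 * coord 0 x + coord 1 x ≤ 0 := by
  have h := sqrt_three_mul_apply_zero x
  simp only [ΩR, Set.mem_ofPred_eq, h, apply_one_eq]
  constructor
  · rintro ⟨h1, h2, h3, h4⟩
    refine ⟨⟨?_, ?_⟩, ?_, ?_⟩ <;> linarith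
  · rintro ⟨⟨h1, h2⟩, h3, h4⟩
    refine ⟨?_, ?_, ?_, ?_⟩ <;> linarith

theorem ΩH_eq : ΩH = {x | |2 * coord 0 x + coord 1 x| ≤ 1} ∩
    ({x | |coord 0 x + 2 * coord 1 x| ≤ 1} ∩ {x | |coord 0 x - coord 1 x| ≤ 1}) := by
  ext x
  exact mem_ΩH_iff x

theorem isClosed_ΩH : IsClosed ΩH := by
  rw [ΩH_eq]
  refine IsClosed.inter ?_ (IsClosed.inter ?_ ?_) <;>
    exact isClosed_le (by fun_prop) continuous_const

theorem isClosed_ΩR : IsClosed ΩR := by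
  have : ΩR = ({x | -1 ≤ coord 0 x - coord 1 x} ∩ {x | coord 0 x - coord 1 x ≤ 0}) ∩
      ({x | -1 ≤ 2 * coord 0 x + coord 1 x} ∩ {x | 2 * coord 0 x + coord 1 x ≤ 0}) := by
    ext x
    exact mem_ΩR_iff x
  rw [this]
  refine IsClosed.inter (IsClosed.inter ?_ ?_) (IsClosed.inter ?_ ?_) <;>
    exact isClosed_le (by fun_prop) (by fun_prop)

theorem measurableSet_ΩH : MeasurableSet ΩH := isClosed_ΩH.measurableSet

theorem measurableSet_ΩR : MeasurableSet ΩR := isClosed_ΩR.measurableSet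

theorem abs_coord_le_of_mem_ΩH {x : Plane} (hx : x ∈ ΩH) : ∀ i, |coord i x| ≤ 1 := by
  obtain ⟨h1, h2, h3⟩ := (mem_ΩH_iff x).1 hx
  rw [abs_le] at h1 h2 h3
  intro i
  fin_cases i
  · simp only [Fin.zero_eta, abs_le]; constructor <;> linarith
  · simp only [Fin.mk_one, abs_le]; constructor <;> linarith

theorem norm_le_of_abs_coord_le {x : Plane} {r : ℝ} (h : ∀ i, |coord i x| ≤ r) :
    ‖x‖ ≤ r * (‖a₁‖ + ‖a₂‖) := by
  rw [eq_comb x]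
  refine (norm_add_le _ _).trans ?_
  rw [norm_smul, norm_smul, Real.norm_eq_abs, Real.norm_eq_abs]
  nlinarith [mul_le_mul_of_nonneg_right (h 0) (norm_nonneg a₁),
    mul_le_mul_of_nonneg_right (h 1) (norm_nonneg a₂)]

theorem isBounded_ΩH : Bornology.IsBounded ΩH := by
  rw [isBounded_iff_forall_norm_le]
  exact ⟨_, fun x hx => norm_le_of_abs_coord_le (abs_coord_le_of_mem_ΩH hx)⟩

theorem isCompact_ΩH : IsCompact ΩH := Metric.isCompact_of_isClosed_isBounded isClosed_ΩH isBounded_ΩH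

theorem rotPt_mem_ΩH_iff (x : Plane) : rotPt x ∈ ΩH ↔ x ∈ ΩH := by
  simp only [mem_ΩH_iff, coord_zero_rotPt, coord_one_rotPt, abs_le]
  constructor
  · rintro ⟨⟨h1, h2⟩, ⟨h3, h4⟩, ⟨h5, h6⟩⟩
    refine ⟨⟨?_, ?_⟩, ⟨?_, ?_⟩, ⟨?_, ?_⟩⟩ <;> linarith
  · rintro ⟨⟨h1, h2⟩, ⟨h3, h4⟩, ⟨h5, h6⟩⟩
    refine ⟨⟨?_, ?_⟩, ⟨?_, ?_⟩, ⟨?_, ?_⟩⟩ <;> linarith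

theorem ΩR_subset_ΩH : ΩR ⊆ ΩH := by
  intro x hx
  obtain ⟨⟨h1, h2⟩, h3, h4⟩ := (mem_ΩR_iff x).1 hx
  rw [mem_ΩH_iff]
  simp only [abs_le]
  refine ⟨⟨?_, ?_⟩, ⟨?_, ?_⟩, ⟨?_, ?_⟩⟩ <;> linarith

theorem rotPt_mem_ΩR_iff (x : Plane) : rotPt x ∈ ΩR ↔
    (0 ≤ 2 * coord 0 x + coord 1 x ∧ 2 * coord 0 x + coord 1 x ≤ 1) ∧
    0 ≤ coord 0 x + 2 * coord 1 x ∧ coord 0 x + 2 * coord 1 x ≤ 1 := by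
  simp only [mem_ΩR_iff, coord_zero_rotPt, coord_one_rotPt]
  constructor
  · rintro ⟨⟨h1, h2⟩, ⟨h3, h4⟩⟩
    refine ⟨⟨?_, ?_⟩, ⟨?_, ?_⟩⟩ <;> linarith
  · rintro ⟨⟨h1, h2⟩, ⟨h3, h4⟩⟩
    refine ⟨⟨?_, ?_⟩, ⟨?_, ?_⟩⟩ <;> linarith

theorem rotPt_rotPt_mem_ΩR_iff (x : Plane) : rotPt (rotPt x) ∈ ΩR ↔
    (-1 ≤ coord 0 x + 2 * coord 1 x ∧ coord 0 x + 2 * coord 1 x ≤ 0) ∧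
    0 ≤ coord 0 x - coord 1 x ∧ coord 0 x - coord 1 x ≤ 1 := by
  simp only [mem_ΩR_iff, coord_zero_rotPt, coord_one_rotPt]
  constructor
  · rintro ⟨⟨h1, h2⟩, ⟨h3, h4⟩⟩
    refine ⟨⟨?_, ?_⟩, ⟨?_, ?_⟩⟩ <;> linarith
  · rintro ⟨⟨h1, h2⟩, ⟨h3, h4⟩⟩
    refine ⟨⟨?_, ?_⟩, ⟨?_, ?_⟩⟩ <;> linarith

/-- A line in the plane is a null set. -/
theorem ae_ne_of_ne_zero {L : Plane →L[ℝ] ℝ} (hL : L ≠ 0) (c : ℝ) : ∀ᵐ x : Plane, L x ≠ c := by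
  by_cases hc : ∃ x₀, L x₀ = c
  · obtain ⟨x₀, hx₀⟩ := hc
    have h0 : volume (LinearMap.ker L.toLinearMap : Set Plane) = 0 := by
      refine Measure.addHaar_submodule _ _ fun h => hL ?_
      ext x
      have : x ∈ LinearMap.ker L.toLinearMap := by rw [h]; trivial
      simpa using this
    have h1 : ∀ᵐ x : Plane, L x ≠ 0 := by
      rw [ae_iff]
      convert h0 using 2
      ext x
      simp
    have h2 := (measurePreserving_sub_right (volume : Measure Plane)
      x₀).quasiMeasurePreserving.ae h1
    filter_upwards [h2] with x hx hxc
    exact hx (by rw [map_sub, hxc, hx₀, sub_self])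
  · push Not at hc
    exact Eventually.of_forall hc

theorem ae_coord_comb_ne {p q : ℝ} (hpq : p ≠ 0 ∨ q ≠ 0) (c : ℝ) :
    ∀ᵐ x : Plane, p * coord 0 x + q * coord 1 x ≠ c := by
  have := ae_ne_of_ne_zero (L := p • coord 0 + q • coord 1) (fun h => ?_) c
  · simpa using this
  · have h1 := DFunLike.congr_fun h a₁
    have h2 := DFunLike.congr_fun h a₂
    simp [coord_a₁, coord_a₂] at h1 h2
    tauto

/-- A set that contains exactly one translate of almost every point. -/
structure Tiles (D : Set Plane) : Prop where
  measurableSet : MeasurableSet D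
  existsUnique : ∀ᵐ x : Plane, ∃! n : ℤ × ℤ, x + latt n.1 n.2 ∈ D

/-- Off the null set where one of the three forms of the hexagon is an integer, all inequalities are
strict. Two lattice vectors that both move a point into the hexagon then differ by `n` with `2n₁ +
n₂`, `n₁ + 2n₂` and `n₁ - n₂` all less than `2` in modulus, which forces `n = 0`. -/
theorem tiles_ΩH : Tiles ΩH := by
  refine ⟨measurableSet_ΩH, ?_⟩
  have key : ∀ n : ℤ × ℤ, ∀ᵐ x : Plane, 2 * coord 0 x + coord 1 x ≠ n.1 ∧
      coord 0 x + 2 * coord 1 x ≠ n.1 ∧ coord 0 x - coord 1 x ≠ n.1 := by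
    intro n
    filter_upwards [ae_coord_comb_ne (p := 2) (q := 1) (by norm_num) n.1,
      ae_coord_comb_ne (p := 1) (q := 2) (by norm_num) n.1,
      ae_coord_comb_ne (p := 1) (q := -1) (by norm_num) n.1] with x h1 h2 h3
    refine ⟨by simpa using h1, by simpa using h2, fun h => h3 (by rw [← h]; ring)⟩
  filter_upwards [ae_all_iff.2 key] with x hx
  obtain ⟨n₁, n₂, hn⟩ := exists_sub_latt_mem x
  refine existsUnique_of_exists_of_unique ⟨(-n₁, -n₂), by
    rwa [latt_neg, ← sub_eq_add_neg]⟩ ?_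
  rintro ⟨m₁, m₂⟩ ⟨l₁, l₂⟩ hm hl
  simp only [mem_ΩH_iff, map_add, coord_zero_latt, coord_one_latt] at hm hl
  obtain ⟨p1, p2, p3⟩ := hm
  obtain ⟨q1, q2, q3⟩ := hl
  have f1 : ∀ k : ℤ, 2 * coord 0 x + coord 1 x ≠ k := fun k => (hx (k, 0)).1
  have f2 : ∀ k : ℤ, coord 0 x + 2 * coord 1 x ≠ k := fun k => (hx (k, 0)).2.1
  have f3 : ∀ k : ℤ, coord 0 x - coord 1 x ≠ k := fun k => (hx (k, 0)).2.2
  -- strict inequalities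
  have strict : ∀ (y : ℝ) (k : ℤ), (∀ j : ℤ, y ≠ j) → |y + k| ≤ 1 → |y + k| < 1 := by
    intro y k hy h
    refine lt_of_le_of_ne h fun he => ?_
    rcases eq_or_eq_neg_of_abs_eq he with h' | h'
    · exact hy (1 - k) (by push_cast; linarith)
    · exact hy (-1 - k) (by push_cast; linarith)
  have diff : ∀ (y : ℝ) (k k' : ℤ), (∀ j : ℤ, y ≠ j) → |y + k| ≤ 1 → |y + k'| ≤ 1 →
      |k - k'| < 2 := by
    intro y k k' hy h h'
    have h1 := abs_lt.1 (strict y k hy h)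
    have h2 := abs_lt.1 (strict y k' hy h')
    have h3 : |((k - k' : ℤ) : ℝ)| < 2 := by
      push_cast
      rw [abs_lt]; constructor <;> linarith [h1.1, h1.2, h2.1, h2.2]
    exact_mod_cast h3
  have d1 := diff _ (2 * m₁ + m₂) (2 * l₁ + l₂) f1
    (by push_cast; convert p1 using 2; ring) (by push_cast; convert q1 using 2; ring)
  have d2 := diff _ (m₁ + 2 * m₂) (l₁ + 2 * l₂) f2
    (by push_cast; convert p2 using 2; ring) (by push_cast; convert q2 using 2; ring)
  have d3 := diff _ (m₁ - m₂) (l₁ - l₂) f3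
    (by push_cast; convert p3 using 2; ring) (by push_cast; convert q3 using 2; ring)
  rw [abs_lt] at d1 d2 d3
  have e1 : m₁ = l₁ := by omega
  have e2 : m₂ = l₂ := by omega
  rw [e1, e2]

/-- The indicators of the translates of `D` add up to `1` almost everywhere. -/
theorem Tiles.lintegral_eq {D : Set Plane} (hD : Tiles D) {f : Plane → ENNReal}
    (hf : AEMeasurable f volume) :
    ∫⁻ x, f x = ∑' n : ℤ × ℤ, ∫⁻ x in D, f (x + latt n.1 n.2) := by
  have h1 : ∀ n : ℤ × ℤ, ∫⁻ x in D, f (x + latt n.1 n.2) =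
      ∫⁻ x, D.indicator 1 (x + latt (-n.1) (-n.2)) * f x := by
    intro n
    rw [← lintegral_indicator hD.measurableSet,
      ← lintegral_add_right_eq_self _ (latt (-n.1) (-n.2))]
    refine lintegral_congr fun x => ?_
    by_cases hx : x + latt (-n.1) (-n.2) ∈ D
    · rw [Set.indicator_of_mem hx, Set.indicator_of_mem hx, Pi.one_apply, one_mul, latt_neg,
        neg_add_cancel_right]
    · simp [Set.indicator_of_notMem hx]
  simp_rw [h1]
  have hmeas : ∀ n : ℤ × ℤ, AEMeasurable
      (fun x => D.indicator (1 : Plane → ENNReal) (x + latt (-n.1) (-n.2)) * f x) volume := fun n =>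
    ((measurable_one.indicator hD.measurableSet).comp (measurable_add_const _)).aemeasurable.mul hf
  rw [← lintegral_tsum hmeas]
  refine lintegral_congr_ae ?_
  filter_upwards [hD.existsUnique] with x hx
  obtain ⟨m, hm, huniq⟩ := hx
  simp only at hm huniq
  have : ∀ n : ℤ × ℤ, n ≠ -m → D.indicator (1 : Plane → ENNReal) (x + latt (-n.1) (-n.2)) * f x = 0 := by
    intro n hn
    rw [Set.indicator_of_notMem, zero_mul]
    intro hmem
    exact hn (by rw [← huniq (-n) hmem, neg_neg])
  rw [tsum_eq_single (-m) this]
  simp [Set.indicator_of_mem hm]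

/-- As an identity of measures, the tiling transfers null sets, measurability and Bochner integrals
to the cell alike. -/
theorem Tiles.volume_eq_sum {D : Set Plane} (hD : Tiles D) : (volume : Measure Plane) =
    Measure.sum fun n : ℤ × ℤ => (volume.restrict D).map fun x => x + latt n.1 n.2 := by
  refine Measure.ext fun s hs => ?_
  rw [← lintegral_indicator_one hs, hD.lintegral_eq ((measurable_one.indicator hs).aemeasurable),
    Measure.sum_apply _ hs]
  refine tsum_congr fun n => ?_
  rw [Measure.map_apply (measurable_add_const _) hs,
    ← lintegral_indicator_one (measurable_add_const _ hs)]
  rfl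

theorem Tiles.ae_iff {D : Set Plane} (hD : Tiles D) {p : Plane → Prop} :
    (∀ᵐ x : Plane, p x) ↔ ∀ n : ℤ × ℤ, ∀ᵐ x ∂(volume.restrict D), p (x + latt n.1 n.2) := by
  constructor
  · intro h n
    exact ae_restrict_of_ae ((measurePreserving_add_right (volume : Measure Plane)
      (latt n.1 n.2)).quasiMeasurePreserving.ae h)
  · intro h
    rw [hD.volume_eq_sum, Measure.ae_sum_iff]
    intro n
    exact (MeasurableEquiv.addRight (latt n.1 n.2)).measurableEmbedding.ae_map_iff.2 (h n)

/-! ### Calculus of weak derivatives -/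

/-- The classical partial derivative. -/
def pd {F : Type*} [NormedAddCommGroup F] [NormedSpace ℝ F] (i : Fin 2) (f : Plane → F) (x : Plane) :
    F := fderiv ℝ f x (EuclideanSpace.single i 1)

theorem contDiff_pd {F : Type*} [NormedAddCommGroup F] [NormedSpace ℝ F] {f : Plane → F}
    (hf : ContDiff ℝ ∞ f) (i : Fin 2) : ContDiff ℝ ∞ (pd i f) :=
  (hf.fderiv_right (m := ∞) (by simp)).clm_apply contDiff_const

theorem hasCompactSupport_pd {F : Type*} [NormedAddCommGroup F] [NormedSpace ℝ F] {f : Plane → F}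
    (hf : HasCompactSupport f) (i : Fin 2) : HasCompactSupport (pd i f) :=
  hf.fderiv_apply (𝕜 := ℝ) _

theorem HasWeakPartial.congr {i : Fin 2} {u v u' v' : Plane → ℂ} (h : HasWeakPartial i u v)
    (hu : u =ᵐ[volume] u') (hv : v =ᵐ[volume] v') : HasWeakPartial i u' v' := by
  refine ⟨h.1.congr hu, h.2.1.congr hv, fun φ hφ hc => ?_⟩
  have e1 : ∫ x, φ x • v x = ∫ x, φ x • v' x :=
    integral_congr_ae (by filter_upwards [hv] with x hx; rw [hx])
  rw [← e1, ← h.2.2 φ hφ hc]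
  exact integral_congr_ae (by filter_upwards [hu] with x hx; rw [hx])

theorem HasWeakPartial.unique {i : Fin 2} {u u' v v' : Plane → ℂ} (h : HasWeakPartial i u v)
    (h' : HasWeakPartial i u' v') (hu : u =ᵐ[volume] u') : v =ᵐ[volume] v' := by
  have h1 := h.add (h'.smul (-1))
  have h2 := h1.ae_zero (by
    filter_upwards [hu] with x hx
    simp [hx])
  filter_upwards [h2] with x hx
  have : v x + -v' x = 0 := by simpa using hx
  rw [← sub_eq_add_neg, sub_eq_zero] at this
  exact this

theorem LocallyIntegrable.comp_add_right' {u : Plane → ℂ} (hu : LocallyIntegrable u volume)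
    (a : Plane) : LocallyIntegrable (fun x => u (x + a)) volume := by
  intro x
  obtain ⟨s, hs, hi⟩ := hu (x + a)
  refine ⟨(fun y => y + a) ⁻¹' s, (continuous_add_const a).continuousAt.preimage_mem_nhds hs, ?_⟩
  have mp := measurePreserving_add_right (volume : Measure Plane) a
  exact (mp.integrableOn_comp_preimage
    (MeasurableEquiv.addRight a).measurableEmbedding).2 hi

theorem HasWeakPartial.comp_add {i : Fin 2} {u v : Plane → ℂ} (h : HasWeakPartial i u v)
    (a : Plane) : HasWeakPartial i (fun x => u (x + a)) (fun x => v (x + a)) := by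
  refine ⟨LocallyIntegrable.comp_add_right' h.1 a, LocallyIntegrable.comp_add_right' h.2.1 a,
    fun φ hφ hc => ?_⟩
  have hφ' : ContDiff ℝ ∞ (fun x => φ (x - a)) := hφ.comp (contDiff_id.sub contDiff_const)
  have hc' : HasCompactSupport (fun x => φ (x - a)) :=
    hc.comp_homeomorph (Homeomorph.subRight a)
  have h1 := h.2.2 _ hφ' hc'
  have e1 : ∀ x, fderiv ℝ (fun x => φ (x - a)) x = fderiv ℝ φ (x - a) := fun x => by
    simp only [sub_eq_add_neg]
    rw [fderiv_comp_add_right]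
  simp only [e1] at h1
  rw [← integral_add_right_eq_self _ a, ← integral_add_right_eq_self (fun x => φ (x - a) • v x) a]
    at h1
  simpa using h1

theorem HasWeakPartial.conj {i : Fin 2} {u v : Plane → ℂ} (h : HasWeakPartial i u v) :
    HasWeakPartial i (fun x => starRingEnd ℂ (u x)) (fun x => starRingEnd ℂ (v x)) := by
  have hloc : ∀ {w : Plane → ℂ}, LocallyIntegrable w volume →
      LocallyIntegrable (fun x => starRingEnd ℂ (w x)) volume := by
    intro w hw x
    obtain ⟨s, hs, hi⟩ := hw x
    exact ⟨s, hs, Complex.conjCLE.toContinuousLinearMap.integrable_comp hi⟩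
  refine ⟨hloc h.1, hloc h.2.1, fun φ hφ hc => ?_⟩
  have h1 := congrArg (starRingEnd ℂ) (h.2.2 φ hφ hc)
  rw [map_neg, ← integral_conj, ← integral_conj] at h1
  simpa [Complex.real_smul] using h1

/-- Test the given derivative with `φ f` and use the classical product rule for it. -/
theorem HasWeakPartial.mul_real {i : Fin 2} {u v : Plane → ℂ} (h : HasWeakPartial i u v)
    {f : Plane → ℝ} (hf : ContDiff ℝ ∞ f) :
    HasWeakPartial i (fun x => f x • u x) (fun x => f x • v x + pd i f x • u x) := by
  have hd := (contDiff_pd hf i).continuous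
  have hu1 : LocallyIntegrable (fun x => f x • u x) volume := h.1.continuous_smul hf.continuous
  have hv1 : LocallyIntegrable (fun x => f x • v x) volume := h.2.1.continuous_smul hf.continuous
  have hu2 : LocallyIntegrable (fun x => pd i f x • u x) volume := h.1.continuous_smul hd
  refine ⟨hu1, hv1.add hu2, fun φ hφ hc => ?_⟩
  have h1 := h.2.2 (fun x => φ x * f x) (hφ.mul hf) (hc.mul_right)
  have e1 : ∀ x, fderiv ℝ (fun x => φ x * f x) x (EuclideanSpace.single i 1) =
      pd i φ x * f x + φ x * pd i f x := by
    intro x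
    rw [fderiv_fun_mul (hφ.differentiable (by simp) x) (hf.differentiable (by simp) x)]
    simp only [pd, _root_.add_apply, _root_.smul_apply, smul_eq_mul]
    ring
  have i1 : Integrable (fun x => pd i φ x • f x • u x) volume :=
    hu1.integrable_smul_left_of_hasCompactSupport (contDiff_pd hφ i).continuous
      (hasCompactSupport_pd hc i)
  have i2 : Integrable (fun x => φ x • pd i f x • u x) volume :=
    hu2.integrable_smul_left_of_hasCompactSupport hφ.continuous hc
  have i3 : Integrable (fun x => φ x • f x • v x) volume :=
    hv1.integrable_smul_left_of_hasCompactSupport hφ.continuous hc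
  simp only [e1, add_smul, mul_smul] at h1
  rw [integral_add i1 i2] at h1
  change ∫ x, pd i φ x • f x • u x = _
  simp only [smul_add]
  rw [integral_add i3 i2]
  linear_combination h1

theorem pd_re {f : Plane → ℂ} (hf : ContDiff ℝ ∞ f) (i : Fin 2) (x : Plane) :
    pd i (fun y => (f y).re) x = (pd i f x).re := by
  have h1 : fderiv ℝ (fun y => Complex.reCLM (f y)) x = Complex.reCLM.comp (fderiv ℝ f x) :=
    fderiv_comp x Complex.reCLM.differentiableAt (hf.differentiable (by simp) x) |>.trans
      (by rw [Complex.reCLM.fderiv])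
  exact DFunLike.congr_fun h1 (EuclideanSpace.single i 1)

theorem pd_im {f : Plane → ℂ} (hf : ContDiff ℝ ∞ f) (i : Fin 2) (x : Plane) :
    pd i (fun y => (f y).im) x = (pd i f x).im := by
  have h1 : fderiv ℝ (fun y => Complex.imCLM (f y)) x = Complex.imCLM.comp (fderiv ℝ f x) :=
    fderiv_comp x Complex.imCLM.differentiableAt (hf.differentiable (by simp) x) |>.trans
      (by rw [Complex.imCLM.fderiv])
  exact DFunLike.congr_fun h1 (EuclideanSpace.single i 1)

/-- Test functions are real, so a complex factor is treated through its real and imaginary parts. -/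
theorem HasWeakPartial.mul {i : Fin 2} {u v : Plane → ℂ} (h : HasWeakPartial i u v)
    {f : Plane → ℂ} (hf : ContDiff ℝ ∞ f) :
    HasWeakPartial i (fun x => f x * u x) (fun x => f x * v x + pd i f x * u x) := by
  have hre : ContDiff ℝ ∞ fun x => (f x).re := Complex.reCLM.contDiff.comp hf
  have him : ContDiff ℝ ∞ fun x => (f x).im := Complex.imCLM.contDiff.comp hf
  have h1 := (h.mul_real hre).add ((h.mul_real him).smul Complex.I)
  refine h1.congr (Eventually.of_forall fun x => ?_) (Eventually.of_forall fun x => ?_)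
  · simp only [Pi.add_apply, Pi.smul_apply, smul_eq_mul, Complex.real_smul]
    nth_rewrite 3 [← Complex.re_add_im (f x)]
    ring
  · simp only [Pi.add_apply, Pi.smul_apply, smul_eq_mul, Complex.real_smul, pd_re hf, pd_im hf]
    nth_rewrite 3 [← Complex.re_add_im (f x)]
    nth_rewrite 3 [← Complex.re_add_im (pd i f x)]
    ring

/-! ### Function classes -/

theorem memLp_mul_of_bound {μ : Measure Plane} {f u : Plane → ℂ} (hu : MemLp u 2 μ)
    (hf : AEStronglyMeasurable f μ) {C : ℝ} (hC : ∀ x, ‖f x‖ ≤ C) :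
    MemLp (fun x => f x * u x) 2 μ := by
  refine hu.of_le_mul (c := C) (hf.mul hu.1) (Eventually.of_forall fun x => ?_)
  rw [norm_mul]
  exact mul_le_mul_of_nonneg_right (hC x) (norm_nonneg _)

theorem LocL2.mul_continuous {u f : Plane → ℂ} (hu : LocL2 u) (hf : Continuous f) :
    LocL2 (fun x => f x * u x) := by
  intro K hK
  obtain ⟨C, hC⟩ := hK.exists_bound_of_continuousOn hf.continuousOn
  refine (hu K hK).of_le_mul (c := C)
    (hf.aestronglyMeasurable.mul (hu K hK).1) ?_
  filter_upwards [ae_restrict_mem hK.measurableSet] with x hx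
  rw [norm_mul]
  exact mul_le_mul_of_nonneg_right (hC x hx) (norm_nonneg _)

theorem LocL2.mul_compactSupport {u f : Plane → ℂ} (hu : LocL2 u) (hf : Continuous f)
    (hc : HasCompactSupport f) : GlobL2 (fun x => f x * u x) := by
  have hK : IsCompact (tsupport f) := hc
  have h1 := hu.mul_continuous hf _ hK
  have h2 := (memLp_indicator_iff_restrict (isClosed_tsupport f).measurableSet).2 h1
  refine h2.ae_eq (Eventually.of_forall fun x => ?_)
  by_cases hx : x ∈ tsupport f
  · rw [Set.indicator_of_mem hx]
  · rw [Set.indicator_of_notMem hx]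
    simp [image_eq_zero_of_notMem_tsupport hx]

theorem GlobL2.locL2 {u : Plane → ℂ} (hu : GlobL2 u) : LocL2 u := fun _ _ => hu.restrict _

theorem LocL2.congr {u v : Plane → ℂ} (hu : LocL2 u) (h : u =ᵐ[volume] v) : LocL2 v :=
  fun K hK => (hu K hK).ae_eq (ae_restrict_of_ae h)

theorem LocL2.locallyIntegrable {u : Plane → ℂ} (hu : LocL2 u) : LocallyIntegrable u volume := by
  rw [locallyIntegrable_iff]
  intro K hK
  have : IsFiniteMeasure (volume.restrict K : Measure Plane) :=
    ⟨by rw [Measure.restrict_apply_univ]; exact hK.measure_lt_top⟩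
  exact (hu K hK).integrable (by norm_num)

/-! ### Jets -/

theorem IsJet.mono {P Q : (Plane → ℂ) → Prop} (h : ∀ u, P u → Q u) {u d₁ d₂}
    (hj : IsJet P u d₁ d₂) : IsJet Q u d₁ d₂ :=
  ⟨h _ hj.base, fun i => h _ (hj.first i), fun i j => h _ (hj.second i j), hj.weak_first,
    hj.weak_second⟩

theorem IsJet.ae_eq {P Q : (Plane → ℂ) → Prop} {u u' d₁ d₁' d₂ d₂'} (hj : IsJet P u d₁ d₂)
    (hj' : IsJet Q u' d₁' d₂') (hu : u =ᵐ[volume] u') :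
    (∀ i, d₁ i =ᵐ[volume] d₁' i) ∧ ∀ i j, d₂ i j =ᵐ[volume] d₂' i j := by
  have h1 : ∀ i, d₁ i =ᵐ[volume] d₁' i := fun i => (hj.weak_first i).unique (hj'.weak_first i) hu
  exact ⟨h1, fun i j => (hj.weak_second i j).unique (hj'.weak_second i j) (h1 j)⟩

theorem RealDiffOp.onJet_congr (H : RealDiffOp) {u u' : Plane → ℂ} {d₁ d₁' : Fin 2 → Plane → ℂ}
    {d₂ d₂' : Fin 2 → Fin 2 → Plane → ℂ} (hu : u =ᵐ[volume] u')
    (h1 : ∀ i, d₁ i =ᵐ[volume] d₁' i) (h2 : ∀ i j, d₂ i j =ᵐ[volume] d₂' i j) :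
    H.onJet u d₁ d₂ =ᵐ[volume] H.onJet u' d₁' d₂' := by
  filter_upwards [hu, ae_all_iff.2 h1, ae_all_iff.2 fun i => ae_all_iff.2 (h2 i)] with x hx h1 h2
  simp only [RealDiffOp.onJet, hx, h1, h2]

theorem RealDiffOp.Maps.ae_eq_onJet {H : RealDiffOp} {P Q : (Plane → ℂ) → Prop} {u u' g d₁ d₂}
    (h : H.Maps P u g) (hj : IsJet Q u' d₁ d₂) (hu : u =ᵐ[volume] u') :
    g =ᵐ[volume] H.onJet u' d₁ d₂ := by
  obtain ⟨e₁, e₂, hj', hg⟩ := h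
  have := hj'.ae_eq hj hu
  exact hg.trans (H.onJet_congr hu this.1 this.2)

theorem RealDiffOp.Maps.unique {H : RealDiffOp} {P Q : (Plane → ℂ) → Prop} {u u' g g'}
    (h : H.Maps P u g) (h' : H.Maps Q u' g') (hu : u =ᵐ[volume] u') : g =ᵐ[volume] g' := by
  obtain ⟨e₁, e₂, hj', hg⟩ := h'
  exact (h.ae_eq_onJet hj' hu).trans hg.symm

theorem IsJet.congr {u u' d₁ d₁' d₂ d₂'} (hj : IsJet LocL2 u d₁ d₂) (hu : u =ᵐ[volume] u')
    (h1 : ∀ i, d₁ i =ᵐ[volume] d₁' i) (h2 : ∀ i j, d₂ i j =ᵐ[volume] d₂' i j) :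
    IsJet LocL2 u' d₁' d₂' :=
  ⟨hj.base.congr hu, fun i => (hj.first i).congr (h1 i), fun i j => (hj.second i j).congr (h2 i j),
    fun i => (hj.weak_first i).congr hu (h1 i),
    fun i j => (hj.weak_second i j).congr (h1 j) (h2 i j)⟩

theorem RealDiffOp.Maps.congr {H : RealDiffOp} {u u' g g'} (h : H.Maps LocL2 u g)
    (hu : u =ᵐ[volume] u') (hg : g =ᵐ[volume] g') : H.Maps LocL2 u' g' := by
  obtain ⟨d₁, d₂, hj, hgj⟩ := h
  refine ⟨d₁, d₂, hj.congr hu (fun _ => EventuallyEq.rfl) (fun _ _ => EventuallyEq.rfl), ?_⟩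
  exact hg.symm.trans (hgj.trans (H.onJet_congr hu (fun _ => EventuallyEq.rfl)
    (fun _ _ => EventuallyEq.rfl)))

/-- The first derivatives of a product with a smooth function. -/
def mulFirst (f u : Plane → ℂ) (d₁ : Fin 2 → Plane → ℂ) (i : Fin 2) (x : Plane) : ℂ :=
  f x * d₁ i x + pd i f x * u x

/-- The second derivatives of a product with a smooth function. -/
def mulSecond (f u : Plane → ℂ) (d₁ : Fin 2 → Plane → ℂ) (d₂ : Fin 2 → Fin 2 → Plane → ℂ)
    (i j : Fin 2) (x : Plane) : ℂ :=
  (f x * d₂ i j x + pd i f x * d₁ j x) + (pd j f x * d₁ i x + pd i (pd j f) x * u x)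

/-- The classes `P` and `Q` are left abstract because the same Leibniz computation serves for
cutoffs, plane waves and the growing weight. -/
theorem IsJet.mul {P Q : (Plane → ℂ) → Prop} {u d₁ d₂} (hj : IsJet P u d₁ d₂) {f : Plane → ℂ}
    (hf : ContDiff ℝ ∞ f) (hQ : IsLinClass Q) (h0 : ∀ v, P v → Q fun x => f x * v x)
    (h1 : ∀ i v, P v → Q fun x => pd i f x * v x)
    (h2 : ∀ i j v, P v → Q fun x => pd i (pd j f) x * v x) :
    IsJet Q (fun x => f x * u x) (mulFirst f u d₁) (mulSecond f u d₁ d₂) where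
  base := h0 _ hj.base
  first i := hQ.add (h0 _ (hj.first i)) (h1 i _ hj.base)
  second i j := hQ.add (hQ.add (h0 _ (hj.second i j)) (h1 i _ (hj.first j)))
    (hQ.add (h1 j _ (hj.first i)) (h2 i j _ hj.base))
  weak_first i := (hj.weak_first i).mul hf
  weak_second i j := ((hj.weak_second i j).mul hf).add
    ((hj.weak_first i).mul (contDiff_pd hf j))

theorem IsJet.mul_locL2 {u d₁ d₂} (hj : IsJet LocL2 u d₁ d₂) {f : Plane → ℂ}
    (hf : ContDiff ℝ ∞ f) :
    IsJet LocL2 (fun x => f x * u x) (mulFirst f u d₁) (mulSecond f u d₁ d₂) :=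
  hj.mul hf isLinClass_locL2 (fun _ hv => hv.mul_continuous hf.continuous)
    (fun i _ hv => hv.mul_continuous (contDiff_pd hf i).continuous)
    (fun i j _ hv => hv.mul_continuous (contDiff_pd (contDiff_pd hf j) i).continuous)

theorem IsJet.mul_compactSupport {u d₁ d₂} (hj : IsJet LocL2 u d₁ d₂) {f : Plane → ℂ}
    (hf : ContDiff ℝ ∞ f) (hc : HasCompactSupport f) :
    IsJet GlobL2 (fun x => f x * u x) (mulFirst f u d₁) (mulSecond f u d₁ d₂) :=
  hj.mul hf isLinClass_globL2 (fun _ hv => hv.mul_compactSupport hf.continuous hc)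
    (fun i _ hv => hv.mul_compactSupport (contDiff_pd hf i).continuous (hasCompactSupport_pd hc i))
    (fun i j _ hv => hv.mul_compactSupport (contDiff_pd (contDiff_pd hf j) i).continuous
      (hasCompactSupport_pd (hasCompactSupport_pd hc j) i))

/-- The commutator of the differential expression with a smooth function. -/
def RealDiffOp.comm (H : RealDiffOp) (f u : Plane → ℂ) (d₁ : Fin 2 → Plane → ℂ) (x : Plane) : ℂ :=
  ∑ i, ∑ j, (H.a i j x : ℂ) * (pd i f x * d₁ j x + pd j f x * d₁ i x) +
    (∑ i, ∑ j, (H.a i j x : ℂ) * pd i (pd j f) x + ∑ i, (H.b i x : ℂ) * pd i f x) * u x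

theorem RealDiffOp.onJet_mul (H : RealDiffOp) (f u : Plane → ℂ) (d₁ : Fin 2 → Plane → ℂ)
    (d₂ : Fin 2 → Fin 2 → Plane → ℂ) (x : Plane) :
    H.onJet (fun x => f x * u x) (mulFirst f u d₁) (mulSecond f u d₁ d₂) x =
      f x * H.onJet u d₁ d₂ x + H.comm f u d₁ x := by
  simp only [RealDiffOp.onJet, RealDiffOp.comm, mulFirst, mulSecond, Fin.sum_univ_two]
  ring

theorem RealDiffOp.Maps.mul {H : RealDiffOp} {u g d₁ d₂} (h : H.Maps LocL2 u g)
    (hj : IsJet LocL2 u d₁ d₂) {f : Plane → ℂ} (hf : ContDiff ℝ ∞ f) :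
    H.Maps LocL2 (fun x => f x * u x) (fun x => f x * g x + H.comm f u d₁ x) := by
  refine ⟨_, _, hj.mul_locL2 hf, ?_⟩
  filter_upwards [h.ae_eq_onJet hj EventuallyEq.rfl] with x hx
  rw [H.onJet_mul, hx]

/-! ### Plateau functions and the unfolding of integrals -/

/-- A smooth function on the line that is `1` on `[-N, N]` and `0` off `[-N - 1, N + 1]`. -/
def plat₁ (N : ℕ) (s : ℝ) : ℝ := Real.smoothTransition (s + N + 1) - Real.smoothTransition (s - N)

theorem contDiff_plat₁ (N : ℕ) : ContDiff ℝ ∞ (plat₁ N) :=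
  (Real.smoothTransition.contDiff.comp ((contDiff_id.add contDiff_const).add contDiff_const)).sub
    (Real.smoothTransition.contDiff.comp (contDiff_id.sub contDiff_const))

theorem plat₁_eq_one {N : ℕ} {s : ℝ} (h : |s| ≤ N) : plat₁ N s = 1 := by
  rw [abs_le] at h
  rw [plat₁, Real.smoothTransition.one_of_one_le (by linarith),
    Real.smoothTransition.zero_of_nonpos (by linarith), sub_zero]

theorem plat₁_eq_zero {N : ℕ} {s : ℝ} (h : N + 1 ≤ |s|) : plat₁ N s = 0 := by
  have hN : (0 : ℝ) ≤ N := Nat.cast_nonneg N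
  rcases le_abs.1 h with h | h
  · rw [plat₁, Real.smoothTransition.one_of_one_le (by linarith),
      Real.smoothTransition.one_of_one_le (by linarith), sub_self]
  · rw [plat₁, Real.smoothTransition.zero_of_nonpos (by linarith),
      Real.smoothTransition.zero_of_nonpos (by linarith), sub_self]

/-- The sum telescopes, `plat₁ 0` being a difference of two consecutive shifts of one step function.
So the integer shifts of `plat₁ 0` form a partition of unity. -/
theorem sum_plat₁ (N : ℕ) (s : ℝ) : ∑ n ∈ Finset.Icc (-N : ℤ) N, plat₁ 0 (s + n) = plat₁ N s := by
  induction N with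
  | zero => simp
  | succ N ih =>
    have h1 : Finset.Icc (-((N + 1 : ℕ) : ℤ)) ((N + 1 : ℕ) : ℤ) =
        insert (-((N + 1 : ℕ) : ℤ)) (insert ((N + 1 : ℕ) : ℤ) (Finset.Icc (-N : ℤ) N)) := by
      ext m
      simp only [Finset.mem_Icc, Finset.mem_insert]
      push_cast
      omega
    rw [h1, Finset.sum_insert (by simp; omega), Finset.sum_insert (by simp), ih]
    simp only [plat₁]
    push_cast
    rw [show s + -((N : ℝ) + 1) + 0 + 1 = s - N by ring,
      show s + -((N : ℝ) + 1) - 0 = s - (N + 1) by ring,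
      show s + ((N : ℝ) + 1) + 0 + 1 = s + (N + 1) + 1 by ring,
      show s + ((N : ℝ) + 1) - 0 = s + N + 1 by ring]
    ring

/-- A smooth function on the plane that is `1` where the lattice coordinates are at most `N`, and
`0` where one of them is at least `N + 1`. -/
def plat (N : ℕ) (x : Plane) : ℂ := ((plat₁ N (coord 0 x) * plat₁ N (coord 1 x) : ℝ) : ℂ)

theorem contDiff_plat (N : ℕ) : ContDiff ℝ ∞ (plat N) :=
  Complex.ofRealCLM.contDiff.comp (((contDiff_plat₁ N).comp (coord 0).contDiff).mul
    ((contDiff_plat₁ N).comp (coord 1).contDiff))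

theorem plat_eq_one {N : ℕ} {x : Plane} (h : ∀ i, |coord i x| ≤ N) : plat N x = 1 := by
  simp [plat, plat₁_eq_one (h 0), plat₁_eq_one (h 1)]

theorem plat_eq_zero {N : ℕ} {x : Plane} {i : Fin 2} (h : N + 1 ≤ |coord i x|) : plat N x = 0 := by
  fin_cases i
  · simp [plat, plat₁_eq_zero (N := N) (s := coord 0 x) h]
  · simp [plat, plat₁_eq_zero (N := N) (s := coord 1 x) h]

theorem conj_plat (N : ℕ) (x : Plane) : starRingEnd ℂ (plat N x) = plat N x := Complex.conj_ofReal _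

/-- The lattice points with coordinates at most `N`. -/
def box (N : ℕ) : Finset (ℤ × ℤ) := Finset.Icc (-N : ℤ) N ×ˢ Finset.Icc (-N : ℤ) N

theorem mem_box {N : ℕ} {n : ℤ × ℤ} : n ∈ box N ↔ |n.1| ≤ N ∧ |n.2| ≤ N := by
  simp [box, abs_le]

theorem sum_plat (N : ℕ) (x : Plane) : ∑ n ∈ box N, plat 0 (x + latt n.1 n.2) = plat N x := by
  simp only [plat, map_add, coord_zero_latt, coord_one_latt]
  rw [box, Finset.sum_product]
  simp only [← Complex.ofReal_sum, ← Finset.mul_sum, ← Finset.sum_mul, sum_plat₁]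

theorem hasCompactSupport_plat (N : ℕ) : HasCompactSupport (plat N) := by
  refine HasCompactSupport.intro (isCompact_closedBall (0 : Plane) ((N + 1) * (‖a₁‖ + ‖a₂‖)))
    fun x hx => ?_
  by_contra hne
  refine hx ?_
  rw [mem_closedBall_zero_iff]
  refine norm_le_of_abs_coord_le fun i => ?_
  by_contra h
  exact hne (plat_eq_zero (not_le.1 h).le)

theorem isOpen_coord_lt (r : ℝ) : IsOpen {x : Plane | ∀ i, |coord i x| < r} := by
  simp only [Set.ofPred_forall]
  exact isOpen_iInter_of_finite fun i => isOpen_lt (by fun_prop) continuous_const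

/-- Near a point where the function is locally constant, all its derivatives vanish. -/
theorem pd_eq_zero_of_eventually {f : Plane → ℂ} {c : ℂ} {x : Plane} (h : ∀ᶠ y in 𝓝 x, f y = c)
    (i : Fin 2) : ∀ᶠ y in 𝓝 x, pd i f y = 0 := by
  filter_upwards [h.eventually_nhds] with y hy
  have : f =ᶠ[𝓝 y] fun _ => c := hy
  rw [pd, this.fderiv_eq]
  simp

theorem RealDiffOp.comm_eq_zero (H : RealDiffOp) {f : Plane → ℂ} {c : ℂ} {x : Plane}
    (h : ∀ᶠ y in 𝓝 x, f y = c) (u : Plane → ℂ) (d₁ : Fin 2 → Plane → ℂ) : H.comm f u d₁ x = 0 := by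
  have h1 : ∀ i, pd i f x = 0 := fun i => (pd_eq_zero_of_eventually h i).self_of_nhds
  have h2 : ∀ i j, pd i (pd j f) x = 0 := fun i j =>
    (pd_eq_zero_of_eventually (pd_eq_zero_of_eventually h j) i).self_of_nhds
  simp [RealDiffOp.comm, h1, h2]

theorem eventually_plat_eq_one {N : ℕ} {x : Plane} (h : ∀ i, |coord i x| < N) :
    ∀ᶠ y in 𝓝 x, plat N y = 1 := by
  filter_upwards [(isOpen_coord_lt N).mem_nhds h] with y hy
  exact plat_eq_one fun i => (hy i).le

theorem eventually_plat_eq_zero {N : ℕ} {x : Plane} {i : Fin 2} (h : N + 1 < |coord i x|) :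
    ∀ᶠ y in 𝓝 x, plat N y = 0 := by
  have ho : IsOpen {y : Plane | N + 1 < |coord i y|} := isOpen_lt continuous_const (by fun_prop)
  filter_upwards [ho.mem_nhds h] with y hy
  exact plat_eq_zero (i := i) (le_of_lt hy)

/-- An integral over the plane of a function supported near the origin, as an integral over the
hexagon. -/
theorem integral_eq_sum_box {G : Plane → ℂ} (hG : Integrable G volume) {N : ℕ}
    (h0 : ∀ᵐ x, (∃ i, (N : ℝ) < |coord i x|) → G x = 0) :
    ∫ x, G x = ∑ n ∈ box (N + 1), ∫ x in ΩH, G (x + latt n.1 n.2) := by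
  have hG' := hG
  rw [tiles_ΩH.volume_eq_sum] at hG'
  have h1 : ∫ x, G x = ∑' n : ℤ × ℤ, ∫ x in ΩH, G (x + latt n.1 n.2) := by
    conv_lhs => rw [tiles_ΩH.volume_eq_sum]
    rw [integral_sum_measure hG']
    refine tsum_congr fun n => ?_
    exact (MeasurableEquiv.addRight (latt n.1 n.2)).measurableEmbedding.integral_map _
  rw [h1]
  refine tsum_eq_sum fun n hn => ?_
  refine integral_eq_zero_of_ae ?_
  filter_upwards [tiles_ΩH.ae_iff.1 h0 n, ae_restrict_mem measurableSet_ΩH] with x hx hxΩ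
  refine hx ?_
  -- Lattice coordinates on the hexagon are at most `1`, hence the box of size `N + 1`: any other
  -- shift moves the hexagon to where a coordinate exceeds `N`.
  have hc := abs_coord_le_of_mem_ΩH hxΩ
  have hc0 := abs_le.1 (hc 0)
  have hc1 := abs_le.1 (hc 1)
  rw [mem_box, not_and_or, not_le, not_le] at hn
  rcases hn with hn | hn
  · refine ⟨0, ?_⟩
    rw [map_add, coord_zero_latt]
    have hn' : ((N + 1 : ℕ) : ℝ) + 1 ≤ |(n.1 : ℝ)| := by
      have : ((N + 1 : ℕ) : ℤ) + 1 ≤ |n.1| := hn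
      exact_mod_cast this
    push_cast at hn'
    rcases le_abs.1 hn' with h | h
    · exact lt_abs.2 (Or.inl (by linarith))
    · exact lt_abs.2 (Or.inr (by linarith))
  · refine ⟨1, ?_⟩
    rw [map_add, coord_one_latt]
    have hn' : ((N + 1 : ℕ) : ℝ) + 1 ≤ |(n.2 : ℝ)| := by
      have : ((N + 1 : ℕ) : ℤ) + 1 ≤ |n.2| := hn
      exact_mod_cast this
    push_cast at hn'
    rcases le_abs.1 hn' with h | h
    · exact lt_abs.2 (Or.inl (by linarith))
    · exact lt_abs.2 (Or.inr (by linarith))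

theorem phase_zero (n₁ n₂ : ℤ) : phase 0 n₁ n₂ = 1 := by simp [phase]

theorem locallyIntegrable_mul_of_locL2 {u v : Plane → ℂ} (hu : LocL2 u) (hv : LocL2 v) :
    LocallyIntegrable (fun x => u x * v x) volume := by
  rw [locallyIntegrable_iff]
  intro K hK
  exact (hu K hK).integrable_mul (hv K hK)

theorem LocL2.conj {u : Plane → ℂ} (hu : LocL2 u) : LocL2 fun x => starRingEnd ℂ (u x) :=
  fun K hK => (hu K hK).star

/-- Integration of a periodic function against the partition of unity. -/
theorem integral_plat_mul {F : Plane → ℂ} (hF : LocallyIntegrable F volume) (hper : IsBloch 0 F) :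
    ∫ x, plat 0 x * F x = ∫ x in ΩH, F x := by
  have hint : Integrable (fun x => plat 0 x * F x) volume := by
    have := hF.integrable_smul_left_of_hasCompactSupport (contDiff_plat 0).continuous
      (hasCompactSupport_plat 0)
    simpa using this
  have hFΩ : IntegrableOn F ΩH volume := hF.integrableOn_isCompact isCompact_ΩH
  rw [integral_eq_sum_box hint (N := 1)]
  · have h1 : ∀ n : ℤ × ℤ, ∫ x in ΩH, plat 0 (x + latt n.1 n.2) * F (x + latt n.1 n.2) =
        ∫ x in ΩH, plat 0 (x + latt n.1 n.2) * F x := by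
      intro n
      refine integral_congr_ae (ae_restrict_of_ae ?_)
      filter_upwards [hper n.1 n.2] with x hx
      rw [hx, phase_zero, one_mul]
    simp only [h1]
    rw [← integral_finsetSum]
    · refine setIntegral_congr_fun measurableSet_ΩH fun x hx => ?_
      rw [← Finset.sum_mul, sum_plat, plat_eq_one, one_mul]
      intro i
      refine (abs_coord_le_of_mem_ΩH hx i).trans ?_
      norm_num
    · intro n _
      have hc : Continuous fun x => plat 0 (x + latt n.1 n.2) :=
        (contDiff_plat 0).continuous.comp (continuous_add_const _)
      exact hFΩ.continuousOn_mul hc.continuousOn isCompact_ΩH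
  · refine Eventually.of_forall fun x hx => ?_
    obtain ⟨i, hi⟩ := hx
    rw [plat_eq_zero (i := i), zero_mul]
    push_cast at hi ⊢
    linarith

/-! ### Symmetry of the operator on Bloch functions -/

theorem RealDiffOp.exists_bound (H : RealDiffOp) : ∃ C : ℝ, 0 ≤ C ∧ (∀ i j x, |H.a i j x| ≤ C) ∧
    (∀ i x, |H.b i x| ≤ C) ∧ ∀ x, |H.c x| ≤ C := by
  obtain ⟨C₁, h₁⟩ := H.bounded_a
  obtain ⟨C₂, h₂⟩ := H.bounded_b
  obtain ⟨C₃, h₃⟩ := H.bounded_c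
  have p₁ : 0 ≤ C₁ := (abs_nonneg _).trans (h₁ 0 0 0)
  have p₂ : 0 ≤ C₂ := (abs_nonneg _).trans (h₂ 0 0)
  have p₃ : 0 ≤ C₃ := (abs_nonneg _).trans (h₃ 0)
  exact ⟨C₁ + C₂ + C₃, by positivity, fun i j x => (h₁ i j x).trans (by linarith),
    fun i x => (h₂ i x).trans (by linarith), fun x => (h₃ x).trans (by linarith)⟩

theorem memLp_ofReal_mul {μ : Measure Plane} {f : Plane → ℝ} {u : Plane → ℂ} (hu : MemLp u 2 μ)
    (hf : Measurable f) {C : ℝ} (hC : ∀ x, |f x| ≤ C) : MemLp (fun x => (f x : ℂ) * u x) 2 μ :=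
  memLp_mul_of_bound hu (Complex.measurable_ofReal.comp hf).aestronglyMeasurable (C := C)
    fun x => by rw [Complex.norm_real]; exact hC x

theorem RealDiffOp.memLp_onJet (H : RealDiffOp) {μ : Measure Plane} {u d₁ d₂} (hu : MemLp u 2 μ)
    (h1 : ∀ i, MemLp (d₁ i) 2 μ) (h2 : ∀ i j, MemLp (d₂ i j) 2 μ) :
    MemLp (H.onJet u d₁ d₂) 2 μ := by
  obtain ⟨C, -, ha, hb, hc⟩ := H.exists_bound
  refine MemLp.add (MemLp.add ?_ ?_) ?_
  · exact memLp_finsetSum _ fun i _ => memLp_finsetSum _ fun j _ =>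
      memLp_ofReal_mul (h2 i j) (H.measurable_a i j) (ha i j)
  · exact memLp_finsetSum _ fun i _ => memLp_ofReal_mul (h1 i) (H.measurable_b i) (hb i)
  · exact memLp_ofReal_mul hu H.measurable_c hc

theorem RealDiffOp.Maps.locL2 {H : RealDiffOp} {u g} (h : H.Maps LocL2 u g) : LocL2 g := by
  obtain ⟨d₁, d₂, hj, hg⟩ := h
  have h1 : LocL2 (H.onJet u d₁ d₂) := fun K hK =>
    H.memLp_onJet (hj.base K hK) (fun i => hj.first i K hK) fun i j => hj.second i j K hK
  exact h1.congr hg.symm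

theorem mem_planeGraph {H : RealDiffOp} {u d₁ d₂} (hj : IsJet GlobL2 u d₁ d₂)
    {p : L2 Set.univ × L2 Set.univ} (h1 : p.1 =ᵐ[volume.restrict Set.univ] u)
    (h2 : p.2 =ᵐ[volume.restrict Set.univ] H.onJet u d₁ d₂) : p ∈ H.planeGraph :=
  ⟨u, H.onJet u d₁ d₂, trivial, ⟨d₁, d₂, hj, EventuallyEq.rfl⟩, h1, h2⟩

theorem integral_symm_plane {H : RealDiffOp} (hH : IsSelfAdjoint H.planeOp) {u d₁ d₂ v e₁ e₂}
    (hu : IsJet GlobL2 u d₁ d₂) (hv : IsJet GlobL2 v e₁ e₂) :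
    ∫ x, starRingEnd ℂ (H.onJet u d₁ d₂ x) * v x = ∫ x, starRingEnd ℂ (u x) * H.onJet v e₁ e₂ x := by
  have hu' : MemLp u 2 (volume.restrict Set.univ) := hu.base.restrict _
  have hv' : MemLp v 2 (volume.restrict Set.univ) := hv.base.restrict _
  have gu : MemLp (H.onJet u d₁ d₂) 2 (volume.restrict Set.univ) :=
    (H.memLp_onJet hu.base hu.first hu.second).restrict _
  have gv : MemLp (H.onJet v e₁ e₂) 2 (volume.restrict Set.univ) :=
    (H.memLp_onJet hv.base hv.first hv.second).restrict _
  have hsym := symmetricGraph_of_isSelfAdjoint hH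
  rw [graph_planeOp] at hsym
  have c1 := hu'.coeFn_toLp
  have c2 := hv'.coeFn_toLp
  have c3 := gu.coeFn_toLp
  have c4 := gv.coeFn_toLp
  have key := hsym (hu'.toLp u, gu.toLp _)
    (mem_planeGraph hu c1 c3)
    (hv'.toLp v, gv.toLp _)
    (mem_planeGraph hv c2 c4)
  rw [L2.inner_def, L2.inner_def] at key
  have e1 : ∫ x, starRingEnd ℂ (H.onJet u d₁ d₂ x) * v x =
      ∫ x in Set.univ, ⟪gu.toLp _ x, hv'.toLp v x⟫_ℂ := by
    rw [← setIntegral_univ]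
    refine integral_congr_ae ?_
    filter_upwards [c2, c3] with x h2 h3
    rw [h2, h3]
    simp [mul_comm]
  have e2 : ∫ x, starRingEnd ℂ (u x) * H.onJet v e₁ e₂ x =
      ∫ x in Set.univ, ⟪hu'.toLp u x, gv.toLp _ x⟫_ℂ := by
    rw [← setIntegral_univ]
    refine integral_congr_ae ?_
    filter_upwards [c1, c4] with x h1 h4
    rw [h1, h4]
    simp [mul_comm]
  rw [e1, e2]
  exact key

theorem norm_phase (k : Plane) (n₁ n₂ : ℤ) : ‖phase k n₁ n₂‖ = 1 := by
  rw [phase, mul_comm, Complex.norm_exp_ofReal_mul_I]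

theorem conj_phase_mul (k : Plane) (n₁ n₂ : ℤ) :
    starRingEnd ℂ (phase k n₁ n₂) * phase k n₁ n₂ = 1 := by
  rw [mul_comm, Complex.mul_conj, Complex.normSq_eq_norm_sq, norm_phase]
  simp

/-- The operator maps Bloch functions to Bloch functions. -/
theorem IsBloch.of_maps {H : RealDiffOp} (hS : H.ShiftInvariant) {k : Plane} {ψ g : Plane → ℂ}
    (hψ : IsBloch k ψ) (h : H.Maps LocL2 ψ g) : IsBloch k g := by
  intro n₁ n₂
  have h1 := hS n₁ n₂ ψ g h
  have h2 := h.smul isLinClass_locL2 (phase k n₁ n₂)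
  exact h1.unique h2 (hψ n₁ n₂)

theorem isBloch_conj_mul {k : Plane} {u v : Plane → ℂ} (hu : IsBloch k u) (hv : IsBloch k v) :
    IsBloch 0 fun x => starRingEnd ℂ (u x) * v x := by
  intro n₁ n₂
  filter_upwards [hu n₁ n₂, hv n₁ n₂] with x h1 h2
  rw [h1, h2, phase_zero, map_mul]
  linear_combination (starRingEnd ℂ (u x) * v x) * conj_phase_mul k n₁ n₂

theorem RealDiffOp.Maps.sum {H : RealDiffOp} {ι : Type*} (s : Finset ι) {u g : ι → Plane → ℂ}
    (h : ∀ i ∈ s, H.Maps LocL2 (u i) (g i)) :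
    H.Maps LocL2 (fun x => ∑ i ∈ s, u i x) (fun x => ∑ i ∈ s, g i x) := by
  classical
  induction s using Finset.induction_on with
  | empty => exact Maps.zero (H := H) isLinClass_locL2
  | insert i s hi ih =>
    simp only [Finset.sum_insert hi]
    exact (h i (Finset.mem_insert_self i s)).add isLinClass_locL2
      (ih fun j hj => h j (Finset.mem_insert_of_mem hj))

/-- Green's formula on the period cell. -/
theorem integral_symm_bloch {H : RealDiffOp} (hH : IsSelfAdjoint H.planeOp) (hS : H.ShiftInvariant)
    {k : Plane} {u g v h : Plane → ℂ} (hu : IsBloch k u) (hv : IsBloch k v)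
    (hug : H.Maps LocL2 u g) (hvh : H.Maps LocL2 v h) :
    ∫ x in ΩH, starRingEnd ℂ (g x) * v x = ∫ x in ΩH, starRingEnd ℂ (u x) * h x := by
  have hg := hu.of_maps hS hug
  have hgL := hug.locL2
  have hhL := hvh.locL2
  obtain ⟨d₁, d₂, hju, hgu⟩ := hug
  obtain ⟨e₁, e₂, hjv, hhv⟩ := id hvh
  -- `plat 2` equals `1` on the support of `plat 0`, so cutting off `u` is not felt where `v` is cut
  -- off, and both products are in `H²(ℝ²)`.
  have jU := hju.mul_compactSupport (contDiff_plat 2) (hasCompactSupport_plat 2)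
  have jV := hjv.mul_compactSupport (contDiff_plat 0) (hasCompactSupport_plat 0)
  set G : Plane → ℂ := fun x => plat 0 x * h x + H.comm (plat 0) v e₁ x with hGdef
  have hGmaps : H.Maps LocL2 (fun x => plat 0 x * v x) G := hvh.mul hjv (contDiff_plat 0)
  have hGzero : ∀ x, (∃ i, (1 : ℝ) < |coord i x|) → G x = 0 := by
    rintro x ⟨i, hi⟩
    have h1 := eventually_plat_eq_zero (N := 0) (x := x) (i := i) (by simpa using hi)
    simp only [hGdef]
    rw [h1.self_of_nhds, zero_mul, zero_add, H.comm_eq_zero h1]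
  have hGjet : H.onJet (fun x => plat 0 x * v x) (mulFirst (plat 0) v e₁)
      (mulSecond (plat 0) v e₁ e₂) =ᵐ[volume] G := by
    filter_upwards [hhv] with x hx
    rw [H.onJet_mul, ← hx]
  -- the left side
  have s1 : ∫ x in ΩH, starRingEnd ℂ (g x) * v x =
      ∫ x, plat 0 x * (starRingEnd ℂ (g x) * v x) :=
    (integral_plat_mul (locallyIntegrable_mul_of_locL2 hgL.conj hjv.base)
      (isBloch_conj_mul hg hv)).symm
  have s2 : ∫ x, plat 0 x * (starRingEnd ℂ (g x) * v x) =
      ∫ x, starRingEnd ℂ (H.onJet (fun x => plat 2 x * u x) (mulFirst (plat 2) u d₁)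
        (mulSecond (plat 2) u d₁ d₂) x) * (plat 0 x * v x) := by
    refine integral_congr_ae ?_
    filter_upwards [hgu] with x hx
    by_cases hc : ∃ i, (2 : ℝ) ≤ |coord i x|
    · obtain ⟨i, hi⟩ := hc
      have : plat 0 x = 0 := plat_eq_zero (i := i) (by push_cast; linarith)
      rw [this]; ring
    · push Not at hc
      have h1 := eventually_plat_eq_one (N := 2) (x := x) (by exact_mod_cast hc)
      rw [H.onJet_mul, ← hx, h1.self_of_nhds, H.comm_eq_zero h1]
      ring_nf
  have s3 := integral_symm_plane hH jU jV
  have s4 : ∫ x, starRingEnd ℂ (plat 2 x * u x) * H.onJet (fun x => plat 0 x * v x)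
      (mulFirst (plat 0) v e₁) (mulSecond (plat 0) v e₁ e₂) x = ∫ x, starRingEnd ℂ (u x) * G x := by
    refine integral_congr_ae ?_
    filter_upwards [hGjet] with x hx
    rw [hx]
    by_cases hc : ∃ i, (1 : ℝ) < |coord i x|
    · rw [hGzero x hc]; ring
    · push Not at hc
      rw [plat_eq_one (N := 2) fun i => (hc i).trans (by norm_num), one_mul]
  -- unfold the right side
  have hint : Integrable (fun x => starRingEnd ℂ (u x) * G x) volume := by
    have i1 := jU.base.star.integrable_mul (H.memLp_onJet jV.base jV.first jV.second)
    refine i1.congr ?_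
    filter_upwards [hGjet] with x hx
    simp only [Pi.mul_apply]
    rw [hx]
    change starRingEnd ℂ (plat 2 x * u x) * G x = _
    by_cases hc : ∃ i, (1 : ℝ) < |coord i x|
    · rw [hGzero x hc]; ring
    · push Not at hc
      rw [plat_eq_one (N := 2) fun i => (hc i).trans (by norm_num), one_mul]
  have s5 : ∫ x, starRingEnd ℂ (u x) * G x = ∑ n ∈ box 2, ∫ x in ΩH,
      starRingEnd ℂ (u (x + latt n.1 n.2)) * G (x + latt n.1 n.2) :=
    integral_eq_sum_box hint (N := 1) (Eventually.of_forall fun x hx => by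
      rw [hGzero x (by exact_mod_cast hx), mul_zero])
  -- The shifts of `plat 0 * v`, with conjugate phases, add up to `plat 2 * v`. Shift invariance
  -- lets `H` be applied to each term, and near the hexagon `plat 2` is `1`, so the commutators
  -- cancel there.
  have hsum : ∀ᵐ x, ∑ n ∈ box 2, starRingEnd ℂ (phase k n.1 n.2) * G (x + latt n.1 n.2) =
      plat 2 x * h x + H.comm (plat 2) v e₁ x := by
    have m1 : H.Maps LocL2
        (fun x => ∑ n ∈ box 2, starRingEnd ℂ (phase k n.1 n.2) *
          (plat 0 (x + latt n.1 n.2) * v (x + latt n.1 n.2)))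
        (fun x => ∑ n ∈ box 2, starRingEnd ℂ (phase k n.1 n.2) * G (x + latt n.1 n.2)) :=
      RealDiffOp.Maps.sum _ fun n _ =>
        (hS n.1 n.2 _ _ hGmaps).smul isLinClass_locL2 (starRingEnd ℂ (phase k n.1 n.2))
    have m2 := hvh.mul hjv (contDiff_plat 2)
    refine m1.unique m2 ?_
    have hv' := ae_all_iff.2 fun n₁ => ae_all_iff.2 fun n₂ => hv n₁ n₂
    filter_upwards [hv'] with x hx
    rw [← sum_plat, Finset.sum_mul]
    refine Finset.sum_congr rfl fun n _ => ?_
    rw [hx]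
    linear_combination (plat 0 (x + latt n.1 n.2) * v x) * conj_phase_mul k n.1 n.2
  have hu' := ae_all_iff.2 fun n₁ => ae_all_iff.2 fun n₂ => hu n₁ n₂
  have s6 : ∑ n ∈ box 2, ∫ x in ΩH, starRingEnd ℂ (u (x + latt n.1 n.2)) * G (x + latt n.1 n.2) =
      ∫ x in ΩH, starRingEnd ℂ (u x) * h x := by
    rw [← integral_finsetSum]
    · refine integral_congr_ae ?_
      filter_upwards [ae_restrict_of_ae hsum, ae_restrict_of_ae hu',
        ae_restrict_mem measurableSet_ΩH] with x hx hux hxΩ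
      have h1 := eventually_plat_eq_one (N := 2) (x := x) fun i =>
        (abs_coord_le_of_mem_ΩH hxΩ i).trans_lt (by norm_num)
      rw [h1.self_of_nhds, H.comm_eq_zero h1, one_mul, add_zero] at hx
      rw [← hx, Finset.mul_sum]
      refine Finset.sum_congr rfl fun n _ => ?_
      rw [hux, map_mul]
      ring
    · intro n _
      have mp := measurePreserving_add_right (volume : Measure Plane) (latt n.1 n.2)
      exact ((mp.integrable_comp hint.1).2 hint).integrableOn
  rw [s1, s2, s3, s4, s5, s6]

/-! ### Periodic extension from the hexagon -/

theorem exists_add_latt_mem (x : Plane) : ∃ n : ℤ × ℤ, x + latt n.1 n.2 ∈ ΩH := by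
  obtain ⟨n₁, n₂, h⟩ := exists_sub_latt_mem x
  exact ⟨(-n₁, -n₂), by rwa [latt_neg, ← sub_eq_add_neg]⟩

/-- A lattice vector that moves `x` into the hexagon. -/
def toCell (x : Plane) : ℤ × ℤ := (exists_add_latt_mem x).choose

theorem toCell_spec (x : Plane) : x + latt (toCell x).1 (toCell x).2 ∈ ΩH :=
  (exists_add_latt_mem x).choose_spec

/-- The lattice periodic function that agrees with `f` on the hexagon. -/
def perExt (f : Plane → ℂ) (x : Plane) : ℂ := f (x + latt (toCell x).1 (toCell x).2)

/-- The arbitrary choice of the translate in `toCell` matters only on a null set; the exceptional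
set is the same for all `f` and `n`. -/
theorem perExt_spec : ∀ᵐ x : Plane, ∀ (f : Plane → ℂ) (n : ℤ × ℤ), x + latt n.1 n.2 ∈ ΩH →
    perExt f x = f (x + latt n.1 n.2) := by
  filter_upwards [tiles_ΩH.existsUnique] with x hx f n hn
  rw [perExt, hx.unique (toCell_spec x) hn]

theorem latt_zero : latt 0 0 = 0 := by simp [latt]

theorem perExt_ae_eq (f : Plane → ℂ) : perExt f =ᵐ[volume.restrict ΩH] f := by
  refine (ae_restrict_iff' measurableSet_ΩH).2 ?_
  filter_upwards [perExt_spec] with x hx hm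
  have := hx f (0, 0) (by simpa [latt_zero] using hm)
  simpa [latt_zero] using this

theorem isBloch_perExt (f : Plane → ℂ) : IsBloch 0 (perExt f) := by
  intro n₁ n₂
  filter_upwards [perExt_spec, (measurePreserving_add_right (volume : Measure Plane)
    (latt n₁ n₂)).quasiMeasurePreserving.ae perExt_spec] with x hx hx'
  rw [phase_zero, one_mul, perExt, hx f ((toCell (x + latt n₁ n₂)).1 + n₁,
    (toCell (x + latt n₁ n₂)).2 + n₂)]
  · rw [latt_add, add_comm (latt _ _) (latt n₁ n₂), add_assoc]
  · rw [latt_add, add_comm (latt _ _) (latt n₁ n₂), ← add_assoc]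
    exact toCell_spec _

theorem IsBloch.eq_of_eq_on_cell {u v : Plane → ℂ} (hu : IsBloch 0 u) (hv : IsBloch 0 v)
    (h : u =ᵐ[volume.restrict ΩH] v) : u =ᵐ[volume] v := by
  refine tiles_ΩH.ae_iff.2 fun n => ?_
  filter_upwards [h, ae_restrict_of_ae (hu n.1 n.2), ae_restrict_of_ae (hv n.1 n.2)] with x h h1 h2
  rw [h1, h2, h]

theorem IsBloch.perExt_eq {u f : Plane → ℂ} (hu : IsBloch 0 u) (h : f =ᵐ[volume.restrict ΩH] u) :
    perExt f =ᵐ[volume] u :=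
  (isBloch_perExt f).eq_of_eq_on_cell hu ((perExt_ae_eq f).trans h)

theorem aestronglyMeasurable_perExt {f : Plane → ℂ}
    (hf : AEStronglyMeasurable f (volume.restrict ΩH)) :
    AEStronglyMeasurable (perExt f) volume := by
  rw [tiles_ΩH.volume_eq_sum]
  refine AEStronglyMeasurable.sum_measure fun n => ?_
  refine (MeasurableEquiv.addRight
    (latt n.1 n.2)).measurableEmbedding.aestronglyMeasurable_map_iff.2 (hf.congr ?_)
  filter_upwards [perExt_ae_eq f, ae_restrict_of_ae (isBloch_perExt f n.1 n.2)] with x h1 h2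
  simp only [Function.comp, MeasurableEquiv.coe_addRight]
  rw [h2, phase_zero, one_mul, h1]

/-- Every translate of the cell contributes the same integral of `‖f‖²`, up to the bound of the
weight there. It is used with the indicator of a compact set and with the inverse square of a
growing weight. -/
theorem lintegral_mul_perExt_le {f : Plane → ℂ} (hf : AEStronglyMeasurable f (volume.restrict ΩH))
    {w : Plane → ENNReal} (hw : Measurable w) {b : ℤ × ℤ → ENNReal}
    (hb : ∀ n, ∀ x ∈ ΩH, w (x + latt n.1 n.2) ≤ b n) :
    ∫⁻ x, w x * ‖perExt f x‖ₑ ^ 2 ≤ (∑' n, b n) * ∫⁻ x in ΩH, ‖f x‖ₑ ^ 2 := by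
  rw [tiles_ΩH.lintegral_eq (f := fun x => w x * ‖perExt f x‖ₑ ^ 2) (hw.aemeasurable.mul
    ((aestronglyMeasurable_perExt hf).enorm.pow_const 2)), ← ENNReal.tsum_mul_right]
  refine ENNReal.tsum_le_tsum fun n => ?_
  rw [← lintegral_const_mul'' _ (hf.enorm.pow_const 2)]
  refine lintegral_mono_ae ?_
  filter_upwards [perExt_ae_eq f, ae_restrict_of_ae (isBloch_perExt f n.1 n.2),
    ae_restrict_mem measurableSet_ΩH] with x h1 h2 h3
  rw [h2, phase_zero, one_mul, h1]
  gcongr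
  exact hb n x h3

theorem eLpNorm_two_sq {μ : Measure Plane} (f : Plane → ℂ) :
    eLpNorm f 2 μ ^ 2 = ∫⁻ x, ‖f x‖ₑ ^ 2 ∂μ := by
  have := eLpNorm_nnreal_pow_eq_lintegral (μ := μ) (f := f) (p := 2) (by norm_num)
  simpa using this

/-- A compact set meets only finitely many translates of the hexagon. -/
theorem exists_eLpNorm_perExt_le {K : Set Plane} (hK : IsCompact K) : ∃ C : NNReal,
    ∀ f : Plane → ℂ, AEStronglyMeasurable f (volume.restrict ΩH) →
      eLpNorm (perExt f) 2 (volume.restrict K) ≤ C * eLpNorm f 2 (volume.restrict ΩH) := by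
  obtain ⟨N, hN⟩ : ∃ N : ℕ, ∀ x ∈ K, ∀ i, |coord i x| ≤ N := by
    have hb : ∀ i, ∃ C, ∀ x ∈ K, ‖coord i x‖ ≤ C := fun i =>
      hK.exists_bound_of_continuousOn (coord i).continuous.continuousOn
    choose C hC using hb
    obtain ⟨N, hN⟩ := exists_nat_ge (max (C 0) (C 1))
    refine ⟨N, fun x hx i => (hC i x hx).trans (le_trans ?_ hN)⟩
    fin_cases i
    · exact le_max_left _ _
    · exact le_max_right _ _
  refine ⟨((box (N + 1)).card : NNReal), fun f hf => ?_⟩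
  have h1 := lintegral_mul_perExt_le hf (w := K.indicator 1) (b := (box (N + 1) : Set (ℤ × ℤ)).indicator 1)
    (measurable_one.indicator hK.measurableSet) (fun n x hx => by
      by_cases hm : x + latt n.1 n.2 ∈ K
      · have hn : n ∈ (box (N + 1) : Set (ℤ × ℤ)) := by
          have h0 := hN _ hm 0
          have h1 := hN _ hm 1
          have g0 := abs_coord_le_of_mem_ΩH hx 0
          have g1 := abs_coord_le_of_mem_ΩH hx 1
          rw [map_add, coord_zero_latt] at h0
          rw [map_add, coord_one_latt] at h1
          rw [Finset.mem_coe, mem_box]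
          simp only [abs_le] at *
          refine ⟨⟨?_, ?_⟩, ?_, ?_⟩ <;> rw [← @Int.cast_le ℝ] <;> push_cast <;>
            linarith
        rw [Set.indicator_of_mem hm, Set.indicator_of_mem hn]
        exact le_rfl
      · rw [Set.indicator_of_notMem hm]
        exact zero_le)
  have h2 : ∑' n, (box (N + 1) : Set (ℤ × ℤ)).indicator (1 : ℤ × ℤ → ENNReal) n =
      (box (N + 1)).card := by
    rw [← tsum_subtype]
    simp
  have h3 : ∫⁻ x, K.indicator 1 x * ‖perExt f x‖ₑ ^ 2 = eLpNorm (perExt f) 2 (volume.restrict K) ^ 2 := by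
    rw [eLpNorm_two_sq, ← lintegral_indicator hK.measurableSet]
    refine lintegral_congr fun x => ?_
    by_cases hm : x ∈ K <;> simp [hm]
  rw [h2, h3, ← eLpNorm_two_sq] at h1
  -- The estimate is for squared norms; `card ≤ card²` allows the cardinality itself as the
  -- constant.
  have h4 : (1 : ENNReal) ≤ (box (N + 1)).card := by
    have : 0 < (box (N + 1)).card := Finset.card_pos.2 ⟨(0, 0), by simp [mem_box]; positivity⟩
    exact_mod_cast this
  rw [← ENNReal.pow_le_pow_left_iff two_ne_zero]
  refine h1.trans ?_
  rw [mul_pow]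
  gcongr
  simp only [ENNReal.coe_natCast]
  calc ((box (N + 1)).card : ENNReal) = (box (N + 1)).card ^ 1 := (pow_one _).symm
    _ ≤ _ := pow_le_pow_right₀ h4 (by norm_num)

theorem locL2_perExt {f : Plane → ℂ} (hf : MemLp f 2 (volume.restrict ΩH)) : LocL2 (perExt f) := by
  intro K hK
  obtain ⟨C, hC⟩ := exists_eLpNorm_perExt_le hK
  exact ⟨(aestronglyMeasurable_perExt hf.1).restrict, (hC f hf.1).trans_lt
    (ENNReal.mul_lt_top ENNReal.coe_lt_top hf.2)⟩

/-! ### Multiplication by bounded functions -/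

open Classical in
/-- Multiplication by a bounded measurable function on `L²(Ω)`. -/
def mulL2 (Ω : Set Plane) (m : Plane → ℂ) : L2 Ω →L[ℂ] L2 Ω :=
  if h : Measurable m ∧ ∃ C : ℝ, ∀ x, ‖m x‖ ≤ C then
    LinearMap.mkContinuousOfExistsBound
      { toFun := fun f => (memLp_mul_of_bound (Lp.memLp f) h.1.aestronglyMeasurable
          h.2.choose_spec).toLp _
        map_add' := fun f g => by
          rw [← MemLp.toLp_add]
          refine MemLp.toLp_congr _ _ ?_
          filter_upwards [Lp.coeFn_add f g] with x hx
          simp only [hx, Pi.add_apply, mul_add]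
        map_smul' := fun c f => by
          rw [RingHom.id_apply, ← MemLp.toLp_const_smul]
          refine MemLp.toLp_congr _ _ ?_
          filter_upwards [Lp.coeFn_smul c f] with x hx
          simp only [hx, Pi.smul_apply, smul_eq_mul]
          ring }
      ⟨h.2.choose, fun f => by
        refine Lp.norm_le_mul_norm_of_ae_le_mul ?_
        filter_upwards [MemLp.coeFn_toLp (memLp_mul_of_bound (Lp.memLp f)
          h.1.aestronglyMeasurable h.2.choose_spec)] with x hx
        simp only [LinearMap.coe_mk, AddHom.coe_mk, hx, norm_mul]
        exact mul_le_mul_of_nonneg_right (h.2.choose_spec x) (norm_nonneg _)⟩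
  -- A default for other multipliers, so that no boundedness proofs appear in the formulas for
  -- operators.
  else 0

theorem mulL2_ae {Ω : Set Plane} {m : Plane → ℂ} (hm : Measurable m) {C : ℝ}
    (hC : ∀ x, ‖m x‖ ≤ C) (f : L2 Ω) :
    mulL2 Ω m f =ᵐ[volume.restrict Ω] fun x => m x * f x := by
  have h : Measurable m ∧ ∃ C : ℝ, ∀ x, ‖m x‖ ≤ C := ⟨hm, C, hC⟩
  rw [mulL2, dif_pos h]
  exact MemLp.coeFn_toLp (memLp_mul_of_bound (Lp.memLp f) h.1.aestronglyMeasurable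
    h.2.choose_spec)

theorem norm_mulL2_le {Ω : Set Plane} {m : Plane → ℂ} (hm : Measurable m) {C : ℝ} (h0 : 0 ≤ C)
    (hC : ∀ x, ‖m x‖ ≤ C) : ‖mulL2 Ω m‖ ≤ C := by
  refine ContinuousLinearMap.opNorm_le_bound _ h0 fun f => Lp.norm_le_mul_norm_of_ae_le_mul ?_
  filter_upwards [mulL2_ae hm hC f] with x hx
  rw [hx, norm_mul]
  exact mul_le_mul_of_nonneg_right (hC x) (norm_nonneg _)

theorem mulL2_ofReal_ae {Ω : Set Plane} {m : Plane → ℝ} (hm : Measurable m) {C : ℝ}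
    (hC : ∀ x, |m x| ≤ C) (f : L2 Ω) :
    mulL2 Ω (fun x => (m x : ℂ)) f =ᵐ[volume.restrict Ω] fun x => (m x : ℂ) * f x :=
  mulL2_ae (Complex.measurable_ofReal.comp hm) (fun x => by simpa using hC x) f

theorem mulL2_ofReal_ae' {Ω : Set Plane} {m : Plane → ℝ} (hm : Measurable m) {C : ℝ}
    (hC : ∀ x, |m x| ≤ C) {f : L2 Ω} {F : Plane → ℂ} (hF : f =ᵐ[volume.restrict Ω] F) :
    mulL2 Ω (fun x => (m x : ℂ)) f =ᵐ[volume.restrict Ω] fun x => (m x : ℂ) * F x :=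
  (mulL2_ofReal_ae hm hC f).trans (hF.mono fun x hx => by simp only [hx])

theorem coe_add_ae {Ω : Set Plane} {f g : L2 Ω} {F G : Plane → ℂ}
    (hf : f =ᵐ[volume.restrict Ω] F) (hg : g =ᵐ[volume.restrict Ω] G) :
    (f + g : L2 Ω) =ᵐ[volume.restrict Ω] fun x => F x + G x :=
  (Lp.coeFn_add f g).trans (hf.add hg)

theorem coe_smul_ae {Ω : Set Plane} {f : L2 Ω} {F : Plane → ℂ} (c : ℂ)
    (hf : f =ᵐ[volume.restrict Ω] F) :
    (c • f : L2 Ω) =ᵐ[volume.restrict Ω] fun x => c * F x :=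
  (Lp.coeFn_smul c f).trans (hf.mono fun x hx => by simp [hx])

theorem coe_sum_ae {Ω : Set Plane} {ι : Type*} (s : Finset ι) {f : ι → L2 Ω}
    {F : ι → Plane → ℂ} (hf : ∀ i, f i =ᵐ[volume.restrict Ω] F i) :
    (∑ i ∈ s, f i : L2 Ω) =ᵐ[volume.restrict Ω] fun x => ∑ i ∈ s, F i x := by
  classical
  induction s using Finset.induction_on with
  | empty =>
    simp only [Finset.sum_empty]
    exact Lp.coeFn_zero ℂ 2 (volume.restrict Ω)
  | insert a s ha ih =>
    simp only [Finset.sum_insert ha]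
    exact coe_add_ae (hf a) ih

/-! ### Banach spaces of second order jets -/

/-- A linear way to extend square integrable functions on `Ω` to locally square integrable
functions on the plane. -/
structure IsExt {Ω : Set Plane} (E : L2 Ω → Plane → ℂ) : Prop where
  add : ∀ f g, E (f + g) =ᵐ[volume] E f + E g
  smul : ∀ (c : ℂ) f, E (c • f) =ᵐ[volume] c • E f
  restr : ∀ f, E f =ᵐ[volume.restrict Ω] f
  aestronglyMeasurable : ∀ f, AEStronglyMeasurable (E f) volume
  bound : ∀ K, IsCompact K → ∃ C : NNReal, ∀ f, eLpNorm (E f) 2 (volume.restrict K) ≤ C * ‖f‖ₑ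

variable {Ω : Set Plane} {E : L2 Ω → Plane → ℂ}

theorem IsExt.locL2 (hE : IsExt E) (f : L2 Ω) : LocL2 (E f) := fun K hK => by
  obtain ⟨C, hC⟩ := hE.bound K hK
  exact ⟨(hE.aestronglyMeasurable f).restrict,
    (hC f).trans_lt (ENNReal.mul_lt_top ENNReal.coe_lt_top enorm_lt_top)⟩

theorem IsExt.zero (hE : IsExt E) : E 0 =ᵐ[volume] 0 := by
  have := hE.smul 0 0
  simpa using this

/-- By Hölder's inequality on the support of `φ`, with the local bound of the extension. This
continuity makes the space of jets closed, hence complete. -/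
theorem IsExt.continuous_integral (hE : IsExt E) {φ : Plane → ℝ} (hφ : Continuous φ)
    (hc : HasCompactSupport φ) : Continuous fun f => ∫ x, φ x • E f x := by
  have hint : ∀ f, Integrable (fun x => φ x • E f x) volume := fun f =>
    (hE.locL2 f).locallyIntegrable.integrable_smul_left_of_hasCompactSupport hφ hc
  let T : L2 Ω →ₗ[ℂ] ℂ :=
    { toFun := fun f => ∫ x, φ x • E f x
      map_add' := fun f g => by
        rw [← integral_add (hint f) (hint g)]
        refine integral_congr_ae ?_
        filter_upwards [hE.add f g] with x hx
        rw [hx, Pi.add_apply, smul_add]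
      map_smul' := fun c f => by
        rw [RingHom.id_apply, ← integral_smul]
        refine integral_congr_ae ?_
        filter_upwards [hE.smul c f] with x hx
        rw [hx, Pi.smul_apply, smul_comm] }
  obtain ⟨M, hM⟩ := hφ.bounded_above_of_compact_support hc
  have hM0 : 0 ≤ M := (norm_nonneg _).trans (hM 0)
  obtain ⟨C, hC⟩ := hE.bound _ hc.isCompact
  have hvol : volume (tsupport φ) ≠ ⊤ := hc.isCompact.measure_ne_top
  refine (T.mkContinuousOfExistsBound
    ⟨M * (C * (volume (tsupport φ) ^ (1 / 2 : ℝ)).toReal), fun f => ?_⟩).continuous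
  have h1 : T f = ∫ x in tsupport φ, φ x • E f x := by
    refine (setIntegral_eq_integral_of_forall_compl_eq_zero fun x hx => ?_).symm
    rw [image_eq_zero_of_notMem_tsupport hx, zero_smul]
  have hm : MemLp (E f) 1 (volume.restrict (tsupport φ)) := by
    have : IsFiniteMeasure (volume.restrict (tsupport φ)) := ⟨by
      rw [Measure.restrict_apply_univ]; exact hvol.lt_top⟩
    exact (hE.locL2 f _ hc.isCompact).mono_exponent (by norm_num)
  have h2 : ‖T f‖ ≤ M * ∫ x in tsupport φ, ‖E f x‖ := by
    rw [h1, ← integral_const_mul]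
    refine norm_integral_le_of_norm_le ((memLp_one_iff_integrable.1 hm).norm.const_mul M) ?_
    refine Eventually.of_forall fun x => ?_
    rw [norm_smul]
    exact mul_le_mul_of_nonneg_right (hM x) (norm_nonneg _)
  refine h2.trans ?_
  rw [mul_assoc]
  gcongr
  rw [integral_norm_eq_lintegral_enorm hm.1, ← eLpNorm_one_eq_lintegral_enorm]
  have h3 := eLpNorm_le_eLpNorm_mul_rpow_measure_univ (p := 1) (q := 2) (by norm_num) hm.1
  rw [Measure.restrict_apply_univ] at h3
  have h4 : eLpNorm (E f) 1 (volume.restrict (tsupport φ)) ≤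
      (C * ‖f‖ₑ) * volume (tsupport φ) ^ (1 / 2 : ℝ) := by
    refine h3.trans (mul_le_mul' (hC f) (le_of_eq ?_))
    norm_num
  have h5 := ENNReal.toReal_mono (by
    refine ENNReal.mul_ne_top (ENNReal.mul_ne_top ENNReal.coe_ne_top enorm_ne_top) ?_
    exact ENNReal.rpow_ne_top_of_nonneg (by norm_num) hvol) h4
  rw [ENNReal.toReal_mul, ENNReal.toReal_mul, toReal_enorm, ENNReal.coe_toReal] at h5
  calc _ ≤ _ := h5
    _ = _ := by ring

/-- The ambient space of jets. -/
abbrev PreJet (Ω : Set Plane) : Type := L2 Ω × (Fin 2 → L2 Ω) × (Fin 2 → Fin 2 → L2 Ω)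

/-- The space of jets of functions with weak derivatives up to second order. -/
def jetSpace (hE : IsExt E) : Submodule ℂ (PreJet Ω) where
  carrier := {p | (∀ i, HasWeakPartial i (E p.1) (E (p.2.1 i))) ∧
    ∀ i j, HasWeakPartial i (E (p.2.1 j)) (E (p.2.2 i j))}
  zero_mem' := ⟨fun i => (HasWeakPartial.zero i).congr hE.zero.symm hE.zero.symm,
    fun i _ => (HasWeakPartial.zero i).congr hE.zero.symm hE.zero.symm⟩
  add_mem' {_ _} hp hq := ⟨fun i => ((hp.1 i).add (hq.1 i)).congr (hE.add _ _).symm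
    (hE.add _ _).symm, fun i j => ((hp.2 i j).add (hq.2 i j)).congr (hE.add _ _).symm
    (hE.add _ _).symm⟩
  smul_mem' c _ hp := ⟨fun i => ((hp.1 i).smul c).congr (hE.smul _ _).symm
    (hE.smul _ _).symm, fun i j => ((hp.2 i j).smul c).congr (hE.smul _ _).symm
    (hE.smul _ _).symm⟩

/-- A weak derivative is defined by one continuous linear condition for each test function. -/
theorem isClosed_hasWeakPartial (hE : IsExt E) {A : Type*} [TopologicalSpace A] {f g : A → L2 Ω}
    (hf : Continuous f) (hg : Continuous g) (i : Fin 2) :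
    IsClosed {p | HasWeakPartial i (E (f p)) (E (g p))} := by
  have : {p | HasWeakPartial i (E (f p)) (E (g p))} =
      ⋂ φ : {φ : Plane → ℝ // ContDiff ℝ ∞ φ ∧ HasCompactSupport φ},
        {p | ∫ x, pd i φ.1 x • E (f p) x = -∫ x, φ.1 x • E (g p) x} := by
    ext p
    simp only [Set.mem_iInter, Set.mem_ofPred_eq]
    exact ⟨fun h φ => h.2.2 φ.1 φ.2.1 φ.2.2, fun h => ⟨(hE.locL2 _).locallyIntegrable,
      (hE.locL2 _).locallyIntegrable, fun φ h1 h2 => h ⟨φ, h1, h2⟩⟩⟩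
  rw [this]
  refine isClosed_iInter fun φ => isClosed_eq ?_ ?_
  · exact (hE.continuous_integral (contDiff_pd φ.2.1 i).continuous
      (hasCompactSupport_pd φ.2.2 i)).comp hf
  · exact ((hE.continuous_integral φ.2.1.continuous φ.2.2).comp hg).neg

theorem isClosed_jetSpace (hE : IsExt E) : IsClosed (jetSpace hE : Set (PreJet Ω)) := by
  have : (jetSpace hE : Set (PreJet Ω)) =
      (⋂ i, {p : PreJet Ω | HasWeakPartial i (E p.1) (E (p.2.1 i))}) ∩
      ⋂ i, ⋂ j, {p : PreJet Ω | HasWeakPartial i (E (p.2.1 j)) (E (p.2.2 i j))} := by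
    ext p
    simp only [Set.mem_inter_iff, Set.mem_iInter, Set.mem_ofPred_eq]
    rfl
  rw [this]
  refine (isClosed_iInter fun i => ?_).inter (isClosed_iInter fun i => isClosed_iInter fun j => ?_)
  · exact isClosed_hasWeakPartial hE (by fun_prop) (by fun_prop) i
  · exact isClosed_hasWeakPartial hE (by fun_prop) (by fun_prop) i

/-- The Banach space of jets of functions with weak derivatives up to second order. -/
def Jet (hE : IsExt E) : Type := jetSpace hE

instance (hE : IsExt E) : NormedAddCommGroup (Jet hE) :=
  inferInstanceAs (NormedAddCommGroup (jetSpace hE))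

instance (hE : IsExt E) : NormedSpace ℂ (Jet hE) :=
  inferInstanceAs (NormedSpace ℂ (jetSpace hE))

instance (hE : IsExt E) : CompleteSpace (Jet hE) := (isClosed_jetSpace hE).completeSpace_coe

/-- The components of a jet. -/
def jetVal (hE : IsExt E) : Jet hE →L[ℂ] PreJet Ω := (jetSpace hE).subtypeL

/-- The function underlying a jet. -/
def jetBase (hE : IsExt E) : Jet hE →L[ℂ] L2 Ω :=
  (ContinuousLinearMap.fst ℂ _ _).comp (jetVal hE)

/-- The first derivatives of a jet. -/
def jetFirst (hE : IsExt E) (i : Fin 2) : Jet hE →L[ℂ] L2 Ω :=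
  (ContinuousLinearMap.proj i).comp ((ContinuousLinearMap.fst ℂ _ _).comp
    ((ContinuousLinearMap.snd ℂ _ _).comp (jetVal hE)))

/-- The second derivatives of a jet. -/
def jetSecond (hE : IsExt E) (i j : Fin 2) : Jet hE →L[ℂ] L2 Ω :=
  (ContinuousLinearMap.proj j).comp ((ContinuousLinearMap.proj (φ := fun _ => Fin 2 → L2 Ω) i).comp
    ((ContinuousLinearMap.snd ℂ _ _).comp ((ContinuousLinearMap.snd ℂ _ _).comp
      (jetVal hE))))

theorem isJet_jet (hE : IsExt E) (p : Jet hE) : IsJet LocL2 (E (jetBase hE p))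
    (fun i => E (jetFirst hE i p)) (fun i j => E (jetSecond hE i j p)) :=
  ⟨hE.locL2 _, fun _ => hE.locL2 _, fun _ _ => hE.locL2 _, p.2.1, p.2.2⟩

/-- The jet of a function with weak derivatives `d₁` and `d₂`. -/
def mkJet (hE : IsExt E) (u : L2 Ω) (d₁ : Fin 2 → L2 Ω) (d₂ : Fin 2 → Fin 2 → L2 Ω)
    (h : IsJet LocL2 (E u) (fun i => E (d₁ i)) (fun i j => E (d₂ i j))) : Jet hE :=
  ⟨(u, d₁, d₂), h.weak_first, h.weak_second⟩

/-- Weak derivatives are determined by the function, so a jet is no more than an element of the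
domain with the graph norm of `H²`. -/
theorem jetBase_injective (hE : IsExt E) : Function.Injective (jetBase hE) := by
  rw [injective_iff_map_eq_zero]
  intro p hp
  have h0 : E (jetBase hE p) =ᵐ[volume] (0 : Plane → ℂ) := by rw [hp]; exact hE.zero
  have hj : IsJet LocL2 (0 : Plane → ℂ) (fun _ => 0) (fun _ _ => 0) :=
    ⟨isLinClass_locL2.zero, fun _ => isLinClass_locL2.zero, fun _ _ => isLinClass_locL2.zero,
      fun i => HasWeakPartial.zero i, fun i _ => HasWeakPartial.zero i⟩
  obtain ⟨h1, h2⟩ := (isJet_jet hE p).ae_eq hj h0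
  have key : ∀ f : L2 Ω, E f =ᵐ[volume] (0 : Plane → ℂ) → f = 0 := fun f hf => by
    rw [Lp.eq_zero_iff_ae_eq_zero]
    exact (hE.restr f).symm.trans (ae_restrict_of_ae hf)
  refine Subtype.ext (Prod.ext hp (Prod.ext (funext fun i => key _ (h1 i))
    (funext fun i => funext fun j => key _ (h2 i j))))

/-! ### Differential operators on jets -/

namespace RealDiffOp

variable (H : RealDiffOp) (hE : IsExt E)

/-- The operator `H` on jets. -/
def jetOp : Jet hE →L[ℂ] L2 Ω :=
  ∑ i, ∑ j, (mulL2 Ω fun x => (H.a i j x : ℂ)).comp (jetSecond hE i j) +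
    ∑ i, (mulL2 Ω fun x => (H.b i x : ℂ)).comp (jetFirst hE i) +
    (mulL2 Ω fun x => (H.c x : ℂ)).comp (jetBase hE)

/-- The first order part of the commutator of `H` with the `i`-th coordinate. -/
def jetGrad (i : Fin 2) : Jet hE →L[ℂ] L2 Ω :=
  ∑ j, ((mulL2 Ω fun x => (H.a i j x : ℂ)).comp (jetFirst hE j) +
    (mulL2 Ω fun x => (H.a j i x : ℂ)).comp (jetFirst hE j)) +
    (mulL2 Ω fun x => (H.b i x : ℂ)).comp (jetBase hE)

/-- Multiplication by the leading coefficient `aᵢⱼ` on jets. -/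
def jetLead (i j : Fin 2) : Jet hE →L[ℂ] L2 Ω :=
  (mulL2 Ω fun x => (H.a i j x : ℂ)).comp (jetBase hE)

theorem jetOp_ae (p : Jet hE) : H.jetOp hE p =ᵐ[volume.restrict Ω]
    H.onJet (E (jetBase hE p)) (fun i => E (jetFirst hE i p)) fun i j => E (jetSecond hE i j p) := by
  obtain ⟨C, -, ha, hb, hc⟩ := H.exists_bound
  simp only [jetOp, add_apply, sum_apply, ContinuousLinearMap.comp_apply]
  refine coe_add_ae (coe_add_ae (coe_sum_ae _ fun i => coe_sum_ae _ fun j => ?_)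
    (coe_sum_ae _ fun i => ?_)) ?_
  · exact mulL2_ofReal_ae' (H.measurable_a i j) (ha i j) (hE.restr _).symm
  · exact mulL2_ofReal_ae' (H.measurable_b i) (hb i) (hE.restr _).symm
  · exact mulL2_ofReal_ae' H.measurable_c hc (hE.restr _).symm

theorem jetGrad_ae (i : Fin 2) (p : Jet hE) : H.jetGrad hE i p =ᵐ[volume.restrict Ω]
    fun x => ∑ j, ((H.a i j x : ℂ) * E (jetFirst hE j p) x + (H.a j i x : ℂ) *
      E (jetFirst hE j p) x) + (H.b i x : ℂ) * E (jetBase hE p) x := by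
  obtain ⟨C, -, ha, hb, hc⟩ := H.exists_bound
  simp only [jetGrad, add_apply, sum_apply, ContinuousLinearMap.comp_apply]
  refine coe_add_ae (coe_sum_ae _ fun j => coe_add_ae ?_ ?_) ?_
  · exact mulL2_ofReal_ae' (H.measurable_a i j) (ha i j) (hE.restr _).symm
  · exact mulL2_ofReal_ae' (H.measurable_a j i) (ha j i) (hE.restr _).symm
  · exact mulL2_ofReal_ae' (H.measurable_b i) (hb i) (hE.restr _).symm

theorem jetLead_ae (i j : Fin 2) (p : Jet hE) : H.jetLead hE i j p =ᵐ[volume.restrict Ω]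
    fun x => (H.a i j x : ℂ) * E (jetBase hE p) x := by
  obtain ⟨C, -, ha, hb, hc⟩ := H.exists_bound
  exact mulL2_ofReal_ae' (H.measurable_a i j) (ha i j) (hE.restr _).symm

end RealDiffOp

/-! ### A slowly growing weight -/

theorem pd_mul {f g : Plane → ℝ} (hf : ContDiff ℝ ∞ f) (hg : ContDiff ℝ ∞ g) (i : Fin 2) :
    pd i (fun x => f x * g x) = fun x => pd i f x * g x + f x * pd i g x := by
  funext x
  have h1 := (hf.differentiable (by simp) x).hasFDerivAt
  have h2 := (hg.differentiable (by simp) x).hasFDerivAt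
  have h3 : HasFDerivAt (fun x => f x * g x) _ x := h1.mul h2
  rw [pd, h3.fderiv]
  simp [pd]
  ring

theorem pd_ofReal {f : Plane → ℝ} (hf : ContDiff ℝ ∞ f) (i : Fin 2) :
    pd i (fun x => (f x : ℂ)) = fun x => ((pd i f x : ℝ) : ℂ) := by
  funext x
  have h1 := (hf.differentiable (by simp) x).hasFDerivAt
  have h3 : HasFDerivAt (fun x => (f x : ℂ)) _ x := Complex.ofRealCLM.hasFDerivAt.comp x h1
  rw [pd, h3.fderiv]
  rfl

theorem pd_inv {f : Plane → ℝ} (hf : ContDiff ℝ ∞ f) (h0 : ∀ x, f x ≠ 0) (i : Fin 2) :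
    pd i (fun x => (f x)⁻¹) = fun x => (-1 * pd i f x) * ((f x)⁻¹ * (f x)⁻¹) := by
  funext x
  have h1 := (hf.differentiable (by simp) x).hasFDerivAt
  have h2 : HasFDerivAt (fun y => (f y)⁻¹) _ x :=
    (hasDerivAt_inv (h0 x)).comp_hasFDerivAt x h1
  rw [pd, h2.fderiv]
  simp [pd]
  field_simp

/-- The weight `1 + ε² |x|²`. -/
def wt (ε : ℝ) (x : Plane) : ℝ := 1 + ε ^ 2 * (x 0 ^ 2 + x 1 ^ 2)

theorem wt_pos (ε : ℝ) (x : Plane) : 0 < wt ε x := by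
  unfold wt
  positivity

theorem one_le_wt (ε : ℝ) (x : Plane) : 1 ≤ wt ε x := by
  have : 0 ≤ ε ^ 2 * (x 0 ^ 2 + x 1 ^ 2) := by positivity
  unfold wt
  linarith

theorem contDiff_apply' (i : Fin 2) : ContDiff ℝ ∞ fun x : Plane => x i :=
  (EuclideanSpace.proj (𝕜 := ℝ) i : Plane →L[ℝ] ℝ).contDiff

theorem contDiff_wt (ε : ℝ) : ContDiff ℝ ∞ (wt ε) :=
  contDiff_const.add (contDiff_const.mul (((contDiff_apply' 0).pow 2).add
    ((contDiff_apply' 1).pow 2)))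

theorem contDiff_wt_inv (ε : ℝ) : ContDiff ℝ ∞ fun x => (wt ε x)⁻¹ :=
  (contDiff_wt ε).inv fun x => (wt_pos ε x).ne'

theorem pd_apply (i j : Fin 2) : pd i (fun x : Plane => x j) = fun _ => if i = j then (1 : ℝ) else 0 := by
  funext x
  have : HasFDerivAt (fun x : Plane => x j) (EuclideanSpace.proj (𝕜 := ℝ) j : Plane →L[ℝ] ℝ) x :=
    (EuclideanSpace.proj (𝕜 := ℝ) j : Plane →L[ℝ] ℝ).hasFDerivAt
  rw [pd, this.fderiv]
  simp [eq_comm]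

theorem pd_wt (ε : ℝ) (i : Fin 2) : pd i (wt ε) = fun x => 2 * ε ^ 2 * x i := by
  funext x
  have h : ∀ j : Fin 2, HasFDerivAt (fun x : Plane => x j)
      (EuclideanSpace.proj (𝕜 := ℝ) j : Plane →L[ℝ] ℝ) x := fun j =>
    (EuclideanSpace.proj (𝕜 := ℝ) j : Plane →L[ℝ] ℝ).hasFDerivAt
  have h1 := ((((h 0).pow 2).add ((h 1).pow 2)).const_mul (ε ^ 2)).const_add 1
  have h2 : HasFDerivAt (wt ε) _ x := h1
  rw [pd, h2.fderiv]
  fin_cases i <;> simp <;> ring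

theorem pd_pd_wt (ε : ℝ) (i j : Fin 2) :
    pd i (pd j (wt ε)) = fun _ => 2 * ε ^ 2 * if i = j then 1 else 0 := by
  rw [pd_wt, pd_mul contDiff_const (contDiff_apply' j), pd_apply]
  funext x
  simp [pd]

/-- The logarithmic derivative of the weight. -/
def wtLog (ε : ℝ) (i : Fin 2) (x : Plane) : ℝ := 2 * ε ^ 2 * x i * (wt ε x)⁻¹

theorem continuous_wtLog (ε : ℝ) (i : Fin 2) : Continuous (wtLog ε i) :=
  (continuous_const.mul (contDiff_apply' i).continuous).mul (contDiff_wt_inv ε).continuous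

/-- From `2ε|xᵢ| ≤ 1 + ε²|x|²`. The logarithmic derivative is of order `ε`, which makes conjugation
by the weight a small perturbation. -/
theorem abs_wtLog_le {ε : ℝ} (h : 0 < ε) (i : Fin 2) (x : Plane) : |wtLog ε i x| ≤ ε := by
  rw [wtLog, abs_mul, abs_of_pos (inv_pos.2 (wt_pos ε x)), mul_inv_le_iff₀ (wt_pos ε x), wt]
  have h1 : x i ^ 2 ≤ x 0 ^ 2 + x 1 ^ 2 := by
    fin_cases i <;> simp <;> positivity
  rw [abs_mul, abs_of_pos (by positivity : 0 < 2 * ε ^ 2)]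
  have h2 : 0 ≤ (ε * |x i| - 1) ^ 2 := sq_nonneg _
  have h3 : |x i| ^ 2 = x i ^ 2 := sq_abs _
  have h4 : ε ^ 2 * |x i| ^ 2 ≤ ε ^ 2 * (x 0 ^ 2 + x 1 ^ 2) := by rw [h3]; gcongr
  have h5 : 2 * ε * |x i| ≤ 1 + ε ^ 2 * (x 0 ^ 2 + x 1 ^ 2) := by nlinarith
  calc _ = ε * (2 * ε * |x i|) := by ring
    _ ≤ _ := by gcongr

theorem wt_inv_le_one (ε : ℝ) (x : Plane) : (wt ε x)⁻¹ ≤ 1 := inv_le_one_of_one_le₀ (one_le_wt ε x)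

theorem pd_wt_inv (ε : ℝ) (i : Fin 2) (x : Plane) :
    pd i (fun x => (wt ε x)⁻¹) x = -wtLog ε i x * (wt ε x)⁻¹ := by
  rw [pd_inv (contDiff_wt ε) (fun x => (wt_pos ε x).ne'), pd_wt]
  simp only [wtLog]
  ring

theorem pd_pd_wt_inv (ε : ℝ) (i j : Fin 2) (x : Plane) :
    pd i (pd j fun x => (wt ε x)⁻¹) x =
      (-(2 * ε ^ 2 * if i = j then 1 else 0) * (wt ε x)⁻¹ + 2 * wtLog ε i x * wtLog ε j x) *
        (wt ε x)⁻¹ := by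
  have hq := contDiff_wt_inv ε
  rw [pd_inv (contDiff_wt ε) (fun x => (wt_pos ε x).ne'),
    pd_mul (contDiff_const.mul (contDiff_pd (contDiff_wt ε) j)) (hq.mul hq),
    pd_mul hq hq, pd_mul contDiff_const (contDiff_pd (contDiff_wt ε) j), pd_pd_wt]
  simp only [pd_wt_inv, pd_wt]
  split_ifs <;> simp [wtLog, pd] <;> ring

/-- Makes the weighted space invariant under shifts, so that a solution can be compared with its
translates. -/
theorem wt_add_le (ε : ℝ) (x a : Plane) : wt ε (x + a) ≤ 2 * wt ε a * wt ε x := by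
  have h : ∀ s t : ℝ, (s + t) ^ 2 ≤ 2 * (s ^ 2 + t ^ 2) := fun s t => by nlinarith [sq_nonneg (s - t)]
  have e : ∀ i, (x + a) i = x i + a i := fun i => rfl
  have h1 : ε ^ 2 * ((x 0 + a 0) ^ 2 + (x 1 + a 1) ^ 2) ≤
      ε ^ 2 * (2 * (x 0 ^ 2 + a 0 ^ 2) + 2 * (x 1 ^ 2 + a 1 ^ 2)) := by
    gcongr <;> exact h _ _
  have h2 : 0 ≤ (ε ^ 2 * (x 0 ^ 2 + x 1 ^ 2)) * (ε ^ 2 * (a 0 ^ 2 + a 1 ^ 2)) := by positivity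
  simp only [wt, e]
  nlinarith

/-- Functions that are square integrable after division by the weight. -/
def WtL2 (ε : ℝ) (v : Plane → ℂ) : Prop := GlobL2 fun x => (((wt ε x)⁻¹ : ℝ) : ℂ) * v x

theorem isLinClass_wtL2 (ε : ℝ) : IsLinClass (WtL2 ε) where
  zero := by
    simp only [WtL2, Pi.zero_apply, mul_zero]
    exact MemLp.zero
  add {u v} hu hv := by
    have := MemLp.add hu hv
    simp only [WtL2, Pi.add_apply, mul_add]
    exact this
  smul z {u} hu := by
    have := MemLp.const_smul hu z
    refine MemLp.ae_eq (Eventually.of_forall fun x => ?_) this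
    simp only [Pi.smul_apply, smul_eq_mul]
    ring

theorem WtL2.mul_bounded {ε : ℝ} {v : Plane → ℂ} (hv : WtL2 ε v) {m : Plane → ℝ}
    (hm : Continuous m) {C : ℝ} (hC : ∀ x, |m x| ≤ C) :
    GlobL2 fun x => ((m x * (wt ε x)⁻¹ : ℝ) : ℂ) * v x := by
  have := memLp_ofReal_mul hv hm.measurable hC
  refine MemLp.ae_eq (Eventually.of_forall fun x => ?_) this
  simp only
  push_cast
  ring

theorem WtL2.locL2 {ε : ℝ} {v : Plane → ℂ} (hv : WtL2 ε v) : LocL2 v := by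
  have := (GlobL2.locL2 hv).mul_continuous (f := fun x => (wt ε x : ℂ))
    (Complex.continuous_ofReal.comp (contDiff_wt ε).continuous)
  refine this.congr (Eventually.of_forall fun x => ?_)
  have h := (wt_pos ε x).ne'
  have h' : (wt ε x : ℂ) ≠ 0 := by exact_mod_cast h
  simp only
  push_cast
  field_simp

theorem WtL2.comp_add {ε : ℝ} {v : Plane → ℂ} (hv : WtL2 ε v) (a : Plane) :
    WtL2 ε fun x => v (x + a) := by
  have h1 : GlobL2 fun x => (((wt ε (x + a))⁻¹ : ℝ) : ℂ) * v (x + a) :=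
    MemLp.comp_measurePreserving hv (measurePreserving_add_right volume a)
  have hc : Continuous fun x => wt ε (x + a) * (wt ε x)⁻¹ :=
    ((contDiff_wt ε).continuous.comp (continuous_add_const a)).mul (contDiff_wt_inv ε).continuous
  have h2 := memLp_ofReal_mul h1 hc.measurable (C := 2 * wt ε a) fun x => by
    rw [abs_of_pos (mul_pos (wt_pos _ _) (inv_pos.2 (wt_pos _ _))), mul_inv_le_iff₀ (wt_pos ε x)]
    exact wt_add_le ε x a
  refine MemLp.ae_eq (Eventually.of_forall fun x => ?_) h2
  have h' : (wt ε (x + a) : ℂ) ≠ 0 := by exact_mod_cast (wt_pos ε (x + a)).ne'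
  simp only
  push_cast
  field_simp

/-- The first and second derivatives of the weight are bounded by multiples of the weight itself, so
multiplication by it stays in the weighted class; the same holds for its inverse. -/
theorem IsJet.mul_wt {ε : ℝ} (h : 0 < ε) {u d₁ d₂} (hj : IsJet GlobL2 u d₁ d₂) :
    IsJet (WtL2 ε) (fun x => (wt ε x : ℂ) * u x) (mulFirst (fun x => (wt ε x : ℂ)) u d₁)
      (mulSecond (fun x => (wt ε x : ℂ)) u d₁ d₂) := by
  have hne : ∀ x, (wt ε x : ℂ) ≠ 0 := fun x => by exact_mod_cast (wt_pos ε x).ne'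
  have hs : ContDiff ℝ ∞ fun x => (wt ε x : ℂ) := Complex.ofRealCLM.contDiff.comp (contDiff_wt ε)
  refine hj.mul hs (isLinClass_wtL2 ε) (fun v hv => ?_) (fun i v hv => ?_) (fun i j v hv => ?_)
  · refine MemLp.ae_eq (Eventually.of_forall fun x => ?_) hv
    have := hne x
    simp only
    push_cast
    field_simp
  · refine MemLp.ae_eq (Eventually.of_forall fun x => ?_)
      (memLp_ofReal_mul hv (continuous_wtLog ε i).measurable (abs_wtLog_le h i))
    rw [pd_ofReal (contDiff_wt ε), pd_wt]
    simp only [wtLog]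
    push_cast
    ring
  · refine MemLp.ae_eq (Eventually.of_forall fun x => ?_)
      (memLp_ofReal_mul hv (f := fun x => (2 * ε ^ 2 * if i = j then 1 else 0) * (wt ε x)⁻¹)
        (contDiff_const.mul (contDiff_wt_inv ε)).continuous.measurable (C := 2 * ε ^ 2) fun x => ?_)
    · rw [pd_ofReal (contDiff_wt ε), pd_ofReal (contDiff_pd (contDiff_wt ε) j), pd_pd_wt]
      simp only
      push_cast
      ring
    · have h1 := wt_inv_le_one ε x
      have h2 := (inv_pos.2 (wt_pos ε x)).le
      rw [abs_of_nonneg (by positivity)]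
      split_ifs
      · nlinarith [sq_nonneg ε]
      · simp; positivity

theorem IsJet.mul_wt_inv {ε : ℝ} (h : 0 < ε) {u d₁ d₂} (hj : IsJet (WtL2 ε) u d₁ d₂) :
    IsJet GlobL2 (fun x => (((wt ε x)⁻¹ : ℝ) : ℂ) * u x)
      (mulFirst (fun x => (((wt ε x)⁻¹ : ℝ) : ℂ)) u d₁)
      (mulSecond (fun x => (((wt ε x)⁻¹ : ℝ) : ℂ)) u d₁ d₂) := by
  have hs : ContDiff ℝ ∞ fun x => (((wt ε x)⁻¹ : ℝ) : ℂ) :=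
    Complex.ofRealCLM.contDiff.comp (contDiff_wt_inv ε)
  refine hj.mul hs isLinClass_globL2 (fun v hv => hv) (fun i v hv => ?_) (fun i j v hv => ?_)
  · have := hv.mul_bounded (m := fun x => -wtLog ε i x) (continuous_wtLog ε i).neg (C := ε) fun x => by
      rw [abs_neg]
      exact abs_wtLog_le h i x
    rw [pd_ofReal (contDiff_wt_inv ε)]
    simpa only [pd_wt_inv] using this
  · have := hv.mul_bounded (m := fun x => -(2 * ε ^ 2 * if i = j then 1 else 0) * (wt ε x)⁻¹ +
      2 * wtLog ε i x * wtLog ε j x) (C := 4 * ε ^ 2)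
      ((continuous_const.mul (contDiff_wt_inv ε).continuous).add
        ((continuous_const.mul (continuous_wtLog ε i)).mul (continuous_wtLog ε j))) fun x => by
      have h1 := wt_inv_le_one ε x
      have h2 := (inv_pos.2 (wt_pos ε x)).le
      have h3 : |wtLog ε i x * wtLog ε j x| ≤ ε * ε := by
        rw [abs_mul]
        exact mul_le_mul (abs_wtLog_le h i x) (abs_wtLog_le h j x) (abs_nonneg _) h.le
      have h4 : |-(2 * ε ^ 2 * if i = j then 1 else 0) * (wt ε x)⁻¹| ≤ 2 * ε ^ 2 := by
        split_ifs
        · rw [abs_mul, abs_neg, abs_of_nonneg h2, abs_of_nonneg (by positivity)]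
          nlinarith [sq_nonneg ε]
        · simp; positivity
      calc _ ≤ _ := abs_add_le _ _
        _ ≤ 2 * ε ^ 2 + 2 * (ε * ε) := by
          refine add_le_add h4 ?_
          rw [mul_assoc, abs_mul, abs_two]
          gcongr
        _ = _ := by ring
    rw [pd_ofReal (contDiff_wt_inv ε), pd_ofReal (contDiff_pd (contDiff_wt_inv ε) j)]
    simpa only [pd_pd_wt_inv] using this

/-! ### Periodic functions have finite weighted norm -/

/-- On the cell shifted by `n` the weight dominates both `1 + n₁²` and `1 + n₂²`. Using one bound
for each factor of the square gives a product that is summable over the lattice. -/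
theorem inv_wt_sq_le {ε : ℝ} (h : 0 < ε) : ∃ C : ℝ, ∀ n : ℤ × ℤ, ∀ x ∈ ΩH,
    ((wt ε (x + latt n.1 n.2))⁻¹) ^ 2 ≤ C * ((1 + (n.1 : ℝ) ^ 2)⁻¹ * (1 + (n.2 : ℝ) ^ 2)⁻¹) := by
  set L := ‖coord 0‖ ^ 2 + ‖coord 1‖ ^ 2
  set M := 3 + 2 * (L / ε ^ 2) with hM
  have hL : 0 ≤ L := by positivity
  have hM0 : 3 ≤ M := by
    have : 0 ≤ 2 * (L / ε ^ 2) := by positivity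
    linarith
  have key : ∀ (n : ℤ) (s : ℝ) (y : Plane), |s| ≤ 1 → (s + n) ^ 2 ≤ L * ‖y‖ ^ 2 →
      1 + (n : ℝ) ^ 2 ≤ M * wt ε y := by
    intro n s y hs hy
    have h1 : (n : ℝ) ^ 2 ≤ 2 * (s + n) ^ 2 + 2 := by
      have : s ^ 2 ≤ 1 := by rw [← sq_abs]; nlinarith [abs_nonneg s]
      nlinarith [sq_nonneg (2 * s + n)]
    have h2 : ‖y‖ ^ 2 = y 0 ^ 2 + y 1 ^ 2 := by
      rw [EuclideanSpace.norm_sq_eq]; simp [Fin.sum_univ_two]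
    have h3 : wt ε y = 1 + ε ^ 2 * ‖y‖ ^ 2 := by rw [h2, wt]
    have h4 : (L / ε ^ 2) * (ε ^ 2 * ‖y‖ ^ 2) = L * ‖y‖ ^ 2 := by field_simp
    have h5 : 0 ≤ ε ^ 2 * ‖y‖ ^ 2 := by positivity
    have h6 : 0 ≤ L / ε ^ 2 := by positivity
    rw [h3, hM]
    nlinarith
  refine ⟨M * M, fun n x hx => ?_⟩
  have hb : ∀ i, (coord i (x + latt n.1 n.2)) ^ 2 ≤ L * ‖x + latt n.1 n.2‖ ^ 2 := fun i => by
    have h1 := (coord i).le_opNorm (x + latt n.1 n.2)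
    rw [Real.norm_eq_abs] at h1
    rw [← sq_abs]
    calc _ ≤ (‖coord i‖ * ‖x + latt n.1 n.2‖) ^ 2 := by gcongr
      _ = ‖coord i‖ ^ 2 * ‖x + latt n.1 n.2‖ ^ 2 := by ring
      _ ≤ _ := by
        gcongr
        fin_cases i <;> simp [L]
  have h0 := hb 0
  have h1 := hb 1
  rw [map_add, coord_zero_latt] at h0
  rw [map_add, coord_one_latt] at h1
  have k0 := key n.1 _ _ (abs_coord_le_of_mem_ΩH hx 0) h0
  have k1 := key n.2 _ _ (abs_coord_le_of_mem_ΩH hx 1) h1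
  set W := wt ε (x + latt n.1 n.2)
  have hW : 0 < W := wt_pos _ _
  have hp0 : 0 < 1 + (n.1 : ℝ) ^ 2 := by positivity
  have hp1 : 0 < 1 + (n.2 : ℝ) ^ 2 := by positivity
  have h2 := mul_le_mul k0 k1 hp1.le (by positivity)
  rw [← mul_inv, inv_pow, inv_eq_one_div, ← div_eq_mul_inv, div_le_div_iff₀ (by positivity) (by positivity)]
  nlinarith

theorem tsum_int_inv_lt_top : ∑' n : ℤ, ENNReal.ofReal (1 + (n : ℝ) ^ 2)⁻¹ < ⊤ := by
  have hs : Summable fun n : ℤ => (1 + (n : ℝ) ^ 2)⁻¹ := by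
    have h := (Real.summable_one_div_int_pow (p := 2)).2 (by norm_num)
    have h' : Summable fun n : ℤ => if n = 0 then (1 : ℝ) else 0 :=
      summable_of_ne_finset_zero (s := {0}) fun n hn => by simp at hn; simp [hn]
    refine Summable.of_nonneg_of_le (fun n => by positivity) (fun n => ?_) (h.add h')
    by_cases hn : n = 0
    · simp [hn]
    · have : 0 < (n : ℝ) ^ 2 := by positivity
      simp only [hn, if_false, add_zero, one_div]
      gcongr
      linarith
  rw [← ENNReal.ofReal_tsum_of_nonneg (fun n => by positivity) hs]
  exact ENNReal.ofReal_lt_top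

theorem wtL2_perExt {ε : ℝ} (h : 0 < ε) {f : Plane → ℂ} (hf : MemLp f 2 (volume.restrict ΩH)) :
    WtL2 ε (perExt f) := by
  obtain ⟨C, hC⟩ := inv_wt_sq_le h
  have hm := aestronglyMeasurable_perExt hf.1
  have hq : Continuous fun x => (wt ε x)⁻¹ := (contDiff_wt_inv ε).continuous
  refine ⟨(Complex.continuous_ofReal.comp hq).aestronglyMeasurable.mul hm, ?_⟩
  have h1 := lintegral_mul_perExt_le hf.1 (w := fun x => ENNReal.ofReal (((wt ε x)⁻¹) ^ 2))
    (hq.pow 2).measurable.ennreal_ofReal (b := fun n => ENNReal.ofReal C * (ENNReal.ofReal (1 + (n.1 : ℝ) ^ 2)⁻¹ *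
      ENNReal.ofReal (1 + (n.2 : ℝ) ^ 2)⁻¹)) fun n x hx => by
      rw [← ENNReal.ofReal_mul (by positivity), ← ENNReal.ofReal_mul' (by positivity)]
      exact ENNReal.ofReal_le_ofReal (hC n x hx)
  refine (ENNReal.pow_lt_top_iff (n := 2)).1 ?_ |>.resolve_right two_ne_zero
  rw [eLpNorm_two_sq]
  refine lt_of_le_of_lt (le_trans (le_of_eq (lintegral_congr fun x => ?_)) h1) ?_
  · rw [enorm_mul, mul_pow]
    congr 1
    rw [← ofReal_norm, ENNReal.ofReal_pow (inv_pos.2 (wt_pos ε x)).le, Complex.norm_real,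
      Real.norm_of_nonneg (inv_pos.2 (wt_pos ε x)).le]
  · refine ENNReal.mul_lt_top ?_ ?_
    · rw [ENNReal.tsum_mul_left, ENNReal.tsum_prod']
      simp only [ENNReal.tsum_mul_left, ENNReal.tsum_mul_right]
      exact ENNReal.mul_lt_top ENNReal.ofReal_lt_top
        (ENNReal.mul_lt_top tsum_int_inv_lt_top tsum_int_inv_lt_top)
    · rw [← eLpNorm_two_sq]
      exact ENNReal.pow_lt_top hf.2

/-! ### The resolvent on the plane -/

theorem ae_of_univ {f g : Plane → ℂ} (h : f =ᵐ[volume.restrict Set.univ] g) : f =ᵐ[volume] g := by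
  rwa [Measure.restrict_univ] at h

theorem isExt_plane : IsExt (Ω := Set.univ) fun f => (f : Plane → ℂ) where
  add f g := by simpa only [Measure.restrict_univ] using Lp.coeFn_add f g
  smul c f := by simpa only [Measure.restrict_univ] using Lp.coeFn_smul c f
  restr f := EventuallyEq.rfl
  aestronglyMeasurable f := by
    simpa only [Measure.restrict_univ] using Lp.aestronglyMeasurable f
  bound K _ := ⟨1, fun f => by
    rw [ENNReal.coe_one, one_mul, Lp.enorm_def]
    exact eLpNorm_mono_measure _ (Measure.restrict_mono (Set.subset_univ K) le_rfl)⟩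

theorem globL2_coe (f : L2 Set.univ) : GlobL2 f := by
  simpa only [Measure.restrict_univ, GlobL2] using Lp.memLp f

/-- The element of `L²(ℝ²)` given by a square integrable function. -/
def GlobL2.toL2 {u : Plane → ℂ} (hu : GlobL2 u) : L2 Set.univ :=
  MemLp.toLp u (by rw [Measure.restrict_univ]; exact hu)

theorem GlobL2.coe_toL2 {u : Plane → ℂ} (hu : GlobL2 u) : hu.toL2 =ᵐ[volume] u :=
  ae_of_univ (MemLp.coeFn_toLp _)

theorem isJet_plane (p : Jet isExt_plane) : IsJet GlobL2 (jetBase isExt_plane p)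
    (fun i => jetFirst isExt_plane i p) (fun i j => jetSecond isExt_plane i j p) :=
  ⟨globL2_coe _, fun _ => globL2_coe _, fun _ _ => globL2_coe _, p.2.1, p.2.2⟩

theorem exists_jet_plane {u d₁ d₂} (hj : IsJet GlobL2 u d₁ d₂) :
    ∃ p : Jet isExt_plane, jetBase isExt_plane p =ᵐ[volume] u ∧
      (∀ i, jetFirst isExt_plane i p =ᵐ[volume] d₁ i) ∧
      ∀ i j, jetSecond isExt_plane i j p =ᵐ[volume] d₂ i j := by
  refine ⟨mkJet isExt_plane hj.base.toL2 (fun i => (hj.first i).toL2)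
    (fun i j => (hj.second i j).toL2) ?_, hj.base.coe_toL2, fun i => (hj.first i).coe_toL2,
    fun i j => (hj.second i j).coe_toL2⟩
  exact (hj.mono fun _ h => h.locL2).congr hj.base.coe_toL2.symm
    (fun i => (hj.first i).coe_toL2.symm) fun i j => (hj.second i j).coe_toL2.symm

theorem L2_univ_ext {f g : L2 Set.univ} (h : f =ᵐ[volume] g) : f = g :=
  Lp.ext (ae_restrict_of_ae h)

theorem jetOp_plane_ae (H : RealDiffOp) (p : Jet isExt_plane) :
    H.jetOp isExt_plane p =ᵐ[volume] H.onJet (jetBase isExt_plane p)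
      (fun i => jetFirst isExt_plane i p) fun i j => jetSecond isExt_plane i j p := by
  simpa only [Measure.restrict_univ] using H.jetOp_ae isExt_plane p

theorem mem_planeGraph_jet (H : RealDiffOp) (p : Jet isExt_plane) :
    (jetBase isExt_plane p, H.jetOp isExt_plane p) ∈ H.planeGraph :=
  mem_planeGraph (isJet_plane p) EventuallyEq.rfl (ae_restrict_of_ae (jetOp_plane_ae H p))

/-- States the resolvent of the unbounded operator as a bounded bijection of Banach spaces, for
which invertibility is stable under small perturbations. -/
theorem bijective_jetOp_plane {H : RealDiffOp} (hH : IsSelfAdjoint H.planeOp) {z : ℂ}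
    (hz : z.im ≠ 0) : Function.Bijective (H.jetOp isExt_plane - z • jetBase isExt_plane) := by
  constructor
  · rw [injective_iff_map_eq_zero]
    intro p hp
    rw [sub_apply, sub_eq_zero, smul_apply] at hp
    have h1 := mem_planeGraph_jet H p
    rw [hp, ← graph_planeOp] at h1
    refine jetBase_injective isExt_plane ?_
    rw [(symmetricGraph_of_isSelfAdjoint hH).eq_zero hz h1, map_zero]
  · intro y
    obtain ⟨q, hq, hy⟩ := surjectiveAt_of_isSelfAdjoint hH hz y
    rw [graph_planeOp] at hq
    obtain ⟨ψ, g, -, ⟨d₁, d₂, hj, hg⟩, h1, h2⟩ := hq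
    replace h1 := ae_of_univ h1
    replace h2 := ae_of_univ h2
    obtain ⟨p, e0, e1, e2⟩ := exists_jet_plane hj
    refine ⟨p, ?_⟩
    rw [sub_apply, smul_apply, ← hy, L2_univ_ext (e0.trans h1.symm)]
    congr 1
    refine L2_univ_ext ((jetOp_plane_ae H p).trans ?_)
    exact ((H.onJet_congr e0 e1 e2).trans hg.symm).trans h2.symm

/-- The operator `p⁻¹ H p - H` on jets, where `p` is the weight. -/
def RealDiffOp.weightedErr (H : RealDiffOp) (ε : ℝ) : Jet isExt_plane →L[ℂ] L2 Set.univ :=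
  ∑ i, (mulL2 Set.univ fun x => (wtLog ε i x : ℂ)).comp (H.jetGrad isExt_plane i) +
    ∑ i, (mulL2 Set.univ fun x => ((2 * ε ^ 2 * (wt ε x)⁻¹ : ℝ) : ℂ)).comp
      (H.jetLead isExt_plane i i)

/-- The operator `p⁻¹ H p` on jets, where `p` is the weight. -/
def RealDiffOp.weighted (H : RealDiffOp) (ε : ℝ) : Jet isExt_plane →L[ℂ] L2 Set.univ :=
  H.jetOp isExt_plane + H.weightedErr ε

theorem two_sq_wt_inv_le (ε : ℝ) (x : Plane) : |2 * ε ^ 2 * (wt ε x)⁻¹| ≤ 2 * ε ^ 2 := by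
  have h1 := wt_inv_le_one ε x
  have h2 := (inv_pos.2 (wt_pos ε x)).le
  rw [abs_of_nonneg (by positivity)]
  nlinarith [sq_nonneg ε]

/-- Divided by the weight, the commutator of `H` with it involves only the logarithmic derivative
`wtLog` and the second derivatives, which are `2ε²` on the diagonal and zero off it. -/
theorem RealDiffOp.weighted_ae (H : RealDiffOp) {ε : ℝ} (h : 0 < ε) (p : Jet isExt_plane)
    {u : Plane → ℂ} {d₁ d₂} (h0 : jetBase isExt_plane p =ᵐ[volume] u)
    (h1 : ∀ i, jetFirst isExt_plane i p =ᵐ[volume] d₁ i)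
    (h2 : ∀ i j, jetSecond isExt_plane i j p =ᵐ[volume] d₂ i j) :
    ∀ᵐ x, (wt ε x : ℂ) * H.weighted ε p x = H.onJet (fun x => (wt ε x : ℂ) * u x)
      (mulFirst (fun x => (wt ε x : ℂ)) u d₁) (mulSecond (fun x => (wt ε x : ℂ)) u d₁ d₂) x := by
  have e1 := coe_add_ae (H.jetOp_ae isExt_plane p) (coe_add_ae
    (coe_sum_ae Finset.univ fun i => mulL2_ofReal_ae' (continuous_wtLog ε i).measurable
      (abs_wtLog_le h i) (H.jetGrad_ae isExt_plane i p))
    (coe_sum_ae Finset.univ fun i => mulL2_ofReal_ae'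
      ((contDiff_const.mul (contDiff_wt_inv ε)).continuous.measurable) (two_sq_wt_inv_le ε)
      (H.jetLead_ae isExt_plane i i p)))
  have e0 : H.weighted ε p = H.jetOp isExt_plane p +
      (∑ i, mulL2 Set.univ (fun x => (wtLog ε i x : ℂ)) (H.jetGrad isExt_plane i p) +
      ∑ i, mulL2 Set.univ (fun x => ((2 * ε ^ 2 * (wt ε x)⁻¹ : ℝ) : ℂ))
        (H.jetLead isExt_plane i i p)) := by
    simp only [weighted, weightedErr, add_apply, sum_apply, ContinuousLinearMap.comp_apply]
  rw [← e0] at e1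
  have e2 := ae_of_univ e1
  filter_upwards [e2, h0, h1 0, h1 1, h2 0 0, h2 0 1, h2 1 0, h2 1 1] with x hx a0 a1 a2 b1 b2 b3 b4
  have k1 : ∀ i, pd i (fun x => (wt ε x : ℂ)) = fun x => ((2 * ε ^ 2 * x i : ℝ) : ℂ) := fun i => by
    rw [pd_ofReal (contDiff_wt ε), pd_wt]
  have k2 : ∀ i j, pd i (pd j fun x => (wt ε x : ℂ)) =
      fun _ => ((2 * ε ^ 2 * if i = j then 1 else 0 : ℝ) : ℂ) := fun i j => by
    rw [pd_ofReal (contDiff_wt ε), pd_ofReal (contDiff_pd (contDiff_wt ε) j), pd_pd_wt]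
  rw [hx, onJet_mul]
  have hne : (wt ε x : ℂ) ≠ 0 := by exact_mod_cast (wt_pos ε x).ne'
  simp only [onJet, comm, Fin.sum_univ_two, a0, a1, a2, b1, b2, b3, b4,
    k2]
  simp only [k1, wtLog]
  simp
  field_simp
  ring

/-- The multipliers are bounded by `ε` and by `2ε² ≤ 2ε`; the remaining factors do not depend on
`ε`. -/
theorem RealDiffOp.norm_weightedErr_le (H : RealDiffOp) : ∃ C : ℝ, 0 ≤ C ∧ ∀ ε, 0 < ε → ε ≤ 1 →
    ‖H.weightedErr ε‖ ≤ ε * C := by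
  refine ⟨∑ i, ‖H.jetGrad isExt_plane i‖ + ∑ i, 2 * ‖H.jetLead isExt_plane i i‖,
    by positivity, fun ε hε h1 => ?_⟩
  rw [weightedErr, mul_add, Finset.mul_sum, Finset.mul_sum]
  refine (norm_add_le _ _).trans (add_le_add (norm_sum_le_of_le _ fun i _ => ?_)
    (norm_sum_le_of_le _ fun i _ => ?_))
  · refine (ContinuousLinearMap.opNorm_comp_le _ _).trans ?_
    refine mul_le_mul_of_nonneg_right ?_ (norm_nonneg _)
    exact norm_mulL2_le (Complex.measurable_ofReal.comp (continuous_wtLog ε i).measurable) hε.le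
      fun x => by rw [Function.comp, Complex.norm_real]; exact abs_wtLog_le hε i x
  · refine (ContinuousLinearMap.opNorm_comp_le _ _).trans ?_
    rw [← mul_assoc]
    refine mul_le_mul_of_nonneg_right ?_ (norm_nonneg _)
    refine norm_mulL2_le (Complex.measurable_ofReal.comp
      (contDiff_const.mul (contDiff_wt_inv ε)).continuous.measurable) (by positivity) fun x => ?_
    rw [Function.comp, Complex.norm_real, Real.norm_eq_abs]
    refine (two_sq_wt_inv_le ε x).trans ?_
    nlinarith

theorem RealDiffOp.exists_weighted_resolvent {H : RealDiffOp} (hH : IsSelfAdjoint H.planeOp)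
    {z : ℂ} (hz : z.im ≠ 0) :
    ∃ ε > 0, (∀ y, ∃ p, H.weighted ε p = z • jetBase isExt_plane p + y) ∧
      ∀ q, H.weighted ε q = z • jetBase isExt_plane q → q = 0 := by
  obtain ⟨hi, hs⟩ := bijective_jetOp_plane hH hz
  let e := ContinuousLinearEquiv.ofBijective (H.jetOp isExt_plane - z • jetBase isExt_plane)
    (LinearMap.ker_eq_bot.2 hi) (LinearMap.range_eq_top.2 hs)
  have he : (e : Jet isExt_plane →L[ℂ] L2 Set.univ) =
    H.jetOp isExt_plane - z • jetBase isExt_plane := by ext; rfl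
  have hn := ContinuousLinearEquiv.nhds e
  rw [he] at hn
  obtain ⟨δ, hδ, hb⟩ := Metric.mem_nhds_iff.1 hn
  obtain ⟨C, hC, hle⟩ := H.norm_weightedErr_le
  -- The perturbation has norm at most `ε C`, which this choice keeps below `δ`; `C + 1` avoids a
  -- division by zero.
  have hε : 0 < min 1 (δ / (2 * (C + 1))) := by positivity
  refine ⟨min 1 (δ / (2 * (C + 1))), hε, ?_⟩
  specialize hle _ hε (min_le_left _ _)
  have hlt : min 1 (δ / (2 * (C + 1))) * C < δ := by
    have h1 : min 1 (δ / (2 * (C + 1))) ≤ δ / (2 * (C + 1)) := min_le_right _ _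
    have h2 : min 1 (δ / (2 * (C + 1))) * (2 * (C + 1)) ≤ δ := by
      rwa [← le_div_iff₀ (by positivity)]
    nlinarith
  obtain ⟨e', he'⟩ := hb (show (H.jetOp isExt_plane - z • jetBase isExt_plane) +
      H.weightedErr (min 1 (δ / (2 * (C + 1)))) ∈
      Metric.ball _ δ by
    rw [Metric.mem_ball, dist_eq_norm, add_sub_cancel_left]
    exact hle.trans_lt hlt)
  have hap : ∀ q, e' q = H.weighted _ q - z • jetBase isExt_plane q := fun q => by
    have := DFunLike.congr_fun he' q
    simp only [add_apply, sub_apply, smul_apply] at this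
    simp only [weighted, add_apply]
    rw [add_sub_right_comm, ← this]
    rfl
  refine ⟨fun y => ?_, fun q hq => ?_⟩
  · obtain ⟨p, hp⟩ := e'.surjective y
    exact ⟨p, by rw [← hp, hap, add_sub_cancel]⟩
  · refine e'.injective ?_
    rw [hap, hq, sub_self]
    exact (map_zero e').symm

/-! ### Solving the periodic problem -/

theorem IsJet.sub {P : (Plane → ℂ) → Prop} (hP : IsLinClass P) {u d₁ d₂ v e₁ e₂}
    (h : IsJet P u d₁ d₂) (h' : IsJet P v e₁ e₂) :
    IsJet P (u + (-1 : ℂ) • v) (fun i => d₁ i + (-1 : ℂ) • e₁ i)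
      (fun i j => d₂ i j + (-1 : ℂ) • e₂ i j) :=
  ⟨hP.add h.base (hP.smul _ h'.base), fun i => hP.add (h.first i) (hP.smul _ (h'.first i)),
    fun i j => hP.add (h.second i j) (hP.smul _ (h'.second i j)),
    fun i => (h.weak_first i).add ((h'.weak_first i).smul _),
    fun i j => (h.weak_second i j).add ((h'.weak_second i j).smul _)⟩

/-- Put `u = wt · v`. The equation becomes one for the weighted operator acting on `v` in `H²(ℝ²)`,
with right side `perExt f` divided by the weight, which is square integrable. Existence comes from
the surjectivity of the weighted operator, periodicity from its injectivity. -/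
theorem exists_periodic_solution {H : RealDiffOp} (hH : IsSelfAdjoint H.planeOp)
    (hS : H.ShiftInvariant) {z : ℂ} (hz : z.im ≠ 0) {f : Plane → ℂ}
    (hf : MemLp f 2 (volume.restrict ΩH)) :
    ∃ u, IsBloch 0 u ∧ H.Maps LocL2 u (z • u + perExt f) := by
  obtain ⟨ε, hε, hsurj, hinj⟩ := H.exists_weighted_resolvent hH hz
  have hne : ∀ x, (wt ε x : ℂ) ≠ 0 := fun x => by exact_mod_cast (wt_pos ε x).ne'
  obtain ⟨p, hp⟩ := hsurj (GlobL2.toL2 (wtL2_perExt hε hf))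
  have hj := (isJet_plane p).mul_wt hε
  set d₁ := mulFirst (fun x => (wt ε x : ℂ)) (jetBase isExt_plane p)
    (fun i => jetFirst isExt_plane i p)
  set d₂ := mulSecond (fun x => (wt ε x : ℂ)) (jetBase isExt_plane p)
    (fun i => jetFirst isExt_plane i p) (fun i j => jetSecond isExt_plane i j p)
  set u : Plane → ℂ := fun x => (wt ε x : ℂ) * jetBase isExt_plane p x with hu
  have hjl : IsJet LocL2 u d₁ d₂ := hj.mono fun _ h => h.locL2
  have hM : H.Maps LocL2 u (z • u + perExt f) := by
    refine ⟨d₁, d₂, hjl, ?_⟩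
    have e1 := H.weighted_ae hε p EventuallyEq.rfl (fun _ => EventuallyEq.rfl)
      fun _ _ => EventuallyEq.rfl
    have e3 := coe_add_ae (coe_smul_ae z (EventuallyEq.refl (ae (volume.restrict Set.univ))
      (jetBase isExt_plane p : Plane → ℂ)))
      (ae_restrict_of_ae (s := Set.univ) (GlobL2.coe_toL2 (wtL2_perExt hε hf)))
    rw [← hp] at e3
    replace e3 := ae_of_univ e3
    filter_upwards [e1, e3] with x h1 h2
    rw [← h1, h2]
    have := hne x
    simp only [Pi.add_apply, Pi.smul_apply, smul_eq_mul, hu]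
    push_cast
    field_simp
  refine ⟨u, fun n₁ n₂ => ?_, hM⟩
  have hsh := hS n₁ n₂ _ _ hM
  have hjs : IsJet (WtL2 ε) (fun x => u (x + latt n₁ n₂)) (fun i x => d₁ i (x + latt n₁ n₂))
      (fun i j x => d₂ i j (x + latt n₁ n₂)) :=
    ⟨hj.base.comp_add _, fun i => (hj.first i).comp_add _, fun i j => (hj.second i j).comp_add _,
      fun i => (hj.weak_first i).comp_add _, fun i j => (hj.weak_second i j).comp_add _⟩
  have hjd := hjs.sub (isLinClass_wtL2 ε) hj
  -- A translate of `u` solves the same equation in the same weighted class, so the difference,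
  -- divided by the weight, is a null vector of the weighted problem.
  set v : Plane → ℂ := (fun x => u (x + latt n₁ n₂)) + (-1 : ℂ) • u with hv
  have hMd : H.Maps LocL2 v (z • v) := by
    refine (hsh.add isLinClass_locL2 (hM.smul isLinClass_locL2 (-1))).congr
      EventuallyEq.rfl ?_
    filter_upwards [isBloch_perExt f n₁ n₂] with x hx
    rw [phase_zero, one_mul] at hx
    simp only [hv, Pi.add_apply, Pi.smul_apply, Function.comp, hx, smul_eq_mul]
    ring
  have hjq := hjd.mul_wt_inv hε
  obtain ⟨q, q0, q1, q2⟩ := exists_jet_plane hjq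
  have e1 := H.weighted_ae hε q q0 q1 q2
  have hjv := (hjq.mono fun _ h => h.locL2).mul_locL2
    (Complex.ofRealCLM.contDiff.comp (contDiff_wt ε))
  have e2 := hMd.ae_eq_onJet hjv (Eventually.of_forall fun x => by
    have := hne x
    simp only [Complex.ofRealCLM_apply, Function.comp]
    push_cast
    field_simp)
  have e3 : H.weighted ε q = z • jetBase isExt_plane q := by
    refine L2_univ_ext ?_
    have e4 := ae_of_univ (Lp.coeFn_smul z (jetBase isExt_plane q))
    filter_upwards [e1, e2, e4, q0] with x h1 h2 h4 h0
    rw [h4, Pi.smul_apply, h0]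
    refine mul_left_cancel₀ (hne x) (h1.trans (h2.symm.trans ?_))
    have := hne x
    simp only [Pi.smul_apply, smul_eq_mul]
    push_cast
    field_simp
  have e5 : q = 0 := hinj q e3
  rw [e5, map_zero] at q0
  have e6 := ae_of_univ (Lp.coeFn_zero ℂ 2 (volume.restrict (Set.univ : Set Plane)))
  filter_upwards [q0, e6] with x h1 h2
  have h3 := h1.symm.trans h2
  rw [Pi.zero_apply, mul_eq_zero] at h3
  have h4 := h3.resolve_left (by exact_mod_cast inv_ne_zero (wt_pos ε x).ne')
  rw [phase_zero, one_mul]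
  simp only [hv, Pi.add_apply, Pi.smul_apply, smul_eq_mul] at h4
  linear_combination h4

/-! ### Plane waves -/

/-- The linear form with `k₁ s + k₂ t` at `s a₁ + t a₂`. -/
def ell (k : Plane) : Plane →L[ℝ] ℝ := k 0 • coord 0 + k 1 • coord 1

theorem ell_apply (k x : Plane) : ell k x = k 0 * coord 0 x + k 1 * coord 1 x := rfl

/-- The partial derivatives of `ell k`. -/
def kap (k : Plane) (i : Fin 2) : ℝ := ell k (EuclideanSpace.single i 1)

/-- The plane wave with quasimomentum `k`. -/
def gauge (k x : Plane) : ℂ := Complex.exp (Complex.I * (ell k x : ℂ))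

theorem contDiff_gauge (k : Plane) : ContDiff ℝ ∞ (gauge k) :=
  (contDiff_const.mul (Complex.ofRealCLM.contDiff.comp (ell k).contDiff)).cexp

theorem norm_gauge (k x : Plane) : ‖gauge k x‖ = 1 := by
  rw [gauge, mul_comm, Complex.norm_exp_ofReal_mul_I]

theorem conj_gauge (k x : Plane) : starRingEnd ℂ (gauge k x) = gauge (-k) x := by
  rw [gauge, gauge, ← Complex.exp_conj]
  simp [ell_apply]
  ring_nf

theorem gauge_add (k l x : Plane) : gauge (k + l) x = gauge k x * gauge l x := by
  rw [gauge, gauge, gauge, ← Complex.exp_add]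
  simp [ell_apply]
  ring_nf

theorem gauge_zero (x : Plane) : gauge 0 x = 1 := by simp [gauge, ell_apply]

theorem gauge_neg_mul (k x : Plane) : gauge (-k) x * gauge k x = 1 := by
  rw [← gauge_add, neg_add_cancel, gauge_zero]

theorem gauge_ne_zero (k x : Plane) : gauge k x ≠ 0 := Complex.exp_ne_zero _

theorem gauge_add_latt (k x : Plane) (n₁ n₂ : ℤ) :
    gauge k (x + latt n₁ n₂) = phase k n₁ n₂ * gauge k x := by
  rw [gauge, gauge, phase, ← Complex.exp_add]
  congr 1
  simp only [ell_apply, map_add, coord_zero_latt, coord_one_latt]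
  push_cast
  ring

theorem pd_gauge (k : Plane) (i : Fin 2) :
    pd i (gauge k) = fun x => Complex.I * kap k i * gauge k x := by
  funext x
  have h1 : HasFDerivAt (fun x => (ell k x : ℂ)) (Complex.ofRealCLM.comp (ell k)) x :=
    (Complex.ofRealCLM.comp (ell k)).hasFDerivAt
  have h2 : HasFDerivAt (gauge k) _ x := (h1.const_mul Complex.I).cexp
  rw [pd, h2.fderiv]
  simp [kap, gauge]
  ring

theorem pd_pd_gauge (k : Plane) (i j : Fin 2) :
    pd i (pd j (gauge k)) = fun x => -(kap k i * kap k j : ℂ) * gauge k x := by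
  rw [pd_gauge]
  funext x
  have h := ((contDiff_gauge k).differentiable (by simp) x).hasFDerivAt
  have h1 : HasFDerivAt (fun x => Complex.I * kap k j * gauge k x) _ x :=
    h.const_mul (Complex.I * kap k j)
  have h2 : pd i (gauge k) x = _ := congrFun (pd_gauge k i) x
  rw [pd] at h2
  rw [pd, h1.fderiv, smul_apply, h2, smul_eq_mul]
  linear_combination (kap k i * kap k j * gauge k x : ℂ) * Complex.I_mul_I

theorem kap_add (k l : Plane) (i : Fin 2) : kap (k + l) i = kap k i + kap l i := by
  simp [kap, ell_apply]; ring

theorem kap_neg (k : Plane) (i : Fin 2) : kap (-k) i = -kap k i := by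
  simp [kap, ell_apply]; ring

theorem kap_zero (i : Fin 2) : kap 0 i = 0 := by simp [kap, ell_apply]

theorem ell_eq_sum (k x : Plane) : ell k x = ∑ i, kap k i * x i := by
  have : x = ∑ i, x i • EuclideanSpace.single i (1 : ℝ) := by
    ext j
    fin_cases j <;> simp [Fin.sum_univ_two]
  conv_lhs => rw [this]
  rw [map_sum]
  refine Finset.sum_congr rfl fun i _ => ?_
  rw [map_smul, smul_eq_mul, kap, mul_comm]

/-- The components of `k` are the values of `ell k` at `a₁` and `a₂`, whose entries are at most `1`
in modulus. So a large wave vector has a large gradient, which is what compactness needs. -/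
theorem abs_apply_le_sum_kap (k : Plane) (i : Fin 2) : |k i| ≤ |kap k 0| + |kap k 1| := by
  have h3 : √3 / 2 ≤ 1 := by
    have : √3 ≤ 2 := (Real.sqrt_le_left (by norm_num)).2 (by norm_num)
    linarith
  have h0 : 0 ≤ √3 / 2 := by positivity
  have e1 : k 0 = kap k 0 * (√3 / 2) + kap k 1 * (1 / 2) := by
    have := ell_eq_sum k a₁
    rw [ell_apply, coord_a₁.1, coord_a₁.2] at this
    simpa [Fin.sum_univ_two, a₁] using this
  have e2 : k 1 = kap k 0 * (√3 / 2) + kap k 1 * (-(1 / 2)) := by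
    have := ell_eq_sum k a₂
    rw [ell_apply, coord_a₂.1, coord_a₂.2] at this
    simpa [Fin.sum_univ_two, a₂] using this
  have key : ∀ c : ℝ, |c| ≤ 1 → |kap k 0 * (√3 / 2) + kap k 1 * c| ≤ |kap k 0| + |kap k 1| := by
    intro c hc
    refine (abs_add_le _ _).trans ?_
    rw [abs_mul, abs_mul, abs_of_nonneg h0]
    exact add_le_add (mul_le_of_le_one_right (abs_nonneg _) h3)
      (mul_le_of_le_one_right (abs_nonneg _) hc)
  fin_cases i
  · simp only [Fin.zero_eta]
    rw [e1]
    exact key _ (by norm_num)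
  · simp only [Fin.mk_one]
    rw [e2]
    exact key _ (by rw [abs_neg]; norm_num)

theorem abs_kap_le (k : Plane) (i : Fin 2) : |kap k i| ≤ (‖coord 0‖ + ‖coord 1‖) * ‖k‖ := by
  have h : ∀ j : Fin 2, |coord j (EuclideanSpace.single i 1)| ≤ ‖coord j‖ := fun j => by
    have := (coord j).le_opNorm (EuclideanSpace.single i 1)
    simpa using this
  have hk : ∀ j : Fin 2, |k j| ≤ ‖k‖ := fun j => by
    simpa using PiLp.norm_apply_le k j
  rw [kap, ell_apply]
  refine (abs_add_le _ _).trans ?_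
  rw [abs_mul, abs_mul, add_mul, mul_comm ‖coord 0‖, mul_comm ‖coord 1‖]
  exact add_le_add (mul_le_mul (hk 0) (h 0) (abs_nonneg _) (norm_nonneg _))
    (mul_le_mul (hk 1) (h 1) (abs_nonneg _) (norm_nonneg _))

/-! ### Integration by parts over a period -/

theorem IsBloch.mul {k l : Plane} {u v : Plane → ℂ} (hu : IsBloch k u) (hv : IsBloch l v) :
    IsBloch (k + l) fun x => u x * v x := fun n₁ n₂ => by
  filter_upwards [hu n₁ n₂, hv n₁ n₂] with x h1 h2
  have : phase (k + l) n₁ n₂ = phase k n₁ n₂ * phase l n₁ n₂ := by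
    rw [phase, phase, phase, ← Complex.exp_add]
    simp
    ring_nf
  rw [h1, h2, this]
  ring

theorem isBloch_gauge (k : Plane) : IsBloch k (gauge k) := fun n₁ n₂ =>
  Eventually.of_forall fun x => gauge_add_latt k x n₁ n₂

theorem IsBloch.congr {k : Plane} {u v : Plane → ℂ} (hu : IsBloch k u) (h : u =ᵐ[volume] v) :
    IsBloch k v := fun n₁ n₂ => by
  filter_upwards [hu n₁ n₂, h, (measurePreserving_add_right (volume : Measure Plane)
    (latt n₁ n₂)).quasiMeasurePreserving.ae h] with x h1 h2 h3
  rw [← h2, ← h3, h1]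

theorem sum_pd_plat (N : ℕ) (i : Fin 2) (x : Plane) :
    ∑ n ∈ box N, pd i (plat 0) (x + latt n.1 n.2) = pd i (plat N) x := by
  have h : plat N = fun x => ∑ n ∈ box N, plat 0 (x + latt n.1 n.2) := by
    funext x
    rw [sum_plat]
  have hd : ∀ n : ℤ × ℤ, HasFDerivAt (fun x => plat 0 (x + latt n.1 n.2))
      (fderiv ℝ (plat 0) (x + latt n.1 n.2)) x := fun n =>
    (hasFDerivAt_comp_add_right (latt n.1 n.2)).2
      ((contDiff_plat 0).differentiable (by simp) _).hasFDerivAt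
  have hs : HasFDerivAt (plat N) (∑ n ∈ box N, fderiv ℝ (plat 0) (x + latt n.1 n.2)) x := by
    rw [h]
    exact HasFDerivAt.fun_sum fun n _ => hd n
  rw [pd, hs.fderiv]
  simp [pd]

/-- The shifted derivatives add up to the derivative of a function that is constant near the
hexagon. -/
theorem integral_pd_plat_mul {F : Plane → ℂ} (hF : LocallyIntegrable F volume) (hper : IsBloch 0 F)
    (i : Fin 2) : ∫ x, pd i (plat 0) x * F x = 0 := by
  have hc := (contDiff_pd (contDiff_plat 0) i).continuous
  have hint : Integrable (fun x => pd i (plat 0) x * F x) volume := by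
    have := hF.integrable_smul_left_of_hasCompactSupport hc
      (hasCompactSupport_pd (hasCompactSupport_plat 0) i)
    simpa using this
  have hFΩ : IntegrableOn F ΩH volume := hF.integrableOn_isCompact isCompact_ΩH
  rw [integral_eq_sum_box hint (N := 1)]
  · have h1 : ∀ n : ℤ × ℤ, ∫ x in ΩH, pd i (plat 0) (x + latt n.1 n.2) * F (x + latt n.1 n.2) =
        ∫ x in ΩH, pd i (plat 0) (x + latt n.1 n.2) * F x := by
      intro n
      refine integral_congr_ae (ae_restrict_of_ae ?_)
      filter_upwards [hper n.1 n.2] with x hx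
      rw [hx, phase_zero, one_mul]
    simp only [h1]
    rw [← integral_finsetSum]
    · refine setIntegral_eq_zero_of_forall_eq_zero fun x hx => ?_
      rw [← Finset.sum_mul, sum_pd_plat, (pd_eq_zero_of_eventually
        (eventually_plat_eq_one fun j => ?_) i).self_of_nhds, zero_mul]
      refine (abs_coord_le_of_mem_ΩH hx j).trans_lt ?_
      norm_num
    · intro n _
      exact hFΩ.continuousOn_mul (hc.comp (continuous_add_const _)).continuousOn isCompact_ΩH
  · refine Eventually.of_forall fun x hx => ?_
    obtain ⟨j, hj⟩ := hx
    rw [(pd_eq_zero_of_eventually (eventually_plat_eq_zero (i := j) ?_) i).self_of_nhds, zero_mul]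
    push_cast at hj ⊢
    linarith

/-- Testing with `plat 0` replaces integration over the cell, so no boundary terms have to be
matched. -/
theorem HasWeakPartial.integral_cell_eq_zero {i : Fin 2} {F G : Plane → ℂ}
    (h : HasWeakPartial i F G) (hF : IsBloch 0 F) (hG : IsBloch 0 G) : ∫ x in ΩH, G x = 0 := by
  have hr : ContDiff ℝ ∞ fun x => (plat 0 x).re := Complex.reCLM.contDiff.comp (contDiff_plat 0)
  have hcs : HasCompactSupport fun x => (plat 0 x).re :=
    (hasCompactSupport_plat 0).comp_left (g := Complex.re) Complex.zero_re
  have h1 := h.2.2 _ hr hcs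
  have hre : ∀ x, ((plat 0 x).re : ℂ) = plat 0 x := fun x => Complex.conj_eq_iff_re.1 (conj_plat 0 x)
  have e1 : ∫ x, fderiv ℝ (fun x => (plat 0 x).re) x (EuclideanSpace.single i 1) • F x =
      ∫ x, pd i (plat 0) x * F x := by
    refine integral_congr_ae (Eventually.of_forall fun x => ?_)
    have h2 := pd_ofReal hr i
    simp only [hre] at h2
    have h3 := congrFun h2 x
    simp only at h3 ⊢
    rw [show pd i (plat 0) x = _ from h3, Complex.real_smul]
    rfl
  have e2 : ∫ x, (plat 0 x).re • G x = ∫ x in ΩH, G x := by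
    rw [← integral_plat_mul h.2.1 hG]
    refine integral_congr_ae (Eventually.of_forall fun x => ?_)
    simp only [Complex.real_smul, hre]
  rw [e1, e2, integral_pd_plat_mul h.1 hF] at h1
  exact neg_eq_zero.1 h1.symm

theorem hasWeakPartial_one (i : Fin 2) : HasWeakPartial i (fun _ => 1) (fun _ => 0) := by
  refine ⟨locallyIntegrable_const _, locallyIntegrable_const _, fun φ hφ hc => ?_⟩
  have h1 : Integrable φ volume := hφ.continuous.integrable_of_hasCompactSupport hc
  have h2 : Integrable (fun x => fderiv ℝ φ x (EuclideanSpace.single i 1)) volume :=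
    (contDiff_pd hφ i).continuous.integrable_of_hasCompactSupport (hasCompactSupport_pd hc i)
  have h3 := integral_mul_fderiv_eq_neg_fderiv_mul_of_integrable (𝕜 := ℝ)
    (f := fun _ : Plane => (1 : ℝ)) (g := φ) (v := EuclideanSpace.single i 1) (μ := volume)
    (by simp) (by simpa using h2) (by simpa using h1) (by fun_prop)
    fun x _ => hφ.differentiable (by simp) x
  simp only [one_mul] at h3
  have h4 : ∫ x, fderiv ℝ φ x (EuclideanSpace.single i 1) = 0 := by
    rw [h3]; simp
  have h5 : ∫ x, (fderiv ℝ φ x (EuclideanSpace.single i 1)) • (1 : ℂ) =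
      ((∫ x, fderiv ℝ φ x (EuclideanSpace.single i 1) : ℝ) : ℂ) := by
    rw [integral_smul_const, Complex.real_smul, mul_one]
  rw [h5, h4]
  simp

/-- The Fourier coefficients of a derivative. -/
theorem HasWeakPartial.integral_gauge_mul {i : Fin 2} {u v : Plane → ℂ} (h : HasWeakPartial i u v)
    (hu : IsBloch 0 u) (hv : IsBloch 0 v) {k : Plane} (hk : IsBloch 0 (gauge k)) :
    ∫ x in ΩH, gauge k x * v x = -(Complex.I * kap k i) * ∫ x in ΩH, gauge k x * u x := by
  have h1 := h.mul (contDiff_gauge k)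
  have hb1 : IsBloch 0 fun x => gauge k x * u x := by simpa using hk.mul hu
  have hb2 : IsBloch 0 fun x => gauge k x * v x := by simpa using hk.mul hv
  have hcomp : ∀ w : Plane → ℂ, LocallyIntegrable w volume →
      IntegrableOn (fun x => gauge k x * w x) ΩH volume := fun w hw =>
    (hw.integrableOn_isCompact isCompact_ΩH).continuousOn_mul
      (contDiff_gauge k).continuous.continuousOn isCompact_ΩH
  simp only [pd_gauge] at h1
  have h2 := h1.integral_cell_eq_zero hb1 (by
    have := hb2.add (hb1.smul (Complex.I * kap k i))
    refine this.congr (Eventually.of_forall fun x => ?_)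
    simp only [Pi.add_apply, Pi.smul_apply, smul_eq_mul]
    ring)
  simp only [mul_assoc (Complex.I * (kap k i : ℂ))] at h2
  rw [integral_add (hcomp v h.2.1) ((hcomp u h.1).const_mul _), integral_const_mul] at h2
  linear_combination h2

/-! ### A compactness criterion -/

theorem hasSum_norm_inner_sq {I Y : Type*} [NormedAddCommGroup Y] [InnerProductSpace ℂ Y]
    (b : HilbertBasis I ℂ Y) (y : Y) : HasSum (fun n => ‖⟪b n, y⟫_ℂ‖ ^ 2) (‖y‖ ^ 2) := by
  have h := (Complex.reCLM).hasSum (b.hasSum_inner_mul_inner y y)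
  convert! h using 1
  · funext n
    rw [Complex.reCLM_apply, ← inner_conj_symm y, mul_comm, Complex.mul_conj,
      Complex.normSq_eq_norm_sq, Complex.ofReal_re]
  · rw [Complex.reCLM_apply, inner_self_eq_norm_sq_to_K]
    norm_cast

/-- By Parseval `N²` times the squared norm of the tail is at most `2(‖v‖² + ‖w‖²)`. -/
theorem norm_sub_sum_inner_le {I Y : Type*} [NormedAddCommGroup Y] [InnerProductSpace ℂ Y]
    (b : HilbertBasis I ℂ Y) (s : Finset I) {y v w : Y} {N : ℝ} (hN : 0 < N)
    (h : ∀ n ∉ s, N * ‖⟪b n, y⟫_ℂ‖ ≤ ‖⟪b n, v⟫_ℂ‖ + ‖⟪b n, w⟫_ℂ‖) :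
    ‖y - ∑ n ∈ s, ⟪b n, y⟫_ℂ • b n‖ ≤ 2 / N * (‖v‖ + ‖w‖) := by
  classical
  set r := y - ∑ n ∈ s, ⟪b n, y⟫_ℂ • b n
  have hr : ∀ n, ⟪b n, r⟫_ℂ = if n ∈ s then 0 else ⟪b n, y⟫_ℂ := by
    intro n
    simp only [r, inner_sub_right, inner_sum, inner_smul_right,
      orthonormal_iff_ite.1 b.orthonormal n]
    split_ifs with hn <;> simp [hn]
  have h1 := (hasSum_norm_inner_sq b r).mul_left (N ^ 2)
  have h2 := ((hasSum_norm_inner_sq b v).add (hasSum_norm_inner_sq b w)).mul_left 2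
  have h3 := hasSum_le (fun n => ?_) h1 h2
  · have h4 : (N * ‖r‖) ^ 2 ≤ (2 * (‖v‖ + ‖w‖)) ^ 2 := by
      nlinarith [norm_nonneg v, norm_nonneg w, mul_nonneg (norm_nonneg v) (norm_nonneg w)]
    have h5 := (pow_le_pow_iff_left₀ (by positivity) (by positivity) two_ne_zero).1 h4
    rw [div_mul_eq_mul_div, le_div_iff₀ hN]
    linarith
  · simp only [hr]
    split_ifs with hn
    · rw [norm_zero, zero_pow two_ne_zero, mul_zero]
      positivity
    · have h4 := h n hn
      have h5 : (N * ‖⟪b n, y⟫_ℂ‖) ^ 2 ≤ (‖⟪b n, v⟫_ℂ‖ + ‖⟪b n, w⟫_ℂ‖) ^ 2 := by gcongr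
      nlinarith [sq_nonneg (‖⟪b n, v⟫_ℂ‖ - ‖⟪b n, w⟫_ℂ‖)]

/-- If the Fourier coefficients of `ι u` decay compared to those of `D₀ u` and `D₁ u`, then `ι` is
compact. -/
theorem isCompactOperator_of_fourier_decay {I X Y : Type*} [NormedAddCommGroup X] [NormedSpace ℂ X]
    [NormedAddCommGroup Y] [InnerProductSpace ℂ Y] [CompleteSpace Y] (b : HilbertBasis I ℂ Y)
    {ι D₀ D₁ : X →L[ℂ] Y} (s : ℕ → Finset I)
    (h : ∀ (N : ℕ) u, ∀ n ∉ s N, (N + 1) * ‖⟪b n, ι u⟫_ℂ‖ ≤ ‖⟪b n, D₀ u⟫_ℂ‖ + ‖⟪b n, D₁ u⟫_ℂ‖) :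
    IsCompactOperator ι := by
  -- The Fourier truncations have finite rank and converge to `ι` in norm, with error at most
  -- `2(‖D₀‖ + ‖D₁‖)/(N + 1)`.
  let F : ℕ → X →L[ℂ] Y := fun N => ∑ n ∈ s N, ((innerSL ℂ (b n)).comp ι).smulRight (b n)
  have hF : ∀ N, IsCompactOperator (F N) := fun N => by
    have hsum : ∀ t : Finset I, IsCompactOperator
        (∑ n ∈ t, ((innerSL ℂ (b n)).comp ι).smulRight (b n) : X →L[ℂ] Y) := by
      classical
      intro t
      induction t using Finset.induction_on with
      | empty => simpa using isCompactOperator_zero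
      | insert a t ha ih =>
        rw [Finset.sum_insert ha]
        refine IsCompactOperator.add ?_ ih
        have : (((innerSL ℂ (b a)).comp ι).smulRight (b a) : X →L[ℂ] Y) =
            ((ContinuousLinearMap.id ℂ ℂ).smulRight (b a)).comp ((innerSL ℂ (b a)).comp ι) := by
          ext; rfl
        rw [this]
        have hid : IsCompactOperator (ContinuousLinearMap.id ℂ ℂ) :=
          isCompactOperator_id_iff_locallyCompactSpace.2 inferInstance
        exact (hid.comp_clm ((innerSL ℂ (b a)).comp ι)).clm_comp
          ((ContinuousLinearMap.id ℂ ℂ).smulRight (b a))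
    exact hsum _
  refine isCompactOperator_of_tendsto (F := F) (l := atTop) ?_ (Eventually.of_forall hF)
  rw [tendsto_iff_norm_sub_tendsto_zero]
  refine squeeze_zero (g := fun N : ℕ => 2 * (‖D₀‖ + ‖D₁‖) * (1 / ((N : ℝ) + 1)))
    (fun _ => norm_nonneg _) (fun N => ?_) ?_
  · refine ContinuousLinearMap.opNorm_le_bound _ (by positivity) fun u => ?_
    rw [sub_apply]
    have h1 : F N u = ∑ n ∈ s N, ⟪b n, ι u⟫_ℂ • b n := by
      simp only [F, sum_apply]
      rfl
    rw [norm_sub_rev, h1]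
    refine (norm_sub_sum_inner_le b (s N) (by positivity) (h N u)).trans ?_
    have h2 := D₀.le_opNorm u
    have h3 := D₁.le_opNorm u
    calc _ ≤ 2 / ((N : ℝ) + 1) * (‖D₀‖ * ‖u‖ + ‖D₁‖ * ‖u‖) := by gcongr
      _ = _ := by ring
  · have := (tendsto_one_div_add_atTop_nhds_zero_nat (𝕜 := ℝ)).const_mul (2 * (‖D₀‖ + ‖D₁‖))
    simpa using this

/-! ### Fourier series on the hexagon -/

/-- The dual lattice. -/
def waveVec (n : ℤ × ℤ) : Plane := !₂[2 * Real.pi * n.1, 2 * Real.pi * n.2]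

theorem isBloch_wave (n : ℤ × ℤ) : IsBloch 0 (gauge (waveVec n)) := fun m₁ m₂ => by
  refine Eventually.of_forall fun x => ?_
  rw [gauge_add_latt, phase_zero]
  congr 1
  rw [phase, Complex.exp_eq_one_iff]
  refine ⟨m₁ * n.1 + m₂ * n.2, ?_⟩
  simp [waveVec]
  ring

theorem waveVec_sub (m n : ℤ × ℤ) : waveVec (n - m) = -waveVec m + waveVec n := by
  ext i
  fin_cases i <;> simp [waveVec] <;> ring

/-- Integrating by parts against the constant `1` gives `kapᵢ` times the integral equal to zero, and
for `n ≠ 0` some `kapᵢ` is not zero. -/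
theorem integral_wave_eq_zero {n : ℤ × ℤ} (hn : n ≠ 0) : ∫ x in ΩH, gauge (waveVec n) x = 0 := by
  have h : ∀ i, (kap (waveVec n) i : ℂ) * ∫ x in ΩH, gauge (waveVec n) x = 0 := fun i => by
    have := (hasWeakPartial_one i).integral_gauge_mul (fun _ _ => by simp [phase_zero])
      (fun _ _ => by simp) (isBloch_wave n)
    simp only [mul_zero, mul_one, integral_zero] at this
    have h2 : (-(Complex.I * (kap (waveVec n) i : ℂ))) * ∫ x in ΩH, gauge (waveVec n) x =
      -Complex.I * ((kap (waveVec n) i : ℂ) * ∫ x in ΩH, gauge (waveVec n) x) := by ring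
    rw [h2] at this
    exact (mul_eq_zero.1 this.symm).resolve_left (by simp)
  by_contra h0
  have hk : ∀ i, kap (waveVec n) i = 0 := fun i => by
    exact_mod_cast (mul_eq_zero.1 (h i)).resolve_right h0
  refine hn (Prod.ext ?_ ?_)
  · have := abs_apply_le_sum_kap (waveVec n) 0
    rw [hk, hk, abs_zero, add_zero, abs_nonpos_iff] at this
    simpa [waveVec, Real.pi_ne_zero] using this
  · have := abs_apply_le_sum_kap (waveVec n) 1
    rw [hk, hk, abs_zero, add_zero, abs_nonpos_iff] at this
    simpa [waveVec, Real.pi_ne_zero] using this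

theorem volume_ΩH_ne_zero : volume ΩH ≠ 0 := by
  intro h
  have h1 : (volume : Measure Plane) = 0 := by
    rw [tiles_ΩH.volume_eq_sum, Measure.restrict_eq_zero.2 h]
    simp
  exact (NeZero.ne (volume : Measure Plane)) h1

theorem memLp_gauge (k : Plane) : MemLp (gauge k) 2 (volume.restrict ΩH) := by
  have : IsFiniteMeasure (volume.restrict ΩH) := ⟨by
    rw [Measure.restrict_apply_univ]; exact isCompact_ΩH.measure_lt_top⟩
  exact MemLp.of_bound (contDiff_gauge k).continuous.aestronglyMeasurable 1
    (Eventually.of_forall fun x => (norm_gauge k x).le)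

theorem inner_toLp_left {Ω : Set Plane} {u : Plane → ℂ} (hu : MemLp u 2 (volume.restrict Ω))
    (f : L2 Ω) : ⟪hu.toLp u, f⟫_ℂ = ∫ x in Ω, starRingEnd ℂ (u x) * f x := by
  rw [L2.inner_def]
  refine integral_congr_ae ?_
  filter_upwards [hu.coeFn_toLp] with x hx
  rw [hx]
  simp [mul_comm]

/-- The normalized plane waves. -/
def waveL2 (n : ℤ × ℤ) : L2 ΩH :=
  ((√(volume.real ΩH))⁻¹ : ℂ) • (memLp_gauge (waveVec n)).toLp _

theorem volume_real_ΩH_pos : 0 < volume.real ΩH :=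
  ENNReal.toReal_pos volume_ΩH_ne_zero isCompact_ΩH.measure_ne_top

theorem inner_waveL2 (n : ℤ × ℤ) (f : L2 ΩH) : ⟪waveL2 n, f⟫_ℂ =
    ((√(volume.real ΩH))⁻¹ : ℂ) * ∫ x in ΩH, gauge (-waveVec n) x * f x := by
  rw [waveL2, inner_smul_left, inner_toLp_left]
  simp only [conj_gauge]
  simp

theorem orthonormal_waveL2 : Orthonormal ℂ waveL2 := by
  rw [orthonormal_iff_ite]
  intro m n
  have hV := volume_real_ΩH_pos
  rw [inner_waveL2]
  have h1 : ∫ x in ΩH, gauge (-waveVec m) x * waveL2 n x =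
      ((√(volume.real ΩH))⁻¹ : ℂ) * ∫ x in ΩH, gauge (waveVec (n - m)) x := by
    rw [← integral_const_mul]
    refine integral_congr_ae ?_
    filter_upwards [coe_smul_ae ((√(volume.real ΩH))⁻¹ : ℂ) (memLp_gauge (waveVec n)).coeFn_toLp]
      with x hx
    rw [waveVec_sub, gauge_add, waveL2, hx]
    ring
  rw [h1]
  split_ifs with h
  · have h2 : ∀ x, gauge (waveVec (n - m)) x = 1 := fun x => by
      rw [h, waveVec_sub, neg_add_cancel, gauge_zero]
    simp only [h2]
    rw [setIntegral_const, Complex.real_smul, mul_one, ← mul_assoc, ← mul_inv, ← Complex.ofReal_mul,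
      Real.mul_self_sqrt hV.le]
    exact inv_mul_cancel₀ (by exact_mod_cast hV.ne')
  · rw [integral_wave_eq_zero (sub_ne_zero.2 (Ne.symm h)), mul_zero, mul_zero]

/-- The projection of the plane onto the torus. -/
def toTorus (x : Plane) : UnitAddTorus (Fin 2) := fun i => (coord i x : UnitAddCircle)

theorem continuous_toTorus : Continuous toTorus :=
  continuous_pi fun i => (AddCircle.continuous_mk' 1).comp (coord i).continuous

theorem mFourier_toTorus (n : Fin 2 → ℤ) (x : Plane) :
    UnitAddTorus.mFourier n (toTorus x) = gauge (waveVec (n 0, n 1)) x := by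
  simp only [UnitAddTorus.mFourier, ContinuousMap.coe_mk, toTorus, Fin.prod_univ_two,
    fourier_coe_apply, gauge, ← Complex.exp_add]
  congr 1
  simp [ell_apply, waveVec]
  ring

/-- Passing to the torus makes the density of the trigonometric polynomials available. -/
theorem exists_torus_lift {g : Plane → ℂ} (hg : Continuous g)
    (hper : ∀ (n₁ n₂ : ℤ) x, g (x + latt n₁ n₂) = g x) :
    ∃ G : C(UnitAddTorus (Fin 2), ℂ), ∀ x, G (toTorus x) = g x := by
  let q : (Fin 2 → ℝ) → UnitAddTorus (Fin 2) := Pi.map fun _ s => (s : UnitAddCircle)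
  have hq : IsOpenQuotientMap q := IsOpenQuotientMap.piMap fun _ =>
    QuotientAddGroup.isOpenQuotientMap_mk
  let g' : C(Fin 2 → ℝ, ℂ) := ⟨fun s => g (s 0 • a₁ + s 1 • a₂), hg.comp (by fun_prop)⟩
  have hf : Function.FactorsThrough g' q := by
    intro s t hst
    have h : ∀ i, ∃ n : ℤ, s i - t i = n := fun i => by
      have h1 : ((s i - t i : ℝ) : UnitAddCircle) = 0 := by
        rw [AddCircle.coe_sub, sub_eq_zero]
        exact congrFun hst i
      obtain ⟨n, hn⟩ := (AddCircle.coe_eq_zero_iff _).1 h1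
      exact ⟨n, by rw [← hn]; simp⟩
    obtain ⟨n₁, h1⟩ := h 0
    obtain ⟨n₂, h2⟩ := h 1
    have : s 0 • a₁ + s 1 • a₂ = (t 0 • a₁ + t 1 • a₂) + latt n₁ n₂ := by
      rw [latt, ← h1, ← h2]
      module
    simp only [g', ContinuousMap.coe_mk, this, hper]
  let Q : C(Fin 2 → ℝ, UnitAddTorus (Fin 2)) := ⟨q, hq.continuous⟩
  have hQ : IsQuotientMap Q := hq.isQuotientMap
  refine ⟨hQ.lift g' hf, fun x => ?_⟩
  have h1 : toTorus x = Q fun i => coord i x := rfl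
  rw [h1]
  have h2 := DFunLike.congr_fun (hQ.lift_comp g' hf) fun i => coord i x
  rw [ContinuousMap.comp_apply] at h2
  rw [h2]
  simp only [g', ContinuousMap.coe_mk]
  rw [← eq_comb]

/-- The functional is continuous for the supremum norm and vanishes on the Fourier monomials, whose
span is dense. -/
theorem integral_torus_mul_eq_zero {f : Plane → ℂ} (hf : IntegrableOn f ΩH volume)
    (h : ∀ n, ∫ x in ΩH, gauge (waveVec n) x * f x = 0) (G : C(UnitAddTorus (Fin 2), ℂ)) :
    ∫ x in ΩH, G (toTorus x) * f x = 0 := by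
  have hint : ∀ G : C(UnitAddTorus (Fin 2), ℂ),
      IntegrableOn (fun x => G (toTorus x) * f x) ΩH volume := fun G =>
    hf.continuousOn_mul (G.continuous.comp continuous_toTorus).continuousOn isCompact_ΩH
  let T : C(UnitAddTorus (Fin 2), ℂ) →ₗ[ℂ] ℂ :=
    { toFun := fun G => ∫ x in ΩH, G (toTorus x) * f x
      map_add' := fun G G' => by
        rw [← integral_add (hint G) (hint G')]
        simp only [ContinuousMap.add_apply, add_mul]
      map_smul' := fun c G => by
        rw [RingHom.id_apply, smul_eq_mul, ← integral_const_mul]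
        simp only [ContinuousMap.smul_apply, smul_eq_mul, mul_assoc] }
  let T' : C(UnitAddTorus (Fin 2), ℂ) →L[ℂ] ℂ := T.mkContinuous (∫ x in ΩH, ‖f x‖) fun G => by
    rw [mul_comm, ← integral_const_mul]
    refine norm_integral_le_of_norm_le (hf.norm.const_mul _) (Eventually.of_forall fun x => ?_)
    rw [norm_mul]
    exact mul_le_mul_of_nonneg_right (G.norm_coe_le_norm _) (norm_nonneg _)
  have hker : (⊤ : Submodule ℂ C(UnitAddTorus (Fin 2), ℂ)) ≤ LinearMap.ker T'.toLinearMap := by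
    rw [← UnitAddTorus.span_mFourier_closure_eq_top]
    refine Submodule.topologicalClosure_minimal _ (Submodule.span_le.2 ?_) T'.isClosed_ker
    rintro _ ⟨n, rfl⟩
    change ∫ x in ΩH, UnitAddTorus.mFourier n (toTorus x) * f x = 0
    simp only [mFourier_toTorus]
    exact h _
  exact hker (Submodule.mem_top (x := G))

/-- The sum of the shifts of a function. -/
def periodize (φ : Plane → ℂ) (x : Plane) : ℂ := ∑ᶠ n : ℤ × ℤ, φ (x + latt n.1 n.2)

theorem periodize_add_latt (φ : Plane → ℂ) (n₁ n₂ : ℤ) (x : Plane) :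
    periodize φ (x + latt n₁ n₂) = periodize φ x := by
  refine (finsum_congr fun n => ?_).trans (finsum_comp_equiv (Equiv.addLeft ((n₁, n₂) : ℤ × ℤ))
    (f := fun n => φ (x + latt n.1 n.2)))
  simp only [Equiv.coe_addLeft, Prod.fst_add, Prod.snd_add, latt_add, add_assoc]

theorem notMem_box_imp {φ : Plane → ℂ} {N M : ℕ} (h : ∀ x i, (N : ℝ) < |coord i x| → φ x = 0)
    {x : Plane} (hx : ∀ i, |coord i x| ≤ M) {n : ℤ × ℤ} (hn : n ∉ box (N + M)) :
    φ (x + latt n.1 n.2) = 0 := by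
  rw [mem_box, not_and_or, not_le, not_le] at hn
  rcases hn with hn | hn
  · refine h _ 0 ?_
    rw [map_add, coord_zero_latt]
    have h1 : ((N + M : ℕ) : ℝ) < |(n.1 : ℝ)| := by exact_mod_cast hn
    have h2 := abs_sub_abs_le_abs_sub (n.1 : ℝ) (-coord 0 x)
    have h3 := hx 0
    rw [abs_neg, sub_neg_eq_add, add_comm (n.1 : ℝ)] at h2
    push_cast at h1
    linarith
  · refine h _ 1 ?_
    rw [map_add, coord_one_latt]
    have h1 : ((N + M : ℕ) : ℝ) < |(n.2 : ℝ)| := by exact_mod_cast hn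
    have h2 := abs_sub_abs_le_abs_sub (n.2 : ℝ) (-coord 1 x)
    have h3 := hx 1
    rw [abs_neg, sub_neg_eq_add, add_comm (n.2 : ℝ)] at h2
    push_cast at h1
    linarith

theorem periodize_eq_sum {φ : Plane → ℂ} {N M : ℕ} (h : ∀ x i, (N : ℝ) < |coord i x| → φ x = 0)
    {x : Plane} (hx : ∀ i, |coord i x| ≤ M) :
    periodize φ x = ∑ n ∈ box (N + M), φ (x + latt n.1 n.2) :=
  finsum_eq_sum_of_support_subset _ fun n hn => by
    by_contra hb
    exact hn (notMem_box_imp h hx hb)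

theorem continuous_periodize {φ : Plane → ℂ} (hφ : Continuous φ) {N : ℕ}
    (h : ∀ x i, (N : ℝ) < |coord i x| → φ x = 0) : Continuous (periodize φ) := by
  refine continuous_iff_continuousAt.2 fun x => ?_
  obtain ⟨M, hM⟩ := exists_nat_gt (max |coord 0 x| |coord 1 x|)
  have hx : x ∈ {y : Plane | ∀ i, |coord i y| < (M : ℝ)} := fun i => by
    fin_cases i
    · exact (le_max_left _ _).trans_lt hM
    · exact (le_max_right _ _).trans_lt hM
  have hc : Continuous fun y => ∑ n ∈ box (N + M), φ (y + latt n.1 n.2) :=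
    continuous_finsetSum _ fun n _ => hφ.comp (continuous_add_const _)
  refine hc.continuousAt.congr ?_
  filter_upwards [(isOpen_coord_lt M).mem_nhds hx] with y hy
  rw [periodize_eq_sum h fun i => (hy i).le]

/-- The integral of a test function against the periodic `f` is the integral over the hexagon of its
periodization against `f`, and the periodization is a continuous function on the torus. -/
theorem ae_eq_zero_of_integral_wave {f : Plane → ℂ} (hf : LocallyIntegrable f volume)
    (hper : IsBloch 0 f) (h : ∀ n, ∫ x in ΩH, gauge (waveVec n) x * f x = 0) :
    ∀ᵐ x, f x = 0 := by
  refine ae_eq_zero_of_integral_contDiff_smul_eq_zero hf fun φ hφ hc => ?_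
  obtain ⟨N, hN⟩ : ∃ N : ℕ, ∀ x i, (N : ℝ) < |coord i x| → φ x = 0 := by
    have hb : ∀ i, ∃ C, ∀ x ∈ tsupport φ, ‖coord i x‖ ≤ C := fun i =>
      hc.isCompact.exists_bound_of_continuousOn (coord i).continuous.continuousOn
    choose C hC using hb
    obtain ⟨N, hN⟩ := exists_nat_ge (max (C 0) (C 1))
    refine ⟨N, fun x i hx => image_eq_zero_of_notMem_tsupport fun hm => ?_⟩
    have h1 := hC i x hm
    rw [Real.norm_eq_abs] at h1
    have h2 : C i ≤ N := by
      refine le_trans ?_ hN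
      fin_cases i
      · exact le_max_left _ _
      · exact le_max_right _ _
    linarith
  have hN' : ∀ x i, (N : ℝ) < |coord i x| → (φ x : ℂ) = 0 := fun x i hx => by
    rw [hN x i hx, Complex.ofReal_zero]
  have hcont : Continuous fun x => (φ x : ℂ) := Complex.continuous_ofReal.comp hφ.continuous
  obtain ⟨G, hG⟩ := exists_torus_lift (continuous_periodize hcont hN') (periodize_add_latt _)
  have hΩ : IntegrableOn f ΩH volume := hf.integrableOn_isCompact isCompact_ΩH
  have h1 := integral_torus_mul_eq_zero hΩ h G
  rw [integral_eq_sum_box (hf.integrable_smul_left_of_hasCompactSupport hφ.continuous hc) (N := N)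
    (Eventually.of_forall fun x ⟨i, hi⟩ => by rw [hN x i hi, zero_smul])]
  have h2 : ∀ n : ℤ × ℤ, ∫ x in ΩH, φ (x + latt n.1 n.2) • f (x + latt n.1 n.2) =
      ∫ x in ΩH, (φ (x + latt n.1 n.2) : ℂ) * f x := by
    intro n
    refine integral_congr_ae (ae_restrict_of_ae ?_)
    filter_upwards [hper n.1 n.2] with x hx
    rw [hx, phase_zero, one_mul, Complex.real_smul]
  simp only [h2]
  rw [← integral_finsetSum]
  · rw [← h1]
    refine setIntegral_congr_fun measurableSet_ΩH fun x hx => ?_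
    rw [← Finset.sum_mul, hG, periodize_eq_sum (M := 1) hN' fun i => by
      simpa using abs_coord_le_of_mem_ΩH hx i]
  · intro n _
    exact hΩ.continuousOn_mul (hcont.comp (continuous_add_const _)).continuousOn isCompact_ΩH

/-- The plane waves form a Hilbert basis of the square integrable functions on the hexagon. -/
def waveBasis : HilbertBasis (ℤ × ℤ) ℂ (L2 ΩH) :=
  HilbertBasis.mkOfOrthogonalEqBot orthonormal_waveL2 (by
    rw [Submodule.eq_bot_iff]
    intro f hf
    rw [Submodule.mem_orthogonal] at hf
    have h0 : ∀ n, ∫ x in ΩH, gauge (waveVec n) x * f x = 0 := fun n => by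
      have h1 := hf (waveL2 (-n)) (Submodule.subset_span ⟨_, rfl⟩)
      have h2 : -waveVec (-n) = waveVec n := by
        have := waveVec_sub (-n) 0
        have h3 : waveVec 0 = 0 := by ext i; fin_cases i <;> simp [waveVec]
        rw [h3, add_zero, zero_sub, neg_neg] at this
        exact this.symm
      rw [inner_waveL2, h2] at h1
      refine (mul_eq_zero.1 h1).resolve_left ?_
      have := (Real.sqrt_pos.2 volume_real_ΩH_pos).ne'
      exact inv_ne_zero (by exact_mod_cast this)
    have h1 := ae_eq_zero_of_integral_wave (locL2_perExt (Lp.memLp f)).locallyIntegrable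
      (isBloch_perExt f) fun n => by
        rw [← h0 n]
        refine integral_congr_ae ?_
        filter_upwards [perExt_ae_eq f] with x hx
        rw [hx]
    rw [Lp.eq_zero_iff_ae_eq_zero]
    exact (perExt_ae_eq f).symm.trans (ae_restrict_of_ae h1))

theorem coe_waveBasis : ⇑waveBasis = waveL2 := HilbertBasis.coe_mkOfOrthogonalEqBot _ _

/-! ### Jets of periodic functions -/

/-- With this extension the space of jets is the periodic `H²`, the domain of `H(0)`. -/
theorem isExt_per : IsExt (Ω := ΩH) fun f => perExt f where
  add f g := (isBloch_perExt _).eq_of_eq_on_cell ((isBloch_perExt f).add (isBloch_perExt g)) (by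
    filter_upwards [perExt_ae_eq (f + g : L2 ΩH), Lp.coeFn_add f g, perExt_ae_eq f, perExt_ae_eq g]
      with x h1 h2 h3 h4
    rw [h1, h2, Pi.add_apply, Pi.add_apply, h3, h4])
  smul c f := (isBloch_perExt _).eq_of_eq_on_cell ((isBloch_perExt f).smul c) (by
    filter_upwards [perExt_ae_eq (c • f : L2 ΩH), Lp.coeFn_smul c f, perExt_ae_eq f]
      with x h1 h2 h3
    rw [h1, h2, Pi.smul_apply, Pi.smul_apply, h3])
  restr f := perExt_ae_eq f
  aestronglyMeasurable f := aestronglyMeasurable_perExt (Lp.aestronglyMeasurable f)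
  bound K hK := by
    obtain ⟨C, hC⟩ := exists_eLpNorm_perExt_le hK
    exact ⟨C, fun f => by
      rw [Lp.enorm_def]
      exact hC f (Lp.aestronglyMeasurable f)⟩

theorem IsBloch.weakPartial {i : Fin 2} {k : Plane} {u v : Plane → ℂ} (hu : IsBloch k u)
    (h : HasWeakPartial i u v) : IsBloch k v := fun n₁ n₂ => by
  have h1 := h.comp_add (latt n₁ n₂)
  have h2 := h.smul (phase k n₁ n₂)
  filter_upwards [h1.unique h2 (hu n₁ n₂)] with x hx
  simpa using hx

/-- The restriction of a locally square integrable function to the hexagon. -/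
def LocL2.toCell {u : Plane → ℂ} (hu : LocL2 u) : L2 ΩH := (hu ΩH isCompact_ΩH).toLp u

theorem LocL2.coe_toCell {u : Plane → ℂ} (hu : LocL2 u) : hu.toCell =ᵐ[volume.restrict ΩH] u :=
  MemLp.coeFn_toLp _

theorem LocL2.perExt_toCell {u : Plane → ℂ} (hu : LocL2 u) (hp : IsBloch 0 u) :
    perExt hu.toCell =ᵐ[volume] u := hp.perExt_eq hu.coe_toCell

theorem exists_jet_per {u d₁ d₂} (hj : IsJet LocL2 u d₁ d₂) (hu : IsBloch 0 u) :
    ∃ p : Jet isExt_per, perExt (jetBase isExt_per p) =ᵐ[volume] u := by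
  have hd₁ : ∀ i, IsBloch 0 (d₁ i) := fun i => hu.weakPartial (hj.weak_first i)
  have hd₂ : ∀ i j, IsBloch 0 (d₂ i j) := fun i j => (hd₁ j).weakPartial (hj.weak_second i j)
  refine ⟨mkJet isExt_per hj.base.toCell (fun i => (hj.first i).toCell)
    (fun i j => (hj.second i j).toCell) ?_, hj.base.perExt_toCell hu⟩
  exact hj.congr (hj.base.perExt_toCell hu).symm
    (fun i => ((hj.first i).perExt_toCell (hd₁ i)).symm)
    fun i j => ((hj.second i j).perExt_toCell (hd₂ i j)).symm

/-- Rellich's theorem on the torus. A derivative multiplies the Fourier coefficient by `i kapᵢ`, and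
outside the box of size `N` a component of the wave vector is at least `2π(N + 1)` in modulus, so
the two multipliers dominate `N + 1`. -/
theorem isCompactOperator_jetBase : IsCompactOperator (jetBase isExt_per) := by
  refine isCompactOperator_of_fourier_decay waveBasis (D₀ := jetFirst isExt_per 0)
    (D₁ := jetFirst isExt_per 1) box fun N p n hn => ?_
  rw [coe_waveBasis]
  have hneg : -waveVec n = waveVec (-n) := by
    ext i
    fin_cases i <;> simp [waveVec]
  have key : ∀ i, ⟪waveL2 n, jetFirst isExt_per i p⟫_ℂ =
      Complex.I * kap (waveVec n) i * ⟪waveL2 n, jetBase isExt_per p⟫_ℂ := by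
    intro i
    have hb : IsBloch 0 (gauge (-waveVec n)) := by rw [hneg]; exact isBloch_wave _
    have h1 := ((isJet_jet isExt_per p).weak_first i).integral_gauge_mul (isBloch_perExt _)
      (isBloch_perExt _) hb
    have h2 : ∀ f : L2 ΩH, ∫ x in ΩH, gauge (-waveVec n) x * perExt f x =
        ∫ x in ΩH, gauge (-waveVec n) x * f x := fun f => by
      refine integral_congr_ae ?_
      filter_upwards [perExt_ae_eq f] with x hx
      rw [hx]
    rw [h2, h2] at h1
    rw [inner_waveL2, inner_waveL2, h1, kap_neg]
    push_cast
    ring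
  rw [key, key, norm_mul, norm_mul, norm_mul, norm_mul, Complex.norm_I, one_mul, one_mul,
    Complex.norm_real, Complex.norm_real, ← add_mul]
  refine mul_le_mul_of_nonneg_right ?_ (norm_nonneg _)
  have hpi : (1 : ℝ) ≤ 2 * Real.pi := by linarith [Real.two_le_pi]
  have hge : ∀ m : ℤ, (N : ℤ) < |m| → (N : ℝ) + 1 ≤ |2 * Real.pi * m| := fun m hm => by
    have h1 : ((N : ℝ) + 1) ≤ |(m : ℝ)| := by exact_mod_cast hm
    rw [abs_mul, abs_of_pos (by positivity : 0 < 2 * Real.pi)]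
    nlinarith [abs_nonneg (m : ℝ)]
  rw [mem_box, not_and_or, not_le, not_le] at hn
  rcases hn with hn | hn
  · refine (hge _ hn).trans ?_
    simpa [waveVec] using abs_apply_le_sum_kap (waveVec n) 0
  · refine (hge _ hn).trans ?_
    simpa [waveVec] using abs_apply_le_sum_kap (waveVec n) 1

/-! ### The operator `H(k)` on periodic jets -/

namespace RealDiffOp

variable (H : RealDiffOp)

/-- The part of `e^{-ikx} H e^{ikx}` that is linear in `k`, up to the factor `i`. -/
def linPart (k : Plane) : Jet isExt_per →L[ℂ] L2 ΩH :=
  ∑ i, (kap k i : ℂ) • H.jetGrad isExt_per i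

/-- The part of `e^{-ikx} H e^{ikx}` that is quadratic in `k`, up to the sign. -/
def quadPart (k : Plane) : Jet isExt_per →L[ℂ] L2 ΩH :=
  ∑ i, ∑ j, (kap k i * kap k j : ℂ) • H.jetLead isExt_per i j

/-- The operator `e^{-ikx} H e^{ikx}` on periodic jets. -/
def gaugedOp (k : Plane) : Jet isExt_per →L[ℂ] L2 ΩH :=
  H.jetOp isExt_per + (Complex.I • H.linPart k - H.quadPart k)

theorem linPart_ae (k : Plane) (p : Jet isExt_per) : H.linPart k p =ᵐ[volume.restrict ΩH]
    fun x => ∑ i, (kap k i : ℂ) * (∑ j, ((H.a i j x : ℂ) * perExt (jetFirst isExt_per j p) x +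
      (H.a j i x : ℂ) * perExt (jetFirst isExt_per j p) x) +
        (H.b i x : ℂ) * perExt (jetBase isExt_per p) x) := by
  simp only [linPart, sum_apply, smul_apply]
  exact coe_sum_ae _ fun i => coe_smul_ae _ (H.jetGrad_ae isExt_per i p)

theorem quadPart_ae (k : Plane) (p : Jet isExt_per) : H.quadPart k p =ᵐ[volume.restrict ΩH]
    fun x => ∑ i, ∑ j, (kap k i * kap k j : ℂ) *
      ((H.a i j x : ℂ) * perExt (jetBase isExt_per p) x) := by
  simp only [quadPart, sum_apply, smul_apply]
  exact coe_sum_ae _ fun i => coe_sum_ae _ fun j => coe_smul_ae _ (H.jetLead_ae isExt_per i j p)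

/-- Derivatives of the plane wave are multiples of it, so its commutator with `H` is the wave times
a polynomial in `k` of degree two. -/
theorem gauge_mul_gaugedOp_ae (k : Plane) (p : Jet isExt_per) :
    ∀ᵐ x ∂(volume.restrict ΩH), gauge k x * H.gaugedOp k p x =
      H.onJet (fun x => gauge k x * perExt (jetBase isExt_per p) x)
        (mulFirst (gauge k) (perExt (jetBase isExt_per p))
          fun i => perExt (jetFirst isExt_per i p))
        (mulSecond (gauge k) (perExt (jetBase isExt_per p))
          (fun i => perExt (jetFirst isExt_per i p))
          fun i j => perExt (jetSecond isExt_per i j p)) x := by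
  have e0 : H.gaugedOp k p = H.jetOp isExt_per p +
      (Complex.I • H.linPart k p + (-1 : ℂ) • H.quadPart k p) := by
    simp only [gaugedOp, add_apply, sub_apply, smul_apply, neg_smul, one_smul]
    rw [sub_eq_add_neg]
  have e1 := coe_add_ae (H.jetOp_ae isExt_per p) (coe_add_ae (coe_smul_ae Complex.I
    (H.linPart_ae k p)) (coe_smul_ae (-1) (H.quadPart_ae k p)))
  rw [← e0] at e1
  filter_upwards [e1] with x hx
  rw [hx, onJet_mul]
  simp only [onJet, comm, Fin.sum_univ_two, pd_pd_gauge]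
  simp only [pd_gauge]
  ring

/-- The identity is known on the hexagon; both sides are Bloch functions, the image under `H` by
shift invariance, so it holds on the plane. -/
theorem maps_gauge {H : RealDiffOp} (hS : H.ShiftInvariant) (k : Plane) (p : Jet isExt_per) :
    H.Maps LocL2 (fun x => gauge k x * perExt (jetBase isExt_per p) x)
      (fun x => gauge k x * perExt (H.gaugedOp k p) x) := by
  have hj := (isJet_jet isExt_per p).mul_locL2 (contDiff_gauge k)
  have hM : H.Maps LocL2 _ _ := ⟨_, _, hj, EventuallyEq.rfl⟩
  refine hM.congr EventuallyEq.rfl ?_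
  have hb : IsBloch k (fun x => gauge k x * perExt (jetBase isExt_per p) x) := by
    simpa using (isBloch_gauge k).mul (isBloch_perExt (jetBase isExt_per p))
  have hb' := IsBloch.of_maps hS hb hM
  have hb0 := (isBloch_gauge (-k)).mul hb'
  rw [neg_add_cancel] at hb0
  have h1 := hb0.perExt_eq (f := H.gaugedOp k p) (by
    filter_upwards [H.gauge_mul_gaugedOp_ae k p] with x hx
    rw [← hx, ← mul_assoc, gauge_neg_mul, one_mul])
  filter_upwards [h1] with x hx
  rw [hx, ← mul_assoc, mul_comm (gauge k x), gauge_neg_mul, one_mul]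

theorem isBloch_gauge_mul (k : Plane) (f : Plane → ℂ) :
    IsBloch k fun x => gauge k x * perExt f x := by
  simpa using (isBloch_gauge k).mul (isBloch_perExt f)

theorem inner_eq_integral {Ω : Set Plane} {f g : L2 Ω} {F G : Plane → ℂ}
    (hf : f =ᵐ[volume.restrict Ω] F) (hg : g =ᵐ[volume.restrict Ω] G) :
    ⟪f, g⟫_ℂ = ∫ x in Ω, starRingEnd ℂ (F x) * G x := by
  rw [L2.inner_def]
  refine integral_congr_ae ?_
  filter_upwards [hf, hg] with x h1 h2
  rw [h1, h2]
  simp [mul_comm]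

/-- The plane waves cancel in the products, which leaves Green's formula for Bloch functions. -/
theorem gaugedOp_symm {H : RealDiffOp} (hH : IsSelfAdjoint H.planeOp) (hS : H.ShiftInvariant)
    (k : Plane) (p q : Jet isExt_per) :
    ⟪H.gaugedOp k p, jetBase isExt_per q⟫_ℂ = ⟪jetBase isExt_per p, H.gaugedOp k q⟫_ℂ := by
  have h := integral_symm_bloch hH hS (isBloch_gauge_mul k _) (isBloch_gauge_mul k _)
    (maps_gauge hS k p) (maps_gauge hS k q)
  have e : ∀ (F G : Plane → ℂ) x, starRingEnd ℂ (gauge k x * F x) * (gauge k x * G x) =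
      starRingEnd ℂ (F x) * G x := fun F G x => by
    rw [map_mul, conj_gauge]
    linear_combination (starRingEnd ℂ (F x) * G x) * gauge_neg_mul k x
  simp only [e] at h
  rw [inner_eq_integral (perExt_ae_eq _).symm (perExt_ae_eq _).symm,
    inner_eq_integral (perExt_ae_eq _).symm (perExt_ae_eq _).symm, h]

/-! ### Eigenspaces of `H(k)` as kernels on a fixed space of jets. -/

/-- Multiplication of the jets by the plane wave. -/
def gaugeBase (k : Plane) : Jet isExt_per →L[ℂ] L2 ΩH :=
  (mulL2 ΩH (gauge k)).comp (jetBase isExt_per)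

theorem gaugeBase_ae (k : Plane) (p : Jet isExt_per) : gaugeBase k p =ᵐ[volume.restrict ΩH]
    fun x => gauge k x * perExt (jetBase isExt_per p) x := by
  refine (mulL2_ae (contDiff_gauge k).continuous.measurable (fun x => (norm_gauge k x).le)
    (jetBase isExt_per p)).trans ?_
  filter_upwards [perExt_ae_eq (jetBase isExt_per p)] with x hx
  rw [hx]

theorem gaugeBase_injective (k : Plane) : Function.Injective (gaugeBase k) := by
  rw [injective_iff_map_eq_zero]
  intro p hp
  refine jetBase_injective isExt_per ?_
  rw [map_zero, Lp.eq_zero_iff_ae_eq_zero]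
  have h := gaugeBase_ae k p
  rw [hp] at h
  filter_upwards [h, Lp.coeFn_zero ℂ 2 (volume.restrict ΩH), perExt_ae_eq (jetBase isExt_per p)]
    with x h1 h2 h3
  rw [h2, Pi.zero_apply, h3] at h1
  exact (mul_eq_zero.1 h1.symm).resolve_left (gauge_ne_zero k x)

/-- Multiplication by the plane wave exchanges periodic and Bloch functions and preserves `H²_loc`.
This removes the dependence of the domain on `k`. -/
theorem eigenspaceOf_blochOp {H : RealDiffOp} (hS : H.ShiftInvariant) (k : Plane) (l : ℂ) :
    eigenspaceOf (H.blochOp k) l =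
      (LinearMap.ker (H.gaugedOp k - l • jetBase isExt_per).toLinearMap).map
        (gaugeBase k).toLinearMap := by
  ext f
  rw [Submodule.mem_map]
  change (f, l • f) ∈ (H.blochOp k).graph ↔ _
  rw [graph_blochOp]
  constructor
  · rintro ⟨ψ, g, hψ, hM, h1, h2⟩
    obtain ⟨d₁, d₂, hj, -⟩ := id hM
    have hv : IsBloch 0 fun x => gauge (-k) x * ψ x := by simpa using (isBloch_gauge (-k)).mul hψ
    obtain ⟨p, hp⟩ := exists_jet_per (hj.mul_locL2 (contDiff_gauge (-k))) hv
    have hp' : (fun x => gauge k x * perExt (jetBase isExt_per p) x) =ᵐ[volume] ψ := by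
      filter_upwards [hp] with x hx
      rw [hx, ← mul_assoc, mul_comm (gauge k x), gauge_neg_mul, one_mul]
    have hg := (maps_gauge hS k p).unique hM hp'
    refine ⟨p, ?_, ?_⟩
    · rw [LinearMap.mem_ker]
      change H.gaugedOp k p - l • jetBase isExt_per p = 0
      rw [sub_eq_zero]
      refine Lp.ext ?_
      filter_upwards [perExt_ae_eq (H.gaugedOp k p), ae_restrict_of_ae hg, h1, h2,
        Lp.coeFn_smul l f, Lp.coeFn_smul l (jetBase isExt_per p),
        perExt_ae_eq (jetBase isExt_per p), ae_restrict_of_ae hp'] with x a1 a2 a3 a4 a5 a6 a7 a8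
      refine mul_left_cancel₀ (gauge_ne_zero k x) ?_
      rw [← a1, a2, ← a4, a5, a6, Pi.smul_apply, Pi.smul_apply, a3, ← a7, ← a8, smul_eq_mul,
        smul_eq_mul]
      ring
    · refine Lp.ext (((gaugeBase_ae k p).trans (ae_restrict_of_ae hp')).trans h1.symm)
  · rintro ⟨p, hp, rfl⟩
    refine ⟨_, _, isBloch_gauge_mul k _, maps_gauge hS k p, gaugeBase_ae k p, ?_⟩
    have hp' : H.gaugedOp k p = l • jetBase isExt_per p := by
      rw [LinearMap.mem_ker] at hp
      exact sub_eq_zero.1 hp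
    have e := coe_smul_ae l (gaugeBase_ae k p)
    refine e.trans ?_
    rw [hp']
    filter_upwards [perExt_ae_eq (l • jetBase isExt_per p : L2 ΩH),
      Lp.coeFn_smul l (jetBase isExt_per p), perExt_ae_eq (jetBase isExt_per p)] with x a1 a2 a3
    rw [a1, a2, a3, Pi.smul_apply, smul_eq_mul]
    ring

theorem multOf_blochOp {H : RealDiffOp} (hS : H.ShiftInvariant) (k : Plane) (l : ℂ) :
    multOf (H.blochOp k) l =
      Module.rank ℂ (LinearMap.ker (H.gaugedOp k - l • jetBase isExt_per).toLinearMap) := by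
  rw [multOf, eigenspaceOf_blochOp hS]
  exact (Submodule.equivMapOfInjective _ (gaugeBase_injective k) _).rank_eq.symm

theorem gaugedOp_zero : H.gaugedOp 0 = H.jetOp isExt_per := by
  simp [gaugedOp, linPart, quadPart, kap_zero]

theorem maps_jet {H : RealDiffOp} (hS : H.ShiftInvariant) (p : Jet isExt_per) :
    H.Maps LocL2 (perExt (jetBase isExt_per p)) (perExt (H.jetOp isExt_per p)) := by
  have := maps_gauge hS 0 p
  simpa only [gauge_zero, one_mul, gaugedOp_zero] using this

theorem surjectiveAt_blochGraph {H : RealDiffOp} (hH : IsSelfAdjoint H.planeOp)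
    (hS : H.ShiftInvariant) {z : ℂ} (hz : z.im ≠ 0) : SurjectiveAt (H.blochGraph 0) z := by
  intro y
  obtain ⟨u, hu, hM⟩ := exists_periodic_solution hH hS hz (Lp.memLp y)
  obtain ⟨d₁, d₂, hj, -⟩ := id hM
  refine ⟨(hj.base.toCell, z • hj.base.toCell + y), ⟨u, _, hu, hM, hj.base.coe_toCell, ?_⟩, by simp⟩
  exact coe_add_ae (coe_smul_ae z hj.base.coe_toCell) (perExt_ae_eq y).symm

theorem symmetricGraph_blochGraph {H : RealDiffOp} (hH : IsSelfAdjoint H.planeOp)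
    (hS : H.ShiftInvariant) (k : Plane) : SymmetricGraph (H.blochGraph k) := by
  rintro p ⟨u, g, hu, hM, h1, h2⟩ q ⟨v, h, hv, hM', h1', h2'⟩
  rw [inner_eq_integral h2 h1', inner_eq_integral h1 h2']
  exact integral_symm_bloch hH hS hu hv hM hM'

/-- Supplies the point of the resolvent set from which the Fredholm alternative for the bordered
operator starts. -/
theorem bijective_jetOp_per {H : RealDiffOp} (hH : IsSelfAdjoint H.planeOp)
    (hS : H.ShiftInvariant) {z : ℂ} (hz : z.im ≠ 0) :
    Function.Bijective (H.jetOp isExt_per - z • jetBase isExt_per) := by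
  have hmem : ∀ p : Jet isExt_per, (jetBase isExt_per p, H.jetOp isExt_per p) ∈ H.blochGraph 0 :=
    fun p => ⟨_, _, isBloch_perExt _, maps_jet hS p, (perExt_ae_eq _).symm, (perExt_ae_eq _).symm⟩
  constructor
  · rw [injective_iff_map_eq_zero]
    intro p hp
    rw [sub_apply, sub_eq_zero, smul_apply] at hp
    have h1 := hmem p
    rw [hp] at h1
    refine jetBase_injective isExt_per ?_
    rw [(symmetricGraph_blochGraph hH hS 0).eq_zero hz h1, map_zero]
  · intro y
    obtain ⟨u, hu, hM⟩ := exists_periodic_solution hH hS hz (Lp.memLp y)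
    obtain ⟨d₁, d₂, hj, -⟩ := id hM
    obtain ⟨p, hp⟩ := exists_jet_per hj hu
    refine ⟨p, ?_⟩
    rw [sub_apply, smul_apply, sub_eq_iff_eq_add]
    refine Lp.ext ?_
    have h1 := (maps_jet hS p).unique hM hp
    filter_upwards [ae_restrict_of_ae h1, perExt_ae_eq (H.jetOp isExt_per p), perExt_ae_eq y,
      ae_restrict_of_ae hp, perExt_ae_eq (jetBase isExt_per p),
      coe_add_ae (EventuallyEq.refl _ (y : Plane → ℂ)) (coe_smul_ae z (EventuallyEq.refl _
        (jetBase isExt_per p : Plane → ℂ)))] with x a1 a2 a3 a4 a5 a6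
    rw [← a2, a1, a6, ← a5, a4, ← a3, Pi.add_apply, Pi.smul_apply, smul_eq_mul]
    ring

end RealDiffOp

/-! ### The cube root of unity -/

theorem τ_pow_three : τ ^ 3 = 1 := by
  rw [τ, ← Complex.exp_nat_mul]
  push_cast
  rw [mul_div_cancel₀ _ (by norm_num : (3 : ℂ) ≠ 0), Complex.exp_two_pi_mul_I]

theorem τ_ne_zero : τ ≠ 0 := Complex.exp_ne_zero _

theorem isPrimitiveRoot_τ : IsPrimitiveRoot τ 3 := by
  have := Complex.isPrimitiveRoot_exp 3 (by norm_num)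
  simpa [τ] using this

theorem τ_sum : 1 + τ + τ ^ 2 = 0 := by
  have := isPrimitiveRoot_τ.geom_sum_eq_zero (by norm_num)
  simpa [Finset.sum_range_succ] using this

theorem norm_τ : ‖τ‖ = 1 := isPrimitiveRoot_τ.norm'_eq_one (by norm_num)

theorem conj_τ : starRingEnd ℂ τ = τ ^ 2 := by
  have h : τ * starRingEnd ℂ τ = 1 := by
    rw [Complex.mul_conj, Complex.normSq_eq_norm_sq, norm_τ]
    norm_num
  refine mul_left_cancel₀ τ_ne_zero (h.trans ?_)
  rw [← pow_succ', τ_pow_three]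

theorem inv_τ : τ⁻¹ = τ ^ 2 := inv_eq_of_mul_eq_one_right (by rw [← pow_succ', τ_pow_three])

theorem inv_τ_pow_two : (τ ^ 2)⁻¹ = τ :=
  inv_eq_of_mul_eq_one_left (by rw [← pow_succ', τ_pow_three])

theorem τ_ne_one : τ ≠ 1 := isPrimitiveRoot_τ.ne_one (by norm_num)

theorem τ_pow_two_ne_one : τ ^ 2 ≠ 1 := isPrimitiveRoot_τ.pow_ne_one_of_pos_of_lt (by norm_num)
  (by norm_num)

/-- The product is `τ` to the power `i - j`, a nontrivial cube root of unity; this is the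
orthogonality of the characters of the rotation group. -/
theorem conj_inv_mul_inv_ne_one {i j : Fin 3} (h : i ≠ j) :
    starRingEnd ℂ (τ ^ (i : ℕ))⁻¹ * (τ ^ (j : ℕ))⁻¹ ≠ 1 := by
  have h3 := τ_pow_three
  have e1 := τ_ne_one
  have e2 := τ_pow_two_ne_one
  have h4 : τ ^ 4 = τ := by linear_combination τ * h3
  fin_cases i <;> fin_cases j <;> first | exact absurd rfl h |
    simp [inv_τ, conj_τ, inv_τ_pow_two, e1, e2, ← pow_mul, h4, ← sq]

/-! ### Rotations of functions -/

theorem measurableEmbedding_rotPt : MeasurableEmbedding rotPt :=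
  (rotIso.toLinearIsometryEquiv rfl).toHomeomorph.measurableEmbedding

theorem preimage_rotPt_ΩH : rotPt ⁻¹' ΩH = ΩH := Set.ext rotPt_mem_ΩH_iff

theorem measurePreserving_rotPt_ΩH :
    MeasurePreserving rotPt (volume.restrict ΩH : Measure Plane) (volume.restrict ΩH) := by
  have := measurePreserving_rotPt.restrict_preimage measurableSet_ΩH
  rwa [preimage_rotPt_ΩH] at this

theorem setIntegral_comp_rotPt (F : Plane → ℂ) : ∫ x in ΩH, F (rotPt x) = ∫ x in ΩH, F x :=
  measurePreserving_rotPt_ΩH.integral_comp measurableEmbedding_rotPt F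

/-- The rotation preserves the hexagon and its measure, so the integral equals `c` times itself. -/
theorem setIntegral_eq_zero_of_rotPt {F : Plane → ℂ} {c : ℂ} (hc : c ≠ 1)
    (h : ∀ᵐ x ∂(volume.restrict ΩH), F (rotPt x) = c * F x) : ∫ x in ΩH, F x = 0 := by
  have h1 := setIntegral_comp_rotPt F
  rw [integral_congr_ae h, integral_const_mul] at h1
  have : (c - 1) * ∫ x in ΩH, F x = 0 := by linear_combination h1
  exact (mul_eq_zero.1 this).resolve_left (sub_ne_zero.2 hc)

/-- The projection to the functions with `R u = τ⁻ʲ u`. -/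
def rotProj (j : Fin 3) (u : Plane → ℂ) (x : Plane) : ℂ :=
  (1 / 3) * (u x + τ ^ (j : ℕ) * u (rotPt x) + τ ^ (2 * (j : ℕ)) * u (rotPt (rotPt x)))

theorem rotProj_rotPt (j : Fin 3) (u : Plane → ℂ) (x : Plane) :
    rotProj j u (rotPt x) = (τ ^ (j : ℕ))⁻¹ * rotProj j u x := by
  have h3 : (τ ^ (j : ℕ)) ^ 3 = 1 := by rw [← pow_mul, mul_comm, pow_mul, τ_pow_three, one_pow]
  rw [eq_inv_mul_iff_mul_eq₀ (pow_ne_zero _ τ_ne_zero), rotProj, rotProj, rotPt_rotPt_rotPt,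
    mul_comm 2, pow_mul]
  linear_combination (1 / 3 * u x) * h3

theorem isEquivariant_rotProj (j : Fin 3) (u : Plane → ℂ) : IsEquivariant j (rotProj j u) :=
  Eventually.of_forall (rotProj_rotPt j u)

theorem sum_rotProj (u : Plane → ℂ) (x : Plane) : ∑ j, rotProj j u x = u x := by
  simp only [rotProj, Fin.sum_univ_three, Fin.val_zero, Fin.val_one, Fin.val_two, pow_zero, mul_zero,
    mul_one, pow_one]
  linear_combination (1 / 3 * (u (rotPt x) + u (rotPt (rotPt x)))) * τ_sum +
    (1 / 3 * u (rotPt (rotPt x)) * τ) * τ_pow_three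

theorem rotProj_eq (j : Fin 3) (u : Plane → ℂ) : rotProj j u =
    (1 / 3 : ℂ) • (u + τ ^ (j : ℕ) • (u ∘ rotPt) + τ ^ (2 * (j : ℕ)) • (u ∘ rotPt) ∘ rotPt) := rfl

theorem IsBloch.comp_rotPt {u : Plane → ℂ} (hu : IsBloch 0 u) : IsBloch 0 (u ∘ rotPt) := by
  intro n₁ n₂
  filter_upwards [measurePreserving_rotPt.quasiMeasurePreserving.ae (hu (-n₁ - n₂) n₁)] with x hx
  rw [Function.comp_apply, Function.comp_apply, rotPt_add_latt, hx, phase_zero, phase_zero]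

theorem IsBloch.rotProj {u : Plane → ℂ} (hu : IsBloch 0 u) (j : Fin 3) :
    IsBloch 0 (rotProj j u) := by
  rw [rotProj_eq]
  exact ((hu.add (hu.comp_rotPt.smul _)).add (hu.comp_rotPt.comp_rotPt.smul _)).smul _

theorem RealDiffOp.Maps.rotProj {H : RealDiffOp} (hR : H.RotInvariant) {u g : Plane → ℂ}
    (h : H.Maps LocL2 u g) (j : Fin 3) : H.Maps LocL2 (rotProj j u) (rotProj j g) := by
  rw [rotProj_eq, rotProj_eq]
  have hP := isLinClass_locL2
  have h1 := hR _ _ h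
  have h2 := hR _ _ h1
  exact ((h.add hP (h1.smul hP _)).add hP (h2.smul hP _)).smul hP _

theorem IsEquivariant.of_maps {H : RealDiffOp} (hR : H.RotInvariant) {j : Fin 3} {u g : Plane → ℂ}
    (hu : IsEquivariant j u) (h : H.Maps LocL2 u g) : IsEquivariant j g :=
  (hR _ _ h).unique (h.smul isLinClass_locL2 (τ ^ (j : ℕ))⁻¹) hu

theorem MemLp.rotProj_ΩH {u : Plane → ℂ} (hu : MemLp u 2 (volume.restrict ΩH)) (j : Fin 3) :
    MemLp (rotProj j u) 2 (volume.restrict ΩH) := by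
  rw [rotProj_eq]
  have h1 := hu.comp_measurePreserving measurePreserving_rotPt_ΩH
  have h2 := h1.comp_measurePreserving measurePreserving_rotPt_ΩH
  exact ((hu.add (h1.const_smul _)).add (h2.const_smul _)).const_smul _

/-! ### The unfolding of functions on the rhombus -/

/-- Almost every point of the hexagon lies in exactly one of the three rotated rhombi. -/
theorem ae_rhombus : ∀ᵐ x : Plane,
    (x ∈ ΩH → (x ∈ ΩR ∧ rotPt x ∉ ΩR ∧ rotPt (rotPt x) ∉ ΩR) ∨
      (x ∉ ΩR ∧ rotPt x ∈ ΩR ∧ rotPt (rotPt x) ∉ ΩR) ∨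
      (x ∉ ΩR ∧ rotPt x ∉ ΩR ∧ rotPt (rotPt x) ∈ ΩR)) := by
  filter_upwards [ae_coord_comb_ne (p := 2) (q := 1) (by norm_num) 0,
    ae_coord_comb_ne (p := 1) (q := 2) (by norm_num) 0,
    ae_coord_comb_ne (p := 1) (q := -1) (by norm_num) 0] with x h1 h2 h3 hx
  have h := mem_rhombus_or hx
  have n1 : ¬(x ∈ ΩR ∧ rotPt x ∈ ΩR) := by
    rw [mem_ΩR_iff, rotPt_mem_ΩR_iff]
    rintro ⟨⟨-, -, q⟩, ⟨q', -⟩, -⟩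
    exact h1 (by linarith)
  have n2 : ¬(rotPt x ∈ ΩR ∧ rotPt (rotPt x) ∈ ΩR) := by
    rw [rotPt_mem_ΩR_iff, rotPt_rotPt_mem_ΩR_iff]
    rintro ⟨⟨-, q, -⟩, ⟨-, q'⟩, -⟩
    exact h2 (by linarith)
  have n3 : ¬(x ∈ ΩR ∧ rotPt (rotPt x) ∈ ΩR) := by
    rw [mem_ΩR_iff, rotPt_rotPt_mem_ΩR_iff]
    rintro ⟨⟨⟨-, q⟩, -⟩, -, q', -⟩
    exact h3 (by linarith)
  tauto

theorem lintegral_ΩH_of_invariant {f : Plane → ENNReal} (hf : AEMeasurable f (volume.restrict ΩH))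
    (h : ∀ x, f (rotPt x) = f x) : ∫⁻ x in ΩH, f x = 3 * ∫⁻ x in ΩR, f x := by
  set F := ΩR.indicator f with hF
  have hmem : ∀ᵐ x ∂(volume.restrict ΩH : Measure Plane),
      f x = F x + F (rotPt x) + F (rotPt (rotPt x)) := by
    rw [ae_restrict_iff' measurableSet_ΩH]
    filter_upwards [ae_rhombus] with x hx hxH
    rcases hx hxH with ⟨a, b, c⟩ | ⟨a, b, c⟩ | ⟨a, b, c⟩ <;> simp [hF, a, b, c, h]
  have hFm : AEMeasurable F (volume.restrict ΩH) := hf.indicator measurableSet_ΩR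
  have mp := measurePreserving_rotPt_ΩH
  have e1 : ∫⁻ x in ΩH, F (rotPt x) = ∫⁻ x in ΩH, F x :=
    mp.lintegral_comp_emb measurableEmbedding_rotPt F
  have e2 : ∫⁻ x in ΩH, F (rotPt (rotPt x)) = ∫⁻ x in ΩH, F x :=
    (mp.lintegral_comp_emb measurableEmbedding_rotPt fun x => F (rotPt x)).trans e1
  have e3 : ∫⁻ x in ΩH, F x = ∫⁻ x in ΩR, f x := by
    rw [hF, lintegral_indicator measurableSet_ΩR, Measure.restrict_restrict measurableSet_ΩR,
      Set.inter_eq_left.2 ΩR_subset_ΩH]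
  have m1 : AEMeasurable (fun x => F (rotPt x)) (volume.restrict ΩH) :=
    hFm.comp_quasiMeasurePreserving mp.quasiMeasurePreserving
  rw [lintegral_congr_ae hmem, lintegral_add_left' (f := fun x => F x + F (rotPt x)) (hFm.add m1),
    lintegral_add_left' hFm, e1, e2, e3]
  ring

/-- At almost every point just one of the three terms survives, and equivariance turns it into the
value of `u` at the point itself. -/
theorem rotProj_indicator_of_isEquivariant {j : Fin 3} {u : Plane → ℂ} (hu : IsEquivariant j u) :
    rotProj j (ΩR.indicator u) =ᵐ[volume.restrict ΩH] fun x => (1 / 3) * u x := by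
  have h0 : τ ^ (j : ℕ) ≠ 0 := pow_ne_zero _ τ_ne_zero
  have h1 := measurePreserving_rotPt.quasiMeasurePreserving.ae hu
  change ∀ᵐ x ∂(volume.restrict ΩH), _
  rw [ae_restrict_iff' measurableSet_ΩH]
  filter_upwards [ae_rhombus, hu, h1] with x hx e1 e2 hxH
  rw [e1] at e2
  rw [rotProj]
  rcases hx hxH with ⟨a, b, c⟩ | ⟨a, b, c⟩ | ⟨a, b, c⟩
  · simp [a, b, c]
  · simp [a, b, c, e1, h0]
  · rw [Set.indicator_of_notMem a, Set.indicator_of_notMem b, Set.indicator_of_mem c, e2, mul_comm 2,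
      pow_mul]
    field_simp
    ring

theorem rotProj_indicator_on_ΩR (j : Fin 3) (u : Plane → ℂ) :
    rotProj j (ΩR.indicator u) =ᵐ[volume.restrict ΩR] fun x => (1 / 3) * u x := by
  change ∀ᵐ x ∂(volume.restrict ΩR), _
  rw [ae_restrict_iff' measurableSet_ΩR]
  filter_upwards [ae_rhombus] with x hx hxR
  rw [rotProj]
  rcases hx (ΩR_subset_ΩH hxR) with ⟨a, b, c⟩ | ⟨a, b, c⟩ | ⟨a, b, c⟩
  · simp [a, b, c]
  · exact absurd hxR a
  · exact absurd hxR a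

theorem norm_rotProj_rotPt (j : Fin 3) (u : Plane → ℂ) (x : Plane) :
    ‖rotProj j u (rotPt x)‖ₑ = ‖rotProj j u x‖ₑ := by
  rw [← ofReal_norm, ← ofReal_norm, rotProj_rotPt, norm_mul, norm_inv, norm_pow, norm_τ, one_pow,
    inv_one, one_mul]

/-- The function on the plane obtained by unfolding a function on the rhombus. -/
def unfoldFun (j : Fin 3) (u : Plane → ℂ) : Plane → ℂ := (√3 : ℂ) • rotProj j (ΩR.indicator u)

theorem memLp_unfold {j : Fin 3} {u : Plane → ℂ} (hu : MemLp u 2 (volume.restrict ΩR)) :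
    MemLp (unfoldFun j u) 2 (volume.restrict ΩH) :=
  (MemLp.rotProj_ΩH (((memLp_indicator_iff_restrict measurableSet_ΩR).2 hu).restrict ΩH)
    j).const_smul _

/-- The modulus of an equivariant function is invariant under rotation, so the hexagon counts three
times the rhombus; on the rhombus the unfolding is `√3 / 3` times the function. -/
theorem eLpNorm_unfold {j : Fin 3} {u : Plane → ℂ} (hu : MemLp u 2 (volume.restrict ΩR)) :
    eLpNorm (unfoldFun j u) 2 (volume.restrict ΩH) = eLpNorm u 2 (volume.restrict ΩR) := by
  have key : eLpNorm (unfoldFun j u) 2 (volume.restrict ΩH) ^ 2 =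
      eLpNorm u 2 (volume.restrict ΩR) ^ 2 := by
    rw [eLpNorm_two_sq, eLpNorm_two_sq, lintegral_ΩH_of_invariant]
    · rw [← lintegral_const_mul' _ _ (by norm_num)]
      refine lintegral_congr_ae ?_
      filter_upwards [rotProj_indicator_on_ΩR j u] with x hx
      rw [unfoldFun, Pi.smul_apply, hx, smul_eq_mul, ← ofReal_norm, ← ofReal_norm, norm_mul, norm_mul,
        Complex.norm_real, Real.norm_eq_abs, abs_of_nonneg (Real.sqrt_nonneg 3),
        show (3 : ENNReal) = ENNReal.ofReal 3 by simp, ← ENNReal.ofReal_pow (by positivity),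
        ← ENNReal.ofReal_pow (by positivity), ← ENNReal.ofReal_mul (by norm_num)]
      congr 1
      simp only [one_div, norm_inv, Complex.norm_ofNat, mul_pow]
      rw [Real.sq_sqrt (by norm_num)]
      ring
    · exact (memLp_unfold hu).1.enorm.pow_const 2
    · intro x
      simp only [unfoldFun, Pi.smul_apply, smul_eq_mul, enorm_mul, norm_rotProj_rotPt]
  exact (ENNReal.pow_right_strictMono two_ne_zero).injective key

theorem unfold_congr {j : Fin 3} {u v : Plane → ℂ} (h : u =ᵐ[volume.restrict ΩR] v) :
    unfoldFun j u =ᵐ[volume] unfoldFun j v := by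
  have h1 : ΩR.indicator u =ᵐ[volume] ΩR.indicator v :=
    (ae_eq_restrict_iff_indicator_ae_eq measurableSet_ΩR).1 h
  have h2 := measurePreserving_rotPt.quasiMeasurePreserving.ae_eq_comp h1
  have h3 := measurePreserving_rotPt.quasiMeasurePreserving.ae_eq_comp h2
  filter_upwards [h1, h2, h3] with x h1 h2 h3
  simp only [Function.comp_apply] at h2 h3
  simp only [unfoldFun, Pi.smul_apply, rotProj, h1, h2, h3]

theorem unfold_add (j : Fin 3) (u v : Plane → ℂ) : unfoldFun j (u + v) = unfoldFun j u + unfoldFun j v := by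
  ext x
  simp only [unfoldFun, Set.indicator_add', Pi.smul_apply, Pi.add_apply, rotProj, smul_eq_mul]
  ring

theorem unfold_smul (j : Fin 3) (z : ℂ) (u : Plane → ℂ) : unfoldFun j (z • u) = z • unfoldFun j u := by
  ext x
  have h : ∀ y, ΩR.indicator (z • u) y = z * ΩR.indicator u y := fun y =>
    Set.indicator_const_smul_apply ΩR z u y
  simp only [unfoldFun, Pi.smul_apply, rotProj, smul_eq_mul, h]
  ring

/-- The unfolding as an isometry from `L²` of the rhombus to `L²` of the hexagon. -/
def unfoldL2 (j : Fin 3) : L2 ΩR →ₗᵢ[ℂ] L2 ΩH where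
  toFun φ := (memLp_unfold (j := j) (Lp.memLp φ)).toLp _
  map_add' φ ψ := by
    rw [← MemLp.toLp_add, MemLp.toLp_eq_toLp_iff, ← unfold_add]
    exact ae_restrict_of_ae (unfold_congr (Lp.coeFn_add φ ψ))
  map_smul' z φ := by
    rw [RingHom.id_apply, ← MemLp.toLp_const_smul, MemLp.toLp_eq_toLp_iff, ← unfold_smul]
    exact ae_restrict_of_ae (unfold_congr (Lp.coeFn_smul z φ))
  norm_map' φ := by
    change ‖(memLp_unfold (j := j) (Lp.memLp φ)).toLp _‖ = _
    rw [Lp.norm_toLp, eLpNorm_unfold (Lp.memLp φ), Lp.norm_def]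

theorem unfoldL2_ae (j : Fin 3) (φ : L2 ΩR) :
    unfoldL2 j φ =ᵐ[volume.restrict ΩH] unfoldFun j φ :=
  (memLp_unfold (Lp.memLp φ)).coeFn_toLp

theorem isUnfolding_unfoldL2 (j : Fin 3) : IsUnfolding j (unfoldL2 j) := by
  intro φ
  filter_upwards [unfoldL2_ae j φ] with x hx
  have h3 : (√3 : ℂ) * (√3 : ℂ) = 3 := by exact_mod_cast sqrt_three_mul_self
  have h0 : (√3 : ℂ) ≠ 0 := fun h => by rw [h] at h3; norm_num at h3
  rw [hx, unfoldFun, Pi.smul_apply, rotProj, Fin.sum_univ_three]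
  simp only [Fin.val_zero, Fin.val_one, Fin.val_two, mul_zero, pow_zero, one_mul, mul_one,
    Function.iterate_zero, id_eq, Function.iterate_succ, Function.comp_apply,
    smul_eq_mul, mul_comm (j : ℕ) 2]
  push_cast
  field_simp
  linear_combination (ΩR.indicator (φ : Plane → ℂ) x + τ ^ (j : ℕ) * ΩR.indicator (φ : Plane → ℂ) (rotPt x) +
    τ ^ (2 * (j : ℕ)) * ΩR.indicator (φ : Plane → ℂ) (rotPt (rotPt x))) * h3

theorem unfoldL2_of_isEquivariant {j : Fin 3} {u : Plane → ℂ} (hu : IsEquivariant j u) {φ : L2 ΩR}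
    (hφ : φ =ᵐ[volume.restrict ΩR] u) :
    unfoldL2 j φ =ᵐ[volume.restrict ΩH] fun x => ((√3)⁻¹ : ℂ) * u x := by
  have h3 : (√3 : ℂ) * (√3 : ℂ) = 3 := by exact_mod_cast sqrt_three_mul_self
  have h0 : (√3 : ℂ) ≠ 0 := fun h => by rw [h] at h3; norm_num at h3
  filter_upwards [unfoldL2_ae j φ, ae_restrict_of_ae (unfold_congr (j := j) hφ),
    rotProj_indicator_of_isEquivariant hu] with x h1 h2 h4
  rw [h1, h2, unfoldFun, Pi.smul_apply, h4, smul_eq_mul]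
  field_simp
  linear_combination u x * h3

theorem inner_unfoldL2_eq_zero {i j : Fin 3} (hij : i ≠ j) (φ ψ : L2 ΩR) :
    ⟪unfoldL2 i φ, unfoldL2 j ψ⟫_ℂ = 0 := by
  rw [RealDiffOp.inner_eq_integral (unfoldL2_ae i φ) (unfoldL2_ae j ψ)]
  refine setIntegral_eq_zero_of_rotPt (conj_inv_mul_inv_ne_one hij)
    (Eventually.of_forall fun x => ?_)
  simp only [unfoldFun, Pi.smul_apply, rotProj_rotPt, smul_eq_mul, map_mul]
  ring

/-! ### Direct sums of operators -/

section Splitting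

variable {E F : Type*} [NormedAddCommGroup E] [InnerProductSpace ℂ E]
  [NormedAddCommGroup F] [InnerProductSpace ℂ F] {T : Fin 3 → F →ₗᵢ[ℂ] E}

theorem eq_of_sum_isometry_eq (horth : ∀ i j, i ≠ j → ∀ f g, ⟪T i f, T j g⟫_ℂ = 0)
    {f g : Fin 3 → F} (h : ∑ j, T j (f j) = ∑ j, T j (g j)) (j : Fin 3) : f j = g j := by
  have h1 : ∑ i, T i (f i - g i) = 0 := by
    simp only [map_sub, Finset.sum_sub_distrib, h, sub_self]
  have h2 : ⟪T j (f j - g j), ∑ i, T i (f i - g i)⟫_ℂ = ⟪f j - g j, f j - g j⟫_ℂ := by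
    rw [inner_sum, Finset.sum_eq_single j (fun i _ hi => horth j i (Ne.symm hi) _ _) (by simp),
      LinearIsometry.inner_map_map]
  rw [h1, inner_zero_right] at h2
  exact sub_eq_zero.1 (inner_self_eq_zero.1 h2.symm)

theorem SplitsAs.symmetricGraph {A : E →ₗ.[ℂ] E} {Q : Fin 3 → F →ₗ.[ℂ] F} (h : SplitsAs A Q T)
    (hA : SymmetricGraph A.graph) (j : Fin 3) : SymmetricGraph (Q j).graph := by
  intro p hp q hq
  have := hA _ (h.intertwines j _ _ hp) _ (h.intertwines j _ _ hq)
  simpa only [LinearIsometry.inner_map_map] using this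

/-- Solve `(A - z) p = T j y` and split `p`; the components of the equation are unique, and the one
with index `j` is the equation for `Q j`. -/
theorem SplitsAs.surjectiveAt {A : E →ₗ.[ℂ] E} {Q : Fin 3 → F →ₗ.[ℂ] F} (h : SplitsAs A Q T)
    {z : ℂ} (hA : SurjectiveAt A.graph z) (j : Fin 3) : SurjectiveAt (Q j).graph z := by
  intro y
  obtain ⟨p, hp, hpy⟩ := hA (T j y)
  obtain ⟨f, hf⟩ := h.complete p.1
  have hdom : ∀ i, f i ∈ (Q i).domain := by
    refine (h.domain_iff f).1 ?_
    rw [← hf]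
    exact LinearPMap.mem_domain_of_mem_graph hp
  have hg : ∀ i, (f i, Q i ⟨f i, hdom i⟩) ∈ (Q i).graph := fun i => (Q i).mem_graph ⟨f i, hdom i⟩
  have hsum : (∑ i, T i (f i), ∑ i, T i (Q i ⟨f i, hdom i⟩)) ∈ A.graph := by
    have := Submodule.sum_mem A.graph fun i (_ : i ∈ Finset.univ) => h.intertwines i _ _ (hg i)
    rwa [← prod_mk_sum] at this
  have h2 : p.2 = ∑ i, T i (Q i ⟨f i, hdom i⟩) := A.mem_graph_snd_inj hp hsum hf
  refine ⟨_, hg j, ?_⟩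
  have h3 : ∑ i, T i (Q i ⟨f i, hdom i⟩ - z • f i) = ∑ i, T i (if i = j then y else 0) := by
    have e : ∑ i, T i (if i = j then y else 0) = T j y := by
      rw [Finset.sum_eq_single j (fun i _ hi => by rw [if_neg hi, map_zero]) (by simp), if_pos rfl]
    rw [e, ← hpy, h2, hf, Finset.smul_sum, ← Finset.sum_sub_distrib]
    exact Finset.sum_congr rfl fun i _ => by rw [map_sub, map_smul]
  have := eq_of_sum_isometry_eq (f := fun i => Q i ⟨f i, hdom i⟩ - z • f i)
    (g := fun i => if i = j then y else 0) h.orthogonal h3 j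
  simpa using this

end Splitting

/-! ### Antiunitary equivalence -/

section Antiunitary

variable {F : Type*} [NormedAddCommGroup F] [InnerProductSpace ℂ F]

/-- Conjugate the resolvent by `C`. An antilinear map sends `z` to its conjugate, so this is done
for real `z` only; for self-adjoint operators the other points are in the resolvent set anyway. -/
theorem notMem_spectrumOf_of_antiunitary {A B : F →ₗ.[ℂ] F} (C : F ≃ₗᵢ⋆[ℂ] F)
    (h : ∀ f g, (f, g) ∈ A.graph ↔ (C f, C g) ∈ B.graph) {z : ℂ} (hz : starRingEnd ℂ z = z)
    (hA : z ∉ spectrumOf A) : z ∉ spectrumOf B := by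
  simp only [spectrumOf, Set.mem_ofPred_eq, not_not] at hA ⊢
  obtain ⟨S, h1, h2⟩ := hA
  refine ⟨C.toContinuousLinearEquiv.toContinuousLinearMap.comp
    (S.comp C.symm.toContinuousLinearEquiv.toContinuousLinearMap), fun f => ?_, fun f g hfg => ?_⟩
  · have := (h _ _).1 (h1 (C.symm f))
    simpa [map_smulₛₗ, hz] using this
  · have h3 := h2 (C.symm f) (C.symm g) ((h _ _).2 (by simpa using hfg))
    have h4 : C.symm (g - z • f) = C.symm g - z • C.symm f := by
      rw [map_sub, map_smulₛₗ, hz]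
    change C (S (C.symm (g - z • f))) = f
    rw [h4, h3, LinearIsometryEquiv.apply_symm_apply]

/-- `C` is only conjugate linear between the eigenspaces, but a semilinear bijection preserves
dimension. -/
theorem multOf_eq_of_antiunitary {A B : F →ₗ.[ℂ] F} (C : F ≃ₗᵢ⋆[ℂ] F)
    (h : ∀ f g, (f, g) ∈ A.graph ↔ (C f, C g) ∈ B.graph) {z : ℂ} (hz : starRingEnd ℂ z = z) :
    multOf A z = multOf B z := by
  have hmem : ∀ f, f ∈ eigenspaceOf A z ↔ C f ∈ eigenspaceOf B z := fun f => by
    change (f, z • f) ∈ A.graph ↔ (C f, z • C f) ∈ B.graph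
    rw [h, map_smulₛₗ, hz]
  refine rank_eq_of_equiv_equiv (starRingEnd ℂ)
    { toFun := fun f => ⟨C f, (hmem f).1 f.2⟩
      invFun := fun g => ⟨C.symm g, (hmem _).2 (by simp)⟩
      left_inv := fun f => by simp
      right_inv := fun g => by simp
      map_add' := fun f g => by ext; simp } (starRingAut (R := ℂ)).bijective fun r f => ?_
  ext
  exact map_smulₛₗ C r (f : F)

theorem isospectral_of_antiunitary [CompleteSpace F] {A B : F →ₗ.[ℂ] F} (hA : IsSelfAdjoint A)
    (hB : IsSelfAdjoint B) (C : F ≃ₗᵢ⋆[ℂ] F)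
    (h : ∀ f g, (f, g) ∈ A.graph ↔ (C f, C g) ∈ B.graph) : Isospectral A B := by
  have h' : ∀ f g, (f, g) ∈ B.graph ↔ (C.symm f, C.symm g) ∈ A.graph := fun f g => by
    rw [h]
    simp
  constructor
  · ext z
    by_cases hz : z.im = 0
    · have hz' := Complex.conj_eq_iff_im.2 hz
      exact not_iff_not.1 ⟨notMem_spectrumOf_of_antiunitary C h hz',
        notMem_spectrumOf_of_antiunitary C.symm h' hz'⟩
    · exact iff_of_false (notMem_spectrumOf hA hz) (notMem_spectrumOf hB hz)
  · intro z
    by_cases hz : z.im = 0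
    · exact multOf_eq_of_antiunitary C h (Complex.conj_eq_iff_im.2 hz)
    · have zero : ∀ {D : F →ₗ.[ℂ] F}, IsSelfAdjoint D → multOf D z = 0 := fun {D} hD => by
        have : eigenspaceOf D z = ⊥ := (Submodule.eq_bot_iff _).2 fun f hf =>
          (symmetricGraph_of_isSelfAdjoint hD).eq_zero hz hf
        rw [multOf, this, rank_bot]
      rw [zero hA, zero hB]

end Antiunitary

/-- Complex conjugation on `L²(Ω)`. -/
def conjL2 (Ω : Set Plane) : L2 Ω ≃ₗᵢ⋆[ℂ] L2 Ω where
  toFun f := star f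
  invFun f := star f
  left_inv f := star_star f
  right_inv f := star_star f
  map_add' f g := Lp.ext (by
    filter_upwards [Lp.coeFn_star (f + g), Lp.coeFn_add f g, Lp.coeFn_add (star f) (star g),
      Lp.coeFn_star f, Lp.coeFn_star g] with x h1 h2 h3 h4 h5
    rw [h1, h3, Pi.star_apply, Pi.add_apply, h2, h4, h5]
    simp)
  map_smul' z f := Lp.ext (by
    filter_upwards [Lp.coeFn_star (z • f), Lp.coeFn_smul z f,
      Lp.coeFn_smul (starRingEnd ℂ z) (star f), Lp.coeFn_star f] with x h1 h2 h3 h4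
    rw [h1, h3, Pi.star_apply, h2, Pi.smul_apply, Pi.smul_apply, h4]
    simp)
  norm_map' f := by
    rw [Lp.norm_def, Lp.norm_def]
    congr 1
    refine eLpNorm_congr_norm_ae ?_
    filter_upwards [Lp.coeFn_star f] with x hx
    change ‖(star f : L2 Ω) x‖ = _
    rw [hx, Pi.star_apply, norm_star]

theorem conjL2_ae {Ω : Set Plane} {f : L2 Ω} {F : Plane → ℂ} (h : f =ᵐ[volume.restrict Ω] F) :
    conjL2 Ω f =ᵐ[volume.restrict Ω] fun x => starRingEnd ℂ (F x) := by
  filter_upwards [Lp.coeFn_star f, h] with x h1 h2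
  change (star f : L2 Ω) x = _
  rw [h1, Pi.star_apply, h2]
  rfl

theorem conjL2_conjL2 {Ω : Set Plane} (f : L2 Ω) : conjL2 Ω (conjL2 Ω f) = f := star_star f

/-! ### The decomposition of `H(0)` -/

namespace RealDiffOp

variable {H : RealDiffOp}

/-- The place where the reality of the coefficients enters: conjugation commutes with `H`. -/
theorem Maps.conj {u g : Plane → ℂ} (h : H.Maps LocL2 u g) :
    H.Maps LocL2 (fun x => starRingEnd ℂ (u x)) (fun x => starRingEnd ℂ (g x)) := by
  obtain ⟨d₁, d₂, hj, hg⟩ := h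
  refine ⟨fun i x => starRingEnd ℂ (d₁ i x), fun i j x => starRingEnd ℂ (d₂ i j x),
    ⟨hj.base.conj, fun i => (hj.first i).conj, fun i j => (hj.second i j).conj,
      fun i => (hj.weak_first i).conj, fun i j => (hj.weak_second i j).conj⟩, ?_⟩
  filter_upwards [hg] with x hx
  simp [hx, onJet]

theorem isBloch_conj {u : Plane → ℂ} (hu : IsBloch 0 u) :
    IsBloch 0 fun x => starRingEnd ℂ (u x) := fun n₁ n₂ => by
  filter_upwards [hu n₁ n₂] with x hx
  rw [hx, phase_zero, one_mul, one_mul]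

theorem conj_inv_τ_pow (j : Fin 3) :
    starRingEnd ℂ (τ ^ (j : ℕ))⁻¹ = (τ ^ ((-j : Fin 3) : ℕ))⁻¹ := by
  fin_cases j
  · simp
  · change starRingEnd ℂ (τ ^ 1)⁻¹ = (τ ^ 2)⁻¹
    rw [pow_one, map_inv₀, conj_τ]
  · change starRingEnd ℂ (τ ^ 2)⁻¹ = (τ ^ 1)⁻¹
    rw [inv_τ_pow_two, conj_τ, pow_one, inv_τ]

theorem isEquivariant_conj {j : Fin 3} {u : Plane → ℂ} (hu : IsEquivariant j u) :
    IsEquivariant (-j) fun x => starRingEnd ℂ (u x) := by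
  filter_upwards [hu] with x hx
  rw [hx, map_mul, conj_inv_τ_pow]

theorem mem_quotGraph_conj {j : Fin 3} {p : L2 ΩR × L2 ΩR} (h : p ∈ H.quotGraph j) :
    (conjL2 ΩR p.1, conjL2 ΩR p.2) ∈ H.quotGraph (-j) := by
  obtain ⟨ψ, g, hψ, hM, h1, h2⟩ := h
  exact ⟨_, _, ⟨isBloch_conj hψ.1, isEquivariant_conj hψ.2⟩, hM.conj, conjL2_ae h1, conjL2_ae h2⟩

theorem mem_quotGraph_conj_iff (j : Fin 3) (f g : L2 ΩR) :
    (f, g) ∈ H.quotGraph j ↔ (conjL2 ΩR f, conjL2 ΩR g) ∈ H.quotGraph (-j) :=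
  ⟨mem_quotGraph_conj, fun h => by simpa [conjL2_conjL2] using mem_quotGraph_conj h⟩

theorem unfoldL2_mem_graph (hR : H.RotInvariant) {j : Fin 3} {f g : L2 ΩR}
    (h : (f, g) ∈ (H.quotOp j).graph) : (unfoldL2 j f, unfoldL2 j g) ∈ (H.blochOp 0).graph := by
  rw [graph_quotOp] at h
  rw [graph_blochOp]
  obtain ⟨ψ, g, hψ, hM, h1, h2⟩ := h
  exact ⟨_, _, hψ.1.smul _, hM.smul isLinClass_locL2 _, unfoldL2_of_isEquivariant hψ.2 h1,
    unfoldL2_of_isEquivariant (hψ.2.of_maps hR hM) h2⟩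

theorem sqrt_three_ne_zero : (√3 : ℂ) ≠ 0 := by simp

/-- The components of a function on the hexagon, as functions on the rhombus. -/
theorem exists_unfold_component {u : Plane → ℂ} (hu : MemLp u 2 (volume.restrict ΩH)) (j : Fin 3) :
    ∃ φ : L2 ΩR, φ =ᵐ[volume.restrict ΩR] (√3 : ℂ) • rotProj j u ∧
      unfoldL2 j φ =ᵐ[volume.restrict ΩH] rotProj j u := by
  have hm : MemLp ((√3 : ℂ) • rotProj j u) 2 (volume.restrict ΩR) :=
    ((MemLp.rotProj_ΩH hu j).mono_measure (Measure.restrict_mono ΩR_subset_ΩH le_rfl)).const_smul _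
  refine ⟨hm.toLp _, hm.coeFn_toLp, ?_⟩
  filter_upwards [unfoldL2_of_isEquivariant ((isEquivariant_rotProj j u).smul (√3 : ℂ))
    hm.coeFn_toLp] with x hx
  rw [hx, Pi.smul_apply, smul_eq_mul, inv_mul_cancel_left₀ sqrt_three_ne_zero]

theorem sum_unfold_component {h : L2 ΩH} {u : Plane → ℂ} (hu : h =ᵐ[volume.restrict ΩH] u)
    {f : Fin 3 → L2 ΩR} (hf : ∀ j, unfoldL2 j (f j) =ᵐ[volume.restrict ΩH] rotProj j u) :
    h = ∑ j, unfoldL2 j (f j) := by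
  refine Lp.ext ?_
  filter_upwards [coe_sum_ae _ hf, hu] with x h1 h2
  rw [h1, h2, sum_rotProj]

theorem exists_eq_sum_unfoldL2 (h : L2 ΩH) : ∃ f : Fin 3 → L2 ΩR, h = ∑ j, unfoldL2 j (f j) := by
  choose f _ hf using exists_unfold_component (Lp.memLp h)
  exact ⟨f, sum_unfold_component EventuallyEq.rfl hf⟩

/-- Rotation invariance puts `rotProj j ψ` in the domain together with `ψ`. By uniqueness of
orthogonal components its restriction to the rhombus, times `√3`, is `f j`. -/
theorem mem_domain_quotOp_of_sum_mem (hR : H.RotInvariant) {f : Fin 3 → L2 ΩR}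
    (hdom : ∑ j, unfoldL2 j (f j) ∈ (H.blochOp 0).domain) (j : Fin 3) :
    f j ∈ (H.quotOp j).domain := by
  obtain ⟨g, hg⟩ := LinearPMap.mem_domain_iff.1 hdom
  rw [graph_blochOp] at hg
  obtain ⟨ψ, G, hψ, hM, h1, -⟩ := hg
  obtain ⟨d₁, d₂, hj, -⟩ := id hM
  choose φ hφ hφ' using exists_unfold_component (hj.base ΩH isCompact_ΩH)
  have hfφ := eq_of_sum_isometry_eq (fun i j hij f g => inner_unfoldL2_eq_zero hij f g)
    (sum_unfold_component h1 hφ') j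
  have hMj := (hM.rotProj hR j).smul isLinClass_locL2 (√3 : ℂ)
  have hG : MemLp ((√3 : ℂ) • rotProj j G) 2 (volume.restrict ΩR) :=
    (hMj.locL2 ΩH isCompact_ΩH).mono_measure (Measure.restrict_mono ΩR_subset_ΩH le_rfl)
  refine LinearPMap.mem_domain_of_mem_graph (y := hG.toLp _) ?_
  rw [graph_quotOp, hfφ]
  exact ⟨_, _, ⟨(hψ.rotProj j).smul _, (isEquivariant_rotProj j ψ).smul _⟩, hMj, hφ j,
    hG.coeFn_toLp⟩

theorem sum_mem_domain_blochOp (hR : H.RotInvariant) {f : Fin 3 → L2 ΩR}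
    (hdom : ∀ j, f j ∈ (H.quotOp j).domain) :
    ∑ j, unfoldL2 j (f j) ∈ (H.blochOp 0).domain := by
  refine Submodule.sum_mem _ fun j _ => ?_
  obtain ⟨g, hg⟩ := LinearPMap.mem_domain_iff.1 (hdom j)
  exact LinearPMap.mem_domain_of_mem_graph (unfoldL2_mem_graph hR hg)

theorem splitsAs_blochOp (hR : H.RotInvariant) : SplitsAs (H.blochOp 0) H.quotOp unfoldL2 :=
  ⟨fun _ _ hij f g => inner_unfoldL2_eq_zero hij f g, exists_eq_sum_unfoldL2,
    fun _ => ⟨mem_domain_quotOp_of_sum_mem hR, sum_mem_domain_blochOp hR⟩,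
    fun _ _ _ h => unfoldL2_mem_graph hR h⟩

/-- Symmetry and full ranges at `±i` pass from `H(0)` to its summands. -/
theorem isSelfAdjoint_quotOp (hH : IsSelfAdjoint H.planeOp) (hS : H.ShiftInvariant)
    (hR : H.RotInvariant) (j : Fin 3) : IsSelfAdjoint (H.quotOp j) := by
  have hsym := symmetricGraph_blochGraph hH hS 0
  have hsur : ∀ {z : ℂ}, z.im ≠ 0 → SurjectiveAt (H.blochGraph 0) z := surjectiveAt_blochGraph hH hS
  rw [← graph_blochOp] at hsym hsur
  have hs := splitsAs_blochOp hR
  exact isSelfAdjoint_of_surjectiveAt (hs.symmetricGraph hsym j)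
    (hs.surjectiveAt (hsur (by simp)) j) (hs.surjectiveAt (hsur (by simp)) j)

/-- Conjugation changes the index `j` to `-j`, and `-1 = 2` modulo three. -/
theorem isospectral_quotOp (hH : IsSelfAdjoint H.planeOp) (hS : H.ShiftInvariant)
    (hR : H.RotInvariant) : Isospectral (H.quotOp 1) (H.quotOp 2) := by
  refine isospectral_of_antiunitary (isSelfAdjoint_quotOp hH hS hR 1)
    (isSelfAdjoint_quotOp hH hS hR 2) (conjL2 ΩR) fun f g => ?_
  rw [graph_quotOp, graph_quotOp]
  exact mem_quotGraph_conj_iff 1 f g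

end RealDiffOp

/-! ### Flatness from the vanishing of the first order term -/

section Expansion

variable {X Y : Type} [NormedAddCommGroup X] [NormedSpace ℂ X] [CompleteSpace X]
  [NormedAddCommGroup Y] [InnerProductSpace ℂ Y] [CompleteSpace Y]

/-- The vanishing of `L` on the eigenspace leaves only `Q` in the matrix elements of `A k - A 0`,
which is the second order smallness required by `locallyFlat_of_double_eigenvalue`. Compactness
makes the bordered operator bijective. -/
theorem locallyFlat_of_expansion {ι : X →L[ℂ] Y} {n : Fin 2 → X} {A L Q : Plane → X →L[ℂ] Y}
    {l₀ : ℝ} {z : ℂ} (hsym : ∀ k u v, ⟪A k u, ι v⟫_ℂ = ⟪ι u, A k v⟫_ℂ)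
    (hinj : Function.Injective ι) (horth : Orthonormal ℂ fun i => ι (n i))
    (hker : ∀ i, A 0 (n i) = (l₀ : ℂ) • ι (n i))
    (hspan : ∀ u, A 0 u = (l₀ : ℂ) • ι u → u ∈ Submodule.span ℂ (Set.range n))
    (hι : IsCompactOperator ι) (hz : Function.Bijective (A 0 - z • ι))
    (hA : ∀ k, A k = A 0 + (Complex.I • L k - Q k)) {C : ℝ} (hL : ∀ k, ‖L k‖ ≤ C * ‖k‖)
    (hQ : ∀ k, ‖Q k‖ ≤ C * ‖k‖ ^ 2) (hzero : ∀ k i j, ⟪ι (n i), L k (n j)⟫_ℂ = 0) :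
    LocallyFlat (fun k l => Module.rank ℂ (LinearMap.ker (A k - (l : ℂ) • ι).toLinearMap)) l₀ := by
  have hC : 0 ≤ C := by
    have := (norm_nonneg _).trans (hL (EuclideanSpace.single 0 1))
    simpa using this
  have hn : ∀ i, ‖ι (n i)‖ = 1 := horth.1
  set M : ℝ := ‖n 0‖ + ‖n 1‖ with hM
  have hnM : ∀ j, ‖n j‖ ≤ M := fun j => by
    fin_cases j
    · exact le_add_of_nonneg_right (norm_nonneg _)
    · exact le_add_of_nonneg_left (norm_nonneg _)
  have hM0 : 0 ≤ M := (norm_nonneg _).trans (hnM 0)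
  have hd : ∀ k, A k - A 0 = Complex.I • L k - Q k := fun k => by rw [hA k, add_sub_cancel_left]
  refine locallyFlat_of_double_eigenvalue hsym horth hker
    (bordered_bijective (hsym 0) hinj horth hker hspan hι hz) (C := 2 * C + C * M) ?_ ?_
  · have hball : ∀ᶠ k : Plane in 𝓝 0, ‖k‖ < 1 := by
      filter_upwards [Metric.ball_mem_nhds (0 : Plane) one_pos] with k hk
      simpa using hk
    filter_upwards [hball] with k hk
    have h1 : ‖k‖ ^ 2 ≤ ‖k‖ := by nlinarith [norm_nonneg k]
    have h2 : ‖Complex.I • L k‖ ≤ C * ‖k‖ := by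
      rw [norm_smul, Complex.norm_I, one_mul]
      exact hL k
    have h3 := mul_le_mul_of_nonneg_left h1 hC
    have h4 : 0 ≤ C * M * ‖k‖ := by positivity
    rw [hd]
    calc _ ≤ _ := norm_sub_le _ _
      _ ≤ _ := by linarith [hQ k]
  · refine Eventually.of_forall fun k i j => ?_
    rw [hd, sub_apply, smul_apply, inner_sub_right, inner_smul_right, hzero, mul_zero, zero_sub,
      norm_neg]
    have h1 : ‖Q k (n j)‖ ≤ C * ‖k‖ ^ 2 * M :=
      ((Q k).le_of_opNorm_le (hQ k) (n j)).trans
        (mul_le_mul_of_nonneg_left (hnM j) (by positivity))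
    have h2 := norm_inner_le_norm (𝕜 := ℂ) (ι (n i)) (Q k (n j))
    rw [hn, one_mul] at h2
    have h3 : 0 ≤ 2 * C * ‖k‖ ^ 2 := by positivity
    linarith

end Expansion

/-! ### Rotation of the quasimomentum. -/

/-- The quasimomentum for which `ell (rotMom k) x = ell k (rotPt x)`. -/
def rotMom (k : Plane) : Plane := !₂[k 1 - k 0, -k 0]

theorem ell_rotPt (k x : Plane) : ell k (rotPt x) = ell (rotMom k) x := by
  simp only [ell_apply, coord_zero_rotPt, coord_one_rotPt, rotMom,
    Matrix.cons_val_zero, Matrix.cons_val_one]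
  ring

theorem add_rotMom (k : Plane) : k + rotMom k + rotMom (rotMom k) = 0 := by
  ext i
  fin_cases i <;> simp [rotMom] <;> ring

/-- The three rotates of `k` add up to zero, and `m` takes the same value on each, so `3 m k = m 0 =
0`. -/
theorem eq_zero_of_rotMom {m : Plane → ℂ} (hadd : ∀ k l, m (k + l) = m k + m l)
    (hrot : ∀ k, m k = m (rotMom k)) (k : Plane) : m k = 0 := by
  have h0 : m 0 = 0 := by simpa using hadd 0 0
  have h := hadd (k + rotMom k) (rotMom (rotMom k))
  rw [add_rotMom, h0, hadd, ← hrot (rotMom k), ← hrot k] at h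
  linear_combination (-1 / 3 : ℂ) * h

theorem conj_mul_self_inv_τ_pow (j : Fin 3) :
    starRingEnd ℂ (τ ^ (j : ℕ))⁻¹ * (τ ^ (j : ℕ))⁻¹ = 1 := by
  rw [mul_comm, Complex.mul_conj, Complex.normSq_eq_norm_sq, norm_inv, norm_pow, norm_τ]
  simp

namespace RealDiffOp

variable {H : RealDiffOp}

/-! ### The first order term for differential operators -/

theorem contDiff_ell (k : Plane) : ContDiff ℝ ∞ fun x => (ell k x : ℂ) :=
  Complex.ofRealCLM.contDiff.comp (ell k).contDiff

theorem pd_ell (k : Plane) (i : Fin 2) : pd i (fun x => (ell k x : ℂ)) = fun _ => (kap k i : ℂ) := by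
  funext x
  have h1 : HasFDerivAt (fun x => (ell k x : ℂ)) (Complex.ofRealCLM.comp (ell k)) x :=
    (Complex.ofRealCLM.comp (ell k)).hasFDerivAt
  rw [pd, h1.fderiv]
  rfl

theorem pd_pd_ell (k : Plane) (i j : Fin 2) :
    pd i (pd j fun x => (ell k x : ℂ)) = fun _ => 0 := by
  rw [pd_ell]
  funext x
  simp [pd]

/-- The commutator of `H` with `ell k` on periodic jets. -/
theorem linPart_ae_comm (k : Plane) (p : Jet isExt_per) : H.linPart k p =ᵐ[volume.restrict ΩH]
    H.comm (fun x => (ell k x : ℂ)) (perExt (jetBase isExt_per p))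
      fun i => perExt (jetFirst isExt_per i p) := by
  filter_upwards [H.linPart_ae k p] with x hx
  rw [hx]
  simp only [comm, pd_pd_ell]
  simp only [pd_ell, Fin.sum_univ_two]
  ring

/-- The commutator is `H(ℓu) - ℓHu`. Rotation invariance is applied to the product `ℓu`, so no
transformation law for the individual coefficients is needed. -/
theorem comm_ell_rotPt (hS : H.ShiftInvariant) (hR : H.RotInvariant) {j : Fin 3} {l₀ : ℂ}
    {p : Jet isExt_per} (hp : H.jetOp isExt_per p = l₀ • jetBase isExt_per p)
    (he : IsEquivariant j (perExt (jetBase isExt_per p))) (k : Plane) :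
    ∀ᵐ x, H.comm (fun x => (ell k x : ℂ)) (perExt (jetBase isExt_per p))
        (fun i => perExt (jetFirst isExt_per i p)) (rotPt x) = (τ ^ (j : ℕ))⁻¹ *
      H.comm (fun x => (ell (rotMom k) x : ℂ)) (perExt (jetBase isExt_per p))
        (fun i => perExt (jetFirst isExt_per i p)) x := by
  have hj := isJet_jet isExt_per p
  set u := perExt (jetBase isExt_per p) with hu
  have hM : H.Maps LocL2 u (l₀ • u) := by
    have := maps_jet hS p
    rw [hp] at this
    exact this.congr EventuallyEq.rfl (isExt_per.smul _ _)
  have h1 := hR _ _ (hM.mul hj (contDiff_ell k))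
  have h2 := (hM.mul hj (contDiff_ell (rotMom k))).smul isLinClass_locL2 (τ ^ (j : ℕ))⁻¹
  have h3 := h1.unique h2 (by
    filter_upwards [he] with x hx
    simp only [Function.comp_apply, Pi.smul_apply, smul_eq_mul, hx, ell_rotPt]
    ring)
  filter_upwards [h3, he] with x hx hex
  simp only [Function.comp_apply, Pi.smul_apply, smul_eq_mul, hex, ell_rotPt] at hx
  linear_combination hx

theorem linPart_add (k l : Plane) : H.linPart (k + l) = H.linPart k + H.linPart l := by
  simp only [linPart, kap_add, Complex.ofReal_add, add_smul, Finset.sum_add_distrib]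

/-- After a rotation of the integral the two phases of `u` cancel and `k` is replaced by its rotate,
so `eq_zero_of_rotMom` applies. -/
theorem inner_linPart_self (hS : H.ShiftInvariant) (hR : H.RotInvariant) {j : Fin 3} {l₀ : ℂ}
    {p : Jet isExt_per} (hp : H.jetOp isExt_per p = l₀ • jetBase isExt_per p)
    (he : IsEquivariant j (perExt (jetBase isExt_per p))) (k : Plane) :
    ⟪jetBase isExt_per p, H.linPart k p⟫_ℂ = 0 := by
  refine eq_zero_of_rotMom (m := fun k => ⟪jetBase isExt_per p, H.linPart k p⟫_ℂ)
    (fun k l => by simp only [linPart_add, add_apply, inner_add_right]) (fun k => ?_) k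
  rw [inner_eq_integral (perExt_ae_eq _).symm (linPart_ae_comm k p),
    inner_eq_integral (perExt_ae_eq _).symm (linPart_ae_comm (rotMom k) p),
    ← setIntegral_comp_rotPt]
  refine integral_congr_ae ?_
  filter_upwards [ae_restrict_of_ae he, ae_restrict_of_ae (comm_ell_rotPt hS hR hp he k)]
    with x h1 h2
  rw [h1, h2, map_mul]
  linear_combination (starRingEnd ℂ (perExt (jetBase isExt_per p) x) *
    H.comm (fun x => (ell (rotMom k) x : ℂ)) (perExt (jetBase isExt_per p))
        (fun i => perExt (jetFirst isExt_per i p)) x) * conj_mul_self_inv_τ_pow j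

/-- The gauged operators at `k` and `-k` are both symmetric; their difference is `2i L(k)`, so `i
L(k)` is symmetric too. -/
theorem linPart_antisymm (hH : IsSelfAdjoint H.planeOp) (hS : H.ShiftInvariant) (k : Plane)
    (p q : Jet isExt_per) :
    ⟪H.linPart k p, jetBase isExt_per q⟫_ℂ = -⟪jetBase isExt_per p, H.linPart k q⟫_ℂ := by
  have h1 := gaugedOp_symm hH hS k p q
  have h2 := gaugedOp_symm hH hS (-k) p q
  have e1 : H.linPart (-k) = -H.linPart k := by
    simp only [linPart, kap_neg, Complex.ofReal_neg, neg_smul, Finset.sum_neg_distrib]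
  have e2 : H.quadPart (-k) = H.quadPart k := by
    simp only [quadPart, kap_neg, Complex.ofReal_neg, neg_mul_neg]
  simp only [gaugedOp, e1, e2, add_apply, sub_apply, smul_apply, neg_apply, inner_add_left,
    inner_add_right, inner_sub_left, inner_sub_right, inner_smul_left, inner_smul_right,
    inner_neg_left, inner_neg_right, Complex.conj_I] at h1 h2
  have h3 : Complex.I * (⟪H.linPart k p, jetBase isExt_per q⟫_ℂ +
      ⟪jetBase isExt_per p, H.linPart k q⟫_ℂ) = 0 := by
    linear_combination (-1 / 2 : ℂ) * h1 + (1 / 2 : ℂ) * h2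
  exact eq_neg_of_add_eq_zero_left ((mul_eq_zero.1 h3).resolve_left Complex.I_ne_zero)

/-- Two periodic jets are complex conjugates of each other. -/
def ConjJets (p q : Jet isExt_per) : Prop :=
  perExt (jetBase isExt_per q) =ᵐ[volume] fun x => starRingEnd ℂ (perExt (jetBase isExt_per p) x)

theorem ConjJets.linPart_ae {p q : Jet isExt_per} (h : ConjJets p q) (k : Plane) :
    H.linPart k q =ᵐ[volume.restrict ΩH] fun x => starRingEnd ℂ (H.linPart k p x) := by
  have hj := isJet_jet isExt_per p
  have hj' : IsJet LocL2 (fun x => starRingEnd ℂ (perExt (jetBase isExt_per p) x))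
      (fun i x => starRingEnd ℂ (perExt (jetFirst isExt_per i p) x))
      (fun i j x => starRingEnd ℂ (perExt (jetSecond isExt_per i j p) x)) :=
    ⟨hj.base.conj, fun i => (hj.first i).conj, fun i j => (hj.second i j).conj,
      fun i => (hj.weak_first i).conj, fun i j => (hj.weak_second i j).conj⟩
  have h1 := ((isJet_jet isExt_per q).ae_eq hj' h).1
  filter_upwards [H.linPart_ae k p, H.linPart_ae k q, ae_restrict_of_ae h,
    ae_restrict_of_ae (h1 0), ae_restrict_of_ae (h1 1)] with x e1 e2 e3 e4 e5
  rw [e1, e2]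
  simp only [Fin.sum_univ_two, e3, e4, e5, map_add, map_mul, Complex.conj_ofReal]

/-- Since `L(k)` is real, both `⟪ū, L u⟫` and `⟪L ū, u⟫` equal the integral of `u L u`, while
antisymmetry makes them opposite. -/
theorem inner_linPart_conj (hH : IsSelfAdjoint H.planeOp) (hS : H.ShiftInvariant)
    {p q : Jet isExt_per} (h : ConjJets p q) (k : Plane) :
    ⟪jetBase isExt_per q, H.linPart k p⟫_ℂ = 0 := by
  have h1 := linPart_antisymm hH hS k q p
  have h2 : ⟪H.linPart k q, jetBase isExt_per p⟫_ℂ = ⟪jetBase isExt_per q, H.linPart k p⟫_ℂ := by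
    rw [inner_eq_integral (h.linPart_ae k) (perExt_ae_eq _).symm,
      inner_eq_integral ((perExt_ae_eq _).symm.trans (ae_restrict_of_ae h)) EventuallyEq.rfl]
    refine integral_congr_ae (Eventually.of_forall fun x => ?_)
    simp only [Complex.conj_conj]
    ring
  rw [h2] at h1
  linear_combination (1 / 2 : ℂ) * h1

theorem inner_linPart_conj' (hH : IsSelfAdjoint H.planeOp) (hS : H.ShiftInvariant)
    {p q : Jet isExt_per} (h : ConjJets p q) (k : Plane) :
    ⟪jetBase isExt_per p, H.linPart k q⟫_ℂ = 0 := by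
  have h1 := linPart_antisymm hH hS k p q
  rw [← inner_conj_symm, inner_linPart_conj hH hS h, map_zero] at h1
  exact neg_eq_zero.1 h1.symm

theorem exists_norm_parts_le (H : RealDiffOp) : ∃ C : ℝ, ∀ k,
    ‖H.linPart k‖ ≤ C * ‖k‖ ∧ ‖H.quadPart k‖ ≤ C * ‖k‖ ^ 2 := by
  set c := ‖coord 0‖ + ‖coord 1‖ with hc
  have hc0 : 0 ≤ c := by positivity
  set C₁ := ∑ i, c * ‖H.jetGrad isExt_per i‖ with hC₁
  set C₂ := ∑ i, ∑ j, c ^ 2 * ‖H.jetLead isExt_per i j‖ with hC₂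
  have h1 : 0 ≤ C₁ := Finset.sum_nonneg fun i _ => by positivity
  have h2 : 0 ≤ C₂ := Finset.sum_nonneg fun i _ => Finset.sum_nonneg fun j _ => by positivity
  have hk : ∀ k i, ‖(kap k i : ℂ)‖ ≤ c * ‖k‖ := fun k i => by
    rw [Complex.norm_real]
    exact abs_kap_le k i
  refine ⟨C₁ + C₂, fun k => ⟨?_, ?_⟩⟩
  · have : ‖H.linPart k‖ ≤ C₁ * ‖k‖ := by
      rw [linPart, hC₁, Finset.sum_mul]
      refine norm_sum_le_of_le _ fun i _ => ?_
      rw [norm_smul]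
      calc _ ≤ c * ‖k‖ * ‖H.jetGrad isExt_per i‖ :=
            mul_le_mul_of_nonneg_right (hk k i) (norm_nonneg _)
        _ = _ := by ring
    nlinarith [norm_nonneg k]
  · have : ‖H.quadPart k‖ ≤ C₂ * ‖k‖ ^ 2 := by
      rw [quadPart, hC₂, Finset.sum_mul]
      refine norm_sum_le_of_le _ fun i _ => ?_
      rw [Finset.sum_mul]
      refine norm_sum_le_of_le _ fun j _ => ?_
      rw [norm_smul]
      have h3 : ‖(kap k i * kap k j : ℂ)‖ ≤ c * ‖k‖ * (c * ‖k‖) := by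
        rw [norm_mul]
        exact mul_le_mul (hk k i) (hk k j) (norm_nonneg _) (by positivity)
      calc _ ≤ c * ‖k‖ * (c * ‖k‖) * ‖H.jetLead isExt_per i j‖ :=
            mul_le_mul_of_nonneg_right h3 (norm_nonneg _)
        _ = _ := by ring
    nlinarith [sq_nonneg ‖k‖]

/-! ### Eigenfunctions -/

/-- `u` is a lattice periodic eigenfunction with `R u = τ⁻ʲ u`. -/
structure IsEigen (H : RealDiffOp) (l : ℂ) (j : Fin 3) (u : Plane → ℂ) : Prop where
  bloch : IsBloch 0 u
  equivariant : IsEquivariant j u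
  maps : H.Maps LocL2 u (l • u)

theorem IsEigen.exists_restr {l : ℂ} {j : Fin 3} {u : Plane → ℂ} (h : H.IsEigen l j u) :
    ∃ φ ∈ eigenspaceOf (H.quotOp j) l, φ =ᵐ[volume.restrict ΩR] u := by
  obtain ⟨d₁, d₂, hj, -⟩ := id h.maps
  have hm : MemLp u 2 (volume.restrict ΩR) :=
    (hj.base ΩH isCompact_ΩH).mono_measure (Measure.restrict_mono ΩR_subset_ΩH le_rfl)
  refine ⟨hm.toLp _, ?_, hm.coeFn_toLp⟩
  change (_, _) ∈ (H.quotOp j).graph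
  rw [graph_quotOp]
  exact ⟨u, _, ⟨h.bloch, h.equivariant⟩, h.maps, hm.coeFn_toLp, coe_smul_ae l hm.coeFn_toLp⟩

theorem ae_eq_of_ae_eq_ΩR {j : Fin 3} {u v : Plane → ℂ} (hu : IsBloch 0 u) (hu' : IsEquivariant j u)
    (hv : IsBloch 0 v) (hv' : IsEquivariant j v) (h : u =ᵐ[volume.restrict ΩR] v) :
    u =ᵐ[volume] v := by
  have h1 := (hu.add (hv.smul (-1))).ae_zero ((hu'.add (hv'.smul (-1))).ae_zero (by
    filter_upwards [h] with x hx
    simp [hx]))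
  filter_upwards [h1] with x hx
  simp only [Pi.add_apply, Pi.smul_apply, smul_eq_mul] at hx
  linear_combination hx

theorem exists_isEigen (hS : H.ShiftInvariant) (hR : H.RotInvariant) {l : ℂ} {j : Fin 3} {φ : L2 ΩR}
    (hφ : φ ∈ eigenspaceOf (H.quotOp j) l) :
    ∃ u, H.IsEigen l j u ∧ φ =ᵐ[volume.restrict ΩR] u := by
  change (φ, l • φ) ∈ (H.quotOp j).graph at hφ
  rw [graph_quotOp] at hφ
  obtain ⟨u, g, ⟨hu, hu'⟩, hM, h1, h2⟩ := hφ
  refine ⟨u, ⟨hu, hu', hM.congr EventuallyEq.rfl ?_⟩, h1⟩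
  exact ae_eq_of_ae_eq_ΩR (IsBloch.of_maps hS hu hM) (hu'.of_maps hR hM) (hu.smul l) (hu'.smul l)
    (h2.symm.trans (coe_smul_ae l h1))

theorem IsEigen.ae_zero_of_multOf {l : ℂ} {j : Fin 3} (h0 : multOf (H.quotOp j) l = 0)
    {u : Plane → ℂ} (hu : H.IsEigen l j u) : u =ᵐ[volume] 0 := by
  obtain ⟨φ, hφ, h1⟩ := hu.exists_restr
  rw [multOf, rank_zero_iff_forall_zero] at h0
  have h2 : φ = 0 := congrArg Subtype.val (h0 ⟨φ, hφ⟩)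
  rw [h2] at h1
  exact ae_eq_of_ae_eq_ΩR hu.bloch hu.equivariant (IsBloch.zero 0) (IsEquivariant.zero j)
    (h1.symm.trans (Lp.coeFn_zero _ _ _))

theorem exists_isEigen_of_multOf (hS : H.ShiftInvariant) (hR : H.RotInvariant) {l : ℂ} {j : Fin 3}
    (h1 : multOf (H.quotOp j) l = 1) : ∃ ψ, H.IsEigen l j ψ ∧ ¬ ψ =ᵐ[volume] 0 ∧
      ∀ u, H.IsEigen l j u → ∃ c : ℂ, u =ᵐ[volume] c • ψ := by
  rw [multOf, rank_eq_one_iff] at h1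
  obtain ⟨⟨φ, hφ⟩, hne, hall⟩ := h1
  obtain ⟨ψ, hψ, hφψ⟩ := exists_isEigen hS hR hφ
  refine ⟨ψ, hψ, fun h0 => hne ?_, fun u hu => ?_⟩
  · refine Subtype.ext ?_
    rw [Submodule.coe_zero, Lp.eq_zero_iff_ae_eq_zero]
    exact hφψ.trans (ae_restrict_of_ae h0)
  · obtain ⟨ρ, hρ, hρu⟩ := hu.exists_restr
    obtain ⟨c, hc⟩ := hall ⟨ρ, hρ⟩
    have hc' : c • φ = ρ := congrArg Subtype.val hc
    refine ⟨c, ae_eq_of_ae_eq_ΩR hu.bloch hu.equivariant (hψ.bloch.smul c) (hψ.equivariant.smul c) ?_⟩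
    have h2 := coe_smul_ae c hφψ
    rw [hc'] at h2
    exact hρu.symm.trans h2

theorem IsEigen.conj {l : ℝ} {j : Fin 3} {u : Plane → ℂ} (h : H.IsEigen l j u) :
    H.IsEigen l (-j) fun x => starRingEnd ℂ (u x) :=
  ⟨isBloch_conj h.bloch, isEquivariant_conj h.equivariant, h.maps.conj.congr EventuallyEq.rfl
    (Eventually.of_forall fun x => by simp)⟩

theorem IsEigen.smul {l : ℂ} {j : Fin 3} {u : Plane → ℂ} (h : H.IsEigen l j u) (c : ℂ) :
    H.IsEigen l j (c • u) :=
  ⟨h.bloch.smul c, h.equivariant.smul c, by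
    have := h.maps.smul isLinClass_locL2 c
    rwa [smul_comm] at this⟩

theorem IsEigen.exists_jet (hS : H.ShiftInvariant) {l : ℂ} {j : Fin 3} {u : Plane → ℂ}
    (h : H.IsEigen l j u) : ∃ p : Jet isExt_per, perExt (jetBase isExt_per p) =ᵐ[volume] u ∧
      H.jetOp isExt_per p = l • jetBase isExt_per p := by
  obtain ⟨d₁, d₂, hj, -⟩ := id h.maps
  obtain ⟨p, hp⟩ := exists_jet_per hj h.bloch
  refine ⟨p, hp, Lp.ext ?_⟩
  filter_upwards [perExt_ae_eq (H.jetOp isExt_per p), ae_restrict_of_ae ((maps_jet hS p).unique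
    h.maps hp), coe_smul_ae l (perExt_ae_eq (jetBase isExt_per p)).symm, ae_restrict_of_ae hp]
    with x h1 h2 h3 h4
  rw [← h1, h2, h3, Pi.smul_apply, smul_eq_mul, h4]

theorem isEquivariant_congr {j : Fin 3} {u v : Plane → ℂ} (hu : IsEquivariant j u)
    (h : u =ᵐ[volume] v) : IsEquivariant j v := by
  filter_upwards [hu, h, measurePreserving_rotPt.quasiMeasurePreserving.ae h] with x h1 h2 h3
  rw [← h2, ← h3, h1]

theorem isEigen_rotProj (hS : H.ShiftInvariant) (hR : H.RotInvariant) {l : ℂ} {p : Jet isExt_per}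
    (hp : H.jetOp isExt_per p = l • jetBase isExt_per p) (j : Fin 3) :
    H.IsEigen l j (rotProj j (perExt (jetBase isExt_per p))) := by
  refine ⟨(isBloch_perExt _).rotProj j, isEquivariant_rotProj j _, ?_⟩
  have hM := maps_jet hS p
  rw [hp] at hM
  have h1 := (hM.congr EventuallyEq.rfl (isExt_per.smul _ _)).rotProj hR j
  refine h1.congr EventuallyEq.rfl (Eventually.of_forall fun x => ?_)
  simp only [rotProj, Pi.smul_apply, smul_eq_mul]
  ring

/-- Simplicity gives one eigenfunction in the component `1`. Its conjugate is taken as the second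
vector, which is what makes the off-diagonal elements of `L(k)` accessible. The component `0` of any
eigenfunction vanishes by hypothesis. -/
theorem exists_eigenjets (hS : H.ShiftInvariant) (hR : H.RotInvariant) {l₀ : ℝ}
    (h1 : multOf (H.quotOp 1) l₀ = 1) (h0 : multOf (H.quotOp 0) l₀ = 0) :
    ∃ n : Fin 2 → Jet isExt_per, (∀ i, H.jetOp isExt_per (n i) = (l₀ : ℂ) • jetBase isExt_per (n i)) ∧
      (∀ i, ‖jetBase isExt_per (n i)‖ = 1) ∧
      IsEquivariant 1 (perExt (jetBase isExt_per (n 0))) ∧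
      IsEquivariant 2 (perExt (jetBase isExt_per (n 1))) ∧ ConjJets (n 0) (n 1) ∧
      ∀ p, H.jetOp isExt_per p = (l₀ : ℂ) • jetBase isExt_per p →
        p ∈ Submodule.span ℂ (Set.range n) := by
  obtain ⟨ψ, hψ, hne, hall⟩ := exists_isEigen_of_multOf hS hR h1
  obtain ⟨p, hp, hpe⟩ := hψ.exists_jet hS
  have hp0 : jetBase isExt_per p ≠ 0 := fun h => hne (by
    rw [h] at hp
    exact hp.symm.trans isExt_per.zero)
  have hnorm : ‖jetBase isExt_per p‖ ≠ 0 := norm_ne_zero_iff.2 hp0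
  set c : ℂ := (‖jetBase isExt_per p‖ : ℂ)⁻¹ with hc
  have hc0 : c ≠ 0 := by simpa [hc] using hp0
  obtain ⟨n₀, h₀, h₀e⟩ := (hψ.smul c).exists_jet hS
  obtain ⟨n₁, h₁, h₁e⟩ := (hψ.smul c).conj.exists_jet hS
  have hconj : ConjJets n₀ n₁ := by
    filter_upwards [h₀, h₁] with x e0 e1
    rw [e0, e1]
  have hn0 : jetBase isExt_per n₀ = c • jetBase isExt_per p := by
    refine Lp.ext ?_
    filter_upwards [perExt_ae_eq (jetBase isExt_per n₀), ae_restrict_of_ae h₀,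
      coe_smul_ae c (perExt_ae_eq (jetBase isExt_per p)).symm, ae_restrict_of_ae hp]
      with x e1 e2 e3 e4
    rw [← e1, e2, e3, Pi.smul_apply, smul_eq_mul, e4]
  have hn0' : ‖jetBase isExt_per n₀‖ = 1 := by
    rw [hn0, norm_smul, hc, norm_inv, Complex.norm_real, norm_norm, inv_mul_cancel₀ hnorm]
  have hn1 : jetBase isExt_per n₁ = conjL2 ΩH (jetBase isExt_per n₀) := by
    refine Lp.ext ?_
    filter_upwards [perExt_ae_eq (jetBase isExt_per n₁), ae_restrict_of_ae hconj,
      conjL2_ae (perExt_ae_eq (jetBase isExt_per n₀)).symm] with x e1 e2 e3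
    rw [← e1, e2, e3]
  refine ⟨![n₀, n₁], fun i => ?_, fun i => ?_, isEquivariant_congr (hψ.smul c).equivariant h₀.symm,
    isEquivariant_congr (hψ.smul c).conj.equivariant h₁.symm, hconj, fun q hq => ?_⟩
  · fin_cases i
    · exact h₀e
    · exact h₁e
  · fin_cases i
    · exact hn0'
    · change ‖jetBase isExt_per n₁‖ = 1
      rw [hn1, LinearIsometryEquiv.norm_map, hn0']
  · have hz := (isEigen_rotProj hS hR hq 0).ae_zero_of_multOf h0
    obtain ⟨c₁, hc₁⟩ := hall _ (isEigen_rotProj hS hR hq 1)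
    -- The conjugate of a function in the component `2` is in the component `-2 = 1`, so it is a
    -- multiple of `ψ`.
    obtain ⟨c₂, hc₂⟩ := hall _ (isEigen_rotProj hS hR hq 2).conj
    have hq' : q = (c₁ / c) • n₀ + (starRingEnd ℂ (c₂ / c)) • n₁ := by
      refine jetBase_injective isExt_per (Lp.ext ?_)
      rw [map_add, map_smul, map_smul]
      filter_upwards [perExt_ae_eq (jetBase isExt_per q), ae_restrict_of_ae hz,
        ae_restrict_of_ae hc₁, ae_restrict_of_ae hc₂,
        coe_add_ae (coe_smul_ae (c₁ / c) (perExt_ae_eq (jetBase isExt_per n₀)).symm)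
          (coe_smul_ae (starRingEnd ℂ (c₂ / c)) (perExt_ae_eq (jetBase isExt_per n₁)).symm),
        ae_restrict_of_ae h₀, ae_restrict_of_ae h₁] with x e1 e2 e3 e4 e5 e6 e7
      have e8 : rotProj 2 (perExt (jetBase isExt_per q)) x = starRingEnd ℂ (c₂ * ψ x) := by
        rw [← smul_eq_mul, ← Pi.smul_apply, ← e4, Complex.conj_conj]
      rw [e5, e6, e7, ← e1, ← sum_rotProj (perExt (jetBase isExt_per q)) x, Fin.sum_univ_three, e2, e3, e8]
      simp only [Pi.zero_apply, Pi.smul_apply, smul_eq_mul, ← map_mul, zero_add]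
      rw [← mul_assoc, ← mul_assoc, div_mul_cancel₀ _ hc0, div_mul_cancel₀ _ hc0]
    rw [hq']
    exact Submodule.add_mem _
      (Submodule.smul_mem _ _ (Submodule.subset_span ⟨0, rfl⟩))
      (Submodule.smul_mem _ _ (Submodule.subset_span ⟨1, rfl⟩))

/-- Of the four matrix elements of the first order term, the diagonal ones vanish by rotation and
the off-diagonal ones by conjugation. -/
theorem locallyFlat_blochOp (hH : IsSelfAdjoint H.planeOp) (hS : H.ShiftInvariant)
    (hR : H.RotInvariant) {l₀ : ℝ} (h1 : multOf (H.quotOp 1) l₀ = 1)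
    (h0 : multOf (H.quotOp 0) l₀ = 0) :
    LocallyFlat (fun k l => multOf (H.blochOp k) l) l₀ := by
  obtain ⟨n, hker, hnorm, he0, he1, hconj, hspan⟩ := exists_eigenjets hS hR h1 h0
  obtain ⟨C, hC⟩ := H.exists_norm_parts_le
  simp only [multOf_blochOp hS]
  have h01 : ⟪jetBase isExt_per (n 0), jetBase isExt_per (n 1)⟫_ℂ = 0 := by
    rw [inner_eq_integral (perExt_ae_eq _).symm (perExt_ae_eq _).symm]
    refine setIntegral_eq_zero_of_rotPt
      (conj_inv_mul_inv_ne_one (show (1 : Fin 3) ≠ 2 by decide)) (ae_restrict_of_ae ?_)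
    filter_upwards [he0, he1] with x e1 e2
    rw [e1, e2, map_mul]
    ring
  refine locallyFlat_of_expansion (L := H.linPart) (Q := H.quadPart) (z := Complex.I)
    (fun k u v => gaugedOp_symm hH hS k u v) (jetBase_injective isExt_per) ⟨hnorm, fun i j hij => ?_⟩
    (fun i => by rw [gaugedOp_zero]; exact hker i) (fun u hu => hspan u (by rwa [← gaugedOp_zero]))
    isCompactOperator_jetBase (by rw [gaugedOp_zero]; exact bijective_jetOp_per hH hS (by simp))
    (fun k => by rw [gaugedOp_zero]; rfl) (fun k => (hC k).1) (fun k => (hC k).2) fun k i j => ?_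
  · fin_cases i <;> fin_cases j
    · exact absurd rfl hij
    · exact h01
    · exact inner_eq_zero_symm.1 h01
    · exact absurd rfl hij
  · fin_cases i <;> fin_cases j
    · exact inner_linPart_self hS hR (hker 0) he0 k
    · exact inner_linPart_conj' hH hS hconj k
    · exact inner_linPart_conj hH hS hconj k
    · exact inner_linPart_self hS hR (hker 1) he1 k

end RealDiffOp

/-! ### Reduction to the period cell -/

/-- The translate of a point that lies in the period cell spanned by `a₁` and `a₂`. -/
def reduce (x : Plane) : Plane := x + latt (-⌊coord 0 x⌋) (-⌊coord 1 x⌋)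

theorem coord_zero_reduce (x : Plane) : coord 0 (reduce x) = Int.fract (coord 0 x) := by
  rw [reduce, map_add, coord_zero_latt, Int.fract]
  push_cast
  ring

theorem coord_one_reduce (x : Plane) : coord 1 (reduce x) = Int.fract (coord 1 x) := by
  rw [reduce, map_add, coord_one_latt, Int.fract]
  push_cast
  ring

theorem reduce_add_latt (x : Plane) (n₁ n₂ : ℤ) : reduce (x + latt n₁ n₂) = reduce x :=
  coord_ext (by simp only [coord_zero_reduce, map_add, coord_zero_latt, Int.fract_add_intCast])
    (by simp only [coord_one_reduce, map_add, coord_one_latt, Int.fract_add_intCast])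

theorem reduce_reduce (x : Plane) : reduce (reduce x) = reduce x := reduce_add_latt _ _ _

theorem reduce_rotPt_reduce (x : Plane) : reduce (rotPt (reduce x)) = reduce (rotPt x) := by
  rw [reduce.eq_1 x, rotPt_add_latt, reduce_add_latt]

theorem bijective_rotPt : Function.Bijective rotPt :=
  ⟨rotIso.injective, fun x => ⟨rotPt (rotPt x), rotPt_rotPt_rotPt x⟩⟩

namespace GraphOp

variable {G : GraphOp}

theorem ShiftInvariant.mem_iff (hS : G.ShiftInvariant) (x : Plane) (n₁ n₂ : ℤ) :
    x + latt n₁ n₂ ∈ G.V ↔ x ∈ G.V := (hS n₁ n₂).1 x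

theorem ShiftInvariant.reduce_mem_iff (hS : G.ShiftInvariant) (x : Plane) :
    reduce x ∈ G.V ↔ x ∈ G.V := hS.mem_iff _ _ _

theorem mem_periodCell_iff (x : Plane) :
    x ∈ {x : Plane | ∃ s ∈ Set.Ico (0 : ℝ) 1, ∃ t ∈ Set.Ico (0 : ℝ) 1, x = s • a₁ + t • a₂} ↔
      coord 0 x ∈ Set.Ico (0 : ℝ) 1 ∧ coord 1 x ∈ Set.Ico (0 : ℝ) 1 := by
  constructor
  · rintro ⟨s, hs, t, ht, rfl⟩
    rw [coord_zero_comb, coord_one_comb]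
    exact ⟨hs, ht⟩
  · rintro ⟨hs, ht⟩
    exact ⟨_, hs, _, ht, eq_comb x⟩

theorem finite_periodCell (G : GraphOp) :
    (G.V ∩ {x | ∃ s ∈ Set.Ico (0 : ℝ) 1, ∃ t ∈ Set.Ico (0 : ℝ) 1, x = s • a₁ + t • a₂}).Finite := by
  refine (G.locallyFinite (1 * (‖a₁‖ + ‖a₂‖))).subset fun x hx => ⟨hx.1, ?_⟩
  obtain ⟨h0, h1⟩ := (mem_periodCell_iff x).1 hx.2
  rw [mem_closedBall_zero_iff]
  refine norm_le_of_abs_coord_le fun i => ?_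
  fin_cases i
  · exact abs_le.2 ⟨neg_one_lt_zero.le.trans h0.1, h0.2.le⟩
  · exact abs_le.2 ⟨neg_one_lt_zero.le.trans h1.1, h1.2.le⟩

/-- The vertices in the period cell. -/
def cell (G : GraphOp) : Finset Plane := G.finite_periodCell.toFinset

theorem mem_cell_iff (x : Plane) : x ∈ G.cell ↔ x ∈ G.V ∧ reduce x = x := by
  rw [cell, Set.Finite.mem_toFinset, Set.mem_inter_iff, mem_periodCell_iff]
  refine and_congr_right fun _ => ⟨fun h => coord_ext ?_ ?_, fun h => ?_⟩
  · rw [coord_zero_reduce, Int.fract_eq_self.2 ⟨h.1.1, h.1.2⟩]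
  · rw [coord_one_reduce, Int.fract_eq_self.2 ⟨h.2.1, h.2.2⟩]
  · rw [← h, coord_zero_reduce, coord_one_reduce]
    exact ⟨⟨Int.fract_nonneg _, Int.fract_lt_one _⟩, Int.fract_nonneg _, Int.fract_lt_one _⟩

theorem reduce_mem_cell_iff (hS : G.ShiftInvariant) (x : Plane) : reduce x ∈ G.cell ↔ x ∈ G.V := by
  rw [mem_cell_iff, hS.reduce_mem_iff, reduce_reduce]
  exact and_iff_left rfl

theorem cellInner_eq_sum (f g : Plane → ℂ) :
    G.cellInner f g = ∑ x ∈ G.cell, starRingEnd ℂ (f x) * g x :=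
  finsum_mem_eq_finite_toFinset_sum _ G.finite_periodCell

theorem apply_reduce {F : Plane → ℂ} (hF : ∀ (n₁ n₂ : ℤ) x, F (x + latt n₁ n₂) = F x) (x : Plane) :
    F (reduce x) = F x := hF _ _ _

/-- The rotation does not preserve the parallelogram, but followed by `reduce` it permutes the
vertices in it, with order dividing three. -/
theorem sum_cell_rotPt (hS : G.ShiftInvariant) (hR : G.RotInvariant) {F : Plane → ℂ}
    (hF : ∀ (n₁ n₂ : ℤ) x, F (x + latt n₁ n₂) = F x) :
    ∑ x ∈ G.cell, F (rotPt x) = ∑ x ∈ G.cell, F x := by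
  have hmem : ∀ x ∈ G.cell, reduce (rotPt x) ∈ G.cell := fun x hx => by
    rw [reduce_mem_cell_iff hS, hR.1]
    exact ((mem_cell_iff x).1 hx).1
  have hrot : ∀ x ∈ G.cell, reduce (rotPt (reduce (rotPt (reduce (rotPt x))))) = x := fun x hx => by
    rw [reduce_rotPt_reduce, ← reduce_rotPt_reduce, reduce_rotPt_reduce (rotPt x),
      reduce_rotPt_reduce, rotPt_rotPt_rotPt]
    exact ((mem_cell_iff x).1 hx).2
  refine Finset.sum_nbij' (fun x => reduce (rotPt x)) (fun x => reduce (rotPt (reduce (rotPt x))))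
    hmem (fun x hx => hmem _ (hmem _ hx)) hrot (fun x hx => hrot x hx) fun x _ => ?_
  rw [apply_reduce hF]

theorem sum_cell_eq_zero (hS : G.ShiftInvariant) (hR : G.RotInvariant) {F : Plane → ℂ} {c : ℂ}
    (hc : c ≠ 1) (hF : ∀ (n₁ n₂ : ℤ) x, F (x + latt n₁ n₂) = F x)
    (h : ∀ x, F (rotPt x) = c * F x) : ∑ x ∈ G.cell, F x = 0 := by
  have h1 := sum_cell_rotPt hS hR hF
  simp only [h] at h1
  rw [← Finset.mul_sum] at h1
  have : (c - 1) * ∑ x ∈ G.cell, F x = 0 := by linear_combination h1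
  exact (mul_eq_zero.1 this).resolve_left (sub_ne_zero.2 hc)

/-- The neighbours of a vertex. -/
def nbr (G : GraphOp) (v : Plane) : Finset Plane := (G.finiteDegree v).toFinset

theorem mem_nbr {u v : Plane} : u ∈ G.nbr v ↔ G.m v u ≠ 0 := Set.Finite.mem_toFinset _

theorem apply_eq_sum (f : Plane → ℂ) (v : Plane) :
    G.apply f v = ∑ u ∈ G.nbr v, (G.m v u : ℂ) * (f v - f u) + (G.q v : ℂ) * f v := by
  rw [apply, finsum_eq_sum_of_support_subset _ (s := G.nbr v)]
  intro u hu
  rw [Finset.mem_coe, mem_nbr]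
  exact fun h0 => hu (by simp [h0])

/-- Summation over the edges that start in the period cell is symmetric. -/
theorem sum_edges_comm (hS : G.ShiftInvariant) {K : Plane → Plane → ℂ}
    (hK : ∀ (n₁ n₂ : ℤ) v u, K (v + latt n₁ n₂) (u + latt n₁ n₂) = K v u) :
    ∑ v ∈ G.cell, ∑ u ∈ G.nbr v, K v u = ∑ v ∈ G.cell, ∑ u ∈ G.nbr v, K u v := by
  have hm : ∀ (n₁ n₂ : ℤ) v u, G.m (v + latt n₁ n₂) (u + latt n₁ n₂) = G.m v u :=
    fun n₁ n₂ => (hS n₁ n₂).2.1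
  -- Reverse the edge and shift it so that it starts in the cell again; this is an involution on the
  -- edges that start in the cell.
  set σ : (_ : Plane) × Plane → (_ : Plane) × Plane := fun p =>
    ⟨reduce p.2, p.1 + latt (-⌊coord 0 p.2⌋) (-⌊coord 1 p.2⌋)⟩ with hσ
  have hmem : ∀ p ∈ G.cell.sigma G.nbr, σ p ∈ G.cell.sigma G.nbr := by
    rintro ⟨v, u⟩ hp
    rw [Finset.mem_sigma, mem_nbr] at hp ⊢
    refine ⟨(reduce_mem_cell_iff hS u).2 (G.m_support _ _ hp.2).2, ?_⟩
    change G.m (reduce u) _ ≠ 0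
    rw [reduce, hm, G.m_symm]
    exact hp.2
  have hinv : ∀ p ∈ G.cell.sigma G.nbr, σ (σ p) = p := by
    rintro ⟨v, u⟩ hp
    have hv := ((mem_cell_iff v).1 (Finset.mem_sigma.1 hp).1).2
    set n₁ := -⌊coord 0 u⌋
    set n₂ := -⌊coord 1 u⌋
    have h1 : reduce (v + latt n₁ n₂) = v := by rw [reduce_add_latt, hv]
    have h2 : latt (-⌊coord 0 (v + latt n₁ n₂)⌋) (-⌊coord 1 (v + latt n₁ n₂)⌋) = -latt n₁ n₂ := by
      rw [reduce] at h1
      have : v + (latt n₁ n₂ +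
        latt (-⌊coord 0 (v + latt n₁ n₂)⌋) (-⌊coord 1 (v + latt n₁ n₂)⌋)) = v := by
        rw [← add_assoc]
        exact h1
      rw [add_eq_left] at this
      exact eq_neg_of_add_eq_zero_right this
    change (⟨reduce (v + latt n₁ n₂), reduce u + latt (-⌊coord 0 (v + latt n₁ n₂)⌋)
      (-⌊coord 1 (v + latt n₁ n₂)⌋)⟩ : (_ : Plane) × Plane) = ⟨v, u⟩
    rw [h1, h2]
    have : reduce u + -latt n₁ n₂ = u := by
      rw [reduce, add_neg_cancel_right]
    rw [this]
  rw [Finset.sum_sigma', Finset.sum_sigma']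
  refine Finset.sum_nbij' σ σ hmem hmem hinv hinv ?_
  rintro ⟨v, u⟩ -
  exact (hK _ _ v u).symm

/-! ### Invariant subspaces -/

theorem sum_nbr_comp {S : Plane → Plane} (hS : G.InvariantUnder S) (hb : Function.Bijective S)
    (v : Plane) (φ : Plane → ℂ) : ∑ u ∈ G.nbr (S v), φ u = ∑ u ∈ G.nbr v, φ (S u) := by
  refine (Finset.sum_bij (fun u _ => S u) (fun u hu => ?_) (fun u _ w _ h => hb.1 h)
    (fun w hw => ?_) fun _ _ => rfl).symm
  · rw [mem_nbr] at hu ⊢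
    rwa [hS.2.1]
  · obtain ⟨u, rfl⟩ := hb.2 w
    refine ⟨u, ?_, rfl⟩
    rw [mem_nbr] at hw ⊢
    rwa [hS.2.1] at hw

/-- The potential is invariant only at vertices, so elsewhere the vanishing of `f` is used. -/
theorem apply_comp {S : Plane → Plane} (hS : G.InvariantUnder S) (hb : Function.Bijective S)
    {f : Plane → ℂ} (hf : ∀ x, x ∉ G.V → f x = 0) (v : Plane) :
    G.apply (fun x => f (S x)) v = G.apply f (S v) := by
  rw [apply_eq_sum, apply_eq_sum, sum_nbr_comp hS hb]
  simp only [hS.2.1]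
  by_cases hv : v ∈ G.V
  · rw [hS.2.2 v hv]
  · rw [hf (S v) (fun h => hv ((hS.1 v).1 h)), mul_zero, mul_zero]

/-- The operator as a linear map. -/
def applyₗ (G : GraphOp) : (Plane → ℂ) →ₗ[ℂ] (Plane → ℂ) where
  toFun := G.apply
  map_add' f g := by
    ext v
    simp only [apply_eq_sum, Pi.add_apply, mul_add, mul_sub, Finset.sum_sub_distrib,
      Finset.sum_add_distrib]
    ring
  map_smul' z f := by
    ext v
    simp only [apply_eq_sum, Pi.smul_apply, smul_eq_mul, RingHom.id_apply, mul_add, Finset.mul_sum]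
    congr 1
    · exact Finset.sum_congr rfl fun u _ => by ring
    · ring

theorem apply_smul (z : ℂ) (f : Plane → ℂ) : G.apply (z • f) = z • G.apply f :=
  map_smul G.applyₗ z f

theorem apply_eq_zero {f : Plane → ℂ} (hf : ∀ x, x ∉ G.V → f x = 0) {v : Plane} (hv : v ∉ G.V) :
    G.apply f v = 0 := by
  rw [apply_eq_sum, hf v hv, mul_zero, add_zero]
  refine Finset.sum_eq_zero fun u hu => ?_
  exact absurd (G.m_support _ _ (mem_nbr.1 hu)).1 hv

theorem bijective_shift (n₁ n₂ : ℤ) : Function.Bijective fun x : Plane => x + latt n₁ n₂ :=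
  (Equiv.addRight (latt n₁ n₂)).bijective

theorem apply_mem_bloch (hS : G.ShiftInvariant) {k : Plane} {f : Plane → ℂ} (hf : f ∈ G.bloch k) :
    G.apply f ∈ G.bloch k := by
  refine ⟨fun x hx => apply_eq_zero hf.1 hx, fun n₁ n₂ x => ?_⟩
  rw [← apply_comp (hS n₁ n₂) (bijective_shift n₁ n₂) hf.1]
  have : (fun x => f (x + latt n₁ n₂)) = phase k n₁ n₂ • f := funext fun x => hf.2 n₁ n₂ x
  rw [this, apply_smul]
  rfl

theorem apply_mem_isotypic (hS : G.ShiftInvariant) (hR : G.RotInvariant) {j : Fin 3} {f : Plane → ℂ}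
    (hf : f ∈ G.isotypic j) : G.apply f ∈ G.isotypic j := by
  refine ⟨apply_mem_bloch hS hf.1, fun x => ?_⟩
  rw [← apply_comp hR bijective_rotPt hf.1.1]
  have : (fun x => f (rotPt x)) = (τ ^ (j : ℕ))⁻¹ • f := funext hf.2
  rw [this, apply_smul]
  rfl

theorem comp_rotPt_mem_bloch (hR : G.RotInvariant) {f : Plane → ℂ} (hf : f ∈ G.bloch 0) :
    (fun x => f (rotPt x)) ∈ G.bloch 0 := by
  refine ⟨fun x hx => hf.1 _ fun h => hx ((hR.1 x).1 h), fun n₁ n₂ x => ?_⟩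
  change f (rotPt (x + latt n₁ n₂)) = _
  rw [rotPt_add_latt, hf.2, phase_zero, phase_zero]

theorem rotProj_mem_isotypic (hR : G.RotInvariant) {f : Plane → ℂ} (hf : f ∈ G.bloch 0) (j : Fin 3) :
    rotProj j f ∈ G.isotypic j := by
  refine ⟨?_, rotProj_rotPt j f⟩
  rw [rotProj_eq]
  have h1 := comp_rotPt_mem_bloch hR hf
  exact Submodule.smul_mem _ _ (Submodule.add_mem _ (Submodule.add_mem _ hf
    (Submodule.smul_mem _ _ h1)) (Submodule.smul_mem _ _ (comp_rotPt_mem_bloch hR h1)))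

theorem mem_bloch_zero_iff (hR : G.RotInvariant) (f : Plane → ℂ) : f ∈ G.bloch 0 ↔
    ∃ g : Fin 3 → Plane → ℂ, (∀ j, g j ∈ G.isotypic j) ∧ f = ∑ j, g j := by
  constructor
  · intro hf
    refine ⟨fun j => rotProj j f, rotProj_mem_isotypic hR hf, funext fun x => ?_⟩
    rw [Finset.sum_apply, sum_rotProj]
  · rintro ⟨g, hg, rfl⟩
    exact Submodule.sum_mem _ fun j _ => (hg j).1

theorem bloch_zero_periodic {f : Plane → ℂ} (hf : f ∈ G.bloch 0) (n₁ n₂ : ℤ) (x : Plane) :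
    f (x + latt n₁ n₂) = f x := by
  rw [hf.2, phase_zero, one_mul]

theorem cellInner_eq_zero (hS : G.ShiftInvariant) (hR : G.RotInvariant) {i j : Fin 3} (hij : i ≠ j)
    {f g : Plane → ℂ} (hf : f ∈ G.isotypic i) (hg : g ∈ G.isotypic j) : G.cellInner f g = 0 := by
  rw [cellInner_eq_sum]
  refine sum_cell_eq_zero hS hR (F := fun x => starRingEnd ℂ (f x) * g x)
    (conj_inv_mul_inv_ne_one hij) (fun n₁ n₂ x => ?_) fun x => ?_
  · simp only [bloch_zero_periodic hf.1, bloch_zero_periodic hg.1]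
  · simp only [hf.2, hg.2, map_mul]
    ring

/-! ### Symmetry -/

/-- The products `conj (f v) * g u` of Bloch functions are invariant under shifts. -/
theorem conj_mul_shift {k : Plane} {f g : Plane → ℂ} (hf : f ∈ G.bloch k) (hg : g ∈ G.bloch k)
    (n₁ n₂ : ℤ) (v u : Plane) :
    starRingEnd ℂ (f (v + latt n₁ n₂)) * g (u + latt n₁ n₂) = starRingEnd ℂ (f v) * g u := by
  rw [hf.2, hg.2, map_mul]
  linear_combination (starRingEnd ℂ (f v) * g u) * conj_phase_mul k n₁ n₂

/-- The diagonal terms agree because `m` and `q` are real; the terms across edges are exchanged by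
`sum_edges_comm`. -/
theorem cellInner_apply_comm (hS : G.ShiftInvariant) {k : Plane} {f g : Plane → ℂ}
    (hf : f ∈ G.bloch k) (hg : g ∈ G.bloch k) :
    G.cellInner (G.apply f) g = G.cellInner f (G.apply g) := by
  have h := sum_edges_comm hS (K := fun v u => (G.m v u : ℂ) * (starRingEnd ℂ (f u) * g v))
    fun n₁ n₂ v u => by rw [(hS n₁ n₂).2.1, conj_mul_shift hf hg]
  have hl : G.cellInner (G.apply f) g = ∑ v ∈ G.cell, (∑ u ∈ G.nbr v,
      (G.m v u : ℂ) * (starRingEnd ℂ (f v) * g v) + (G.q v : ℂ) * (starRingEnd ℂ (f v) * g v)) -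
      ∑ v ∈ G.cell, ∑ u ∈ G.nbr v, (G.m v u : ℂ) * (starRingEnd ℂ (f u) * g v) := by
    rw [cellInner_eq_sum, ← Finset.sum_sub_distrib]
    refine Finset.sum_congr rfl fun v _ => ?_
    simp only [apply_eq_sum, map_add, map_sum, map_mul, map_sub, Complex.conj_ofReal, add_mul,
      Finset.sum_mul]
    rw [add_sub_right_comm, ← Finset.sum_sub_distrib]
    congr 1
    · exact Finset.sum_congr rfl fun u _ => by ring
    · ring
  have hr : G.cellInner f (G.apply g) = ∑ v ∈ G.cell, (∑ u ∈ G.nbr v,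
      (G.m v u : ℂ) * (starRingEnd ℂ (f v) * g v) + (G.q v : ℂ) * (starRingEnd ℂ (f v) * g v)) -
      ∑ v ∈ G.cell, ∑ u ∈ G.nbr v, (G.m u v : ℂ) * (starRingEnd ℂ (f v) * g u) := by
    rw [cellInner_eq_sum, ← Finset.sum_sub_distrib]
    refine Finset.sum_congr rfl fun v _ => ?_
    simp only [apply_eq_sum, mul_add, Finset.mul_sum]
    rw [add_sub_right_comm, ← Finset.sum_sub_distrib]
    congr 1
    · exact Finset.sum_congr rfl fun u _ => by rw [G.m_symm u v]; ring
    · ring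
  rw [hl, hr, h]

theorem eq_of_eq_on_cell (hS : G.ShiftInvariant) {k : Plane} {f g : Plane → ℂ} (hf : f ∈ G.bloch k)
    (hg : g ∈ G.bloch k) (h : ∀ x ∈ G.cell, f x = g x) : f = g := by
  funext x
  by_cases hx : x ∈ G.V
  · have h1 := h _ ((reduce_mem_cell_iff hS x).2 hx)
    rw [reduce, hf.2, hg.2] at h1
    exact mul_left_cancel₀ (Complex.exp_ne_zero _) h1
  · rw [hf.1 x hx, hg.1 x hx]

theorem eq_zero_of_cellInner_self (hS : G.ShiftInvariant) {k : Plane} {f : Plane → ℂ}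
    (hf : f ∈ G.bloch k) (h : G.cellInner f f = 0) : f = 0 := by
  have h1 : ∑ x ∈ G.cell, ‖f x‖ ^ 2 = 0 := by
    rw [cellInner_eq_sum] at h
    have : ((∑ x ∈ G.cell, ‖f x‖ ^ 2 : ℝ) : ℂ) = 0 := by
      rw [← h]
      push_cast
      refine Finset.sum_congr rfl fun x _ => ?_
      rw [Complex.conj_mul']
    exact_mod_cast this
  rw [Finset.sum_eq_zero_iff_of_nonneg fun x _ => by positivity] at h1
  exact eq_of_eq_on_cell hS hf (Submodule.zero_mem _) fun x hx => by simpa using h1 x hx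

/-! ### Isospectrality -/

theorem eigen_eq_bot (hS : G.ShiftInvariant) {W : Submodule ℂ (Plane → ℂ)} (hW : W ≤ G.bloch 0)
    {z : ℂ} (hz : z.im ≠ 0) : G.eigen W z = ⊥ := by
  rw [Submodule.eq_bot_iff]
  rintro f ⟨hf, he⟩
  have h := cellInner_apply_comm hS (hW hf) (hW hf)
  rw [he] at h
  simp only [cellInner_eq_sum, Pi.smul_apply, smul_eq_mul, map_mul, mul_assoc, mul_left_comm _ z,
    ← Finset.mul_sum] at h
  refine eq_zero_of_cellInner_self hS (hW hf) ?_
  rw [cellInner_eq_sum]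
  have h1 : (starRingEnd ℂ z - z) * ∑ x ∈ G.cell, starRingEnd ℂ (f x) * f x = 0 := by
    linear_combination h
  exact (mul_eq_zero.1 h1).resolve_left fun h0 =>
    hz (Complex.conj_eq_iff_im.1 (sub_eq_zero.1 h0))

theorem conj_mem_eigen {i j : Fin 3} (hij : i = -j) {z : ℂ} (hz : starRingEnd ℂ z = z)
    {f : Plane → ℂ} (hf : f ∈ G.eigen (G.isotypic j) z) :
    (fun x => starRingEnd ℂ (f x)) ∈ G.eigen (G.isotypic i) z := by
  obtain ⟨⟨hb, he⟩, ha⟩ := hf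
  refine ⟨⟨⟨fun x hx => ?_, fun n₁ n₂ x => ?_⟩, fun x => ?_⟩, ?_⟩
  · change starRingEnd ℂ (f x) = 0
    rw [hb.1 x hx, map_zero]
  · change starRingEnd ℂ (f (x + latt n₁ n₂)) = _
    rw [hb.2, phase_zero, one_mul, one_mul]
  · change starRingEnd ℂ (f (rotPt x)) = _
    rw [he, map_mul, RealDiffOp.conj_inv_τ_pow, hij]
  · funext v
    have h := congrArg (starRingEnd ℂ) (congrFun ha v)
    rw [apply_eq_sum] at h ⊢
    simpa [hz] using h

/-- Complex conjugation as a bijection of eigenspaces. -/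
def conjEigen {i j : Fin 3} (hij : i = -j) {z : ℂ} (hz : starRingEnd ℂ z = z) :
    G.eigen (G.isotypic j) z ≃+ G.eigen (G.isotypic i) z where
  toFun f := ⟨_, conj_mem_eigen hij hz f.2⟩
  invFun f := ⟨_, conj_mem_eigen (by rw [hij, neg_neg]) hz f.2⟩
  left_inv f := Subtype.ext (funext fun x => Complex.conj_conj _)
  right_inv f := Subtype.ext (funext fun x => Complex.conj_conj _)
  map_add' f g := Subtype.ext (funext fun x => map_add (starRingEnd ℂ) _ _)

/-- For real `z` conjugation is a semilinear bijection of the eigenspaces; for other `z` symmetry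
makes both trivial. -/
theorem mult_isotypic_eq (hS : G.ShiftInvariant) (z : ℂ) :
    G.mult (G.isotypic 1) z = G.mult (G.isotypic 2) z := by
  by_cases hz : z.im = 0
  · exact rank_eq_of_equiv_equiv (starRingEnd ℂ)
      (conjEigen (by decide) (Complex.conj_eq_iff_im.2 hz)) (starRingAut (R := ℂ)).bijective
      fun r f => Subtype.ext (funext fun x => map_mul (starRingEnd ℂ) _ _)
  · have h : ∀ j, G.isotypic j ≤ G.bloch 0 := fun j f hf => hf.1
    rw [mult, mult, eigen_eq_bot hS (h 1) hz, eigen_eq_bot hS (h 2) hz]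

end GraphOp

namespace GraphOp

/-! ### The operators `H(k)` on functions on the period cell -/

/-- Functions on the vertices in the period cell. -/
abbrev CellSpace (G : GraphOp) : Type := EuclideanSpace ℂ G.cell

open Classical in
/-- The periodic extension of a function on the period cell. -/
def ext (G : GraphOp) : CellSpace G →ₗ[ℂ] (Plane → ℂ) where
  toFun g x := if h : reduce x ∈ G.cell then g ⟨reduce x, h⟩ else 0
  map_add' f g := by
    funext x
    by_cases h : reduce x ∈ G.cell <;> simp [h]
  map_smul' z f := by
    funext x
    by_cases h : reduce x ∈ G.cell <;> simp [h]

/-- The restriction of a function to the period cell. -/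
def res (G : GraphOp) : (Plane → ℂ) →ₗ[ℂ] CellSpace G where
  toFun f := WithLp.toLp 2 fun w => f w
  map_add' _ _ := rfl
  map_smul' _ _ := rfl

variable {G : GraphOp}

theorem res_apply (f : Plane → ℂ) (w : G.cell) : G.res f w = f w := rfl

theorem ext_coe (g : CellSpace G) (w : G.cell) : G.ext g w = g w := by
  have h : reduce (w : Plane) = w := ((mem_cell_iff _).1 w.2).2
  change (if h : reduce (w : Plane) ∈ G.cell then g ⟨reduce w, h⟩ else 0) = _
  rw [dif_pos (by rw [h]; exact w.2)]
  exact congrArg g (Subtype.ext h)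

theorem ext_mem_bloch (hS : G.ShiftInvariant) (g : CellSpace G) : G.ext g ∈ G.bloch 0 := by
  refine ⟨fun x hx => dif_neg fun h => hx ((reduce_mem_cell_iff hS x).1 h), fun n₁ n₂ x => ?_⟩
  rw [phase_zero, one_mul]
  change (if h : reduce (x + latt n₁ n₂) ∈ G.cell then _ else _) = _
  simp only [reduce_add_latt]
  rfl

theorem ext_res (hS : G.ShiftInvariant) {f : Plane → ℂ} (hf : f ∈ G.bloch 0) :
    G.ext (G.res f) = f :=
  eq_of_eq_on_cell hS (ext_mem_bloch hS _) hf fun x hx => ext_coe (G.res f) ⟨x, hx⟩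

theorem inner_eq_sum {f g : CellSpace G} {F K : Plane → ℂ} (hf : ∀ w : G.cell, f w = F w)
    (hg : ∀ w : G.cell, g w = K w) : ⟪f, g⟫_ℂ = ∑ x ∈ G.cell, starRingEnd ℂ (F x) * K x := by
  rw [PiLp.inner_apply, ← Finset.sum_coe_sort G.cell]
  refine Finset.sum_congr rfl fun w _ => ?_
  rw [hf, hg]
  simp [mul_comm]

/-- The operator `g ↦ g(u) e_v`. -/
def unit (G : GraphOp) (v : G.cell) (u : Plane) : CellSpace G →L[ℂ] CellSpace G :=
  (LinearMap.toContinuousLinearMap ((LinearMap.proj u).comp G.ext)).smulRight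
    (EuclideanSpace.single v 1)

open Classical in
theorem unit_apply (v : G.cell) (u : Plane) (g : CellSpace G) (w : G.cell) :
    G.unit v u g w = if w = v then G.ext g u else 0 := by
  simp [unit]

/-- The operator with the matrix elements `m(v,u) c(v,u)`. -/
def edgeOp (G : GraphOp) (c : Plane → Plane → ℂ) : CellSpace G →L[ℂ] CellSpace G :=
  ∑ v : G.cell, ∑ u ∈ G.nbr v, ((G.m v u : ℂ) * c v u) • G.unit v u

theorem edgeOp_apply (c : Plane → Plane → ℂ) (g : CellSpace G) (w : G.cell) :
    G.edgeOp c g w = ∑ u ∈ G.nbr w, (G.m w u : ℂ) * c w u * G.ext g u := by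
  classical
  simp only [edgeOp, sum_apply, smul_apply, WithLp.ofLp_sum, WithLp.ofLp_smul, Finset.sum_apply,
    Pi.smul_apply, unit_apply, smul_eq_mul, mul_ite, mul_zero]
  rw [Finset.sum_eq_single w]
  · simp
  · intro v _ hv
    simp [hv.symm]
  · simp

/-- Only finitely many edges start in the cell, so bounds for the matrix elements can be added. -/
theorem exists_norm_edgeOp_le {c : Plane → Plane → Plane → ℂ} {B : Plane → Plane → ℝ} (s : ℕ)
    (hc : ∀ k v u, ‖c k v u‖ ≤ B v u * ‖k‖ ^ s) :
    ∃ C : ℝ, ∀ k, ‖G.edgeOp (c k)‖ ≤ C * ‖k‖ ^ s := by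
  refine ⟨∑ v : G.cell, ∑ u ∈ G.nbr v, G.m v u * B v u * ‖G.unit v u‖, fun k => ?_⟩
  rw [edgeOp, Finset.sum_mul]
  refine norm_sum_le_of_le _ fun v _ => ?_
  rw [Finset.sum_mul]
  refine norm_sum_le_of_le _ fun u _ => ?_
  rw [norm_smul, norm_mul, Complex.norm_real, Real.norm_eq_abs, abs_of_nonneg (G.m_nonneg _ _)]
  calc _ ≤ G.m v u * (B v u * ‖k‖ ^ s) * ‖G.unit v u‖ := by
        gcongr
        · exact G.m_nonneg _ _
        · exact hc k v u
    _ = _ := by ring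

/-- The part of `e^{-ikx} H e^{ikx}` that is linear in `k`, up to the factor `i`. -/
def linOp (G : GraphOp) (k : Plane) : CellSpace G →L[ℂ] CellSpace G :=
  -G.edgeOp fun v u => (ell k (u - v) : ℂ)

/-- The part of `e^{-ikx} H e^{ikx}` of higher order in `k`, up to the sign. -/
def remOp (G : GraphOp) (k : Plane) : CellSpace G →L[ℂ] CellSpace G :=
  G.edgeOp fun v u => gauge k (u - v) - 1 - Complex.I * (ell k (u - v) : ℂ)

/-- The operator `H(0)`. -/
def periodicOp (G : GraphOp) : CellSpace G →L[ℂ] CellSpace G :=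
  LinearMap.toContinuousLinearMap (G.res.comp (G.applyₗ.comp G.ext))

/-- The operator `e^{-ikx} H e^{ikx}` on functions on the period cell. -/
def gaugedOp (G : GraphOp) (k : Plane) : CellSpace G →L[ℂ] CellSpace G :=
  G.periodicOp + (Complex.I • G.linOp k - G.remOp k)

theorem periodicOp_apply (g : CellSpace G) (w : G.cell) :
    G.periodicOp g w = G.apply (G.ext g) w := rfl

theorem gauge_sub (k x y : Plane) : gauge k (x - y) = gauge (-k) y * gauge k x := by
  rw [gauge, gauge, gauge, ← Complex.exp_add]
  congr 1
  simp only [ell_apply, map_sub, PiLp.neg_apply]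
  push_cast
  ring

/-- The potential commutes with the plane wave, and an edge from `v` to `u` acquires the factor
`gauge k (u - v)`, split into its value at `k = 0`, its linear part and the rest. -/
theorem gaugedOp_apply (k : Plane) (g : CellSpace G) (w : G.cell) :
    G.gaugedOp k g w = gauge (-k) w * G.apply (fun x => gauge k x * G.ext g x) w := by
  have h : G.gaugedOp k g w = G.periodicOp g w + (Complex.I * G.linOp k g w - G.remOp k g w) := rfl
  have h1 : G.linOp k g w = -G.edgeOp (fun v u => (ell k (u - v) : ℂ)) g w := rfl
  rw [h, h1, remOp, edgeOp_apply, edgeOp_apply, periodicOp_apply, apply_eq_sum, apply_eq_sum]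
  have h2 : gauge (-k) w * ((G.q w : ℂ) * (gauge k w * G.ext g w)) = (G.q w : ℂ) * G.ext g w := by
    linear_combination ((G.q w : ℂ) * G.ext g w) * gauge_neg_mul k w
  rw [mul_add, h2, mul_neg, Finset.mul_sum, Finset.mul_sum, add_right_comm, ← neg_add', ← Finset.sum_add_distrib,
    ← sub_eq_add_neg, ← Finset.sum_sub_distrib]
  congr 1
  refine Finset.sum_congr rfl fun u _ => ?_
  rw [gauge_sub]
  linear_combination (-(G.m w u : ℂ) * G.ext g w) * gauge_neg_mul k w

theorem gaugedOp_zero : G.gaugedOp 0 = G.periodicOp := by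
  ext g w
  rw [gaugedOp_apply, neg_zero, gauge_zero, one_mul, periodicOp_apply]
  simp only [gauge_zero, one_mul]

theorem gauge_mul_mem_bloch {l : Plane} (k : Plane) {f : Plane → ℂ} (hf : f ∈ G.bloch l) :
    (fun x => gauge k x * f x) ∈ G.bloch (k + l) := by
  refine ⟨fun x hx => mul_eq_zero_of_right _ (hf.1 x hx), fun n₁ n₂ x => ?_⟩
  have : phase (k + l) n₁ n₂ = phase k n₁ n₂ * phase l n₁ n₂ := by
    rw [phase, phase, phase, ← Complex.exp_add]
    congr 1
    simp
    ring
  change gauge k (x + latt n₁ n₂) * f (x + latt n₁ n₂) = _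
  rw [gauge_add_latt, hf.2, this]
  ring

/-- The Bloch function with quasimomentum `k` that corresponds to a function on the cell. -/
def toBloch (G : GraphOp) (k : Plane) : CellSpace G →ₗ[ℂ] (Plane → ℂ) where
  toFun g x := gauge k x * G.ext g x
  map_add' f g := by
    funext x
    simp [mul_add]
  map_smul' z f := by
    funext x
    simp [mul_left_comm]

theorem toBloch_mem (hS : G.ShiftInvariant) (k : Plane) (g : CellSpace G) :
    G.toBloch k g ∈ G.bloch k := by
  have := gauge_mul_mem_bloch k (ext_mem_bloch hS g)
  rwa [add_zero] at this

theorem toBloch_injective (k : Plane) : Function.Injective (G.toBloch k) := by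
  intro f g h
  ext w
  have h1 : gauge k w * G.ext f w = gauge k w * G.ext g w := congrFun h w
  rw [ext_coe, ext_coe] at h1
  exact mul_left_cancel₀ (gauge_ne_zero k w) h1

theorem apply_toBloch (k : Plane) (g : CellSpace G) (w : G.cell) :
    G.apply (G.toBloch k g) w = gauge k w * G.gaugedOp k g w := by
  rw [gaugedOp_apply, ← mul_assoc, mul_comm (gauge k _), gauge_neg_mul, one_mul]
  rfl

/-- As for differential operators, the plane wave moves all Bloch spaces to one finite dimensional
space; equality on the cell extends to the graph by the Bloch condition. -/
theorem eigen_bloch (hS : G.ShiftInvariant) (k : Plane) (l : ℂ) : G.eigen (G.bloch k) l =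
    (LinearMap.ker (G.gaugedOp k - l • ContinuousLinearMap.id ℂ _).toLinearMap).map
      (G.toBloch k) := by
  have hker : ∀ p, p ∈ LinearMap.ker (G.gaugedOp k - l • ContinuousLinearMap.id ℂ _).toLinearMap ↔
      G.gaugedOp k p = l • p := fun p => by
    rw [LinearMap.mem_ker]
    exact sub_eq_zero
  ext f
  rw [Submodule.mem_map]
  constructor
  · rintro ⟨hf, he⟩
    have h0 : (fun x => gauge (-k) x * f x) ∈ G.bloch 0 := by
      simpa using gauge_mul_mem_bloch (-k) hf
    have h1 : G.toBloch k (G.res fun x => gauge (-k) x * f x) = f := by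
      funext x
      change gauge k x * G.ext _ x = _
      rw [ext_res hS h0, ← mul_assoc, mul_comm (gauge k x), gauge_neg_mul, one_mul]
    refine ⟨_, (hker _).2 ?_, h1⟩
    ext w
    have h2 := apply_toBloch k (G.res fun x => gauge (-k) x * f x) w
    rw [h1, he] at h2
    refine mul_left_cancel₀ (gauge_ne_zero k w) (h2.symm.trans ?_)
    rw [PiLp.smul_apply, res_apply, Pi.smul_apply, smul_eq_mul, smul_eq_mul]
    linear_combination (-l * f w) * gauge_neg_mul k w
  · rintro ⟨p, hp, rfl⟩
    rw [hker] at hp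
    have hm := toBloch_mem hS k p
    refine ⟨hm, eq_of_eq_on_cell hS (apply_mem_bloch hS hm) (Submodule.smul_mem _ l hm)
      fun x hx => ?_⟩
    have h2 := apply_toBloch k p ⟨x, hx⟩
    rw [hp] at h2
    rw [h2, PiLp.smul_apply, ← ext_coe, Pi.smul_apply, smul_eq_mul, smul_eq_mul]
    change _ = l * (gauge k x * G.ext p x)
    ring

theorem mult_bloch (hS : G.ShiftInvariant) (k : Plane) (l : ℂ) : G.mult (G.bloch k) l =
    Module.rank ℂ (LinearMap.ker (G.gaugedOp k - l • ContinuousLinearMap.id ℂ _).toLinearMap) := by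
  rw [mult, eigen_bloch hS]
  exact (Submodule.equivMapOfInjective _ (toBloch_injective k) _).rank_eq.symm

theorem gaugedOp_symm (hS : G.ShiftInvariant) (k : Plane) (f g : CellSpace G) :
    ⟪G.gaugedOp k f, g⟫_ℂ = ⟪f, G.gaugedOp k g⟫_ℂ := by
  have h := cellInner_apply_comm hS (toBloch_mem hS k f) (toBloch_mem hS k g)
  rw [cellInner_eq_sum, cellInner_eq_sum] at h
  rw [inner_eq_sum (F := fun x => gauge (-k) x * G.apply (G.toBloch k f) x)
      (fun w => gaugedOp_apply k f w) (fun w => (ext_coe g w).symm),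
    inner_eq_sum (K := fun x => gauge (-k) x * G.apply (G.toBloch k g) x)
      (fun w => (ext_coe f w).symm) (fun w => gaugedOp_apply k g w)]
  calc _ = _ := Finset.sum_congr rfl fun x _ => ?_
    _ = _ := h
    _ = _ := Finset.sum_congr rfl fun x _ => ?_
  · change starRingEnd ℂ (gauge (-k) x * G.apply (G.toBloch k f) x) * G.ext g x =
      starRingEnd ℂ (G.apply (G.toBloch k f) x) * (gauge k x * G.ext g x)
    rw [map_mul, conj_gauge, neg_neg]
    ring
  · change starRingEnd ℂ (gauge k x * G.ext f x) * _ =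
      _ * (gauge (-k) x * G.apply (G.toBloch k g) x)
    rw [map_mul, conj_gauge]
    ring

theorem bijective_periodicOp (hS : G.ShiftInvariant) :
    Function.Bijective (G.gaugedOp 0 - Complex.I • ContinuousLinearMap.id ℂ (CellSpace G)) := by
  have hinj : Function.Injective
      (G.gaugedOp 0 - Complex.I • ContinuousLinearMap.id ℂ (CellSpace G)).toLinearMap := by
    rw [injective_iff_map_eq_zero]
    intro p hp
    have hp' : G.gaugedOp 0 p = Complex.I • p := sub_eq_zero.1 hp
    have h := gaugedOp_symm hS 0 p p
    rw [hp', inner_smul_left, inner_smul_right, Complex.conj_I] at h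
    have h1 : Complex.I * ⟪p, p⟫_ℂ = 0 := by linear_combination (-1 / 2 : ℂ) * h
    exact inner_self_eq_zero.1 ((mul_eq_zero.1 h1).resolve_left Complex.I_ne_zero)
  exact ⟨hinj, LinearMap.injective_iff_surjective.1 hinj⟩

/-! ### The first order term for discrete operators -/

theorem inner_linOp (k : Plane) (f g : CellSpace G) : ⟪f, G.linOp k g⟫_ℂ =
    -∑ v ∈ G.cell, ∑ u ∈ G.nbr v,
      starRingEnd ℂ (G.ext f v) * ((G.m v u : ℂ) * (ell k (u - v) : ℂ) * G.ext g u) := by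
  rw [inner_eq_sum (fun w => (ext_coe f w).symm)
    (K := fun v => -∑ u ∈ G.nbr v, (G.m v u : ℂ) * (ell k (u - v) : ℂ) * G.ext g u)
    fun w => congrArg Neg.neg (edgeOp_apply (fun v u => (ell k (u - v) : ℂ)) g w)]
  simp only [mul_neg, Finset.sum_neg_distrib, Finset.mul_sum]

theorem ell_add (k l x : Plane) : ell (k + l) x = ell k x + ell l x := by
  simp only [ell_apply, PiLp.add_apply]
  ring

/-- Rotating the edges turns `ell k` of the edge vector into `ell (rotMom k)`, while the weights and
the products of the phases are unchanged. -/
theorem inner_linOp_self (hS : G.ShiftInvariant) (hR : G.RotInvariant) {j : Fin 3} {f : CellSpace G}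
    (hf : G.ext f ∈ G.isotypic j) (k : Plane) : ⟪f, G.linOp k f⟫_ℂ = 0 := by
  refine eq_zero_of_rotMom (m := fun k => ⟪f, G.linOp k f⟫_ℂ) (fun k l => ?_) (fun k => ?_) k
  · simp only [inner_linOp, ell_add, ← neg_add, ← Finset.sum_add_distrib]
    refine congrArg _ (Finset.sum_congr rfl fun v _ => Finset.sum_congr rfl fun u _ => ?_)
    push_cast
    ring
  · have hper := bloch_zero_periodic hf.1
    have h := sum_cell_rotPt hS hR (F := fun v => ∑ u ∈ G.nbr v,
      starRingEnd ℂ (G.ext f v) * ((G.m v u : ℂ) * (ell k (u - v) : ℂ) * G.ext f u))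
      fun n₁ n₂ v => by
        rw [sum_nbr_comp (hS n₁ n₂) (bijective_shift n₁ n₂)]
        refine Finset.sum_congr rfl fun u _ => ?_
        rw [hper, hper, (hS n₁ n₂).2.1, add_sub_add_right_eq_sub]
    rw [inner_linOp, inner_linOp, ← h]
    refine congrArg _ (Finset.sum_congr rfl fun v _ => ?_)
    rw [sum_nbr_comp hR bijective_rotPt]
    refine Finset.sum_congr rfl fun u _ => ?_
    have h1 : rotPt u - rotPt v = rotPt (u - v) := (map_sub rotIso u v).symm
    rw [hR.2.1, h1, ell_rotPt, hf.2, hf.2, map_mul]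
    linear_combination (starRingEnd ℂ (G.ext f v) * ((G.m v u : ℂ) *
      (ell (rotMom k) (u - v) : ℂ) * G.ext f u)) * conj_mul_self_inv_τ_pow j

/-- Reversing an edge changes the sign of `ell k (u - v)` and leaves the other factors unchanged, so
the sum equals its negative. -/
theorem sum_edges_mul_ell (hS : G.ShiftInvariant) {F : Plane → ℂ} (hF : F ∈ G.bloch 0) (k : Plane) :
    ∑ v ∈ G.cell, ∑ u ∈ G.nbr v, F v * ((G.m v u : ℂ) * (ell k (u - v) : ℂ) * F u) = 0 := by
  have h := sum_edges_comm hS (K := fun v u => F v * ((G.m v u : ℂ) * (ell k (u - v) : ℂ) * F u))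
    fun n₁ n₂ v u => by
      rw [bloch_zero_periodic hF, bloch_zero_periodic hF, (hS n₁ n₂).2.1, add_sub_add_right_eq_sub]
  have h1 : ∀ v u, F u * ((G.m u v : ℂ) * (ell k (v - u) : ℂ) * F v) =
      -(F v * ((G.m v u : ℂ) * (ell k (u - v) : ℂ) * F u)) := fun v u => by
    rw [G.m_symm u v, ← neg_sub u v, map_neg]
    push_cast
    ring
  have h2 : ∑ v ∈ G.cell, ∑ u ∈ G.nbr v, F u * ((G.m u v : ℂ) * (ell k (v - u) : ℂ) * F v) =
      -∑ v ∈ G.cell, ∑ u ∈ G.nbr v, F v * ((G.m v u : ℂ) * (ell k (u - v) : ℂ) * F u) := by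
    rw [← Finset.sum_neg_distrib]
    refine Finset.sum_congr rfl fun v _ => ?_
    rw [← Finset.sum_neg_distrib]
    exact Finset.sum_congr rfl fun u _ => h1 v u
  linear_combination (1 / 2 : ℂ) * h + (1 / 2 : ℂ) * h2

theorem inner_linOp_conj (hS : G.ShiftInvariant) {f g : CellSpace G}
    (h : ∀ x, G.ext g x = starRingEnd ℂ (G.ext f x)) (k : Plane) :
    ⟪g, G.linOp k f⟫_ℂ = 0 ∧ ⟪f, G.linOp k g⟫_ℂ = 0 := by
  have h0 := sum_edges_mul_ell hS (ext_mem_bloch hS f) k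
  constructor
  · rw [inner_linOp, neg_eq_zero]
    simpa only [h, Complex.conj_conj] using h0
  · rw [inner_linOp, neg_eq_zero]
    have h1 := congrArg (starRingEnd ℂ) h0
    simpa only [h, map_sum, map_mul, Complex.conj_ofReal, map_zero] using h1

/-- For `|t| ≤ 1` this is Taylor's formula; otherwise the three terms `1`, `1` and `|t|` are each at
most `t²`. -/
theorem norm_exp_sub_le (t : ℝ) :
    ‖Complex.exp (Complex.I * t) - 1 - Complex.I * t‖ ≤ 3 * t ^ 2 := by
  have hn : ‖Complex.I * (t : ℂ)‖ = |t| := by simp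
  by_cases ht : |t| ≤ 1
  · have h := Complex.norm_exp_sub_one_sub_id_le (x := Complex.I * t) (by rwa [hn])
    rw [hn, sq_abs] at h
    nlinarith [sq_nonneg t]
  · push Not at ht
    have h1 : ‖Complex.exp (Complex.I * t)‖ = 1 := by
      rw [mul_comm, Complex.norm_exp_ofReal_mul_I]
    have h2 : |t| ≤ t ^ 2 := by
      rw [← sq_abs]
      nlinarith
    calc _ ≤ ‖Complex.exp (Complex.I * t)‖ + ‖(1 : ℂ)‖ + ‖Complex.I * (t : ℂ)‖ :=
          (norm_sub_le _ _).trans (add_le_add_left (norm_sub_le _ _) _)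
      _ ≤ _ := by
        rw [h1, norm_one, hn]
        linarith

theorem abs_ell_le (k x : Plane) : |ell k x| ≤ (|coord 0 x| + |coord 1 x|) * ‖k‖ := by
  have hk : ∀ j : Fin 2, |k j| ≤ ‖k‖ := fun j => by
    simpa using PiLp.norm_apply_le k j
  rw [ell_apply]
  calc _ ≤ |k 0 * coord 0 x| + |k 1 * coord 1 x| := abs_add_le _ _
    _ = |k 0| * |coord 0 x| + |k 1| * |coord 1 x| := by rw [abs_mul, abs_mul]
    _ ≤ ‖k‖ * |coord 0 x| + ‖k‖ * |coord 1 x| := by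
      gcongr
      · exact hk 0
      · exact hk 1
    _ = _ := by ring

theorem exists_norm_ops_le (G : GraphOp) : ∃ C : ℝ, ∀ k,
    ‖G.linOp k‖ ≤ C * ‖k‖ ∧ ‖G.remOp k‖ ≤ C * ‖k‖ ^ 2 := by
  obtain ⟨C₁, h1⟩ := exists_norm_edgeOp_le (G := G) (c := fun k v u => (ell k (u - v) : ℂ)) 1
    (B := fun v u => |coord 0 (u - v)| + |coord 1 (u - v)|) fun k v u => by
      rw [Complex.norm_real, pow_one]
      exact abs_ell_le _ _
  obtain ⟨C₂, h2⟩ := exists_norm_edgeOp_le (G := G)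
    (c := fun k v u => gauge k (u - v) - 1 - Complex.I * (ell k (u - v) : ℂ)) 2
    (B := fun v u => 3 * (|coord 0 (u - v)| + |coord 1 (u - v)|) ^ 2) fun k v u => by
      refine (norm_exp_sub_le (ell k (u - v))).trans ?_
      rw [mul_assoc, ← mul_pow, ← sq_abs (ell k (u - v))]
      gcongr
      exact abs_ell_le _ _
  refine ⟨max C₁ C₂, fun k => ⟨?_, ?_⟩⟩
  · rw [linOp, norm_neg]
    refine (h1 k).trans ?_
    rw [pow_one]
    gcongr
    exact le_max_left _ _
  · refine (h2 k).trans ?_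
    gcongr
    exact le_max_right _ _

/-! ### Flatness -/

theorem rotProj_mem_eigen (hR : G.RotInvariant) {z : ℂ} {f : Plane → ℂ}
    (hf : f ∈ G.eigen (G.bloch 0) z) (j : Fin 3) : rotProj j f ∈ G.eigen (G.isotypic j) z := by
  refine ⟨rotProj_mem_isotypic hR hf.1 j, ?_⟩
  have h1 : G.apply (f ∘ rotPt) = z • (f ∘ rotPt) := funext fun x => by
    have := apply_comp hR bijective_rotPt hf.1.1 x
    rw [hf.2] at this
    exact this
  have h2 : G.apply ((f ∘ rotPt) ∘ rotPt) = z • ((f ∘ rotPt) ∘ rotPt) := funext fun x => by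
    have := apply_comp hR bijective_rotPt (comp_rotPt_mem_bloch hR hf.1).1 x
    exact this.trans (congrFun h1 (rotPt x))
  have h0 : G.applyₗ f = z • f := hf.2
  have h1' : G.applyₗ (f ∘ rotPt) = z • (f ∘ rotPt) := h1
  have h2' : G.applyₗ ((f ∘ rotPt) ∘ rotPt) = z • ((f ∘ rotPt) ∘ rotPt) := h2
  change G.applyₗ (rotProj j f) = _
  rw [rotProj_eq, map_smul, map_add, map_add, map_smul, map_smul, h0, h1', h2']
  module

/-- The second vector is again the conjugate of the first, and the three rotation components of an
eigenvector are identified one by one. -/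
theorem exists_eigenvectors (hS : G.ShiftInvariant) (hR : G.RotInvariant) {l₀ : ℝ}
    (h1 : G.mult (G.isotypic 1) l₀ = 1) (h0 : G.mult (G.isotypic 0) l₀ = 0) :
    ∃ n : Fin 2 → CellSpace G, (∀ i, G.gaugedOp 0 (n i) = (l₀ : ℂ) • n i) ∧ (∀ i, ‖n i‖ = 1) ∧
      G.ext (n 0) ∈ G.isotypic 1 ∧ G.ext (n 1) ∈ G.isotypic 2 ∧
      (∀ x, G.ext (n 1) x = starRingEnd ℂ (G.ext (n 0) x)) ∧
      ∀ p, G.gaugedOp 0 p = (l₀ : ℂ) • p → p ∈ Submodule.span ℂ (Set.range n) := by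
  rw [mult, rank_eq_one_iff] at h1
  obtain ⟨⟨ψ, hψ⟩, hne, hall⟩ := h1
  have hψ0 : G.res ψ ≠ 0 := fun h => hne (Subtype.ext
    ((ext_res hS hψ.1.1).symm.trans (by rw [h, map_zero]; rfl)))
  have hnorm : ‖G.res ψ‖ ≠ 0 := norm_ne_zero_iff.2 hψ0
  set c : ℂ := (‖G.res ψ‖ : ℂ)⁻¹ with hc
  have hc0 : c ≠ 0 := by simpa [hc] using hψ0
  have hF0 : c • ψ ∈ G.eigen (G.isotypic 1) l₀ := Submodule.smul_mem _ c hψ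
  have hF1 := conj_mem_eigen (i := 2) (by decide) (Complex.conj_ofReal l₀) hF0
  have he0 := ext_res hS hF0.1.1
  have he1 := ext_res hS hF1.1.1
  have hker : ∀ {F : Plane → ℂ}, F ∈ G.bloch 0 → G.apply F = (l₀ : ℂ) • F →
      G.gaugedOp 0 (G.res F) = (l₀ : ℂ) • G.res F := fun {F} hF hA => by
    ext w
    rw [gaugedOp_zero, periodicOp_apply, ext_res hS hF, hA]
    rfl
  have hn0 : ‖G.res (c • ψ)‖ = 1 := by
    rw [map_smul, norm_smul, hc, norm_inv, Complex.norm_real, norm_norm, inv_mul_cancel₀ hnorm]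
  refine ⟨![G.res (c • ψ), G.res fun x => starRingEnd ℂ ((c • ψ) x)], fun i => ?_, fun i => ?_,
    ?_, ?_, fun x => ?_, fun p hp => ?_⟩
  · fin_cases i
    · exact hker hF0.1.1 hF0.2
    · exact hker hF1.1.1 hF1.2
  · fin_cases i
    · exact hn0
    · change ‖G.res fun x => starRingEnd ℂ ((c • ψ) x)‖ = 1
      rw [← hn0, EuclideanSpace.norm_eq, EuclideanSpace.norm_eq]
      simp [res_apply]
  · change G.ext (G.res (c • ψ)) ∈ _
    rw [he0]
    exact hF0.1
  · change G.ext (G.res fun x => starRingEnd ℂ ((c • ψ) x)) ∈ _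
    rw [he1]
    exact hF1.1
  · change G.ext (G.res fun x => starRingEnd ℂ ((c • ψ) x)) x = starRingEnd ℂ (G.ext (G.res (c • ψ)) x)
    rw [he0, he1]
  · have hpe : G.ext p ∈ G.eigen (G.bloch 0) l₀ := by
      refine ⟨ext_mem_bloch hS p, eq_of_eq_on_cell hS (apply_mem_bloch hS (ext_mem_bloch hS p))
        (Submodule.smul_mem _ _ (ext_mem_bloch hS p)) fun x hx => ?_⟩
      have h2 := congrArg (fun f : CellSpace G => f ⟨x, hx⟩) hp
      simp only [gaugedOp_zero, periodicOp_apply] at h2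
      rw [h2, PiLp.smul_apply, ← ext_coe]
      rfl
    have hz := rotProj_mem_eigen hR hpe 0
    rw [mult, rank_zero_iff_forall_zero] at h0
    have hz' : rotProj 0 (G.ext p) = 0 := congrArg Subtype.val (h0 ⟨_, hz⟩)
    obtain ⟨c₁, hc₁⟩ := hall ⟨_, rotProj_mem_eigen hR hpe 1⟩
    obtain ⟨c₂, hc₂⟩ := hall ⟨_, conj_mem_eigen (by decide) (Complex.conj_ofReal l₀)
      (rotProj_mem_eigen hR hpe 2)⟩
    have hc₁' : c₁ • ψ = rotProj 1 (G.ext p) := congrArg Subtype.val hc₁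
    have hc₂' : c₂ • ψ = fun x => starRingEnd ℂ (rotProj 2 (G.ext p) x) := congrArg Subtype.val hc₂
    have hp' : p = (c₁ / c) • G.res (c • ψ) +
        starRingEnd ℂ (c₂ / c) • G.res fun x => starRingEnd ℂ ((c • ψ) x) := by
      ext w
      have e8 : rotProj 2 (G.ext p) w = starRingEnd ℂ (c₂ * ψ w) := by
        rw [← smul_eq_mul, ← Pi.smul_apply, hc₂', Complex.conj_conj]
      rw [PiLp.add_apply, PiLp.smul_apply, PiLp.smul_apply, res_apply, res_apply, ← ext_coe,
        ← sum_rotProj (G.ext p) w, Fin.sum_univ_three, hz', ← hc₁', e8]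
      simp only [Pi.zero_apply, Pi.smul_apply, smul_eq_mul, ← map_mul, zero_add]
      rw [← mul_assoc, ← mul_assoc, div_mul_cancel₀ _ hc0, div_mul_cancel₀ _ hc0]
    rw [hp']
    exact Submodule.add_mem _
      (Submodule.smul_mem _ _ (Submodule.subset_span ⟨0, rfl⟩))
      (Submodule.smul_mem _ _ (Submodule.subset_span ⟨1, rfl⟩))

theorem locallyFlat_bloch (hS : G.ShiftInvariant) (hR : G.RotInvariant) {l₀ : ℝ}
    (h1 : G.mult (G.isotypic 1) l₀ = 1) (h0 : G.mult (G.isotypic 0) l₀ = 0) :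
    LocallyFlat (fun k l => G.mult (G.bloch k) l) l₀ := by
  obtain ⟨n, hker, hnorm, he0, he1, hconj, hspan⟩ := exists_eigenvectors hS hR h1 h0
  obtain ⟨C, hC⟩ := G.exists_norm_ops_le
  simp only [mult_bloch hS]
  have h01 : ⟪n 0, n 1⟫_ℂ = 0 := by
    rw [inner_eq_sum (fun w => (ext_coe (n 0) w).symm) (fun w => (ext_coe (n 1) w).symm),
      ← cellInner_eq_sum]
    exact cellInner_eq_zero hS hR (by decide) he0 he1
  refine locallyFlat_of_expansion (ι := ContinuousLinearMap.id ℂ (CellSpace G)) (L := G.linOp)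
    (Q := G.remOp) (z := Complex.I) (fun k u v => gaugedOp_symm hS k u v) Function.injective_id
    ⟨hnorm, fun i j hij => ?_⟩ hker hspan ?_ (bijective_periodicOp hS)
    (fun k => by rw [gaugedOp_zero]; rfl) (fun k => (hC k).1) (fun k => (hC k).2) fun k i j => ?_
  · fin_cases i <;> fin_cases j
    · exact absurd rfl hij
    · exact h01
    · exact inner_eq_zero_symm.1 h01
    · exact absurd rfl hij
  -- In finite dimension the identity is compact, as the closed unit ball is.
  · exact ⟨Metric.closedBall 0 1, isCompact_closedBall 0 1, Metric.closedBall_mem_nhds 0 one_pos⟩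
  · fin_cases i <;> fin_cases j
    · exact inner_linOp_self hS hR he0 k
    · exact (inner_linOp_conj hS hconj k).2
    · exact (inner_linOp_conj hS hconj k).1
    · exact inner_linOp_self hS hR he1 k

end GraphOp

end HexLattice

end

open HexLattice in
theorem theorem6 :
    (∀ H : RealDiffOp, IsSelfAdjoint H.planeOp → H.ShiftInvariant → H.RotInvariant →
      (∃ T : Fin 3 → L2 ΩR →ₗᵢ[ℂ] L2 ΩH,
        (∀ j, IsUnfolding j (T j)) ∧ SplitsAs (H.blochOp 0) H.quotOp T) ∧
      (∀ j, IsSelfAdjoint (H.quotOp j)) ∧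
      Isospectral (H.quotOp 1) (H.quotOp 2) ∧
      ∀ l₀ : ℝ, multOf (H.quotOp 1) l₀ = 1 → multOf (H.quotOp 0) l₀ = 0 →
        LocallyFlat (fun k l => multOf (H.blochOp k) l) l₀) ∧
    (∀ G : GraphOp, G.ShiftInvariant → G.RotInvariant →
      ((∀ j, ∀ f ∈ G.isotypic j, G.apply f ∈ G.isotypic j) ∧
        (∀ f, f ∈ G.bloch 0 ↔ ∃ g : Fin 3 → Plane → ℂ, (∀ j, g j ∈ G.isotypic j) ∧ f = ∑ j, g j) ∧
        ∀ i j, i ≠ j → ∀ f ∈ G.isotypic i, ∀ g ∈ G.isotypic j, G.cellInner f g = 0) ∧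
      (∀ z, G.mult (G.isotypic 1) z = G.mult (G.isotypic 2) z) ∧
      ∀ l₀ : ℝ, G.mult (G.isotypic 1) l₀ = 1 → G.mult (G.isotypic 0) l₀ = 0 →
        LocallyFlat (fun k l => G.mult (G.bloch k) l) l₀) := by
  refine ⟨fun H hH hS hR => ⟨⟨unfoldL2, isUnfolding_unfoldL2, RealDiffOp.splitsAs_blochOp hR⟩,
    RealDiffOp.isSelfAdjoint_quotOp hH hS hR, RealDiffOp.isospectral_quotOp hH hS hR,
    fun _ h1 h0 => RealDiffOp.locallyFlat_blochOp hH hS hR h1 h0⟩,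
    fun G hS hR => ⟨⟨fun _ _ hf => GraphOp.apply_mem_isotypic hS hR hf,
      GraphOp.mem_bloch_zero_iff hR, fun _ _ hij _ hf _ hg => ?_⟩,
      GraphOp.mult_isotypic_eq hS, fun _ h1 h0 => GraphOp.locallyFlat_bloch hS hR h1 h0⟩⟩
  exact GraphOp.cellInner_eq_zero hS hR hij hf hg
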